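/- Work over $\mathbb{C}$. A \emph{rational ruled surface} is a non-developable surface $R\subset\mathbb{P}^3$ that is the Zariski closure of the union of the lines (\emph{rulings}) $\{t_0\,p(s)+t_1\,q(s) : (t_0:t_1)\in\mathbb{P}^1\}$, $s\in\mathbb{C}$, where $p,q\in\mathbb{C}[s]^4$; non-developable means that the generic ruling is regular, i.e. $\det[p,q,\dot p,\dot q]\not\equiv 0$. For $a\in\mathbb{P}^3$ the \emph{contour} $C_a(R)$ is the Zariski closure of the set of smooth points $x\in R$ with $a\in T_xR$. We say that a surface $R'$ \emph{contains a curve $C$ as a contour curve with respect to $a$} if $C\subseteq C_a(R')$. We say that \emph{$n$ generic contours determine the rational ruled surfaces of degree $k$} if for every rational ruled surface $R$ of degree $k$ there is a non-empty Zariski open set $U\subseteq(\mathbb{P}^3)^n$ such that for all $(a_1,\dots,a_n)\in U$ the surface $R$ is the only rational ruled surface (of any degree) that contains $C_{a_i}(R)$ as a contour curve with respect to $a_i$ for every $i=1,\dots,n$. Let $c(k)$ be the least such $n$. \textbf{Theorem.} For every $k\ge 3$ one has $c(k)=2$: two generic contours determine a rational ruled surface of degree $k$ uniquely, and fewer do not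 suffice. Moreover, for every rational ruled surface $R$ of degree $k\geq 3$, parametrized by $t_0p(s)+t_1q(s)$, there is a non-empty Zariski open set $U\subseteq\mathbb{P}^3\times\mathbb{P}^3$ such that for all $(a,b)\in U$: \begin{enumerate} \item $C_a(R)$ and $C_b(R)$ are rational curves, and $C_a(R)\cap C_b(R)$ contains at least $k=\deg R$ smooth points of $R$. \item For all proper (generically injective) parametrizations $c_a,c_b:\mathbb{P}^1\to\mathbb{P}^3$ of $C_a(R)$ and $C_b(R)$ there is exactly one linear fractional transformation $\psi$ of $\mathbb{P}^1$ such that, for all but finitely many $u$, $c_a(u)$ and $c_b(\psi(u))$ are distinct points of one ruling of $R$. The surface $R$ is the Zariski closure of the union over $u\in\mathbb{P}^1$ of the lines joining $c_a(u)$ and $c_b(\psi(u))$. \item This $\psi$ is forced by the intersection points of the two contours: $c_b(\psi(u))=c_a(u)$ for every $u$ with $c_a(u)\in C_b(R)$, and $\psi$ is the only linear fractional transformation for which this holds for all $u$ such that $c_a(u)$ is a smooth point of $R$ lying on $C_b(R)$. \end{enumerate} -/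

import Mathlib

open scoped LinearAlgebra.Projectivization

namespace RuledContours

/-- The complex projective line. -/
abbrev P1 : Type := ℙ ℂ (Fin 2 → ℂ)

/-- The complex projective space of dimension three. -/
abbrev P3 : Type := ℙ ℂ (Fin 4 → ℂ)

/-- `F` vanishes at every point of `X` (used for homogeneous `F` only, for which the choice
of the representative is irrelevant). -/
def VanishesOn (F : MvPolynomial (Fin 4) ℂ) (X : Set P3) : Prop :=
  ∀ x ∈ X, MvPolynomial.eval x.rep F = 0

/-- The Zariski closure of a set of points of the projective space. -/
def zariskiClosure (X : Set P3) : Set P3 :=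
  {x | ∀ (d : ℕ) (F : MvPolynomial (Fin 4) ℂ), F.IsHomogeneous d → VanishesOn F X →
    MvPolynomial.eval x.rep F = 0}

/-- The (linear cone over the) embedded projective tangent space of `X` at `x`: the vectors
annihilated by the gradients at `x` of all homogeneous polynomials that vanish on `X`. -/
def tangentSpace (X : Set P3) (x : P3) : Submodule ℂ (Fin 4 → ℂ) where
  carrier := {v | ∀ (d : ℕ) (F : MvPolynomial (Fin 4) ℂ), F.IsHomogeneous d → VanishesOn F X →
    ∑ i, v i * MvPolynomial.eval x.rep (MvPolynomial.pderiv i F) = 0}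
  add_mem' := by
    intro v w hv hw d F hF hX
    simp only [Pi.add_apply, add_mul, Finset.sum_add_distrib]
    rw [hv d F hF hX, hw d F hF hX, add_zero]
  zero_mem' := by
    intro d F hF hX
    simp
  smul_mem' := by
    intro c v hv d F hF hX
    simp only [Pi.smul_apply, smul_eq_mul, mul_assoc]
    rw [← Finset.mul_sum, hv d F hF hX, mul_zero]

/-- The smooth points of a surface `X`: the points of `X` at which the projective tangent space
is a plane. -/
def smoothLocus (X : Set P3) : Set P3 :=
  {x | x ∈ X ∧ Module.finrank ℂ (tangentSpace X x) = 3}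

/-- The contour of the surface `X` with respect to the viewpoint `a`: the Zariski closure of the
set of the smooth points whose tangent plane passes through `a`. -/
def contour (X : Set P3) (a : P3) : Set P3 :=
  zariskiClosure {x | x ∈ smoothLocus X ∧ a.submodule ≤ tangentSpace X x}

/-- The set `X` is an irreducible surface of degree `k`: the zero locus of an irreducible form
of degree `k`. -/
def HasDegree (X : Set P3) (k : ℕ) : Prop :=
  ∃ F : MvPolynomial (Fin 4) ℂ, Irreducible F ∧ F.IsHomogeneous k ∧
    X = {x | MvPolynomial.eval x.rep F = 0}

/-- The value at `s` of a vector of polynomials. -/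
noncomputable def evalVec (p : Fin 4 → Polynomial ℂ) (s : ℂ) : Fin 4 → ℂ :=
  fun i => (p i).eval s

/-- The ruling belonging to the parameter value `s`: all points `t₀ p(s) + t₁ q(s)`. -/
def ruling (p q : Fin 4 → Polynomial ℂ) (s : ℂ) : Set P3 :=
  {x | x.submodule ≤ Submodule.span ℂ {evalVec p s, evalVec q s}}

/-- The generic ruling is regular: `det [p, q, p', q']` is not identically zero. -/
def GenericallyRegular (p q : Fin 4 → Polynomial ℂ) : Prop :=
  Matrix.det (Matrix.of ![p, q, fun i => Polynomial.derivative (p i),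
    fun i => Polynomial.derivative (q i)]) ≠ 0

/-- `t₀ p(s) + t₁ q(s)` parametrizes `R`, and `R` is non-developable (the generic ruling is
regular; in particular the lines do sweep out a surface). -/
def IsRuledParametrization (p q : Fin 4 → Polynomial ℂ) (R : Set P3) : Prop :=
  GenericallyRegular p q ∧ R = zariskiClosure (⋃ s : ℂ, ruling p q s)

/-- Non-developable rational ruled surfaces. -/
def IsRationalRuledSurface (R : Set P3) : Prop :=
  ∃ p q : Fin 4 → Polynomial ℂ, IsRuledParametrization p q R

/-- The property `P` holds for all points of a non-empty Zariski open subset of `(ℙ³)ⁿ`. Such a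
subset contains the image of the non-vanishing locus of a non-zero polynomial in the homogeneous
coordinates of the `n` points, and conversely such an image is open and non-empty. -/
def ForGeneric {n : ℕ} (P : (Fin n → P3) → Prop) : Prop :=
  ∃ G : MvPolynomial (Fin n × Fin 4) ℂ, G ≠ 0 ∧
    ∀ (v : Fin n → Fin 4 → ℂ) (hv : ∀ i, v i ≠ 0),
      MvPolynomial.eval (fun ij => v ij.1 ij.2) G ≠ 0 →
        P (fun i => Projectivization.mk ℂ (v i) (hv i))

/-- Rational ruled surfaces of degree `k` are determined by `n` generic contours: the only
rational ruled surface (of whatever degree) that contains the `n` contours of `R` as contour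
curves with respect to the same viewpoints is `R` itself. -/
def DeterminedByContours (k n : ℕ) : Prop :=
  ∀ R : Set P3, IsRationalRuledSurface R → HasDegree R k →
    ForGeneric (fun a : Fin n → P3 =>
      ∀ R' : Set P3, IsRationalRuledSurface R' →
        (∀ i, contour R (a i) ⊆ contour R' (a i)) → R' = R)

/-- A morphism from the projective line to the projective space, given by four binary forms of
the same degree without a common zero. -/
structure RationalMap where
  degree : ℕ
  form : Fin 4 → MvPolynomial (Fin 2) ℂ
  homogeneous : ∀ i, (form i).IsHomogeneous degree
  base_point_free : ∀ v : Fin 2 → ℂ, v ≠ 0 → ∃ i, MvPolynomial.eval v (form i) ≠ 0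

/-- The point with parameter `u`. -/
noncomputable def RationalMap.pt (c : RationalMap) (u : P1) : P3 :=
  Projectivization.mk ℂ (fun i => MvPolynomial.eval u.rep (c.form i)) (by
    intro h
    obtain ⟨i, hi⟩ := c.base_point_free u.rep u.rep_nonzero
    exact hi (congrFun h i))

/-- `c` is a proper parametrization of the curve `C`: its image is dense in `C`, and all but
finitely many parameter values are determined by their points. -/
def IsProperParametrization (c : RationalMap) (C : Set P3) : Prop :=
  C = zariskiClosure (Set.range c.pt) ∧ {u : P1 | ∃ v, v ≠ u ∧ c.pt v = c.pt u}.Finite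

/-- Linear fractional transformations of the projective line. -/
def IsMoebius (f : P1 → P1) : Prop :=
  ∃ g : (Fin 2 → ℂ) ≃ₗ[ℂ] (Fin 2 → ℂ), f = Projectivization.map g.toLinearMap g.injective

/-- The points of the line joining `x` and `y` (the point itself if `x = y`). -/
def joinPoints (x y : P3) : Set P3 :=
  {z | z.submodule ≤ x.submodule ⊔ y.submodule}

/-- The reparametrization `f` matches the two parametrized curves ruling by ruling: for all but
finitely many `u`, the points `c(u)` and `c'(f(u))` are distinct points of one ruling. -/
def MatchesRulings (p q : Fin 4 → Polynomial ℂ) (c c' : RationalMap) (f : P1 → P1) : Prop :=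
  {u : P1 | ¬ (c.pt u ≠ c'.pt (f u) ∧
    ∃ s : ℂ, c.pt u ∈ ruling p q s ∧ c'.pt (f u) ∈ ruling p q s)}.Finite

end RuledContours

open RuledContours

/-! A ruled surface is a curve `u ↦ pl u` on the Klein quadric. By Lüroth's theorem it is properly
parametrized by binary forms without a common zero (`exists_scroll`), and the degree of these forms
is the degree `k` of the surface, since a generic line meets `k` different rulings
(`Surface.degree_eq`). Hence a smooth point lies on one ruling only, and the family of rulings is
transversal there.

The tangent plane at a point `x` of the ruling `u` is `Ns (der u w) x`. It contains `a` exactly when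
`x` lies in the plane `Ns (der u w) a`, so a ruling carries in general one contour point. Up to a
common factor this point is `cv u a`, a vector of binary forms in `u` that is linear in `a`. For
generic `a` the contour is therefore a rational curve, properly parametrized by the rulings
(`General.contour_eq`), and two contours are matched by the identity of the parameter line of the
rulings; for other proper parametrizations this becomes a linear fractional transformation. If `b`
lies in the plane of `a` and the ruling `u`, the two contour points on this ruling coincide. The
line `ab` meets `k` rulings, so there are `k` such coincidences, and `k ≥ 3` of them determine the
transformation (`reconstruction`).

Uniqueness: suppose that a second surface contains both contours as contour curves. Its generic
ruling `σ` passes through points `cv (A σ) a` and `cv (B σ) b`, for morphisms `A`, `B` of the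
projective line (`General.exists_factor`). The plane of `a` and a ruling contains the tangent of the
contour curve with respect to `a`; as a generic tangent misses `a`, this plane can be read off from
the curve and is the same for both surfaces (`General.eventually_plane`). So `cv (B σ) b` lies in
the plane of `a` and the ruling `A σ` of the first surface, and `cv (A σ) a` in the plane of `b` and
the ruling `B σ`. For generic `a`, `b` and `u` no other `t` satisfies these two incidences
(`eventually_skew`), so `A σ` and `B σ` are proportional, and the rulings agree
(`GeneralPair.unique`). The genericity rests on `exists_planar_ne_zero`: the contour with respect to
the point `x = cv u a` of the surface is in general not contained in the plane of `a` and the ruling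
`u`. Otherwise the rulings would meet this plane in points of one line through `x`
(`cross_of_planar`), whereas a line of the plane through a smooth point of the ruling `u` meets `k -
1 ≥ 2` further rulings in different points.

One contour does not suffice: every ruling may be turned about its contour point inside the plane
that it spans with `a`. The tangent planes along the curve, and hence the contour curve, persist
(`General.exists_other`). Conoids provide surfaces of every degree.

Genericity is expressed by the filter `gen`. Points are chosen one after the other, and Chevalley's
theorem turns the successive choices into one open condition (`gen_uncurry`). Resultants show that
swept-out sets are closed, and resultants over the dual numbers provide smooth points on them. -/

open scoped LinearAlgebra.Projectivization
open RuledContours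
namespace RuledContours
open Filter MvPolynomial

/-! ### Generic points of affine space and polynomial functions. -/

/-- The filter of the sets that contain a non-empty Zariski open subset of affine space. -/
def gen (ι : Type*) : Filter (ι → ℂ) where
  sets := {s | ∃ G : MvPolynomial ι ℂ, G ≠ 0 ∧ ∀ v, eval v G ≠ 0 → v ∈ s}
  univ_sets := ⟨1, one_ne_zero, fun _ _ => trivial⟩
  sets_of_superset := by
    rintro s t ⟨G, hG, h⟩ hst
    exact ⟨G, hG, fun v hv => hst (h v hv)⟩
  inter_sets := by
    rintro s t ⟨G, hG, h⟩ ⟨G', hG', h'⟩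
    refine ⟨G * G', mul_ne_zero hG hG', fun v hv => ?_⟩
    rw [map_mul] at hv
    exact ⟨h v (left_ne_zero_of_mul hv), h' v (right_ne_zero_of_mul hv)⟩

theorem eventually_gen {ι : Type*} {P : (ι → ℂ) → Prop} :
    (∀ᶠ v in gen ι, P v) ↔ ∃ G : MvPolynomial ι ℂ, G ≠ 0 ∧ ∀ v, eval v G ≠ 0 → P v := Iff.rfl

theorem exists_eval_ne_zero {ι : Type*} {G : MvPolynomial ι ℂ} (hG : G ≠ 0) :
    ∃ v, eval v G ≠ 0 := by
  by_contra! h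
  exact hG (MvPolynomial.funext fun v => by simp [h v])

instance {ι : Type*} : (gen ι).NeBot := by
  refine ⟨fun h => ?_⟩
  have : ∀ᶠ v in gen ι, False := by rw [h]; exact trivial
  obtain ⟨G, hG, h⟩ := eventually_gen.1 this
  obtain ⟨v, hv⟩ := exists_eval_ne_zero hG
  exact h v hv

/-- Polynomial functions on affine space. -/
def Pol {ι : Type*} (f : (ι → ℂ) → ℂ) : Prop := ∃ F : MvPolynomial ι ℂ, ∀ v, f v = eval v F

namespace Pol
variable {ι κ : Type*} {f g : (ι → ℂ) → ℂ}

theorem coord (i : ι) : Pol (fun v : ι → ℂ => v i) := ⟨X i, fun v => by simp⟩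

theorem const (c : ℂ) : Pol (fun _ : ι → ℂ => c) := ⟨C c, fun v => by simp⟩

theorem add (hf : Pol f) (hg : Pol g) : Pol (fun v => f v + g v) := by
  obtain ⟨F, hF⟩ := hf; obtain ⟨G, hG⟩ := hg
  exact ⟨F + G, fun v => by simp [hF, hG]⟩

theorem mul (hf : Pol f) (hg : Pol g) : Pol (fun v => f v * g v) := by
  obtain ⟨F, hF⟩ := hf; obtain ⟨G, hG⟩ := hg
  exact ⟨F * G, fun v => by simp [hF, hG]⟩

theorem neg (hf : Pol f) : Pol (fun v => - f v) := by
  obtain ⟨F, hF⟩ := hf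
  exact ⟨-F, fun v => by simp [hF]⟩

theorem sub (hf : Pol f) (hg : Pol g) : Pol (fun v => f v - g v) := by
  obtain ⟨F, hF⟩ := hf; obtain ⟨G, hG⟩ := hg
  exact ⟨F - G, fun v => by simp [hF, hG]⟩

theorem sum {α : Type*} (s : Finset α) {f : α → (ι → ℂ) → ℂ} (hf : ∀ a, Pol (f a)) :
    Pol (fun v => ∑ a ∈ s, f a v) := by
  choose F hF using hf
  exact ⟨∑ a ∈ s, F a, fun v => by simp [hF]⟩

theorem evalComp (p : MvPolynomial κ ℂ) {g : κ → (ι → ℂ) → ℂ} (hg : ∀ k, Pol (g k)) :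
    Pol (fun v => eval (fun k => g k v) p) := by
  choose G hG using hg
  refine ⟨bind₁ G p, fun v => ?_⟩
  have h : (fun k => g k v) = fun k => eval v (G k) := funext fun k => hG k v
  have h' := aeval_bind₁ (R := ℂ) (S := ℂ) v G p
  simp only [← coe_aeval_eq_eval, RingHom.coe_coe] at h ⊢
  rw [h]
  exact h'.symm

theorem eventually_ne (hf : Pol f) {v : ι → ℂ} (h : f v ≠ 0) : ∀ᶠ v in gen ι, f v ≠ 0 := by
  obtain ⟨F, hF⟩ := hf
  refine eventually_gen.2 ⟨F, ?_, fun w hw => by rwa [hF]⟩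
  rintro rfl
  simp [hF] at h

theorem eq_zero (hf : Pol f) (h : ∀ᶠ v in gen ι, f v = 0) (v : ι → ℂ) : f v = 0 := by
  by_contra hv
  obtain ⟨w, h1, h2⟩ := ((hf.eventually_ne hv).and h).exists
  exact h1 h2

end Pol

attribute [fun_prop] Pol
attribute [fun_prop] Pol.coord Pol.const Pol.add Pol.mul Pol.sub Pol.neg Pol.sum Pol.evalComp

/-- If `G` is non-zero at `(a₀, b₀)`, then `G (a, b₀)` is a non-zero polynomial in `a`, and wherever
it does not vanish, `G (a, ·)` is a non-zero polynomial in `b`. The converse needs constructibility,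
see `gen_uncurry`. -/
theorem gen_curry {ι κ : Type*} {P : (ι ⊕ κ → ℂ) → Prop} (h : ∀ᶠ z in gen (ι ⊕ κ), P z) :
    ∀ᶠ a in gen ι, ∀ᶠ b in gen κ, P (Sum.elim a b) := by
  obtain ⟨G, hG, h⟩ := eventually_gen.1 h
  obtain ⟨z, hz⟩ := exists_eval_ne_zero hG
  have hp : Pol fun a : ι → ℂ => eval (Sum.elim a (z ∘ Sum.inr)) G := by
    have := Pol.evalComp (ι := ι) G (g := Sum.elim (fun i v => v i) fun k _ => z (Sum.inr k))
      (by rintro (i | i); exacts [Pol.coord i, Pol.const _])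
    convert this using 4
    ext (i | i) <;> rfl
  have hne : eval (Sum.elim (z ∘ Sum.inl) (z ∘ Sum.inr)) G ≠ 0 := by
    rwa [Sum.elim_comp_inl_inr]
  filter_upwards [hp.eventually_ne hne] with a ha
  have hq : Pol fun b : κ → ℂ => eval (Sum.elim a b) G := by
    have := Pol.evalComp (ι := κ) G (g := Sum.elim (fun i _ => a i) fun k v => v k)
      (by rintro (i | i); exacts [Pol.const _, Pol.coord i])
    convert this using 4
    ext (i | i) <;> rfl
  filter_upwards [hq.eventually_ne ha] with b hb
  exact h _ hb

/-! ### Constructible properties and Chevalley's theorem. -/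

/-- Constructible properties of the points of affine space. -/
def Constr {ι : Type*} (P : (ι → ℂ) → Prop) : Prop :=
  ∃ T : Set (PrimeSpectrum (MvPolynomial ι ℂ)), Topology.IsConstructible T ∧
    ∀ v, P v ↔ pointToPoint (K := ℂ) v ∈ T

namespace Constr
variable {ι κ : Type} {P Q : (ι → ℂ) → Prop}

theorem not (h : Constr P) : Constr (fun v => ¬ P v) := by
  obtain ⟨T, hT, h⟩ := h
  exact ⟨Tᶜ, hT.compl, fun v => not_congr (h v)⟩

theorem and (h : Constr P) (h' : Constr Q) : Constr (fun v => P v ∧ Q v) := by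
  obtain ⟨T, hT, h⟩ := h
  obtain ⟨S, hS, h'⟩ := h'
  exact ⟨T ∩ S, hT.inter hS, fun v => and_congr (h v) (h' v)⟩

theorem or (h : Constr P) (h' : Constr Q) : Constr (fun v => P v ∨ Q v) := by
  obtain ⟨T, hT, h⟩ := h
  obtain ⟨S, hS, h'⟩ := h'
  exact ⟨T ∪ S, hT.union hS, fun v => or_congr (h v) (h' v)⟩

theorem imp (h : Constr P) (h' : Constr Q) : Constr (fun v => P v → Q v) := by
  simpa only [imp_iff_not_or] using h.not.or h'

theorem eqZero {f : (ι → ℂ) → ℂ} (hf : Pol f) : Constr (fun v => f v = 0) := by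
  obtain ⟨F, hF⟩ := hf
  refine ⟨(PrimeSpectrum.basicOpen F : Set _)ᶜ, ?_, fun v => ?_⟩
  · exact ((PrimeSpectrum.isRetrocompact_basicOpen).isConstructible
      (PrimeSpectrum.basicOpen F).2).compl
  · simp [hF, pointToPoint]

theorem forallFin {α : Type*} [Finite α] {P : α → (ι → ℂ) → Prop} (h : ∀ i, Constr (P i)) :
    Constr (fun v => ∀ i, P i v) := by
  choose T hT h using h
  exact ⟨⋂ i, T i, .iInter hT, fun v => by simp [h]⟩

theorem existsFin {α : Type*} [Finite α] {P : α → (ι → ℂ) → Prop} (h : ∀ i, Constr (P i)) :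
    Constr (fun v => ∃ i, P i v) := by
  choose T hT h using h
  exact ⟨⋃ i, T i, .iUnion hT, fun v => by simp [h]⟩

/-- Chevalley's theorem gives constructibility of the image on prime spectra. Its points over a
closed point need not be closed, but polynomial rings are Jacobson, so a closed one can be chosen,
and by the Nullstellensatz it is a vector. -/
theorem exists_snd [Finite ι] [Finite κ] {P : (ι ⊕ κ → ℂ) → Prop} (h : Constr P) :
    Constr (fun v : ι → ℂ => ∃ w : κ → ℂ, P (Sum.elim v w)) := by
  obtain ⟨T, hT, h⟩ := h
  let φ : MvPolynomial ι ℂ →ₐ[ℂ] MvPolynomial (ι ⊕ κ) ℂ := rename Sum.inl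
  have hφ : (φ : MvPolynomial ι ℂ →+* MvPolynomial (ι ⊕ κ) ℂ).FinitePresentation := by
    have : Algebra.FinitePresentation ℂ (MvPolynomial (ι ⊕ κ) ℂ) := inferInstance
    refine RingHom.FinitePresentation.of_finiteType.1 ?_
    have h1 : (algebraMap ℂ (MvPolynomial (ι ⊕ κ) ℂ)).FiniteType :=
      RingHom.finiteType_algebraMap.2 inferInstance
    refine RingHom.FiniteType.of_comp_finiteType (f := algebraMap ℂ (MvPolynomial ι ℂ)) ?_
    convert h1
    exact φ.comp_algebraMap
  refine ⟨_, PrimeSpectrum.isConstructible_comap_image hφ hT, fun v => ?_⟩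
  have key : ∀ z : ι ⊕ κ → ℂ, PrimeSpectrum.comap (φ : MvPolynomial ι ℂ →+* MvPolynomial (ι ⊕ κ) ℂ)
      (pointToPoint (K := ℂ) z) = pointToPoint (K := ℂ) (z ∘ Sum.inl) := by
    intro z
    ext F
    simp [pointToPoint, PrimeSpectrum.comap_asIdeal, Ideal.mem_comap, φ, aeval_rename]
  constructor
  · rintro ⟨w, hw⟩
    exact ⟨_, (h _).1 hw, by rw [key]; rfl⟩
  · rintro ⟨p, hpT, hp⟩
    obtain ⟨S, rfl⟩ := PrimeSpectrum.exists_constructibleSetData_iff.2 hT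
    rw [PrimeSpectrum.ConstructibleSetData.toSet, Set.mem_iUnion₂] at hpT
    obtain ⟨c, hc, hpc⟩ := hpT
    have hcl : IsClosed ({pointToPoint (K := ℂ) v} : Set (PrimeSpectrum (MvPolynomial ι ℂ))) := by
      rw [PrimeSpectrum.isClosed_singleton_iff_isMaximal]
      exact isMaximal_iff_eq_vanishingIdeal_singleton.2 ⟨v, rfl⟩
    -- The fibre over `v` of one basic piece of `T`. It is locally closed and contains `p`, so it
    -- contains a closed point.
    let Z := (PrimeSpectrum.zeroLocus (Set.range c.g) ∩
      PrimeSpectrum.comap (φ : MvPolynomial ι ℂ →+* MvPolynomial (ι ⊕ κ) ℂ) ⁻¹' {pointToPoint (K := ℂ) v}) ∩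
      (PrimeSpectrum.zeroLocus {c.f})ᶜ
    have hZ : IsLocallyClosed Z := by
      refine IsLocallyClosed.inter (IsClosed.isLocallyClosed ?_) (IsOpen.isLocallyClosed ?_)
      · exact (PrimeSpectrum.isClosed_zeroLocus _).inter
          (hcl.preimage (PrimeSpectrum.continuous_comap _))
      · exact (PrimeSpectrum.isClosed_zeroLocus _).isOpen_compl
    obtain ⟨m, hmZ, hm⟩ := nonempty_inter_closedPoints (Z := Z) ⟨p, ⟨hpc.1, hp⟩, hpc.2⟩ hZ
    rw [mem_closedPoints_iff, PrimeSpectrum.isClosed_singleton_iff_isMaximal] at hm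
    obtain ⟨z, hz⟩ := isMaximal_iff_eq_vanishingIdeal_singleton.1 hm
    obtain rfl : m = pointToPoint (K := ℂ) z := PrimeSpectrum.ext hz
    have h1 := hmZ.1.2
    rw [Set.mem_preimage, key, Set.mem_singleton_iff] at h1
    have h2 : z ∘ Sum.inl = v := by
      funext i
      have h3 : (X i - C (v i)) ∈ (pointToPoint (k := ℂ) (K := ℂ) (z ∘ Sum.inl)).asIdeal := by
        rw [h1]
        simp [pointToPoint]
      simpa [pointToPoint, mem_vanishingIdeal_singleton_iff, sub_eq_zero] using h3
    refine ⟨z ∘ Sum.inr, (h _).2 ?_⟩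
    rw [← h2, Sum.elim_comp_inl_inr]
    exact Set.mem_iUnion₂.2 ⟨c, hc, hmZ.1.1, hmZ.2⟩

theorem forall_snd [Finite ι] [Finite κ] {P : (ι ⊕ κ → ℂ) → Prop} (h : Constr P) :
    Constr (fun v : ι → ℂ => ∀ w : κ → ℂ, P (Sum.elim v w)) := by
  simpa only [not_exists, not_not] using h.not.exists_snd.not

theorem all [Finite ι] [Finite κ] {P : (ι → ℂ) → (κ → ℂ) → Prop}
    (h : Constr fun z : ι ⊕ κ → ℂ => P (fun i => z (Sum.inl i)) fun i => z (Sum.inr i)) :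
    Constr fun v => ∀ w, P v w := h.forall_snd

theorem ex [Finite ι] [Finite κ] {P : (ι → ℂ) → (κ → ℂ) → Prop}
    (h : Constr fun z : ι ⊕ κ → ℂ => P (fun i => z (Sum.inl i)) fun i => z (Sum.inr i)) :
    Constr fun v => ∃ w, P v w := h.exists_snd

/-- The alternative holds for open sets and passes to complements and unions, because affine space
is irreducible: two non-empty open sets intersect. -/
theorem dichotomy (h : Constr P) : (∀ᶠ v in gen ι, P v) ∨ ∀ᶠ v in gen ι, ¬ P v := by
  obtain ⟨T, hT, h⟩ := h
  suffices H : (∃ G : MvPolynomial ι ℂ, G ≠ 0 ∧ ∀ v, eval v G ≠ 0 →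
      pointToPoint (K := ℂ) v ∈ T) ∨ (∃ G : MvPolynomial ι ℂ, G ≠ 0 ∧ ∀ v, eval v G ≠ 0 →
      pointToPoint (K := ℂ) v ∉ T) by
    rcases H with ⟨G, hG, H⟩ | ⟨G, hG, H⟩
    · exact Or.inl ⟨G, hG, fun v hv => (h v).2 (H v hv)⟩
    · exact Or.inr ⟨G, hG, fun v hv => fun h' => H v hv ((h v).1 h')⟩
  clear h
  induction hT using Topology.IsConstructible.empty_union_induction with
  | open_retrocompact U hU _ =>
    rcases Set.eq_empty_or_nonempty U with rfl | ⟨p, hp⟩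
    · exact Or.inr ⟨1, one_ne_zero, fun v _ => by simp⟩
    · obtain ⟨_, ⟨G, rfl⟩, hpG, hGU⟩ :=
        PrimeSpectrum.isTopologicalBasis_basic_opens.exists_subset_of_mem_open hp hU
      refine Or.inl ⟨G, ?_, fun v hv => hGU ?_⟩
      · rintro rfl
        simp at hpG
      · simpa [pointToPoint, mem_vanishingIdeal_singleton_iff, coe_aeval_eq_eval] using hv
  | union s hs t ht h1 h2 =>
    rcases h1 with ⟨G, hG, h1⟩ | ⟨G, hG, h1⟩
    · exact Or.inl ⟨G, hG, fun v hv => Or.inl (h1 v hv)⟩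
    · rcases h2 with ⟨G', hG', h2⟩ | ⟨G', hG', h2⟩
      · exact Or.inl ⟨G', hG', fun v hv => Or.inr (h2 v hv)⟩
      · refine Or.inr ⟨G * G', mul_ne_zero hG hG', fun v hv => ?_⟩
        rw [map_mul] at hv
        rintro (h | h)
        · exact h1 v (left_ne_zero_of_mul hv) h
        · exact h2 v (right_ne_zero_of_mul hv) h
  | compl s hs h1 =>
    rcases h1 with ⟨G, hG, h1⟩ | ⟨G, hG, h1⟩
    · exact Or.inr ⟨G, hG, fun v hv h => h (h1 v hv)⟩
    · exact Or.inl ⟨G, hG, h1⟩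

end Constr

/-- Without constructibility the exceptional set in `b` could depend wildly on `a`. With it, failure
of the conclusion would mean generic failure, and `gen_curry` would contradict the hypothesis. -/
theorem gen_uncurry {ι κ : Type} {P : (ι ⊕ κ → ℂ) → Prop} (hP : Constr P)
    (h : ∀ᶠ a in gen ι, ∀ᶠ b in gen κ, P (Sum.elim a b)) : ∀ᶠ z in gen (ι ⊕ κ), P z := by
  refine hP.dichotomy.resolve_right fun h' => ?_
  obtain ⟨a, h1, h2⟩ := (h.and (gen_curry h')).exists
  obtain ⟨b, h3, h4⟩ := (h1.and h2).exists
  exact h4 h3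

theorem gen_rename {ι κ : Type*} (e : ι ≃ κ) {P : (κ → ℂ) → Prop} (h : ∀ᶠ z in gen κ, P z) :
    ∀ᶠ z in gen ι, P (z ∘ e.symm) := by
  obtain ⟨G, hG, h⟩ := eventually_gen.1 h
  refine eventually_gen.2 ⟨rename e.symm G, ?_, fun v hv => h _ ?_⟩
  · exact (map_ne_zero_iff _ (rename_injective _ e.symm.injective)).2 hG
  · rwa [eval_rename] at hv

/-- Allows the choice of whichever variable is convenient first; in one order there are often only
finitely many bad values to avoid. -/
theorem gen_swap {ι κ : Type} {P : (ι → ℂ) → (κ → ℂ) → Prop}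
    (hP : Constr fun z : ι ⊕ κ → ℂ => P (fun i => z (Sum.inl i)) fun i => z (Sum.inr i))
    (h : ∀ᶠ a in gen ι, ∀ᶠ b in gen κ, P a b) : ∀ᶠ b in gen κ, ∀ᶠ a in gen ι, P a b := by
  have h1 := gen_rename (Equiv.sumComm κ ι) (gen_uncurry hP (by simpa using h))
  have h2 := gen_curry h1
  filter_upwards [h2] with b hb
  filter_upwards [hb] with a ha
  exact ha

/-! ### Binary forms -/

/-- The determinant of two vectors of the plane. -/
def wedge (u v : Fin 2 → ℂ) : ℂ := u 0 * v 1 - u 1 * v 0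

theorem wedge_self (u : Fin 2 → ℂ) : wedge u u = 0 := by simp [wedge, mul_comm]

theorem wedge_swap (u v : Fin 2 → ℂ) : wedge u v = - wedge v u := by simp [wedge]; ring

theorem wedge_smul_left (c : ℂ) (u v : Fin 2 → ℂ) : wedge (c • u) v = c * wedge u v := by
  simp [wedge]; ring

theorem wedge_smul_right (c : ℂ) (u v : Fin 2 → ℂ) : wedge u (c • v) = c * wedge u v := by
  simp [wedge]; ring

theorem exists_smul_of_wedge {u v : Fin 2 → ℂ} (hv : v ≠ 0) (h : wedge u v = 0) :
    ∃ c : ℂ, u = c • v := by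
  unfold wedge at h
  by_cases h0 : v 0 = 0
  · have h1 : v 1 ≠ 0 := fun h1 => hv (by ext i; fin_cases i <;> simp [h0, h1])
    refine ⟨u 1 / v 1, ?_⟩
    ext i; fin_cases i
    · simp only [h0, mul_zero, sub_zero, mul_eq_zero, h1, or_false] at h
      simp [h0, h]
    · simp [h1]
  · refine ⟨u 0 / v 0, ?_⟩
    ext i; fin_cases i
    · simp [h0]
    · simp only [Fin.mk_one, Pi.smul_apply, smul_eq_mul]
      field_simp
      linear_combination -h

theorem exists_wedge_ne_zero {u : Fin 2 → ℂ} (hu : u ≠ 0) : ∃ w, wedge u w ≠ 0 := by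
  by_contra! h
  have h1 := h ![0, 1]
  have h2 := h ![1, 0]
  simp [wedge] at h1 h2
  exact hu (by ext i; fin_cases i <;> simp [h1, h2])

theorem exists_combination {u w : Fin 2 → ℂ} (h : wedge u w ≠ 0) (v : Fin 2 → ℂ) :
    ∃ α β : ℂ, v = α • u + β • w := by
  refine ⟨wedge v w / wedge u w, wedge u v / wedge u w, ?_⟩
  ext i
  simp only [Pi.add_apply, Pi.smul_apply, smul_eq_mul]
  rw [div_mul_eq_mul_div, div_mul_eq_mul_div, ← add_div, eq_div_iff h]
  fin_cases i <;> simp [wedge] <;> ring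

/-- The linear form vanishing at `v`. -/
noncomputable def lin (v : Fin 2 → ℂ) : MvPolynomial (Fin 2) ℂ := C (v 1) * X 0 - C (v 0) * X 1

theorem eval_lin (u v : Fin 2 → ℂ) : eval u (lin v) = wedge u v := by
  simp [lin, wedge]; ring

theorem lin_isHomogeneous (v : Fin 2 → ℂ) : (lin v).IsHomogeneous 1 :=
  (isHomogeneous_C_mul_X _ _).sub (isHomogeneous_C_mul_X _ _)

theorem eval_smul_form {ι : Type*} {f : MvPolynomial ι ℂ} {d : ℕ} (hf : f.IsHomogeneous d) (c : ℂ)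
    (u : ι → ℂ) : eval (c • u) f = c ^ d * eval u f := by
  rw [eval_eq, eval_eq, Finset.mul_sum]
  refine Finset.sum_congr rfl fun m hm => ?_
  have h := hf (mem_support_iff.1 hm)
  have h' : ∑ i ∈ m.support, m i = d := by
    rw [← h, Finsupp.weight_apply, Finsupp.sum]
    simp
  simp only [Pi.smul_apply, smul_eq_mul, mul_pow, Finset.prod_mul_distrib, Finset.prod_pow_eq_pow_sum, h']
  ring

theorem form_homogeneousComponent_mul {ι : Type*} {f g : MvPolynomial ι ℂ} {d : ℕ}
    (hf : f.IsHomogeneous d) (e : ℕ) :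
    homogeneousComponent (d + e) (f * g) = f * homogeneousComponent e g := by
  classical
  conv_lhs => rw [← sum_homogeneousComponent g, Finset.mul_sum, map_sum]
  have : ∀ i, homogeneousComponent (d + e) (f * homogeneousComponent i g) =
      if i = e then f * homogeneousComponent i g else 0 := by
    intro i
    rw [homogeneousComponent_of_mem (hf.mul (homogeneousComponent_isHomogeneous i g))]
    simp [eq_comm]
  simp only [this, Finset.sum_ite_eq', Finset.mem_range]
  split_ifs with h
  · rfl
  · rw [homogeneousComponent_eq_zero _ _ (by omega), mul_zero]

/-- Modulo `lin v` every variable `X i` equals `v i * w` for a linear form `w` with value `1` at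
`v`. Hence `f` becomes `f(v) * w ^ d = 0`. The cofactor obtained in this way need not be visibly
homogeneous, so it is replaced by its component of the right degree. -/
theorem IsHomogeneous.exists_eq_lin_mul {f : MvPolynomial (Fin 2) ℂ} {d : ℕ}
    (hf : f.IsHomogeneous d) (h0 : f ≠ 0) {v : Fin 2 → ℂ} (hv : v ≠ 0) (h : eval v f = 0) :
    ∃ e g, d = e + 1 ∧ IsHomogeneous g e ∧ f = lin v * g := by
  have hdvd : lin v ∣ f := by
    let I := Ideal.span {lin v}
    rw [← Ideal.mem_span_singleton, ← Ideal.Quotient.eq_zero_iff_mem]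
    have key : ∀ i, Ideal.Quotient.mk I (X i) =
        Ideal.Quotient.mk I (C (v i) * (if v 0 = 0 then C (v 1)⁻¹ * X 1 else C (v 0)⁻¹ * X 0)) := by
      have hl : Ideal.Quotient.mk I (lin v) = 0 :=
        Ideal.Quotient.eq_zero_iff_mem.2 (Ideal.mem_span_singleton_self _)
      intro i
      rw [← sub_eq_zero, ← map_sub, Ideal.Quotient.eq_zero_iff_mem]
      refine Ideal.mem_span_singleton.2 ?_
      split_ifs with h0
      · have h1 : v 1 ≠ 0 := fun h1 => hv (by ext i; fin_cases i <;> simp [h0, h1])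
        have : C (v 1) * C (v 1)⁻¹ = (1 : MvPolynomial (Fin 2) ℂ) := by simp [← C_mul, h1]
        fin_cases i
        · refine ⟨C (v 1)⁻¹, ?_⟩
          simp only [lin, h0, Fin.zero_eta, map_zero]
          linear_combination (-X 0) * this
        · simp only [Fin.mk_one]
          refine ⟨0, ?_⟩
          linear_combination (-X 1) * this
      · fin_cases i
        · simp [← mul_assoc, ← C_mul, h0]
        · refine ⟨-C (v 0)⁻¹, ?_⟩
          have : C (v 0) * C (v 0)⁻¹ = (1 : MvPolynomial (Fin 2) ℂ) := by simp [← C_mul, h0]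
          simp only [lin, Fin.mk_one]
          linear_combination (-X 1) * this
    set w := (if v 0 = 0 then C (v 1)⁻¹ * X 1 else C (v 0)⁻¹ * X 0 : MvPolynomial (Fin 2) ℂ)
    have h1 : Ideal.Quotient.mk I f = Ideal.Quotient.mk I (aeval (fun i => C (v i) * w) f) := by
      have : (Ideal.Quotient.mkₐ ℂ I) = (Ideal.Quotient.mkₐ ℂ I).comp
          (aeval (fun i => C (v i) * w)) := by
        ext i
        simpa using key i
      exact DFunLike.congr_fun this f
    rw [h1]
    have h2 : aeval (fun i => C (v i) * w) f = 0 := by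
      have h3 : aeval (fun i => C (v i) * w) f = C (eval v f) * w ^ d := by
        rw [aeval_def, eval₂_eq, eval_eq, map_sum, Finset.sum_mul]
        refine Finset.sum_congr rfl fun m hm => ?_
        have h := hf (mem_support_iff.1 hm)
        have h' : ∑ i ∈ m.support, m i = d := by
          rw [← h, Finsupp.weight_apply, Finsupp.sum]
          simp
        simp only [mul_pow, Finset.prod_mul_distrib, Finset.prod_pow_eq_pow_sum, h', algebraMap_eq,
          map_mul, map_prod, map_pow]
        ring
      rw [h3, h]; simp
    rw [h2, map_zero]
  obtain ⟨g, rfl⟩ := hdvd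
  cases d with
  | zero =>
    exfalso
    obtain ⟨c, hc⟩ : ∃ c, lin v * g = C c :=
      ⟨_, (totalDegree_eq_zero_iff_eq_C.1 ((totalDegree_zero_iff_isHomogeneous _).2 hf))⟩
    rw [hc] at h h0
    simp at h
    exact h0 (by simp [h])
  | succ e =>
    refine ⟨e, homogeneousComponent e g, rfl, homogeneousComponent_isHomogeneous _ _, ?_⟩
    have := form_homogeneousComponent_mul (g := g) (lin_isHomogeneous v) e
    rw [← this, add_comm 1 e, homogeneousComponent_eq_self hf]

/-- The derivative in the direction `w`. -/
noncomputable def D {ι : Type*} (w : ι → ℂ) :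
    Derivation ℂ (MvPolynomial ι ℂ) (MvPolynomial ι ℂ) :=
  mkDerivation ℂ fun i => C (w i)

theorem D_X {ι : Type*} (w : ι → ℂ) (i : ι) : D w (X i) = C (w i) := mkDerivation_X _ _ _

theorem D_C {ι : Type*} (w : ι → ℂ) (c : ℂ) : D w (C c) = 0 := (D w).map_algebraMap c

theorem D_mul {ι : Type*} (w : ι → ℂ) (f g : MvPolynomial ι ℂ) :
    D w (f * g) = f * D w g + g * D w f := (D w).leibniz f g

theorem D_eq_sum {ι : Type*} [Fintype ι] (w : ι → ℂ) (f : MvPolynomial ι ℂ) :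
    D w f = ∑ j, C (w j) * pderiv j f := by
  classical
  have : D w = ∑ j, (C (w j) : MvPolynomial ι ℂ) • pderiv (R := ℂ) j := by
    refine derivation_ext fun i => ?_
    rw [D_X, ← Derivation.coeFnAddMonoidHom_apply, map_sum, Finset.sum_apply,
      Finset.sum_eq_single i] <;>
      simp +contextual [pderiv_X, eq_comm]
  rw [this, ← Derivation.coeFnAddMonoidHom_apply, map_sum, Finset.sum_apply]
  simp

theorem eval_D {ι : Type*} [Fintype ι] (w u : ι → ℂ) (f : MvPolynomial ι ℂ) :
    eval u (D w f) = ∑ j, w j * eval u (pderiv j f) := by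
  simp [D_eq_sum]

theorem eval_D_add {ι : Type*} [Fintype ι] (w w' u : ι → ℂ) (f : MvPolynomial ι ℂ) :
    eval u (D (w + w') f) = eval u (D w f) + eval u (D w' f) := by
  simp [eval_D, add_mul, Finset.sum_add_distrib]

theorem eval_D_smul {ι : Type*} [Fintype ι] (c : ℂ) (w u : ι → ℂ) (f : MvPolynomial ι ℂ) :
    eval u (D (c • w) f) = c * eval u (D w f) := by
  simp [eval_D, Finset.mul_sum, mul_assoc]

theorem D_isHomogeneous {ι : Type*} [Fintype ι] {f : MvPolynomial ι ℂ} {d : ℕ}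
    (hf : f.IsHomogeneous d) (w : ι → ℂ) : (D w f).IsHomogeneous (d - 1) := by
  rw [D_eq_sum]
  refine IsHomogeneous.sum _ _ _ fun j _ => ?_
  simpa using (isHomogeneous_C _ (w j)).mul (hf.pderiv (i := j))

theorem euler {ι : Type*} [Fintype ι] {f : MvPolynomial ι ℂ} {d : ℕ} (hf : f.IsHomogeneous d)
    (u : ι → ℂ) : eval u (D u f) = d * eval u f := by
  rw [eval_D]
  have := congrArg (eval u) hf.sum_X_mul_pderiv
  simpa using this

theorem D_lin (v w : Fin 2 → ℂ) : D w (lin v) = C (wedge w v) := by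
  simp [lin, D_X, wedge]; ring

/-- The composition of a polynomial with a polynomial path. -/
theorem derivative_aeval {ι : Type*} [Fintype ι] (γ : ι → Polynomial ℂ) (F : MvPolynomial ι ℂ) :
    (aeval γ F).derivative = ∑ i, (γ i).derivative * aeval γ (pderiv i F) := by
  classical
  induction F using MvPolynomial.induction_on with
  | C a => simp
  | add p q hp hq => simp [hp, hq, mul_add, Finset.sum_add_distrib]
  | mul_X p n hp =>
    simp only [map_mul, aeval_X, Polynomial.derivative_mul, hp, Derivation.leibniz, smul_eq_mul,
      map_add, mul_add, Finset.sum_add_distrib, pderiv_X, Finset.sum_mul]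
    rw [add_comm]
    congr 1
    · rw [Finset.sum_eq_single n] <;> simp +contextual [eq_comm, mul_comm]
    · exact Finset.sum_congr rfl fun i _ => by ring

theorem eval_aeval_path {ι : Type*} (γ : ι → Polynomial ℂ) (F : MvPolynomial ι ℂ) (s : ℂ) :
    (aeval γ F).eval s = eval (fun i => (γ i).eval s) F := by
  induction F using MvPolynomial.induction_on with
  | C a => simp
  | add p q hp hq => simp [hp, hq]
  | mul_X p n hp => simp [hp]

/-- The restriction of `f` to the line `u + s w`. -/
noncomputable def chart {ι : Type*} (u w : ι → ℂ) (f : MvPolynomial ι ℂ) : Polynomial ℂ :=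
  aeval (fun i => Polynomial.C (u i) + Polynomial.X * Polynomial.C (w i)) f

theorem eval_chart {ι : Type*} (u w : ι → ℂ) (f : MvPolynomial ι ℂ) (s : ℂ) :
    (chart u w f).eval s = eval (u + s • w) f := by
  rw [chart, eval_aeval_path]
  congr 2
  ext i
  simp only [Polynomial.eval_add, Polynomial.eval_C, Polynomial.eval_mul, Polynomial.eval_X,
    Pi.add_apply, Pi.smul_apply, smul_eq_mul]

theorem derivative_chart {ι : Type*} [Fintype ι] (u w : ι → ℂ) (f : MvPolynomial ι ℂ) :
    (chart u w f).derivative = chart u w (D w f) := by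
  rw [chart, derivative_aeval, chart, D_eq_sum, map_sum]
  refine Finset.sum_congr rfl fun i _ => ?_
  rw [map_mul, aeval_C, Polynomial.algebraMap_eq]
  congr 1
  simp

/-- On the chart `(s, 1)` the form is a polynomial in `s`. If it is not a non-zero constant, it has
a root; if it is the constant `c`, then `f = c * X 1 ^ d`, which vanishes at `(1, 0)`. -/
theorem exists_zero {f : MvPolynomial (Fin 2) ℂ} {d : ℕ} (hf : f.IsHomogeneous d) (hd : d ≠ 0) :
    ∃ v, v ≠ 0 ∧ eval v f = 0 := by
  by_cases h : (chart ![0, 1] ![1, 0] f).degree = 0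
  · obtain ⟨c, hc⟩ := Polynomial.natDegree_eq_zero.1 (Polynomial.natDegree_eq_of_degree_eq_some h)
    refine ⟨![1, 0], by simp, ?_⟩
    have hp : Pol fun v : Fin 2 → ℂ => eval v f - c * eval v (X 1 ^ d) := by
      exact ⟨f - C c * X 1 ^ d, fun v => by simp⟩
    have := hp.eq_zero ?_ ![1, 0]
    · simpa [hd] using this
    · filter_upwards [(Pol.coord (1 : Fin 2)).eventually_ne (v := 1) (by simp)] with v hv
      have h1 := eval_chart ![0, 1] ![1, 0] f (v 0 / v 1)
      rw [← hc, Polynomial.eval_C] at h1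
      have h2 : v = v 1 • (![0, 1] + (v 0 / v 1) • ![1, 0]) := by
        ext i; fin_cases i <;> simp; field_simp
      conv_lhs => rw [h2]
      rw [eval_smul_form hf, ← h1, ← h2]
      simp; ring
  · obtain ⟨s, hs⟩ := IsAlgClosed.exists_root _ h
    refine ⟨_, fun h0 => ?_, (eval_chart ![0, 1] ![1, 0] f s).symm.trans hs⟩
    simpa using congrFun h0 1

theorem form_degree_zero {ι : Type*} {f : MvPolynomial ι ℂ} (hf : f.IsHomogeneous 0) (u v : ι → ℂ) :
    eval u f = eval v f := by
  have := totalDegree_eq_zero_iff_eq_C.1 ((totalDegree_zero_iff_isHomogeneous _).2 hf)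
  rw [this]; simp

theorem mk_eq_mk_iff_wedge {u v : Fin 2 → ℂ} (hu : u ≠ 0) (hv : v ≠ 0) :
    Projectivization.mk ℂ u hu = Projectivization.mk ℂ v hv ↔ wedge u v = 0 := by
  rw [Projectivization.mk_eq_mk_iff']
  constructor
  · rintro ⟨c, rfl⟩
    rw [wedge_smul_left, wedge_self, mul_zero]
  · intro h
    obtain ⟨c, hc⟩ := exists_smul_of_wedge hv h
    exact ⟨c, hc.symm⟩

/-- The zeros of a binary form. -/
def zeros (f : MvPolynomial (Fin 2) ℂ) : Set P1 := {u | eval u.rep f = 0}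

theorem rep_mk {n : ℕ} {v : Fin n → ℂ} (hv : v ≠ 0) :
    ∃ c : ℂ, c ≠ 0 ∧ (Projectivization.mk ℂ v hv).rep = c • v := by
  obtain ⟨c, hc⟩ := Projectivization.exists_smul_eq_mk_rep ℂ v hv
  exact ⟨c, c.ne_zero, by rw [← hc]; rfl⟩

theorem eval_rep_mk {n : ℕ} {f : MvPolynomial (Fin n) ℂ} {d : ℕ} (hf : f.IsHomogeneous d)
    {v : Fin n → ℂ} (hv : v ≠ 0) :
    eval (Projectivization.mk ℂ v hv).rep f = 0 ↔ eval v f = 0 := by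
  obtain ⟨c, hc, h⟩ := rep_mk hv
  rw [h, eval_smul_form hf]
  simp [hc]

theorem mk_mem_zeros {f : MvPolynomial (Fin 2) ℂ} {d : ℕ} (hf : f.IsHomogeneous d)
    {v : Fin 2 → ℂ} (hv : v ≠ 0) : Projectivization.mk ℂ v hv ∈ zeros f ↔ eval v f = 0 :=
  eval_rep_mk hf hv

theorem wedge_rep (x y : P1) : wedge x.rep y.rep = 0 ↔ x = y := by
  rw [← mk_eq_mk_iff_wedge x.rep_nonzero y.rep_nonzero, Projectivization.mk_rep,
    Projectivization.mk_rep]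

theorem zeros_lin_mul {v : Fin 2 → ℂ} (hv : v ≠ 0) (g : MvPolynomial (Fin 2) ℂ) :
    zeros (lin v * g) = insert (Projectivization.mk ℂ v hv) (zeros g) := by
  ext u
  simp only [zeros, Set.mem_ofPred_eq, map_mul, mul_eq_zero, eval_lin, Set.mem_insert_iff]
  rw [← mk_eq_mk_iff_wedge u.rep_nonzero hv, Projectivization.mk_rep]

theorem zeros_finite {f : MvPolynomial (Fin 2) ℂ} {d : ℕ} (hf : f.IsHomogeneous d) (h0 : f ≠ 0) :
    (zeros f).Finite ∧ (zeros f).ncard ≤ d := by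
  induction d generalizing f with
  | zero =>
    have : zeros f = ∅ := by
      ext u
      obtain ⟨v, hv⟩ := exists_eval_ne_zero h0
      simp [zeros, form_degree_zero hf u.rep v, hv]
    simp [this]
  | succ e ih =>
    obtain ⟨v, hv, h⟩ := exists_zero hf (by omega)
    obtain ⟨e', g, he, hg, rfl⟩ := IsHomogeneous.exists_eq_lin_mul hf h0 hv h
    obtain rfl : e = e' := by omega
    obtain ⟨h1, h2⟩ := ih hg (right_ne_zero_of_mul h0)
    rw [zeros_lin_mul hv]
    exact ⟨h1.insert _, (Set.ncard_insert_le _ _).trans (by omega)⟩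

/-- When a linear factor is split off at a simple zero, the cofactor does not vanish there, so each
step of the induction removes exactly one point. -/
theorem zeros_ncard_eq {f : MvPolynomial (Fin 2) ℂ} {d : ℕ} (hf : f.IsHomogeneous d) (h0 : f ≠ 0)
    (hs : ∀ v, v ≠ 0 → eval v f = 0 → ∃ w, eval v (D w f) ≠ 0) : (zeros f).ncard = d := by
  induction d generalizing f with
  | zero => exact Nat.le_zero.1 (zeros_finite hf h0).2
  | succ e ih =>
    obtain ⟨v, hv, h⟩ := exists_zero hf (by omega)
    obtain ⟨e', g, he, hg, rfl⟩ := IsHomogeneous.exists_eq_lin_mul hf h0 hv h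
    obtain rfl : e = e' := by omega
    rw [zeros_lin_mul hv, Set.ncard_insert_of_notMem ?_ (zeros_finite hg (right_ne_zero_of_mul h0)).1,
      ih hg (right_ne_zero_of_mul h0)]
    · intro t ht hgt
      obtain ⟨w, hw⟩ := hs t ht (by simp [hgt])
      exact ⟨w, fun h' => hw (by simp [hgt, h'])⟩
    · rw [mk_mem_zeros hg hv]
      intro h'
      obtain ⟨w, hw⟩ := hs v hv h
      exact hw (by simp [h', eval_lin, wedge_self])

/-- Removal of the common factor of a family of binary forms. -/
theorem exists_content {ι : Type*} {d : ℕ} {f : ι → MvPolynomial (Fin 2) ℂ}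
    (hf : ∀ i, (f i).IsHomogeneous d) (h0 : ∃ i, f i ≠ 0) :
    ∃ (m e : ℕ) (h : MvPolynomial (Fin 2) ℂ) (g : ι → MvPolynomial (Fin 2) ℂ), d = m + e ∧ h ≠ 0 ∧
      h.IsHomogeneous m ∧ (∀ i, (g i).IsHomogeneous e) ∧ (∀ i, f i = h * g i) ∧
      ∀ u, u ≠ 0 → ∃ i, eval u (g i) ≠ 0 := by
  induction d generalizing f with
  | zero =>
    refine ⟨0, 0, 1, f, rfl, one_ne_zero, isHomogeneous_one _ _, hf, by simp, fun u hu => ?_⟩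
    obtain ⟨i, hi⟩ := h0
    obtain ⟨v, hv⟩ := exists_eval_ne_zero hi
    exact ⟨i, by rwa [form_degree_zero (hf i) u v]⟩
  | succ d ih =>
    by_cases H : ∀ u, u ≠ 0 → ∃ i, eval u (f i) ≠ 0
    · exact ⟨0, d + 1, 1, f, by omega, one_ne_zero, isHomogeneous_one _ _, hf, by simp, H⟩
    push Not at H
    obtain ⟨v, hv, H⟩ := H
    have : ∀ i, ∃ g, IsHomogeneous g d ∧ f i = lin v * g := by
      intro i
      by_cases h : f i = 0
      · exact ⟨0, isHomogeneous_zero _ _ _, by simp [h]⟩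
      · obtain ⟨e, g, he, hg, h⟩ := IsHomogeneous.exists_eq_lin_mul (hf i) h hv (H i)
        obtain rfl : d = e := by omega
        exact ⟨g, hg, h⟩
    choose g hg hfg using this
    obtain ⟨m, e, h, g', hd, hh, hhm, hg', hgg, hb⟩ := ih hg (by
      obtain ⟨i, hi⟩ := h0
      exact ⟨i, fun h => hi (by rw [hfg, h, mul_zero])⟩)
    have hl : lin v ≠ 0 := by
      obtain ⟨i, hi⟩ := h0
      rw [hfg] at hi
      exact left_ne_zero_of_mul hi
    refine ⟨m + 1, e, lin v * h, g', by omega, mul_ne_zero hl hh, ?_, hg', fun i => ?_, hb⟩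
    · rw [add_comm]; exact (lin_isHomogeneous v).mul hhm
    · rw [hfg, hgg, mul_assoc]

/-- The main tool for generic choices: a binary form has finitely many zeros, so a condition that is
generic at each of them can be imposed at all of them at once. The invariance `hQ` makes the
condition depend on the projective point only. -/
theorem eventually_forall_zero {β : Type*} {l : Filter β} {f : MvPolynomial (Fin 2) ℂ} {d : ℕ}
    (hf : f.IsHomogeneous d) (h0 : f ≠ 0) {Q : (Fin 2 → ℂ) → β → Prop}
    (hQ : ∀ (c : ℂ) u b, c ≠ 0 → Q u b → Q (c • u) b)
    (h : ∀ t, t ≠ 0 → eval t f = 0 → ∀ᶠ b in l, Q t b) :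
    ∀ᶠ b in l, ∀ t, t ≠ 0 → eval t f = 0 → Q t b := by
  have h1 : ∀ᶠ b in l, ∀ x ∈ zeros f, Q x.rep b :=
    (zeros_finite hf h0).1.eventually_all.2 fun x hx => h _ x.rep_nonzero hx
  filter_upwards [h1] with b hb t ht hft
  have h2 := hb (Projectivization.mk ℂ t ht) ((mk_mem_zeros hf ht).2 hft)
  obtain ⟨c, hc, h3⟩ := rep_mk ht
  rw [h3] at h2
  simpa [smul_smul, hc] using hQ c⁻¹ _ b (inv_ne_zero hc) h2

/-- If `P` fails at `u`, it fails at all `c • u` with `c ≠ 0`. Then `c ↦ G (c • u)` is the zero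
polynomial and every homogeneous component of `G` vanishes at `u`. In two variables this makes the
exceptional set of projective points finite. -/
theorem exists_form_of_eventually {ι : Type*} {P : (ι → ℂ) → Prop}
    (hP : ∀ (c : ℂ) u, c ≠ 0 → P u → P (c • u)) (h : ∀ᶠ u in gen ι, P u) :
    ∃ (d : ℕ) (f : MvPolynomial ι ℂ), f.IsHomogeneous d ∧ f ≠ 0 ∧ ∀ u, eval u f ≠ 0 → P u := by
  obtain ⟨G, hG, h⟩ := eventually_gen.1 h
  obtain ⟨d, hd⟩ : ∃ d, homogeneousComponent d G ≠ 0 := by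
    by_contra! H
    exact hG (by rw [← sum_homogeneousComponent G]; simp [H])
  refine ⟨d, _, homogeneousComponent_isHomogeneous d G, hd, fun u hu => ?_⟩
  by_contra hPu
  let q : Polynomial ℂ := ∑ i ∈ Finset.range (G.totalDegree + 1),
    Polynomial.C (eval u (homogeneousComponent i G)) * Polynomial.X ^ i
  have hq : ∀ c, q.eval c = eval (c • u) G := by
    intro c
    conv_rhs => rw [← sum_homogeneousComponent G, map_sum]
    simp only [q, Polynomial.eval_finsetSum]
    refine Finset.sum_congr rfl fun i _ => ?_
    rw [eval_smul_form (homogeneousComponent_isHomogeneous i G)]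
    simp only [Polynomial.eval_mul, Polynomial.eval_C, Polynomial.eval_pow, Polynomial.eval_X]
    ring
  have h0 : q = 0 := by
    refine Polynomial.eq_zero_of_infinite_isRoot _ (Set.Infinite.mono (s := {0}ᶜ) ?_ ?_)
    · intro c hc
      by_contra hne
      rw [Set.mem_ofPred_eq, Polynomial.IsRoot, hq] at hne
      have := hP c⁻¹ _ (inv_ne_zero hc) (h _ hne)
      rw [smul_smul, inv_mul_cancel₀ hc, one_smul] at this
      exact hPu this
    · exact (Set.finite_singleton 0).infinite_compl
  have h1 : q.coeff d = eval u (homogeneousComponent d G) := by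
    simp only [q, Polynomial.finsetSum_coeff, Polynomial.coeff_C_mul, Polynomial.coeff_X_pow]
    simp only [mul_ite, mul_one, mul_zero, Finset.sum_ite_eq, Finset.mem_range]
    split_ifs with h
    · rfl
    · rw [homogeneousComponent_eq_zero _ _ (by omega), map_zero]
  rw [h0] at h1
  exact hu (by simpa using h1.symm)

/-- Two forms of positive degree without a common zero have a non-zero Wronskian. -/
theorem wronskian_ne_zero {f g : MvPolynomial (Fin 2) ℂ} {d : ℕ} (hd : d ≠ 0)
    (hf : f.IsHomogeneous d) (h0 : f ≠ 0) (h : ∀ u, u ≠ 0 → eval u f = 0 → eval u g ≠ 0) :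
    ∃ w, f * D w g - g * D w f ≠ 0 := by
  obtain ⟨v, hv, hfv⟩ := exists_zero hf hd
  have key : ∀ (d : ℕ) (f : MvPolynomial (Fin 2) ℂ), f ≠ 0 → f.IsHomogeneous d →
      ∃ (m : ℕ) (f' : MvPolynomial (Fin 2) ℂ), f = lin v ^ m * f' ∧ eval v f' ≠ 0 := by
    intro d
    induction d with
    | zero =>
      intro f h0 hf
      obtain ⟨t, ht⟩ := exists_eval_ne_zero h0
      exact ⟨0, f, by simp, by rwa [form_degree_zero hf v t]⟩
    | succ d ih =>
      intro f h0 hf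
      by_cases hfv : eval v f = 0
      · obtain ⟨e, g, he, hg, rfl⟩ := IsHomogeneous.exists_eq_lin_mul hf h0 hv hfv
        obtain rfl : d = e := by omega
        obtain ⟨m, f', h1, h2⟩ := ih g (right_ne_zero_of_mul h0) hg
        exact ⟨m + 1, f', by rw [h1]; ring, h2⟩
      · exact ⟨0, f, by simp, hfv⟩
  obtain ⟨m, f', rfl, hf'⟩ := key d f h0 hf
  obtain ⟨w, hw⟩ := exists_wedge_ne_zero hv
  refine ⟨w, fun H => ?_⟩
  cases m with
  | zero => exact hf' (by simpa using hfv)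
  | succ m =>
    have hl : lin v ^ m ≠ 0 := fun hl => h0 (by rw [pow_succ, hl]; simp)
    -- At the zero `v` the Wronskian has order one less than `f`: after cancellation of `lin v ^ m`,
    -- the term with the factor `m + 1` is the only one that survives at `v`.
    have h1 : lin v ^ m * (lin v * f' * D w g - g * (((m + 1 : ℕ) : MvPolynomial (Fin 2) ℂ) * C (wedge w v) * f' +
        lin v * D w f')) = 0 := by
      rw [← H, D_mul, Derivation.leibniz_pow, D_lin]
      simp only [Nat.add_sub_cancel, nsmul_eq_mul, smul_eq_mul]
      push_cast
      ring
    have h2 := congrArg (eval v) ((mul_eq_zero.1 h1).resolve_left hl)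
    have h3 := h v hv hfv
    rw [wedge_swap] at h2
    simp [eval_lin, wedge_self, h3, hw, hf'] at h2
    norm_cast at h2

/-! ### Plücker coordinates -/

/-- The skew symmetric map with the entries `x`. -/
def N (x : Fin 6 → ℂ) (z : Fin 4 → ℂ) : Fin 4 → ℂ :=
  ![x 0 * z 1 + x 1 * z 2 + x 2 * z 3, -x 0 * z 0 + x 3 * z 2 + x 4 * z 3,
    -x 1 * z 0 - x 3 * z 1 + x 5 * z 3, -x 2 * z 0 - x 4 * z 1 - x 5 * z 2]

/-- The dual Plücker coordinates. -/
def dual (x : Fin 6 → ℂ) : Fin 6 → ℂ := ![x 5, -x 4, x 3, x 2, -x 1, x 0]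

/-- The skew symmetric map with the dual entries; `Ns x z` is the plane joining the line `x` and
the point `z`. -/
def Ns (x : Fin 6 → ℂ) (z : Fin 4 → ℂ) : Fin 4 → ℂ := N (dual x) z

/-- The polar form of the Plücker quadric. -/
def pair (x y : Fin 6 → ℂ) : ℂ :=
  x 0 * y 5 - x 1 * y 4 + x 2 * y 3 + x 3 * y 2 - x 4 * y 1 + x 5 * y 0

/-- The Plücker quadric. -/
def pf (x : Fin 6 → ℂ) : ℂ := x 0 * x 5 - x 1 * x 4 + x 2 * x 3

/-- The Plücker coordinates of the line joining two points. -/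
def wed (p q : Fin 4 → ℂ) : Fin 6 → ℂ :=
  ![p 0 * q 1 - p 1 * q 0, p 0 * q 2 - p 2 * q 0, p 0 * q 3 - p 3 * q 0,
    p 1 * q 2 - p 2 * q 1, p 1 * q 3 - p 3 * q 1, p 2 * q 3 - p 3 * q 2]

/-- The scalar product. -/
def dt (z w : Fin 4 → ℂ) : ℂ := z 0 * w 0 + z 1 * w 1 + z 2 * w 2 + z 3 * w 3

theorem dt_comm (z w : Fin 4 → ℂ) : dt z w = dt w z := by simp [dt, mul_comm]
theorem dt_add_left (z z' w : Fin 4 → ℂ) : dt (z + z') w = dt z w + dt z' w := by simp [dt]; ring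
theorem dt_add_right (z w w' : Fin 4 → ℂ) : dt z (w + w') = dt z w + dt z w' := by simp [dt]; ring
theorem dt_smul_left (c : ℂ) (z w : Fin 4 → ℂ) : dt (c • z) w = c * dt z w := by simp [dt]; ring
theorem dt_smul_right (c : ℂ) (z w : Fin 4 → ℂ) : dt z (c • w) = c * dt z w := by simp [dt]; ring
theorem dt_zero_right (w : Fin 4 → ℂ) : dt w 0 = 0 := by simp [dt]

theorem exists_dt_ne_zero {z : Fin 4 → ℂ} (hz : z ≠ 0) : ∃ w, dt z w ≠ 0 := by
  obtain ⟨i, hi⟩ := Function.ne_iff.1 hz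
  refine ⟨Pi.single i 1, ?_⟩
  fin_cases i <;> simpa [dt, Pi.single_apply] using hi

theorem N_add_left (x y : Fin 6 → ℂ) (z : Fin 4 → ℂ) : N (x + y) z = N x z + N y z := by
  ext i; fin_cases i <;> simp [N] <;> ring
theorem N_smul_left (c : ℂ) (x : Fin 6 → ℂ) (z : Fin 4 → ℂ) : N (c • x) z = c • N x z := by
  ext i; fin_cases i <;> simp [N] <;> ring
theorem N_add_right (x : Fin 6 → ℂ) (z w : Fin 4 → ℂ) : N x (z + w) = N x z + N x w := by
  ext i; fin_cases i <;> simp [N] <;> ring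
theorem N_smul_right (c : ℂ) (x : Fin 6 → ℂ) (z : Fin 4 → ℂ) : N x (c • z) = c • N x z := by
  ext i; fin_cases i <;> simp [N] <;> ring
theorem N_zero_right (x : Fin 6 → ℂ) : N x 0 = 0 := by ext i; fin_cases i <;> simp [N]
theorem N_zero_left (z : Fin 4 → ℂ) : N 0 z = 0 := by ext i; fin_cases i <;> simp [N]

theorem dual_add (x y : Fin 6 → ℂ) : dual (x + y) = dual x + dual y := by
  ext i; fin_cases i <;> simp [dual] <;> ring
theorem dual_smul (c : ℂ) (x : Fin 6 → ℂ) : dual (c • x) = c • dual x := by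
  ext i; fin_cases i <;> simp [dual]
theorem dual_dual (x : Fin 6 → ℂ) : dual (dual x) = x := by
  ext i; fin_cases i <;> simp [dual]
theorem dual_zero : dual 0 = 0 := by ext i; fin_cases i <;> simp [dual]
theorem dual_ne_zero {x : Fin 6 → ℂ} (h : x ≠ 0) : dual x ≠ 0 := fun h' =>
  h (by rw [← dual_dual x, h', dual_zero])
theorem pf_dual (x : Fin 6 → ℂ) : pf (dual x) = pf x := by simp [pf, dual]; ring
theorem pair_dual (x y : Fin 6 → ℂ) : pair (dual x) (dual y) = pair x y := by
  simp [pair, dual]; ring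

theorem Ns_add_left (x y : Fin 6 → ℂ) (z : Fin 4 → ℂ) : Ns (x + y) z = Ns x z + Ns y z := by
  rw [Ns, dual_add, N_add_left]; rfl
theorem Ns_smul_left (c : ℂ) (x : Fin 6 → ℂ) (z : Fin 4 → ℂ) : Ns (c • x) z = c • Ns x z := by
  rw [Ns, dual_smul, N_smul_left]; rfl
theorem Ns_add_right (x : Fin 6 → ℂ) (z w : Fin 4 → ℂ) : Ns x (z + w) = Ns x z + Ns x w :=
  N_add_right _ _ _
theorem Ns_smul_right (c : ℂ) (x : Fin 6 → ℂ) (z : Fin 4 → ℂ) : Ns x (c • z) = c • Ns x z :=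
  N_smul_right _ _ _
theorem Ns_zero_right (x : Fin 6 → ℂ) : Ns x 0 = 0 := N_zero_right _

theorem pair_comm (x y : Fin 6 → ℂ) : pair x y = pair y x := by simp [pair]; ring
theorem pair_self (x : Fin 6 → ℂ) : pair x x = 2 * pf x := by simp [pair, pf]; ring
theorem pair_smul_left (c : ℂ) (x y : Fin 6 → ℂ) : pair (c • x) y = c * pair x y := by
  simp [pair]; ring
theorem pair_smul_right (c : ℂ) (x y : Fin 6 → ℂ) : pair x (c • y) = c * pair x y := by
  simp [pair]; ring
theorem pair_add_left (x x' y : Fin 6 → ℂ) : pair (x + x') y = pair x y + pair x' y := by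
  simp [pair]; ring
theorem pair_add_right (x y y' : Fin 6 → ℂ) : pair x (y + y') = pair x y + pair x y' := by
  simp [pair]; ring
theorem pf_smul (c : ℂ) (x : Fin 6 → ℂ) : pf (c • x) = c ^ 2 * pf x := by simp [pf]; ring
theorem pf_wed (p q : Fin 4 → ℂ) : pf (wed p q) = 0 := by simp [pf, wed]; ring

theorem exists_pair {x : Fin 6 → ℂ} (hx : x ≠ 0) : ∃ y, pair x y = 1 := by
  obtain ⟨i, hi⟩ := Function.ne_iff.1 hx
  obtain ⟨y, hy⟩ : ∃ y, pair x y ≠ 0 := by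
    refine ⟨dual (Pi.single i 1), ?_⟩
    fin_cases i <;> simpa [pair, dual, Pi.single_apply] using hi
  exact ⟨(pair x y)⁻¹ • y, by rw [pair_smul_right, inv_mul_cancel₀ hy]⟩

theorem dt_N (x : Fin 6 → ℂ) (z w : Fin 4 → ℂ) : dt z (N x w) = - dt w (N x z) := by
  simp [dt, N]; ring
theorem dt_N_self (x : Fin 6 → ℂ) (z : Fin 4 → ℂ) : dt z (N x z) = 0 := by
  simp [dt, N]; ring
theorem dt_Ns (x : Fin 6 → ℂ) (z w : Fin 4 → ℂ) : dt z (Ns x w) = - dt w (Ns x z) := dt_N _ _ _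
theorem dt_Ns_self (x : Fin 6 → ℂ) (z : Fin 4 → ℂ) : dt z (Ns x z) = 0 := dt_N_self _ _

/-- The polarization of the identity `N x (Ns x z) = -pf x • z`. The incidence relations between
points, lines and planes are drawn from it. -/
theorem N_Ns_add (x y : Fin 6 → ℂ) (z : Fin 4 → ℂ) :
    N x (Ns y z) + N y (Ns x z) = (-pair x y) • z := by
  ext i; fin_cases i <;> simp [N, Ns, dual, pair] <;> ring
theorem Ns_N_add (x y : Fin 6 → ℂ) (z : Fin 4 → ℂ) :
    Ns x (N y z) + Ns y (N x z) = (-pair x y) • z := by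
  rw [← pair_dual, ← N_Ns_add]
  simp [Ns, dual_dual]

theorem N_Ns_self {x : Fin 6 → ℂ} (hx : pf x = 0) (z : Fin 4 → ℂ) : N x (Ns x z) = 0 := by
  have := N_Ns_add x x z
  rw [pair_self, hx] at this
  simpa [← two_smul ℂ] using this
theorem Ns_N_self {x : Fin 6 → ℂ} (hx : pf x = 0) (z : Fin 4 → ℂ) : Ns x (N x z) = 0 := by
  have := Ns_N_add x x z
  rw [pair_self, hx] at this
  simpa [← two_smul ℂ] using this

/-- So `N x z` is the point in which the line `x` meets the plane `z`, and it is zero if the plane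
contains the line. -/
theorem N_wed (p q z : Fin 4 → ℂ) : N (wed p q) z = dt q z • p - dt p z • q := by
  ext i; fin_cases i <;> simp [N, wed, dt] <;> ring
theorem Ns_wed_left (p q : Fin 4 → ℂ) : Ns (wed p q) p = 0 := by
  ext i; fin_cases i <;> simp [Ns, N, wed, dual] <;> ring
theorem Ns_wed_right (p q : Fin 4 → ℂ) : Ns (wed p q) q = 0 := by
  ext i; fin_cases i <;> simp [Ns, N, wed, dual] <;> ring
theorem wed_combination (p q : Fin 4 → ℂ) (a b c d : ℂ) :
    wed (a • p + b • q) (c • p + d • q) = (a * d - b * c) • wed p q := by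
  ext i; fin_cases i <;> simp [wed] <;> ring
theorem Ns_wed_cyc (p q z : Fin 4 → ℂ) : Ns (wed p q) z = Ns (wed q z) p := by
  ext i; fin_cases i <;> simp [Ns, N, wed, dual] <;> ring
theorem wed_swap (p q : Fin 4 → ℂ) : wed p q = (-1 : ℂ) • wed q p := by
  ext i; fin_cases i <;> simp [wed] <;> ring
theorem wed_self (p : Fin 4 → ℂ) : wed p p = 0 := by
  ext i; fin_cases i <;> simp [wed] <;> ring
theorem pair_wed_eq (x : Fin 6 → ℂ) (p q : Fin 4 → ℂ) : pair x (wed p q) = dt p (Ns x q) := by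
  simp [pair, wed, dt, Ns, N, dual]; ring

/-- With `pair x y = 1` the identity `N_Ns_add` reads `z = -N x (Ns y z)`. Points of a line can
therefore be written `N x ζ`, an expression that can be moved along with the line. -/
theorem eq_N_of_Ns {x : Fin 6 → ℂ} (hx : x ≠ 0) {z : Fin 4 → ℂ} (hz : Ns x z = 0) :
    ∃ ζ, z = N x ζ := by
  obtain ⟨y, hy⟩ := exists_pair hx
  refine ⟨(-1 : ℂ) • Ns y z, ?_⟩
  have := N_Ns_add x y z
  rw [hz, N_zero_right, hy, add_zero] at this
  rw [N_smul_right, this]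
  simp
theorem eq_Ns_of_N {x : Fin 6 → ℂ} (hx : x ≠ 0) {z : Fin 4 → ℂ} (hz : N x z = 0) :
    ∃ ζ, z = Ns x ζ := by
  have := eq_N_of_Ns (dual_ne_zero hx) (z := z) (by rwa [Ns, dual_dual])
  exact this

theorem exists_N_ne_zero {x : Fin 6 → ℂ} (hx : x ≠ 0) : ∃ z, N x z ≠ 0 := by
  by_contra! h
  apply hx
  have h0 := h ![1, 0, 0, 0]
  have h1 := h ![0, 1, 0, 0]
  have h2 := h ![0, 0, 1, 0]
  simp [N] at h0 h1 h2
  ext i; fin_cases i <;> simp [h0, h1, h2]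
theorem exists_Ns_ne_zero {x : Fin 6 → ℂ} (hx : x ≠ 0) : ∃ z, Ns x z ≠ 0 :=
  exists_N_ne_zero (dual_ne_zero hx)

/-- Two columns of the skew matrix of `x` are points of the line. By the Plücker relation their
exterior product is `x` times the corresponding entry, and some entry is non-zero. -/
theorem exists_eq_wed {x : Fin 6 → ℂ} (h : pf x = 0) : ∃ p q, x = wed p q := by
  by_cases hx : x = 0
  · exact ⟨0, 0, by rw [hx, wed_self]⟩
  have key : ∀ (c : ℂ) (p q : Fin 4 → ℂ), c ≠ 0 → wed p q = c • x → ∃ p q, x = wed p q := by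
    intro c p q hc h
    refine ⟨c⁻¹ • p, q, ?_⟩
    have := wed_combination p q c⁻¹ 0 0 1
    simp only [zero_smul, add_zero, one_smul, zero_add, mul_one, zero_mul, sub_zero] at this
    rw [this, h, smul_smul, inv_mul_cancel₀ hc, one_smul]
  have h' : x 0 * x 5 - x 1 * x 4 + x 2 * x 3 = 0 := h
  obtain ⟨i, hi⟩ := Function.ne_iff.1 hx
  fin_cases i
  · refine key (x 0) (N x ![1, 0, 0, 0]) (N x ![0, 1, 0, 0]) hi ?_
    ext j; fin_cases j <;> simp [N, wed] <;> first | ring1 | linear_combination h' | linear_combination -h'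
  · refine key (x 1) (N x ![1, 0, 0, 0]) (N x ![0, 0, 1, 0]) hi ?_
    ext j; fin_cases j <;> simp [N, wed] <;> first | ring1 | linear_combination h'
  · refine key (x 2) (N x ![1, 0, 0, 0]) (N x ![0, 0, 0, 1]) hi ?_
    ext j; fin_cases j <;> simp [N, wed] <;> first | ring1 | linear_combination h' | linear_combination -h'
  · refine key (x 3) (N x ![0, 1, 0, 0]) (N x ![0, 0, 1, 0]) hi ?_
    ext j; fin_cases j <;> simp [N, wed] <;> first | ring1 | linear_combination h' | linear_combination -h'
  · refine key (x 4) (N x ![0, 1, 0, 0]) (N x ![0, 0, 0, 1]) hi ?_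
    ext j; fin_cases j <;> simp [N, wed] <;> first | ring1 | linear_combination h'
  · refine key (x 5) (N x ![0, 0, 1, 0]) (N x ![0, 0, 0, 1]) hi ?_
    ext j; fin_cases j <;> simp [N, wed] <;> first | ring1 | linear_combination h' | linear_combination -h'

theorem mem_span_of_Ns {p q z : Fin 4 → ℂ} (h : wed p q ≠ 0) :
    Ns (wed p q) z = 0 ↔ z ∈ Submodule.span ℂ {p, q} := by
  rw [Submodule.mem_span_pair]
  constructor
  · intro hz
    obtain ⟨ζ, rfl⟩ := eq_N_of_Ns h hz
    exact ⟨dt q ζ, - dt p ζ, by rw [N_wed]; module⟩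
  · rintro ⟨a, b, rfl⟩
    rw [Ns_add_right, Ns_smul_right, Ns_smul_right, Ns_wed_left, Ns_wed_right]
    simp

/-- A line is determined by its points. -/
theorem exists_smul_of_line_le {x y : Fin 6 → ℂ} (hx : pf x = 0) (hy : pf y = 0) (hy0 : y ≠ 0)
    (h : ∀ z, Ns x z = 0 → Ns y z = 0) : ∃ c : ℂ, x = c • y := by
  obtain ⟨p, q, rfl⟩ := exists_eq_wed hx
  obtain ⟨p', q', rfl⟩ := exists_eq_wed hy
  obtain ⟨a, b, rfl⟩ := Submodule.mem_span_pair.1 ((mem_span_of_Ns hy0).1 (h p (Ns_wed_left p q)))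
  obtain ⟨c, d, rfl⟩ := Submodule.mem_span_pair.1 ((mem_span_of_Ns hy0).1 (h q (Ns_wed_right _ q)))
  exact ⟨_, wed_combination _ _ _ _ _ _⟩

/-- Intersecting lines. -/
theorem pair_eq_zero_of_common {x y : Fin 6 → ℂ} {z : Fin 4 → ℂ} (hz : z ≠ 0) (h : Ns x z = 0)
    (h' : Ns y z = 0) : pair x y = 0 := by
  have := N_Ns_add x y z
  rw [h, h', N_zero_right, N_zero_right, add_zero, eq_comm, smul_eq_zero] at this
  simpa using this.resolve_right hz

/-- The planes `z` and `w` meet the line `x` in `N x z` and `N x w`. The hypothesis puts the second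
point on the plane `z`, so the two points agree, unless the line lies in the plane `z` and `c = 0`.
-/
theorem exists_smul_N {x : Fin 6 → ℂ} (hx : pf x = 0) {z w : Fin 4 → ℂ} (h : dt z (N x w) = 0)
    (hw : N x w ≠ 0) : ∃ c : ℂ, N x z = c • N x w := by
  obtain ⟨p, q, rfl⟩ := exists_eq_wed hx
  rw [N_wed] at h hw
  have h1 : wedge ![dt q z, -dt p z] ![dt q w, -dt p w] = 0 := by
    simp only [wedge, Matrix.cons_val_zero, Matrix.cons_val_one]
    have : dt z (dt q w • p - dt p w • q) = dt q w * dt p z - dt p w * dt q z := by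
      simp [dt]; ring
    rw [this] at h
    linear_combination h
  have h2 : ![dt q w, -dt p w] ≠ 0 := by
    intro h0
    have e0 := congrFun h0 0
    have e1 := congrFun h0 1
    simp at e0 e1
    exact hw (by simp [e0, e1])
  obtain ⟨c, hc⟩ := exists_smul_of_wedge h2 h1
  refine ⟨c, ?_⟩
  have e0 := congrFun hc 0
  have e1 := congrFun hc 1
  simp at e0 e1
  rw [N_wed, N_wed, e0, e1]
  module

/-- The points of a plane through a line. -/
theorem exists_of_dt_Ns {x : Fin 6 → ℂ} (hx : pf x = 0) {a z : Fin 4 → ℂ} (ha : Ns x a ≠ 0)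
    (h : dt z (Ns x a) = 0) : ∃ (c : ℂ) (y : Fin 4 → ℂ), Ns x y = 0 ∧ z = c • a + y := by
  obtain ⟨c, hc⟩ := exists_smul_N (x := dual x) (by rwa [pf_dual]) h ha
  refine ⟨c, z - c • a, ?_, by module⟩
  change N (dual x) (z - c • a) = 0
  rw [sub_eq_add_neg, ← neg_smul, N_add_right, hc, N_smul_right]
  module

theorem exists_smul_Ns {x : Fin 6 → ℂ} (hx : pf x = 0) {z w : Fin 4 → ℂ} (h : dt z (Ns x w) = 0)
    (hw : Ns x w ≠ 0) : ∃ c : ℂ, Ns x z = c • Ns x w :=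
  exists_smul_N (x := dual x) (by rwa [pf_dual]) h hw

theorem wed_eq_zero_iff {p q : Fin 4 → ℂ} (hq : q ≠ 0) : wed p q = 0 ↔ ∃ c : ℂ, p = c • q := by
  constructor
  · intro h
    obtain ⟨w, hw⟩ := exists_dt_ne_zero hq
    have := N_wed p q w
    rw [h, N_zero_left, eq_comm, sub_eq_zero] at this
    refine ⟨(dt q w)⁻¹ * dt p w, ?_⟩
    rw [mul_smul, ← this, smul_smul, inv_mul_cancel₀ hw, one_smul]
  · rintro ⟨c, rfl⟩
    have := wed_combination q 0 c 0 1 0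
    simpa [wed_self] using this

/-! ### Zariski closures and surfaces -/

theorem vanishesOn_iff {F : MvPolynomial (Fin 4) ℂ} {d : ℕ} (hF : F.IsHomogeneous d) {X : Set P3} :
    VanishesOn F X ↔ ∀ (v : Fin 4 → ℂ) (hv : v ≠ 0), Projectivization.mk ℂ v hv ∈ X →
      eval v F = 0 := by
  constructor
  · intro h v hv hX
    exact (eval_rep_mk hF hv).1 (h _ hX)
  · intro h x hx
    exact h x.rep x.rep_nonzero (by rwa [Projectivization.mk_rep])

theorem mk_mem_closure {X : Set P3} {v : Fin 4 → ℂ} (hv : v ≠ 0) :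
    Projectivization.mk ℂ v hv ∈ zariskiClosure X ↔ ∀ (d : ℕ) (F : MvPolynomial (Fin 4) ℂ),
      F.IsHomogeneous d → VanishesOn F X → eval v F = 0 :=
  forall₂_congr fun _ _ => forall₂_congr fun hF _ => eval_rep_mk hF hv

theorem subset_zariskiClosure (X : Set P3) : X ⊆ zariskiClosure X := fun x hx _ _ _ h => h x hx

theorem vanishesOn_closure {F : MvPolynomial (Fin 4) ℂ} {d : ℕ} (hF : F.IsHomogeneous d)
    {X : Set P3} : VanishesOn F (zariskiClosure X) ↔ VanishesOn F X :=
  ⟨fun h x hx => h x (subset_zariskiClosure X hx), fun h _ hx => hx d F hF h⟩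

theorem zariskiClosure_subset {X Y : Set P3} (h : X ⊆ zariskiClosure Y) :
    zariskiClosure X ⊆ zariskiClosure Y :=
  fun _ hx d F hF hY => hx d F hF fun y hy => (vanishesOn_closure hF).2 hY y (h hy)

theorem zariskiClosure_mono {X Y : Set P3} (h : X ⊆ Y) : zariskiClosure X ⊆ zariskiClosure Y :=
  zariskiClosure_subset (h.trans (subset_zariskiClosure Y))

theorem zariskiClosure_eq_of {X Y : Set P3} (h : X ⊆ zariskiClosure Y) (h' : Y ⊆ zariskiClosure X) :
    zariskiClosure X = zariskiClosure Y :=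
  (zariskiClosure_subset h).antisymm (zariskiClosure_subset h')

theorem zariskiClosure_zeroLocus {F : MvPolynomial (Fin 4) ℂ} {d : ℕ} (hF : F.IsHomogeneous d) :
    zariskiClosure {x : P3 | eval x.rep F = 0} = {x : P3 | eval x.rep F = 0} :=
  Set.Subset.antisymm (fun _ hx => hx d F hF fun _ hy => hy) (subset_zariskiClosure _)

/-- An irreducible form generates the ideal of its zero locus. -/
theorem dvd_of_forall_eval {F G : MvPolynomial (Fin 4) ℂ} (hF : Irreducible F)
    (h : ∀ v, eval v F = 0 → eval v G = 0) : F ∣ G := by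
  have h1 : G ∈ vanishingIdeal ℂ (zeroLocus ℂ (Ideal.span {F})) := by
    rw [mem_vanishingIdeal_iff]
    intro v hv
    rw [mem_zeroLocus_iff] at hv
    have := hv F (Ideal.mem_span_singleton_self F)
    simp only [aeval_eq_eval] at this ⊢
    exact h v this
  rw [vanishingIdeal_zeroLocus_eq_radical] at h1
  have hp : (Ideal.span {F}).IsPrime := by
    rw [Ideal.span_singleton_prime hF.ne_zero]
    exact hF.prime
  rwa [hp.radical, Ideal.mem_span_singleton] at h1

theorem eval_aeval {ι κ : Type*} (g : ι → MvPolynomial κ ℂ) (F : MvPolynomial ι ℂ) (v : κ → ℂ) :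
    eval v (aeval g F) = eval (fun i => eval v (g i)) F := by
  induction F using MvPolynomial.induction_on with
  | C a => simp
  | add p q hp hq => rw [map_add, map_add, map_add, hp, hq]
  | mul_X p n hp => rw [map_mul, map_mul, map_mul, hp, aeval_X, eval_X]

theorem exists_form_zero {F : MvPolynomial (Fin 4) ℂ} {k : ℕ} (hF : F.IsHomogeneous k)
    (hk : k ≠ 0) : ∃ v, v ≠ 0 ∧ eval v F = 0 := by
  let G : MvPolynomial (Fin 2) ℂ := aeval ![X 0, X 1, 0, 0] F
  have hG : G.IsHomogeneous k := by
    have := hF.aeval (S := ℂ) (![X 0, X 1, 0, 0] : Fin 4 → MvPolynomial (Fin 2) ℂ) (n := 1) (by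
      intro i; fin_cases i
      · exact isHomogeneous_X _ _
      · exact isHomogeneous_X _ _
      · exact isHomogeneous_zero _ _ _
      · exact isHomogeneous_zero _ _ _)
    rwa [one_mul] at this
  obtain ⟨v, hv, h⟩ := exists_zero hG hk
  refine ⟨![v 0, v 1, 0, 0], ?_, ?_⟩
  · intro h0
    apply hv
    ext i; fin_cases i
    · exact congrFun h0 0
    · exact congrFun h0 1
  · rw [eval_aeval] at h
    refine Eq.trans ?_ h
    congr 2
    ext i; fin_cases i <;> simp

theorem dvd_of_vanishesOn {F G : MvPolynomial (Fin 4) ℂ} {k d : ℕ} (hF : Irreducible F)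
    (hFk : F.IsHomogeneous k) (hk : k ≠ 0) (hG : G.IsHomogeneous d)
    (h : VanishesOn G {x : P3 | eval x.rep F = 0}) : F ∣ G := by
  have h' := (vanishesOn_iff hG).1 h
  refine dvd_of_forall_eval hF fun v hv => ?_
  by_cases h0 : v = 0
  -- The origin is not a projective point. Only a form of degree zero can be non-zero there, and
  -- such a form is constant, with value zero at the genuine zero `w` of `F`.
  · obtain ⟨w, hw, hFw⟩ := exists_form_zero hFk hk
    have hGw := h' w hw ((eval_rep_mk hFk hw).2 hFw)
    cases d with
    | zero => rwa [form_degree_zero hG v w]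
    | succ d =>
      have := eval_smul_form hG 0 v
      subst h0
      simpa using this
  · exact h' v h0 ((eval_rep_mk hFk h0).2 hv)

/-- A form vanishing on the surface is `F * A`, and at a zero of `F` its gradient is a multiple of
the gradient of `F`; so one equation describes the tangent space. -/
theorem mem_tangentSpace_iff {F : MvPolynomial (Fin 4) ℂ} {k : ℕ} (hF : Irreducible F)
    (hFk : F.IsHomogeneous k) (hk : k ≠ 0) {x : P3} (hx : eval x.rep F = 0) {v : Fin 4 → ℂ} :
    v ∈ tangentSpace {x : P3 | eval x.rep F = 0} x ↔ eval x.rep (D v F) = 0 := by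
  constructor
  · intro h
    rw [eval_D]
    exact h k F hFk fun y hy => hy
  · intro h d G hG hGX
    obtain ⟨A, rfl⟩ := dvd_of_vanishesOn hF hFk hk hG hGX
    rw [← eval_D, D_mul]
    simp [h, hx]

theorem mem_smoothLocus_iff {F : MvPolynomial (Fin 4) ℂ} {k : ℕ} (hF : Irreducible F)
    (hFk : F.IsHomogeneous k) (hk : k ≠ 0) {x : P3} :
    x ∈ smoothLocus {x : P3 | eval x.rep F = 0} ↔
      eval x.rep F = 0 ∧ ∃ v, eval x.rep (D v F) ≠ 0 := by
  refine and_congr_right fun hx => ?_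
  let φ : (Fin 4 → ℂ) →ₗ[ℂ] ℂ :=
    { toFun := fun v => eval x.rep (D v F)
      map_add' := fun v w => eval_D_add _ _ _ _
      map_smul' := fun c v => eval_D_smul _ _ _ _ }
  have h : tangentSpace {x : P3 | eval x.rep F = 0} x = φ.ker := by
    ext v
    rw [mem_tangentSpace_iff hF hFk hk hx, LinearMap.mem_ker]
    rfl
  rw [h]
  have h1 := φ.finrank_range_add_finrank_ker
  rw [Module.finrank_fin_fun] at h1
  constructor
  · intro h3
    by_contra! h0
    have : φ = 0 := LinearMap.ext h0
    rw [this, LinearMap.range_zero, finrank_bot] at h1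
    rw [this] at h3
    omega
  · rintro ⟨v, hv⟩
    have : φ.range = ⊤ := LinearMap.range_eq_top.2 (LinearMap.surjective fun h0 => hv (by
      have := LinearMap.congr_fun h0 v
      exact this))
    rw [this, finrank_top, Module.finrank_self] at h1
    omega

/-! ### Elimination -/

theorem natDegree_chart_le {f : MvPolynomial (Fin 2) ℂ} {e : ℕ} (hf : f.IsHomogeneous e)
    (u w : Fin 2 → ℂ) : (chart u w f).natDegree ≤ e := by
  rw [chart, aeval_def, eval₂_eq]
  refine Polynomial.natDegree_sum_le_of_forall_le _ _ fun m hm => ?_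
  have h' : ∑ i ∈ m.support, m i = e := by
    rw [← hf (mem_support_iff.1 hm), Finsupp.weight_apply, Finsupp.sum]
    simp
  refine (Polynomial.natDegree_C_mul_le _ _).trans ?_
  refine (Polynomial.natDegree_prod_le _ _).trans ?_
  rw [← h']
  refine Finset.sum_le_sum fun i _ => ?_
  refine Polynomial.natDegree_pow_le.trans ?_
  have : (Polynomial.C (u i) + Polynomial.X * Polynomial.C (w i)).natDegree ≤ 1 := by compute_degree
  nlinarith

/-- Reversal of the coefficients exchanges the two base points of the chart. Thus the coefficient of
degree `e` is the value at `w`, the point at infinity of the chart. -/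
theorem reflect_chart {f : MvPolynomial (Fin 2) ℂ} {e : ℕ} (hf : f.IsHomogeneous e)
    (u w : Fin 2 → ℂ) : Polynomial.reflect e (chart u w f) = chart w u f := by
  refine Polynomial.eq_of_infinite_eval_eq _ _ (Set.Infinite.mono (s := {0}ᶜ) (fun s hs => ?_)
    (Set.finite_singleton 0).infinite_compl)
  have hs : s ≠ 0 := hs
  let := invertibleOfNonzero (inv_ne_zero hs)
  have h := Polynomial.eval₂_reflect_mul_pow (RingHom.id ℂ) s⁻¹ e (chart u w f)
    (natDegree_chart_le hf u w)
  rw [invOf_eq_inv, inv_inv] at h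
  change Polynomial.eval s _ * _ = Polynomial.eval _ _ at h
  rw [eval_chart] at h
  have e1 : w + s • u = s • (u + s⁻¹ • w) := by
    rw [smul_add, smul_smul, mul_inv_cancel₀ hs, one_smul, add_comm]
  change Polynomial.eval s _ = Polynomial.eval s _
  rw [eval_chart, e1, eval_smul_form hf, ← h, mul_comm, mul_assoc, ← mul_pow, inv_mul_cancel₀ hs,
    one_pow, mul_one]

theorem coeff_chart {f : MvPolynomial (Fin 2) ℂ} {e : ℕ} (hf : f.IsHomogeneous e)
    (u w : Fin 2 → ℂ) : (chart u w f).coeff e = eval w f := by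
  have h := congrArg (Polynomial.eval 0) (reflect_chart hf u w)
  rw [eval_chart, zero_smul, add_zero, ← Polynomial.coeff_zero_eq_eval_zero,
    Polynomial.coeff_reflect] at h
  simpa using h

/-- A formal degree `n` larger than the degree of `g` only contributes a power of the leading
coefficient of `f`. -/
theorem resultant_ne_zero_of_roots {f g : Polynomial ℂ} {m n : ℕ} (hf : f.natDegree = m)
    (hf0 : f ≠ 0) (hg : g.natDegree ≤ n) (h : ∀ s, f.eval s = 0 → g.eval s ≠ 0) :
    f.resultant g m n ≠ 0 := by
  obtain ⟨j, rfl⟩ := Nat.exists_eq_add_of_le hg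
  rw [Polynomial.resultant_add_right_deg _ _ _ _ _ le_rfl, ← hf]
  refine mul_ne_zero (pow_ne_zero _ (by simpa using hf0)) (Polynomial.resultant_ne_zero _ _ ?_)
  rw [Polynomial.isCoprime_iff_aeval_ne_zero_of_isAlgClosed ℂ ℂ]
  intro s
  by_cases hs : f.eval s = 0
  · exact Or.inr (by simpa using h s hs)
  · exact Or.inl (by simpa using hs)

/-- The restriction to a chart of a family of forms that depends linearly on `x`. -/
noncomputable def fam {A : Type} [CommRing A] [Algebra ℂ A] (u w : Fin 2 → ℂ)
    (S : Fin 4 → MvPolynomial (Fin 2) ℂ) (x : Fin 4 → A) : Polynomial A :=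
  ∑ j, Polynomial.C (x j) * (chart u w (S j)).map (algebraMap ℂ A)

/-- The value of such a family. -/
noncomputable def comb (S : Fin 4 → MvPolynomial (Fin 2) ℂ) (x : Fin 4 → ℂ) :
    MvPolynomial (Fin 2) ℂ := ∑ j, C (x j) * S j

theorem comb_isHomogeneous {S : Fin 4 → MvPolynomial (Fin 2) ℂ} {e : ℕ}
    (hS : ∀ j, (S j).IsHomogeneous e) (x : Fin 4 → ℂ) : (comb S x).IsHomogeneous e :=
  IsHomogeneous.sum _ _ _ fun j _ => by simpa using (isHomogeneous_C _ (x j)).mul (hS j)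

theorem eval_comb (S : Fin 4 → MvPolynomial (Fin 2) ℂ) (x : Fin 4 → ℂ) (u : Fin 2 → ℂ) :
    eval u (comb S x) = ∑ j, x j * eval u (S j) := by simp [comb]

theorem fam_complex (u w : Fin 2 → ℂ) (S : Fin 4 → MvPolynomial (Fin 2) ℂ) (x : Fin 4 → ℂ) :
    fam u w S x = chart u w (comb S x) := by
  rw [fam, comb, chart, map_sum]
  refine Finset.sum_congr rfl fun j _ => ?_
  rw [map_mul, aeval_C, Polynomial.algebraMap_eq, Algebra.algebraMap_self, Polynomial.map_id, chart]

theorem fam_map {A B : Type} [CommRing A] [Algebra ℂ A] [CommRing B] [Algebra ℂ B] (φ : A →ₐ[ℂ] B)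
    (u w : Fin 2 → ℂ) (S : Fin 4 → MvPolynomial (Fin 2) ℂ) (x : Fin 4 → A) :
    (fam u w S x).map (φ : A →+* B) = fam u w S (fun j => φ (x j)) := by
  simp only [fam, Polynomial.map_sum, Polynomial.map_mul, Polynomial.map_C, Polynomial.map_map,
    AlgHom.comp_algebraMap]
  rfl

/-- The resultant of two such families. -/
noncomputable def elim (u w : Fin 2 → ℂ) (S S' : Fin 4 → MvPolynomial (Fin 2) ℂ) (e : ℕ) :
    MvPolynomial (Fin 4) ℂ :=
  (fam u w S X).resultant (fam u w S' X) e e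

theorem aeval_elim {A : Type} [CommRing A] [Algebra ℂ A] (u w : Fin 2 → ℂ)
    (S S' : Fin 4 → MvPolynomial (Fin 2) ℂ) (e : ℕ) (x : Fin 4 → A) :
    aeval x (elim u w S S' e) = (fam u w S x).resultant (fam u w S' x) e e := by
  have h : ∀ S : Fin 4 → MvPolynomial (Fin 2) ℂ, (fam u w S (A := MvPolynomial (Fin 4) ℂ) X).map
      ((aeval x : MvPolynomial (Fin 4) ℂ →ₐ[ℂ] A) : MvPolynomial (Fin 4) ℂ →+* A) = fam u w S x := by
    intro S
    rw [fam_map]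
    congr 1
    funext j
    exact aeval_X x j
  rw [← h S, ← h S', Polynomial.resultant_map_map]
  rfl

theorem eval_elim_eq_zero {S S' : Fin 4 → MvPolynomial (Fin 2) ℂ} {e : ℕ} (he : e ≠ 0)
    (hS : ∀ j, (S j).IsHomogeneous e) (hS' : ∀ j, (S' j).IsHomogeneous e) {u w : Fin 2 → ℂ}
    (huw : wedge u w ≠ 0) {x : Fin 4 → ℂ} {t : Fin 2 → ℂ} (ht : t ≠ 0)
    (h : eval t (comb S x) = 0) (h' : eval t (comb S' x) = 0) : eval x (elim u w S S' e) = 0 := by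
  rw [← coe_aeval_eq_eval, RingHom.coe_coe, aeval_elim, fam_complex, fam_complex]
  have d := natDegree_chart_le (comb_isHomogeneous hS x) u w
  have d' := natDegree_chart_le (comb_isHomogeneous hS' x) u w
  obtain ⟨a, b, rfl⟩ := exists_combination huw t
  -- If the common zero is the point at infinity of the chart, both polynomials have degree less
  -- than `e`, and the resultant with formal degrees `e` vanishes for this reason. Otherwise they
  -- have the common root `b / a`.
  by_cases ha : a = 0
  · have hb : b ≠ 0 := by
      rintro rfl
      simp [ha] at ht
    simp only [ha, zero_smul, zero_add, eval_smul_form (comb_isHomogeneous hS x),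
      eval_smul_form (comb_isHomogeneous hS' x), mul_eq_zero, pow_eq_zero_iff he, hb,
      false_or] at h h'
    have key : ∀ f : Polynomial ℂ, f.natDegree ≤ e → f.coeff e = 0 → f.natDegree < e := by
      intro f h1 h2
      refine lt_of_le_of_ne h1 fun h3 => ?_
      rw [← h3] at h2
      have : f = 0 := by simpa using h2
      rw [this] at h3
      exact he (by simpa using h3.symm)
    refine Polynomial.resultant_eq_zero_of_lt_lt _ _ _ _ (key _ d ?_) (key _ d' ?_)
    · rwa [coeff_chart (comb_isHomogeneous hS x)]
    · rwa [coeff_chart (comb_isHomogeneous hS' x)]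
  · obtain ⟨p, q, -, -, H⟩ := Polynomial.exists_mul_add_mul_eq_C_resultant _ _ d d' (Or.inl he)
    have H := congrArg (Polynomial.eval (b / a)) H
    have e1 : a • u + b • w = a • (u + (b / a) • w) := by
      rw [smul_add, smul_smul, mul_div_cancel₀ _ ha]
    rw [e1, eval_smul_form (comb_isHomogeneous hS x), mul_eq_zero] at h
    rw [e1, eval_smul_form (comb_isHomogeneous hS' x), mul_eq_zero] at h'
    simp only [pow_eq_zero_iff he, ha, false_or] at h h'
    simpa [eval_chart, h, h'] using H.symm

theorem eval_elim_ne_zero {S S' : Fin 4 → MvPolynomial (Fin 2) ℂ} {e : ℕ}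
    (hS : ∀ j, (S j).IsHomogeneous e) (hS' : ∀ j, (S' j).IsHomogeneous e) {u w : Fin 2 → ℂ}
    (huw : wedge u w ≠ 0) {x : Fin 4 → ℂ} (hw : eval w (comb S x) ≠ 0)
    (h : ∀ t, t ≠ 0 → eval t (comb S x) = 0 → eval t (comb S' x) ≠ 0) :
    eval x (elim u w S S' e) ≠ 0 := by
  rw [← coe_aeval_eq_eval, RingHom.coe_coe, aeval_elim, fam_complex, fam_complex]
  have hc : (chart u w (comb S x)).coeff e ≠ 0 := by
    rwa [coeff_chart (comb_isHomogeneous hS x)]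
  refine resultant_ne_zero_of_roots
    (Polynomial.natDegree_eq_of_le_of_coeff_ne_zero
      (natDegree_chart_le (comb_isHomogeneous hS x) u w) hc)
    (fun h0 => hc (by simp [h0])) (natDegree_chart_le (comb_isHomogeneous hS' x) u w) fun s hs => ?_
  rw [eval_chart] at hs ⊢
  refine h _ (fun h0 => huw ?_) hs
  have : u = (-s) • w := by
    rw [neg_smul]; exact eq_neg_of_add_eq_zero_left h0
  rw [this, wedge_smul_left, wedge_self, mul_zero]

/-- Forms in `x` vanishing where a non-homogeneous polynomial vanishes on a cone. -/
theorem exists_homogeneous_component {H : MvPolynomial (Fin 4) ℂ} {P : (Fin 4 → ℂ) → Prop}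
    (hP : ∀ (c : ℂ) x, P x → P (c • x)) (h : ∀ x, P x → eval x H = 0) (d : ℕ) (x : Fin 4 → ℂ)
    (hx : P x) : eval x (homogeneousComponent d H) = 0 := by
  by_contra hne
  let q : Polynomial ℂ := ∑ i ∈ Finset.range (H.totalDegree + 1),
    Polynomial.C (eval x (homogeneousComponent i H)) * Polynomial.X ^ i
  have hq : q = 0 := by
    refine Polynomial.funext fun c => ?_
    have h1 := h _ (hP c x hx)
    rw [← sum_homogeneousComponent H, map_sum] at h1
    rw [Polynomial.eval_zero, ← h1]
    simp only [q, Polynomial.eval_finsetSum]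
    refine Finset.sum_congr rfl fun i _ => ?_
    rw [eval_smul_form (homogeneousComponent_isHomogeneous i H)]
    simp only [Polynomial.eval_mul, Polynomial.eval_C, Polynomial.eval_pow, Polynomial.eval_X]
    ring
  have h1 : q.coeff d = eval x (homogeneousComponent d H) := by
    simp only [q, Polynomial.finsetSum_coeff, Polynomial.coeff_C_mul, Polynomial.coeff_X_pow]
    simp only [mul_ite, mul_one, mul_zero, Finset.sum_ite_eq, Finset.mem_range]
    split_ifs with h
    · rfl
    · rw [homogeneousComponent_eq_zero _ _ (by omega), map_zero]
  rw [hq] at h1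
  exact hne (by simpa using h1.symm)

/-! ### First order elimination -/

-- Over the dual numbers, evaluation at `x + ε v` records the value and the derivative in the
-- direction `v` together.
open TrivSqZeroExt in
theorem aeval_dual (x v : Fin 4 → ℂ) (H : MvPolynomial (Fin 4) ℂ) :
    aeval (fun j => (inl (x j) + inr (v j) : TrivSqZeroExt ℂ ℂ)) H =
      inl (eval x H) + inr (eval x (D v H)) := by
  induction H using MvPolynomial.induction_on with
  | C a => rw [aeval_C, D_C, algebraMap_eq_inl]; ext <;> simp
  | add p q hp hq =>
    rw [map_add, hp, hq]
    ext <;> simp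
  | mul_X p n hp =>
    rw [map_mul, hp, aeval_X, D_mul, D_X]
    ext <;> simp [add_comm]
    ring

open TrivSqZeroExt in
theorem eval_map_dual (p : Polynomial ℂ) (r : ℂ) :
    (p.map (algebraMap ℂ (TrivSqZeroExt ℂ ℂ))).eval (inr r) =
      inl (p.eval 0) + inr (r * p.derivative.eval 0) := by
  induction p using Polynomial.induction_on' with
  | add p q hp hq =>
    rw [Polynomial.map_add, Polynomial.eval_add, hp, hq]
    ext <;> simp [mul_add]
  | monomial n a =>
    rw [Polynomial.map_monomial, Polynomial.eval_monomial, algebraMap_eq_inl]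
    rcases n with _ | _ | n
    · ext <;> simp
    · ext <;> simp [mul_comm]
    · have : (inr r : TrivSqZeroExt ℂ ℂ) ^ (n + 1 + 1) = 0 := by
        rw [pow_succ, pow_succ, mul_assoc, inr_mul_inr, mul_zero]
      rw [this]
      ext <;> simp

open TrivSqZeroExt in
theorem eval_fam_dual (u w : Fin 2 → ℂ) (S : Fin 4 → MvPolynomial (Fin 2) ℂ) (x v : Fin 4 → ℂ)
    (r : ℂ) : (fam u w S (fun j => (inl (x j) + inr (v j) : TrivSqZeroExt ℂ ℂ))).eval (inr r) =
      inl (eval u (comb S x)) + inr (r * eval u (D w (comb S x)) + eval u (comb S v)) := by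
  have h : ∀ j, (Polynomial.C (inl (x j) + inr (v j) : TrivSqZeroExt ℂ ℂ) *
      (chart u w (S j)).map (algebraMap ℂ (TrivSqZeroExt ℂ ℂ))).eval (inr r) =
      inl (x j * eval u (S j)) + inr (r * (x j * eval u (D w (S j))) + v j * eval u (S j)) := by
    intro j
    rw [Polynomial.eval_mul, Polynomial.eval_C, eval_map_dual, derivative_chart, eval_chart,
      eval_chart, zero_smul, add_zero]
    ext <;> simp
    ring
  rw [fam, Polynomial.eval_finsetSum, Finset.sum_congr rfl fun j _ => h j, eval_comb, eval_comb,
    comb, map_sum, map_sum, Finset.mul_sum, ← Finset.sum_add_distrib]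
  simp only [D_mul, D_C, mul_zero, add_zero, map_mul, eval_C]
  ext
  · simp [fst_sum]
  · simp [snd_sum]

-- The resultant is computed over the dual numbers at `x + ε v`. The simple common zero `u` moves to
-- `ε r` for the first family; splitting off this root leaves a factor that is invertible, since
-- there is no other common zero, times the value of the second family at the moved root. The
-- `ε`-part of that value is `h2` up to a non-zero factor.
set_option maxHeartbeats 1000000 in
open TrivSqZeroExt in
theorem eval_D_elim_ne_zero {S S' : Fin 4 → MvPolynomial (Fin 2) ℂ} {e : ℕ}
    (hS : ∀ j, (S j).IsHomogeneous e) (hS' : ∀ j, (S' j).IsHomogeneous e) {u w : Fin 2 → ℂ}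
    (huw : wedge u w ≠ 0) {x v : Fin 4 → ℂ} (hw : eval w (comb S x) ≠ 0)
    (h0 : eval u (comb S x) = 0) (h0' : eval u (comb S' x) = 0)
    (h : ∀ t, t ≠ 0 → eval t (comb S x) = 0 → eval t (comb S' x) = 0 → wedge t u = 0)
    (h1 : eval u (D w (comb S x)) ≠ 0)
    (h2 : eval u (D w (comb S x)) * eval u (comb S' v) -
      eval u (D w (comb S' x)) * eval u (comb S v) ≠ 0) :
    eval x (D v (elim u w S S' e)) ≠ 0 := by
  set y : Fin 4 → TrivSqZeroExt ℂ ℂ := fun j => inl (x j) + inr (v j) with hy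
  set P := fam u w S y with hP
  set Q := fam u w S' y with hQ
  set φ : TrivSqZeroExt ℂ ℂ →ₐ[ℂ] ℂ := fstHom ℂ ℂ ℂ
  have hφy : (fun j => φ (y j)) = x := funext fun j => by simp [φ, hy]
  have hPφ : P.map (φ : TrivSqZeroExt ℂ ℂ →+* ℂ) = chart u w (comb S x) := by
    rw [hP, fam_map, hφy, fam_complex]
  have hQφ : Q.map (φ : TrivSqZeroExt ℂ ℂ →+* ℂ) = chart u w (comb S' x) := by
    rw [hQ, fam_map, hφy, fam_complex]
  have hdeg : ∀ S : Fin 4 → MvPolynomial (Fin 2) ℂ, (∀ j, (S j).IsHomogeneous e) →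
      (fam u w S y).natDegree ≤ e := fun S hS =>
    Polynomial.natDegree_sum_le_of_forall_le _ _ fun j _ =>
      (Polynomial.natDegree_C_mul_le _ _).trans
        (Polynomial.natDegree_map_le.trans (natDegree_chart_le (hS j) u w))
  have hPc : φ (P.coeff e) ≠ 0 := by
    have : φ (P.coeff e) = (P.map (φ : TrivSqZeroExt ℂ ℂ →+* ℂ)).coeff e := by
      rw [Polynomial.coeff_map]; rfl
    rw [this, hPφ, coeff_chart (comb_isHomogeneous hS x)]
    exact hw
  have hPd : P.natDegree = e := Polynomial.natDegree_eq_of_le_of_coeff_ne_zero (hdeg S hS)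
    fun h => hPc (by rw [h, map_zero])
  -- The velocity of the zero `u` of the first family when `x` moves in the direction `v`; it is
  -- defined because `u` is a simple zero.
  set r : ℂ := - eval u (comb S v) / eval u (D w (comb S x)) with hr
  have hroot : P.eval (inr r) = 0 := by
    rw [hP, hy, eval_fam_dual, h0, hr, div_mul_cancel₀ _ h1]
    ext <;> simp
  obtain ⟨P1, hP1⟩ := Polynomial.dvd_iff_isRoot.2 hroot
  have hP1d : e = (Polynomial.X - Polynomial.C (inr r : TrivSqZeroExt ℂ ℂ)).natDegree +
      P1.natDegree := by
    rw [← Polynomial.Monic.natDegree_mul' (Polynomial.monic_X_sub_C _), ← hP1, hPd]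
    rintro rfl
    rw [mul_zero] at hP1
    exact hPc (by rw [hP1, Polynomial.coeff_zero, map_zero])
  have hQd : Q.natDegree ≤ e := hdeg S' hS'
  have hres : P.resultant Q e e = Q.eval (inr r) * P1.resultant Q P1.natDegree e := by
    conv_lhs => rw [hP1]; arg 3; rw [hP1d]
    rw [Polynomial.resultant_mul_left _ _ _ _ hQd, Polynomial.natDegree_X_sub_C,
      Polynomial.resultant_X_sub_C_left _ _ _ hQd]
  have hrmap : (φ : TrivSqZeroExt ℂ ℂ →+* ℂ) (inr r) = 0 := by simp [φ]
  have hmap : chart u w (comb S x) =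
      Polynomial.X * P1.map (φ : TrivSqZeroExt ℂ ℂ →+* ℂ) := by
    rw [← hPφ, hP1, Polynomial.map_mul, Polynomial.map_sub, Polynomial.map_X, Polynomial.map_C]
    rw [hrmap, Polynomial.C_0, sub_zero]
  have hc1 : (chart u w (comb S x)).coeff e ≠ 0 := by
    rwa [coeff_chart (comb_isHomogeneous hS x)]
  rw [Polynomial.natDegree_X_sub_C] at hP1d
  have hc2 : (P1.map (φ : TrivSqZeroExt ℂ ℂ →+* ℂ)).coeff P1.natDegree ≠ 0 := by
    rw [hP1d, hmap, add_comm, Polynomial.coeff_X_mul] at hc1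
    exact hc1
  have hres1 : φ (P1.resultant Q P1.natDegree e) ≠ 0 := by
    have := Polynomial.resultant_map_map (f := P1) (g := Q) (m := P1.natDegree) (n := e)
      (φ : TrivSqZeroExt ℂ ℂ →+* ℂ)
    change _ = φ _ at this
    rw [← this, hQφ]
    refine resultant_ne_zero_of_roots
      (Polynomial.natDegree_eq_of_le_of_coeff_ne_zero Polynomial.natDegree_map_le hc2)
      (fun h => hc2 (by simp [h])) (natDegree_chart_le (comb_isHomogeneous hS' x) u w) ?_
    intro s hs hs'
    have h3 : (chart u w (comb S x)).eval s = 0 := by rw [hmap]; simp [hs]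
    rw [eval_chart] at h3 hs'
    have hne : u + s • w ≠ 0 := by
      intro h0
      have : u = (-s) • w := by
        rw [neg_smul]; exact eq_neg_of_add_eq_zero_left h0
      exact huw (by rw [this, wedge_smul_left, wedge_self, mul_zero])
    have h4 := h _ hne h3 hs'
    have h5 : wedge (u + s • w) u = - s * wedge u w := by simp [wedge]; ring
    rw [h5] at h4
    obtain rfl : s = 0 := by simpa [huw] using h4
    apply h1
    have h6 := derivative_chart u w (comb S x)
    rw [hmap] at h6
    have h7 := congrArg (Polynomial.eval 0) h6
    rw [eval_chart] at h7
    simpa [hs, Polynomial.derivative_mul] using h7.symm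
  have hfin := aeval_elim u w S S' e y
  rw [hy, aeval_dual, ← hy, hres, hQ, hy, eval_fam_dual, h0', ← hy] at hfin
  have hsnd := congrArg snd hfin
  simp only [snd_add, snd_inl, snd_inr, zero_add, snd_mul, fst_add, fst_inl, fst_inr, add_zero,
    zero_mul, op_smul_eq_smul, smul_eq_mul] at hsnd
  rw [hsnd]
  refine mul_ne_zero hres1 ?_
  rw [hr]
  intro h3
  apply h2
  field_simp at h3
  linear_combination h3

/-! ### Loci swept out by the kernels of a linear family -/

/-- The cone over the locus swept out by the kernels of the matrices of forms `T(u)`. -/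
def Swept {ι : Type} (T : ι → Fin 4 → MvPolynomial (Fin 2) ℂ) (x : Fin 4 → ℂ) : Prop :=
  ∃ u, u ≠ 0 ∧ ∀ i, eval u (comb (T i) x) = 0

theorem Swept.smul {ι : Type} {T : ι → Fin 4 → MvPolynomial (Fin 2) ℂ} (c : ℂ) (x : Fin 4 → ℂ)
    (h : Swept T x) : Swept T (c • x) := by
  obtain ⟨u, hu, h⟩ := h
  refine ⟨u, hu, fun i => ?_⟩
  have := h i
  rw [eval_comb] at this ⊢
  simp only [Pi.smul_apply, smul_eq_mul, mul_assoc]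
  rw [← Finset.mul_sum, this, mul_zero]

/-- A linear combination of the rows of a matrix of forms. -/
noncomputable def rows {ι : Type} [Fintype ι] (T : ι → Fin 4 → MvPolynomial (Fin 2) ℂ) (α : ι → ℂ)
    (j : Fin 4) : MvPolynomial (Fin 2) ℂ := ∑ i, C (α i) * T i j

section
variable {ι : Type} [Fintype ι] {T : ι → Fin 4 → MvPolynomial (Fin 2) ℂ} {e : ℕ}

theorem rows_isHomogeneous (hT : ∀ i j, (T i j).IsHomogeneous e) (α : ι → ℂ) (j : Fin 4) :
    (rows T α j).IsHomogeneous e :=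
  IsHomogeneous.sum _ _ _ fun i _ => by simpa using (isHomogeneous_C _ (α i)).mul (hT i j)

theorem comb_rows (α : ι → ℂ) (x : Fin 4 → ℂ) :
    comb (rows T α) x = ∑ i, C (α i) * comb (T i) x := by
  simp only [comb, rows, Finset.mul_sum]
  rw [Finset.sum_comm]
  exact Finset.sum_congr rfl fun i _ => Finset.sum_congr rfl fun j _ => by ring

theorem eval_comb_rows (α : ι → ℂ) (x : Fin 4 → ℂ) (u : Fin 2 → ℂ) :
    eval u (comb (rows T α) x) = ∑ i, α i * eval u (comb (T i) x) := by
  simp [comb_rows]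

theorem eval_D_comb_rows (α : ι → ℂ) (x : Fin 4 → ℂ) (u w : Fin 2 → ℂ) :
    eval u (D w (comb (rows T α) x)) = ∑ i, α i * eval u (D w (comb (T i) x)) := by
  rw [comb_rows, map_sum, map_sum]
  exact Finset.sum_congr rfl fun i _ => by rw [D_mul, D_C]; simp

theorem eventually_sum_ne_zero {y : ι → ℂ} (hy : y ≠ 0) :
    ∀ᶠ α in gen ι, ∑ i, α i * y i ≠ 0 := by
  classical
  obtain ⟨i, hi⟩ := Function.ne_iff.1 hy
  refine Pol.eventually_ne (f := fun α => ∑ i, α i * y i)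
    (Pol.sum _ fun i => (Pol.coord i).mul (Pol.const _)) (v := Pi.single i 1) ?_
  simpa [Pi.single_apply] using hi

theorem exists_elim_eq_zero (he : e ≠ 0) (hT : ∀ i j, (T i j).IsHomogeneous e) {u w : Fin 2 → ℂ}
    (huw : wedge u w ≠ 0) (α β : ι → ℂ) {x : Fin 4 → ℂ} (hx : Swept T x) :
    eval x (elim u w (rows T α) (rows T β) e) = 0 := by
  obtain ⟨t, ht, h⟩ := hx
  exact eval_elim_eq_zero he (rows_isHomogeneous hT α) (rows_isHomogeneous hT β) huw ht
    (by simp [eval_comb_rows, h]) (by simp [eval_comb_rows, h])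

/-- Swept-out loci are closed. For a generic combination `α` of the rows the form at `x` has
finitely many zeros, and a generic second combination `β` vanishes at none of them. Their resultant
vanishes on the locus but not at `x`; so does one of its homogeneous components. -/
theorem exists_separating_form (he : e ≠ 0) (hT : ∀ i j, (T i j).IsHomogeneous e)
    {x : Fin 4 → ℂ} (hx : ¬ Swept T x) : ∃ (d : ℕ) (H : MvPolynomial (Fin 4) ℂ),
      H.IsHomogeneous d ∧ (∀ y, Swept T y → eval y H = 0) ∧ eval x H ≠ 0 := by
  simp only [Swept, not_exists, not_and, not_forall] at hx
  obtain ⟨i₀, h₀⟩ := hx ![1, 0] (by simp)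
  obtain ⟨α, hα⟩ := (eventually_sum_ne_zero (y := fun i => eval ![1, 0] (comb (T i) x))
    (Function.ne_iff.2 ⟨i₀, h₀⟩)).exists
  rw [← eval_comb_rows] at hα
  have hf := comb_isHomogeneous (rows_isHomogeneous hT α) x
  have hf0 : comb (rows T α) x ≠ 0 := fun h => hα (by rw [h, map_zero])
  obtain ⟨β, hβ⟩ := (eventually_forall_zero (l := gen ι) hf hf0
    (Q := fun t β => eval t (comb (rows T β) x) ≠ 0) (fun c t β hc h => by
      rw [eval_smul_form (comb_isHomogeneous (rows_isHomogeneous hT β) x)]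
      exact mul_ne_zero (pow_ne_zero _ hc) h) (fun t ht _ => by
      simp only [eval_comb_rows]
      obtain ⟨i, hi⟩ := hx t ht
      exact eventually_sum_ne_zero (Function.ne_iff.2 ⟨i, hi⟩))).exists
  have hw : wedge ![0, -1] ![1, 0] ≠ 0 := by simp [wedge]
  have hne := eval_elim_ne_zero (rows_isHomogeneous hT α) (rows_isHomogeneous hT β) hw hα hβ
  have hex : ∃ d, eval x (homogeneousComponent d (elim ![0, -1] ![1, 0] (rows T α) (rows T β) e)) ≠ 0 := by
    by_contra! h
    apply hne
    rw [← sum_homogeneousComponent (elim _ _ _ _ _), map_sum]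
    exact Finset.sum_eq_zero fun d _ => h d
  obtain ⟨d, hd⟩ := hex
  exact ⟨d, _, homogeneousComponent_isHomogeneous _ _, fun y hy =>
    exists_homogeneous_component (P := Swept T) Swept.smul
      (fun z hz => exists_elim_eq_zero he hT hw α β hz) d y hy, hd⟩

theorem D_eq_sum_homogeneousComponent (v : Fin 4 → ℂ) (H : MvPolynomial (Fin 4) ℂ) :
    D v H = ∑ i ∈ Finset.range (H.totalDegree + 1), D v (homogeneousComponent i H) := by
  conv_lhs => rw [← sum_homogeneousComponent H, map_sum]

/-- The hypotheses say that `x` is swept out by the parameter `u` alone, without ramification, and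
that `v` is not tangent to the locus at `x`. The first order resultant of two generic combinations
of the rows is then an equation of the locus with non-zero derivative along `v`. -/
theorem exists_smooth_form (he : e ≠ 0) (hT : ∀ i j, (T i j).IsHomogeneous e)
    {x v : Fin 4 → ℂ} {u : Fin 2 → ℂ} (hu : u ≠ 0) (hx : ∀ i, eval u (comb (T i) x) = 0)
    (huniq : ∀ t, t ≠ 0 → (∀ i, eval t (comb (T i) x) = 0) → wedge t u = 0)
    (hw : ∀ w, wedge u w ≠ 0 → (∃ i, eval u (D w (comb (T i) x)) ≠ 0) ∧
      ∀ c, ∃ i, eval u (comb (T i) v) ≠ c * eval u (D w (comb (T i) x))) :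
    ∃ (d : ℕ) (H : MvPolynomial (Fin 4) ℂ),
      H.IsHomogeneous d ∧ (∀ y, Swept T y → eval y H = 0) ∧ eval x (D v H) ≠ 0 := by
  obtain ⟨w₀, hw₀⟩ := exists_wedge_ne_zero hu
  obtain ⟨i₀, h₀⟩ := (hw w₀ hw₀).1
  obtain ⟨α, hα⟩ := (eventually_sum_ne_zero (y := fun i => eval u (D w₀ (comb (T i) x)))
    (Function.ne_iff.2 ⟨i₀, h₀⟩)).exists
  rw [← eval_D_comb_rows] at hα
  have hf := comb_isHomogeneous (rows_isHomogeneous hT α) x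
  have hf0 : comb (rows T α) x ≠ 0 := fun h => hα (by rw [h, map_zero, map_zero])
  -- The chart is placed so that its point at infinity is not a zero of the first form; its leading
  -- coefficient is then non-zero.
  obtain ⟨w, hfw, huw⟩ : ∃ w, eval w (comb (rows T α) x) ≠ 0 ∧ wedge u w ≠ 0 := by
    obtain ⟨w, hw⟩ := exists_eval_ne_zero hf0
    refine ⟨w, hw, fun h => hw ?_⟩
    obtain ⟨c, rfl⟩ := exists_smul_of_wedge hu (u := w) (by rw [wedge_swap, h, neg_zero])
    rw [eval_smul_form hf, eval_comb_rows]
    simp [hx]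
  have hα' : eval u (D w (comb (rows T α) x)) ≠ 0 := by
    obtain ⟨a, b, rfl⟩ := exists_combination huw w₀
    rw [eval_D_add, eval_D_smul, eval_D_smul, euler hf, eval_comb_rows] at hα
    simp only [hx, mul_zero, Finset.sum_const_zero, zero_add] at hα
    exact right_ne_zero_of_mul hα
  have hβ1 := eventually_forall_zero (l := gen ι) hf hf0
    (Q := fun t β => eval t (comb (rows T β) x) = 0 → wedge t u = 0) (fun c t β hc h h' => by
      rw [eval_smul_form (comb_isHomogeneous (rows_isHomogeneous hT β) x), mul_eq_zero] at h'
      rw [wedge_smul_left, h (h'.resolve_left (pow_ne_zero _ hc)), mul_zero]) (fun t ht _ => by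
      by_cases hi : ∀ i, eval t (comb (T i) x) = 0
      · exact Eventually.of_forall fun β _ => huniq t ht hi
      · push Not at hi
        obtain ⟨i, hi⟩ := hi
        filter_upwards [eventually_sum_ne_zero (y := fun i => eval t (comb (T i) x))
          (Function.ne_iff.2 ⟨i, hi⟩)] with β hβ h
        rw [eval_comb_rows] at h
        exact absurd h hβ)
  have hβ2 : ∀ᶠ β in gen ι, eval u (D w (comb (rows T α) x)) * eval u (comb (rows T β) v) -
      eval u (D w (comb (rows T β) x)) * eval u (comb (rows T α) v) ≠ 0 := by
    obtain ⟨i, hi⟩ := (hw w huw).2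
      (eval u (comb (rows T α) v) / eval u (D w (comb (rows T α) x)))
    filter_upwards [eventually_sum_ne_zero (y := fun i => eval u (D w (comb (rows T α) x)) *
      eval u (comb (T i) v) - eval u (D w (comb (T i) x)) * eval u (comb (rows T α) v))
      (Function.ne_iff.2 ⟨i, fun h => hi (by
        have h' : _ - _ = (0 : ℂ) := h
        field_simp
        linear_combination h')⟩)] with β hβ h
    apply hβ
    rw [← h, eval_comb_rows β v, eval_D_comb_rows β x, Finset.mul_sum, Finset.sum_mul,
      ← Finset.sum_sub_distrib]
    exact Finset.sum_congr rfl fun i _ => by ring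
  obtain ⟨β, hb1, hb2⟩ := (hβ1.and hβ2).exists
  have hne := eval_D_elim_ne_zero (rows_isHomogeneous hT α) (rows_isHomogeneous hT β) huw hfw
    (by simp [eval_comb_rows, hx]) (by simp [eval_comb_rows, hx]) hb1 hα' hb2
  have hex : ∃ d, eval x (D v (homogeneousComponent d (elim u w (rows T α) (rows T β) e))) ≠ 0 := by
    by_contra! h
    apply hne
    rw [D_eq_sum_homogeneousComponent, map_sum]
    exact Finset.sum_eq_zero fun d _ => h d
  obtain ⟨d, hd⟩ := hex
  exact ⟨d, _, homogeneousComponent_isHomogeneous _ _, fun y hy =>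
    exists_homogeneous_component (P := Swept T) Swept.smul
      (fun z hz => exists_elim_eq_zero he hT huw α β hz) d y hy, hd⟩

end

/-! ### Lüroth's theorem for binary forms -/

theorem aeval_smul_form {ι A : Type*} [CommRing A] [Algebra ℂ A] {f : MvPolynomial ι ℂ} {d : ℕ}
    (hf : f.IsHomogeneous d) (c : A) (y : ι → A) :
    aeval (fun i => c * y i) f = c ^ d * aeval y f := by
  rw [aeval_def, aeval_def, eval₂_eq, eval₂_eq, Finset.mul_sum]
  refine Finset.sum_congr rfl fun m hm => ?_
  have h' : ∑ i ∈ m.support, m i = d := by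
    rw [← hf (mem_support_iff.1 hm), Finsupp.weight_apply, Finsupp.sum]
    simp
  simp only [mul_pow, Finset.prod_mul_distrib, Finset.prod_pow_eq_pow_sum, h']
  ring

theorem form_eq_zero_of_chart {K : MvPolynomial (Fin 2) ℂ} {d : ℕ} (hK : K.IsHomogeneous d)
    (h : ∀ s, eval ![s, 1] K = 0) : K = 0 := by
  refine MvPolynomial.funext fun u => ?_
  rw [map_zero]
  refine Pol.eq_zero (f := fun u => eval u K) ⟨K, fun _ => rfl⟩ ?_ u
  filter_upwards [(Pol.coord (1 : Fin 2)).eventually_ne (v := 1) (by simp)] with v hv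
  have h2 : v = v 1 • ![v 0 / v 1, 1] := by
    ext i; fin_cases i <;> simp; field_simp
  rw [h2, eval_smul_form hK, h, mul_zero]

theorem aeval_homogenize_pair {L : Type*} [Field L] [Algebra ℂ L] {P : Polynomial ℂ} {n : ℕ}
    (hn : P.natDegree ≤ n) (a : L) {b : L} (hb : b ≠ 0) :
    aeval ![a, b] (P.homogenize n) = b ^ n * Polynomial.aeval (a / b) P := by
  have h := Polynomial.aeval_homogenize_of_eq_one hn ![a / b, 1] (by simp)
  have h2 := aeval_smul_form (Polynomial.isHomogeneous_homogenize (n := n) P) b ![a / b, 1]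
  rw [h] at h2
  rw [show ![a, b] = fun i => b * ![a / b, 1] i by
    ext i; fin_cases i <;> simp; field_simp]
  exact h2

theorem exists_homogenization {n : ℕ} (j : Fin n) (F : MvPolynomial (Fin n) ℂ) {k : ℕ}
    (hk : F.totalDegree ≤ k) : ∃ G : MvPolynomial (Fin n) ℂ, G.IsHomogeneous k ∧
      ∀ (L : Type) [Field L] [Algebra ℂ L] (y : Fin n → L), y j ≠ 0 →
        aeval y G = y j ^ k * aeval (fun i => y i / y j) F := by
  refine ⟨∑ i ∈ Finset.range (F.totalDegree + 1), homogeneousComponent i F * X j ^ (k - i), ?_, ?_⟩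
  · refine IsHomogeneous.sum _ _ _ fun i hi => ?_
    rw [Finset.mem_range] at hi
    have := (homogeneousComponent_isHomogeneous i F).mul ((isHomogeneous_X ℂ j).pow (k - i))
    convert this using 1
    omega
  · intro L _ _ y hy
    conv_rhs => rw [← sum_homogeneousComponent F, map_sum, Finset.mul_sum]
    rw [map_sum]
    refine Finset.sum_congr rfl fun i hi => ?_
    rw [Finset.mem_range] at hi
    have h := aeval_smul_form (homogeneousComponent_isHomogeneous i F) (y j)⁻¹ y
    rw [show (fun i => y i / y j) = fun i => (y j)⁻¹ * y i by ext i; rw [div_eq_inv_mul], h,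
      map_mul, map_pow, aeval_X]
    have : y j ^ k = y j ^ (k - i) * y j ^ i := by rw [← pow_add]; congr 1; omega
    rw [this, inv_pow]
    field_simp

theorem pair_isHomogeneous {A B : MvPolynomial (Fin 2) ℂ} {e d : ℕ} (hA : A.IsHomogeneous e)
    (hB : B.IsHomogeneous e) {g : MvPolynomial (Fin 2) ℂ} (hg : g.IsHomogeneous d) :
    (aeval ![A, B] g : MvPolynomial (Fin 2) ℂ).IsHomogeneous (e * d) :=
  hg.aeval (S := ℂ) ![A, B] (n := e) (by intro i; fin_cases i; exacts [hA, hB])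

theorem eval_pair (A B g : MvPolynomial (Fin 2) ℂ) (u : Fin 2 → ℂ) :
    eval u (aeval ![A, B] g) = eval ![eval u A, eval u B] g := by
  rw [eval_aeval]
  congr 2
  ext i; fin_cases i <;> rfl

-- Lüroth's theorem: the ratios of the `f i` generate a field `ℂ(r)` with `r = A / B` in lowest
-- terms. The ratios expressed by `r` yield the forms `g`. Conversely `r`, expressed by the ratios,
-- yields `Φ / Ψ`, an inverse of the map defined by `g`, which is therefore generically injective.
open scoped Polynomial in
set_option maxHeartbeats 1000000 in
theorem exists_luroth {n m : ℕ} {f : Fin n → MvPolynomial (Fin 2) ℂ}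
    (hf : ∀ i, (f i).IsHomogeneous m)
    (hnc : ∃ u t i j, eval u (f i) * eval t (f j) ≠ eval u (f j) * eval t (f i)) :
    ∃ (d e k : ℕ) (g : Fin n → MvPolynomial (Fin 2) ℂ) (A B : MvPolynomial (Fin 2) ℂ)
      (Φ Ψ : MvPolynomial (Fin n) ℂ), e ≠ 0 ∧ (∀ i, (g i).IsHomogeneous d) ∧
      (∀ u, u ≠ 0 → ∃ i, eval u (g i) ≠ 0) ∧ A.IsHomogeneous e ∧ B.IsHomogeneous e ∧
      (∀ u, u ≠ 0 → eval u A ≠ 0 ∨ eval u B ≠ 0) ∧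
      (∀ u i j, eval u (f i) * eval ![eval u A, eval u B] (g j) =
        eval u (f j) * eval ![eval u A, eval u B] (g i)) ∧
      Φ.IsHomogeneous k ∧ Ψ.IsHomogeneous k ∧
      (∃ u, eval (fun i => eval u (g i)) Ψ ≠ 0) ∧
      ∀ u : Fin 2 → ℂ, u 0 * eval (fun i => eval u (g i)) Ψ =
        u 1 * eval (fun i => eval u (g i)) Φ := by
  classical
  let L := RatFunc ℂ
  let α : ℂ[X] →ₐ[ℂ] L := IsScalarTower.toAlgHom ℂ ℂ[X] L
  have hα : Function.Injective α := IsFractionRing.injective ℂ[X] L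
  let F : Fin n → ℂ[X] := fun i => aeval ![Polynomial.X, 1] (f i)
  have hFe : ∀ i s, (F i).eval s = eval ![s, 1] (f i) := by
    intro i s
    rw [eval_aeval_path]
    congr 2
    ext l; fin_cases l <;> simp
  obtain ⟨j, hj⟩ : ∃ j, f j ≠ 0 := by
    by_contra! h
    obtain ⟨u, t, i, j, hne⟩ := hnc
    exact hne (by simp [h])
  let y : Fin n → L := fun i => α (F i)
  have hF0 : F j ≠ 0 := fun h0 => hj (form_eq_zero_of_chart (hf j) fun s => by
    rw [← hFe, h0, Polynomial.eval_zero])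
  have hy0 : y j ≠ 0 := (map_ne_zero_iff α hα).2 hF0
  let x : Fin n → L := fun i => y i / y j
  let E : IntermediateField ℂ L := IntermediateField.adjoin ℂ (Set.range x)
  have hxE : ∀ i, x i ∈ E := fun i => IntermediateField.subset_adjoin _ _ ⟨i, rfl⟩
  have hE : E ≠ ⊥ := by
    intro hbot
    have hc : ∀ i, ∃ c : ℂ, f i = C c * f j := by
      intro i
      have := hxE i
      rw [hbot, IntermediateField.mem_bot] at this
      obtain ⟨c, hc⟩ := this
      refine ⟨c, ?_⟩
      have h1 : y i = α (Polynomial.C c * F j) := by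
        rw [map_mul, ← Polynomial.algebraMap_eq, AlgHom.commutes, hc]
        exact (div_mul_cancel₀ _ hy0).symm
      have h2 : F i = Polynomial.C c * F j := hα h1
      rw [← sub_eq_zero]
      refine form_eq_zero_of_chart ((hf i).sub (by simpa using (isHomogeneous_C _ c).mul (hf j)))
        fun s => ?_
      have h3 := congrArg (Polynomial.eval s) h2
      rw [Polynomial.eval_mul, Polynomial.eval_C, hFe, hFe] at h3
      simp [h3]
    choose c hc using hc
    obtain ⟨u, t, i, l, hne⟩ := hnc
    apply hne
    rw [hc i, hc l]
    simp only [map_mul, eval_C]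
    ring
  let r : L := RatFunc.Luroth.generator E
  have hr : Transcendental ℂ r := RatFunc.Luroth.transcendental_generator hE
  have hEr : E = IntermediateField.adjoin ℂ {r} := RatFunc.Luroth.eq_adjoin_generator
  have hrE : r ∈ E := RatFunc.Luroth.generator_mem
  let A0 := r.num
  let B0 := r.denom
  have hB0 : B0 ≠ 0 := r.denom_ne_zero
  have hb : α B0 ≠ 0 := (map_ne_zero_iff α hα).2 hB0
  have hrab : α A0 / α B0 = r := RatFunc.num_div_denom r
  have hr0 : r ≠ 0 := RatFunc.Luroth.generator_ne_zero hE
  -- numerators and denominators in the generator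
  have h1 : ∀ i, ∃ P Q : ℂ[X], x i * Polynomial.aeval r Q = Polynomial.aeval r P ∧ Q ≠ 0 := by
    intro i
    have := hxE i
    rw [hEr, IntermediateField.mem_adjoin_simple_iff] at this
    obtain ⟨P, Q, h⟩ := this
    by_cases hQ : Q = 0
    · exact ⟨0, 1, by simp [h, hQ], one_ne_zero⟩
    · refine ⟨P, Q, ?_, hQ⟩
      rw [h, div_mul_cancel₀]
      exact fun h0 => hQ ((transcendental_iff.1 hr) Q h0)
  choose P Q hPQ hQ0 using h1
  obtain ⟨M, hM⟩ : ∃ M, ∀ i, (P i).natDegree ≤ M ∧ (Q i).natDegree ≤ M :=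
    ⟨∑ i, ((P i).natDegree + (Q i).natDegree), fun i => by
      have := Finset.single_le_sum (f := fun i => (P i).natDegree + (Q i).natDegree)
        (fun _ _ => Nat.zero_le _) (Finset.mem_univ i)
      omega⟩
  have hpt : ∀ (R : ℂ[X]), R.natDegree ≤ M → aeval ![α A0, α B0] (R.homogenize M) =
      α B0 ^ M * Polynomial.aeval r R := fun R hR => by
    rw [aeval_homogenize_pair hR _ hb, hrab]
  -- A common denominator of all ratios as functions of `r`, with the corresponding numerators `g'`.
  let G : MvPolynomial (Fin 2) ℂ := ∏ i, (Q i).homogenize M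
  let g' : Fin n → MvPolynomial (Fin 2) ℂ := fun i =>
    (P i).homogenize M * ∏ l ∈ Finset.univ.erase i, (Q l).homogenize M
  have hg' : ∀ i, (g' i).IsHomogeneous (M + ∑ l ∈ Finset.univ.erase i, M) := fun i =>
    (Polynomial.isHomogeneous_homogenize _).mul (IsHomogeneous.prod _ _ _ fun l _ =>
      Polynomial.isHomogeneous_homogenize _)
  simp only [Finset.sum_const, Finset.card_erase_of_mem (Finset.mem_univ _)] at hg'
  have hyG : ∀ i, y i * aeval ![α A0, α B0] G = y j * aeval ![α A0, α B0] (g' i) := by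
    intro i
    have e1 : G = (Q i).homogenize M * ∏ l ∈ Finset.univ.erase i, (Q l).homogenize M :=
      (Finset.mul_prod_erase _ _ (Finset.mem_univ i)).symm
    have e2 : y i = y j * x i := (mul_div_cancel₀ _ hy0).symm
    rw [e1, map_mul, map_mul, hpt _ (hM i).1, hpt _ (hM i).2, e2, ← hPQ i]
    ring
  have hG0 : aeval ![α A0, α B0] G ≠ 0 := by
    rw [map_prod]
    refine Finset.prod_ne_zero_iff.2 fun i _ => ?_
    rw [hpt _ (hM i).2]
    exact mul_ne_zero (pow_ne_zero _ hb) fun h0 => hQ0 i ((transcendental_iff.1 hr) _ h0)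
  have hg'j : aeval ![α A0, α B0] (g' j) = aeval ![α A0, α B0] G :=
    (mul_left_cancel₀ hy0 (hyG j)).symm
  obtain ⟨-, d, h, g, -, -, -, hg, hgg, hbpf⟩ := exists_content hg' ⟨j, fun h0 => hG0 (by
    rw [← hg'j, h0, map_zero])⟩
  have hgj : aeval ![α A0, α B0] h ≠ 0 ∧ aeval ![α A0, α B0] (g j) ≠ 0 := by
    rw [← hg'j, hgg, map_mul] at hG0
    exact ⟨left_ne_zero_of_mul hG0, right_ne_zero_of_mul hG0⟩
  have hyg : ∀ i, y i * aeval ![α A0, α B0] (g j) = y j * aeval ![α A0, α B0] (g i) := by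
    intro i
    have := hyG i
    rw [← hg'j, hgg, hgg, map_mul, map_mul] at this
    refine mul_left_cancel₀ hgj.1 ?_
    linear_combination this
  -- the inverse
  obtain ⟨Φ0, Ψ0, hr1⟩ := (IntermediateField.mem_adjoin_range_iff _ _ _).1 hrE
  have hΨ0 : aeval x Ψ0 ≠ 0 := fun h0 => hr0 (by rw [hr1, h0, div_zero])
  let k := max Φ0.totalDegree Ψ0.totalDegree
  obtain ⟨Φ, hΦ, hΦe⟩ := exists_homogenization j Φ0 (le_max_left _ Ψ0.totalDegree)
  obtain ⟨Ψ, hΨ, hΨe⟩ := exists_homogenization j Ψ0 (le_max_right Φ0.totalDegree _)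
  let gv : Fin n → L := fun i => aeval ![α A0, α B0] (g i)
  have hgv : (fun i => gv i / gv j) = x := by
    ext i
    rw [div_eq_div_iff hgj.2 hy0, mul_comm, ← hyg i, mul_comm]
  have hΨg : aeval gv Ψ ≠ 0 := by
    rw [hΨe L gv hgj.2, hgv]
    exact mul_ne_zero (pow_ne_zero _ hgj.2) hΨ0
  have hinv : r * aeval gv Ψ = aeval gv Φ := by
    rw [hΨe L gv hgj.2, hΦe L gv hgj.2, hgv, hr1]
    field_simp
  have hgv' : ∀ Θ : MvPolynomial (Fin n) ℂ, aeval gv Θ = aeval ![α A0, α B0] (aeval g Θ) := by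
    intro Θ
    rw [← AlgHom.comp_apply, comp_aeval]
  -- The relation between a parameter and its point holds at `(r, 1)`. Since `r` is transcendental,
  -- it holds identically.
  let K : MvPolynomial (Fin 2) ℂ := X 0 * aeval g Ψ - X 1 * aeval g Φ
  have hK : K.IsHomogeneous (1 + d * k) :=
    ((isHomogeneous_X _ _).mul (hΨ.aeval g hg)).sub ((isHomogeneous_X _ _).mul (hΦ.aeval g hg))
  have hK0 : K = 0 := by
    have h2 : aeval ![α A0, α B0] K = 0 := by
      simp only [K, map_sub, map_mul, aeval_X, ← hgv', Matrix.cons_val_zero, Matrix.cons_val_one]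
      rw [← hinv, ← hrab, ← mul_assoc, mul_div_cancel₀ _ hb, sub_self]
    have h3 := aeval_smul_form hK (α B0) ![r, 1]
    have h4 : (fun i => α B0 * ![r, 1] i) = ![α A0, α B0] := by
      rw [← hrab]
      ext i; fin_cases i
      · exact mul_div_cancel₀ _ hb
      · exact mul_one _
    rw [h4, h2, eq_comm, mul_eq_zero, or_iff_right (pow_ne_zero _ hb)] at h3
    have h5 : aeval ![r, 1] K = Polynomial.aeval r (aeval ![Polynomial.X, 1] K : ℂ[X]) := by
      have : (Polynomial.aeval r).comp (aeval ![Polynomial.X, (1 : ℂ[X])]) =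
          (aeval ![r, 1] : MvPolynomial (Fin 2) ℂ →ₐ[ℂ] L) := by
        ext i; fin_cases i <;> simp
      rw [← this]; rfl
    rw [h5] at h3
    have h6 := (transcendental_iff.1 hr) _ h3
    refine form_eq_zero_of_chart hK fun s => ?_
    have h7 := congrArg (Polynomial.eval s) h6
    rw [eval_aeval_path, Polynomial.eval_zero] at h7
    rw [← h7]
    congr 2
    ext l; fin_cases l <;> simp
  -- the parametrization as a pair of forms
  let e := max A0.natDegree B0.natDegree
  have hA : A0.natDegree ≤ e := le_max_left _ _
  have hB : B0.natDegree ≤ e := le_max_right _ _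
  have he : e ≠ 0 := by
    intro he
    obtain ⟨a, ha⟩ := Polynomial.natDegree_eq_zero.1 (by omega : A0.natDegree = 0)
    obtain ⟨b, hb⟩ := Polynomial.natDegree_eq_zero.1 (by omega : B0.natDegree = 0)
    refine RatFunc.Luroth.generator_ne_C hE ⟨a / b, ?_⟩
    change r = _
    rw [← hrab, ← ha, ← hb]
    change algebraMap _ _ _ / algebraMap _ _ _ = _
    rw [RatFunc.algebraMap_C, RatFunc.algebraMap_C, map_div₀]
  have hpoint : ∀ (R : ℂ[X]), R.natDegree ≤ e → ∀ s, eval ![s, 1] (R.homogenize e) = R.eval s := by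
    intro R hR s
    have := Polynomial.aeval_homogenize_of_eq_one hR ![s, 1] (by simp)
    simpa [aeval_eq_eval] using this
  have hinf : ∀ R : ℂ[X], R.natDegree ≤ e → eval ![1, 0] (R.homogenize e) = R.coeff e := by
    intro R hR
    have h2 := coeff_chart (Polynomial.isHomogeneous_homogenize (n := e) R) ![0, 1] ![1, 0]
    rw [← h2]
    congr 1
    refine Polynomial.funext fun s => ?_
    rw [eval_chart, ← hpoint R hR]
    congr 2
    ext i; fin_cases i <;> simp
  refine ⟨d, e, k, g, A0.homogenize e, B0.homogenize e, Φ, Ψ, he, hg, hbpf,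
    Polynomial.isHomogeneous_homogenize _, Polynomial.isHomogeneous_homogenize _, ?_, ?_,
    hΦ, hΨ, ?_, ?_⟩
  · intro u hu
    by_contra! hAB
    by_cases hu1 : u 1 = 0
    · have hu0 : u 0 ≠ 0 := fun h0 => hu (by ext i; fin_cases i <;> simp [h0, hu1])
      have h2 : u = u 0 • ![1, 0] := by ext i; fin_cases i <;> simp [hu1]
      rw [h2, eval_smul_form (Polynomial.isHomogeneous_homogenize _),
        eval_smul_form (Polynomial.isHomogeneous_homogenize _), hinf _ hA, hinf _ hB] at hAB
      simp only [mul_eq_zero, pow_eq_zero_iff he, hu0, false_or] at hAB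
      rcases le_total A0.natDegree B0.natDegree with hle | hle
      · have : e = B0.natDegree := max_eq_right hle
        rw [this, Polynomial.coeff_natDegree, Polynomial.leadingCoeff_eq_zero] at hAB
        exact hB0 hAB.2
      · have : e = A0.natDegree := max_eq_left hle
        rw [this, Polynomial.coeff_natDegree, Polynomial.leadingCoeff_eq_zero] at hAB
        rw [hAB.1, Polynomial.natDegree_zero] at this
        exact he this
    · have h2 : u = u 1 • ![u 0 / u 1, 1] := by
        ext i; fin_cases i <;> simp; field_simp
      rw [h2, eval_smul_form (Polynomial.isHomogeneous_homogenize _),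
        eval_smul_form (Polynomial.isHomogeneous_homogenize _), hpoint _ hA, hpoint _ hB] at hAB
      simp only [mul_eq_zero, pow_eq_zero_iff he, hu1, false_or] at hAB
      obtain ⟨p, q, hpq⟩ := r.isCoprime_num_denom
      have h3 := congrArg (Polynomial.eval (u 0 / u 1)) hpq
      have h4 : Polynomial.eval (u 0 / u 1) r.num = 0 := hAB.1
      have h5 : Polynomial.eval (u 0 / u 1) r.denom = 0 := hAB.2
      simp [h4, h5] at h3
  · intro u i l
    rw [← eval_pair, ← eval_pair, ← map_mul, ← map_mul, ← sub_eq_zero, ← map_sub]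
    have hh : ∀ i l, (f i * aeval ![A0.homogenize e, B0.homogenize e] (g l)).IsHomogeneous
        (m + e * d) := fun i l => (hf i).mul (pair_isHomogeneous
          (Polynomial.isHomogeneous_homogenize _) (Polynomial.isHomogeneous_homogenize _) (hg l))
    rw [form_eq_zero_of_chart ((hh i l).sub (hh l i)), map_zero]
    intro s
    rw [map_sub, map_mul, map_mul, eval_pair, eval_pair, hpoint _ hA, hpoint _ hB, ← hFe, ← hFe]
    have h2 : F i * aeval ![A0, B0] (g l) = F l * aeval ![A0, B0] (g i) := by
      apply hα
      have h3 : ∀ i, α (aeval ![A0, B0] (g i)) = aeval ![α A0, α B0] (g i) := by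
        intro i
        rw [← AlgHom.comp_apply, comp_aeval]
        congr 2
        ext l; fin_cases l <;> rfl
      rw [map_mul, map_mul, h3, h3]
      refine mul_left_cancel₀ hgj.2 ?_
      change _ * (y i * _) = _ * (y l * _)
      linear_combination aeval ![α A0, α B0] (g l) * hyg i - aeval ![α A0, α B0] (g i) * hyg l
    have h3 := congrArg (Polynomial.eval s) h2
    rw [Polynomial.eval_mul, Polynomial.eval_mul, eval_aeval_path ![A0, B0] (g l),
      eval_aeval_path ![A0, B0] (g i)] at h3
    have h4 : (fun i => Polynomial.eval s (![A0, B0] i)) = ![A0.eval s, B0.eval s] := by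
      ext i; fin_cases i <;> rfl
    rw [h4] at h3
    rw [h3, sub_self]
  · by_contra! h0
    apply hΨg
    rw [hgv']
    have : aeval g Ψ = 0 := MvPolynomial.funext fun u => by rw [eval_aeval, h0, map_zero]
    rw [this, map_zero]
  · intro u
    have := congrArg (eval u) hK0
    rw [map_sub, map_mul, map_mul, eval_X, eval_X, eval_aeval, eval_aeval, map_zero,
      sub_eq_zero] at this
    exact this

/-- A generically injective pair of forms is linear. -/
theorem degree_eq_one_of_generically_injective {A B : MvPolynomial (Fin 2) ℂ} {e : ℕ}
    (hA : A.IsHomogeneous e) (hB : B.IsHomogeneous e)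
    (hAB : ∀ u, u ≠ 0 → eval u A ≠ 0 ∨ eval u B ≠ 0)
    (hinj : ∀ᶠ u in gen (Fin 2), ∀ t, t ≠ 0 →
      eval u A * eval t B = eval u B * eval t A → wedge t u = 0) : e = 1 := by
  obtain ⟨u₀, hu₀, hu₀'⟩ := (hinj.and ((Pol.coord (0 : Fin 2)).eventually_ne (v := 1) (by simp))).exists
  have hu₀0 : u₀ ≠ 0 := by rintro rfl; simp at hu₀'
  rcases Nat.eq_zero_or_pos e with rfl | he
  · exfalso
    obtain ⟨w, hw⟩ := exists_wedge_ne_zero hu₀0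
    refine hw ?_
    have hw0 : w ≠ 0 := by rintro rfl; simp [wedge] at hw
    rw [wedge_swap, hu₀ w hw0 (by rw [form_degree_zero hA u₀ w, form_degree_zero hB u₀ w, mul_comm]),
      neg_zero]
  have hA0 : A ≠ 0 := by
    rintro rfl
    obtain ⟨v, hv, h⟩ := exists_zero hB he.ne'
    simpa [h] using hAB v hv
  obtain ⟨w, hw⟩ := wronskian_ne_zero he.ne' hA hA0
    fun u hu h => (hAB u hu).resolve_left (by simpa using h)
  have hW : (A * D w B - B * D w A).IsHomogeneous (e + (e - 1)) :=
    (hA.mul (D_isHomogeneous hB w)).sub (hB.mul (D_isHomogeneous hA w))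
  -- The zeros of `φ t` are the parameters with the same image as `t`. For generic `t` none of them
  -- is a zero of the Wronskian, so there are `e` simple ones; by injectivity `t` is the only one.
  let φ : (Fin 2 → ℂ) → MvPolynomial (Fin 2) ℂ := fun t => C (eval t B) * A - C (eval t A) * B
  have hφ : ∀ t, (φ t).IsHomogeneous e := fun t =>
    (by simpa using (isHomogeneous_C _ (eval t B)).mul hA : (C (eval t B) * A).IsHomogeneous e).sub
      (by simpa using (isHomogeneous_C _ (eval t A)).mul hB)
  have hev : ∀ t u, eval u (φ t) = eval t B * eval u A - eval t A * eval u B := by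
    intro t u; simp [φ]
  have hne : ∀ u, u ≠ 0 → ∀ᶠ t in gen (Fin 2), eval u (φ t) ≠ 0 := by
    intro u hu
    by_contra h
    have hp : Pol fun t => eval u (φ t) := by
      simp only [hev]
      exact ⟨B * C (eval u A) - A * C (eval u B), fun t => by simp⟩
    have h0 : ∀ t, eval u (φ t) = 0 := by
      by_contra! h1
      obtain ⟨t, ht⟩ := h1
      exact h (hp.eventually_ne ht)
    simp only [hev] at h0
    rcases hAB u hu with h1 | h1
    · obtain ⟨v, hv, h2⟩ := exists_zero hA he.ne'
      have h3 := h0 v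
      have := (hAB v hv).resolve_left (by simpa using h2)
      simp [h2, h1, this] at h3
    · by_cases hB0 : B = 0
      · simp [hB0] at h1
      obtain ⟨v, hv, h2⟩ := exists_zero hB he.ne'
      have h3 := h0 v
      have := (hAB v hv).resolve_right (by simpa using h2)
      simp [h2, h1, this] at h3
  have hgen := eventually_forall_zero hW hw (Q := fun u t => eval u (φ t) ≠ 0)
    (fun c u t hc h => by
      rw [eval_smul_form (hφ t)]
      exact mul_ne_zero (pow_ne_zero _ hc) h) (fun u hu _ => hne u hu)
  obtain ⟨t, ⟨ht1, ht2⟩, ht3, ht4⟩ := ((hinj.and hgen).and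
    (((Pol.coord (0 : Fin 2)).eventually_ne (v := 1) (by simp)).and (hne u₀ hu₀0))).exists
  have ht0 : t ≠ 0 := by rintro rfl; simp at ht3
  have hcard := zeros_ncard_eq (hφ t) (fun h => ht4 (by rw [h, map_zero])) (by
    intro v hv hv0
    refine ⟨w, fun h => ht2 v hv ?_ hv0⟩
    rw [hev] at hv0
    have h' : eval t B * eval v (D w A) - eval t A * eval v (D w B) = 0 := by
      rw [← h]; simp [φ]
    simp only [map_sub, map_mul]
    rcases hAB t ht0 with h1 | h1
    · refine (mul_eq_zero.1 (?_ : eval t A * _ = 0)).resolve_left h1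
      linear_combination (-eval v A) * h' + eval v (D w A) * hv0
    · refine (mul_eq_zero.1 (?_ : eval t B * _ = 0)).resolve_left h1
      linear_combination (-eval v B) * h' + eval v (D w B) * hv0)
  by_contra hne1
  have h1 : 1 < (zeros (φ t)).ncard := by omega
  have hmem : Projectivization.mk ℂ t ht0 ∈ zeros (φ t) :=
    (mk_mem_zeros (hφ t) ht0).2 (by rw [hev]; ring)
  obtain ⟨x, hx, hxt⟩ := Set.exists_ne_of_one_lt_ncard h1 (Projectivization.mk ℂ t ht0)
  apply hxt
  have hx0 : eval x.rep (φ t) = 0 := hx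
  rw [hev] at hx0
  rw [← Projectivization.mk_rep x, mk_eq_mk_iff_wedge x.rep_nonzero ht0]
  exact ht1 _ x.rep_nonzero (by linear_combination -hx0)

/-! ### Families of lines -/

/-- The value of a family of forms. -/
noncomputable def ev {n : ℕ} (f : Fin n → MvPolynomial (Fin 2) ℂ) (u : Fin 2 → ℂ) : Fin n → ℂ :=
  fun i => eval u (f i)

/-- The derivative of a family of forms. -/
noncomputable def dv {n : ℕ} (f : Fin n → MvPolynomial (Fin 2) ℂ) (u w : Fin 2 → ℂ) : Fin n → ℂ :=
  fun i => eval u (D w (f i))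

section
variable {n d : ℕ} {f : Fin n → MvPolynomial (Fin 2) ℂ}

theorem ev_smul (hf : ∀ i, (f i).IsHomogeneous d) (c : ℂ) (u : Fin 2 → ℂ) :
    ev f (c • u) = c ^ d • ev f u := funext fun i => eval_smul_form (hf i) c u

theorem dv_add (u w w' : Fin 2 → ℂ) : dv f u (w + w') = dv f u w + dv f u w' :=
  funext fun _ => eval_D_add _ _ _ _

theorem dv_smul (c : ℂ) (u w : Fin 2 → ℂ) : dv f u (c • w) = c • dv f u w :=
  funext fun _ => eval_D_smul _ _ _ _

theorem dv_self (hf : ∀ i, (f i).IsHomogeneous d) (u : Fin 2 → ℂ) :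
    dv f u u = (d : ℂ) • ev f u := by
  funext i
  change eval u (D u (f i)) = (d : ℂ) * eval u (f i)
  exact euler (hf i) u

theorem Pol.ev (f : Fin n → MvPolynomial (Fin 2) ℂ) (i : Fin n) : Pol fun u => ev f u i :=
  ⟨f i, fun _ => rfl⟩

theorem Pol.dv (f : Fin n → MvPolynomial (Fin 2) ℂ) (w : Fin 2 → ℂ) (i : Fin n) :
    Pol fun u => dv f u w i := ⟨D w (f i), fun _ => rfl⟩

end

theorem pair_ev_dv {f : Fin 6 → MvPolynomial (Fin 2) ℂ} (hf : ∀ u, pf (ev f u) = 0)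
    (u w : Fin 2 → ℂ) : pair (ev f u) (dv f u w) = 0 := by
  have h : f 0 * f 5 - f 1 * f 4 + f 2 * f 3 = 0 := MvPolynomial.funext fun u => by
    simpa [pf, ev] using hf u
  have := congrArg (fun F => eval u (D w F)) h
  simp only [map_add, map_sub, D_mul, map_zero, map_mul] at this
  simp only [pair, ev, dv]
  linear_combination this

theorem exists_smul_of_cross {n : ℕ} {x y : Fin n → ℂ} (hy : y ≠ 0)
    (h : ∀ i k, x i * y k = x k * y i) : ∃ c : ℂ, x = c • y := by
  obtain ⟨k, hk⟩ := Function.ne_iff.1 hy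
  have hk : y k ≠ 0 := hk
  refine ⟨x k / y k, funext fun i => ?_⟩
  simp only [Pi.smul_apply, smul_eq_mul]
  field_simp
  exact h i k

/-- A one-parameter family of lines, given by its Plücker coordinates. -/
structure Scroll where
  degree : ℕ
  form : Fin 6 → MvPolynomial (Fin 2) ℂ
  homogeneous : ∀ i, (form i).IsHomogeneous degree
  base_point_free : ∀ u, u ≠ 0 → ∃ i, eval u (form i) ≠ 0
  pf_eq_zero : ∀ u, pf (ev form u) = 0
  nondeg : ∃ u w, pf (dv form u w) ≠ 0
  proper : ∀ᶠ u in gen (Fin 2), ∀ t, t ≠ 0 → (∃ c : ℂ, ev form t = c • ev form u) → wedge t u = 0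

namespace Scroll
variable (T : Scroll)

/-- The Plücker coordinates of a line of the family. -/
noncomputable def pl (u : Fin 2 → ℂ) : Fin 6 → ℂ := ev T.form u

/-- The derivative of the Plücker coordinates. -/
noncomputable def der (u w : Fin 2 → ℂ) : Fin 6 → ℂ := dv T.form u w

theorem pl_smul (c : ℂ) (u : Fin 2 → ℂ) : T.pl (c • u) = c ^ T.degree • T.pl u :=
  ev_smul T.homogeneous c u

theorem pl_ne_zero {u : Fin 2 → ℂ} (hu : u ≠ 0) : T.pl u ≠ 0 := by
  obtain ⟨i, hi⟩ := T.base_point_free u hu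
  exact fun h => hi (congrFun h i)

theorem pf_pl (u : Fin 2 → ℂ) : pf (T.pl u) = 0 := T.pf_eq_zero u

theorem pair_pl_der (u w : Fin 2 → ℂ) : pair (T.pl u) (T.der u w) = 0 :=
  pair_ev_dv T.pf_eq_zero u w

theorem der_add (u w w' : Fin 2 → ℂ) : T.der u (w + w') = T.der u w + T.der u w' := dv_add u w w'

theorem der_smul (c : ℂ) (u w : Fin 2 → ℂ) : T.der u (c • w) = c • T.der u w := dv_smul c u w

theorem der_self (u : Fin 2 → ℂ) : T.der u u = (T.degree : ℂ) • T.pl u := dv_self T.homogeneous u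

theorem pol_pl (i : Fin 6) : Pol fun u => T.pl u i := Pol.ev _ i

theorem pol_der (w : Fin 2 → ℂ) (i : Fin 6) : Pol fun u => T.der u w i := Pol.dv _ w i

theorem degree_ne_zero : T.degree ≠ 0 := by
  intro h
  obtain ⟨u, w, hn⟩ := T.nondeg
  apply hn
  have : T.der u w = 0 := by
    ext i
    have hd := D_isHomogeneous (T.homogeneous i) w
    have : D w (T.form i) = 0 := by
      have hi := T.homogeneous i
      rw [h] at hi
      rw [totalDegree_eq_zero_iff_eq_C.1 ((totalDegree_zero_iff_isHomogeneous _).2 hi), D_C]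
    simp [der, dv, this]
  change pf (T.der u w) = 0
  rw [this]; simp [pf]

/-- The cone over the surface swept out by the lines. -/
def On (v : Fin 4 → ℂ) : Prop := ∃ u, u ≠ 0 ∧ Ns (T.pl u) v = 0

/-- The matrix of forms whose kernels are the lines. -/
noncomputable def mat : Fin 4 → Fin 4 → MvPolynomial (Fin 2) ℂ :=
  ![![0, T.form 5, -T.form 4, T.form 3], ![-T.form 5, 0, T.form 2, -T.form 1],
    ![T.form 4, -T.form 2, 0, T.form 0], ![-T.form 3, T.form 1, -T.form 0, 0]]

theorem mat_isHomogeneous (i j : Fin 4) : (T.mat i j).IsHomogeneous T.degree := by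
  fin_cases i <;> fin_cases j <;>
    first
    | exact isHomogeneous_zero _ _ _
    | exact T.homogeneous _
    | exact (T.homogeneous _).neg

theorem eval_comb_mat (u : Fin 2 → ℂ) (x : Fin 4 → ℂ) (i : Fin 4) :
    eval u (comb (T.mat i) x) = Ns (T.pl u) x i := by
  rw [eval_comb, Fin.sum_univ_four]
  fin_cases i <;> simp [mat, Ns, N, dual, pl, ev] <;> ring

theorem swept_mat (x : Fin 4 → ℂ) : Swept T.mat x ↔ T.On x := by
  refine exists_congr fun u => and_congr_right fun _ => ?_
  simp only [eval_comb_mat]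
  exact ⟨fun h => funext h, fun h i => by rw [h]; rfl⟩

theorem exists_separating {x : Fin 4 → ℂ} (hx : ¬ T.On x) :
    ∃ (d : ℕ) (H : MvPolynomial (Fin 4) ℂ), H.IsHomogeneous d ∧ (∀ y, T.On y → eval y H = 0) ∧
      eval x H ≠ 0 := by
  rw [← swept_mat] at hx
  simpa only [swept_mat] using exists_separating_form T.degree_ne_zero T.mat_isHomogeneous hx

theorem On.smul {T : Scroll} {x : Fin 4 → ℂ} (h : T.On x) (c : ℂ) : T.On (c • x) := by
  obtain ⟨u, hu, h⟩ := h
  exact ⟨u, hu, by rw [Ns_smul_right, h, smul_zero]⟩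

end Scroll

theorem Pol.N {ι : Type*} {x : (ι → ℂ) → Fin 6 → ℂ} {z : (ι → ℂ) → Fin 4 → ℂ}
    (hx : ∀ i, Pol fun v => x v i) (hz : ∀ i, Pol fun v => z v i) (i : Fin 4) :
    Pol fun v => N (x v) (z v) i := by
  fin_cases i <;> simp only [RuledContours.N] <;> simp <;> fun_prop

theorem Pol.dual {ι : Type*} {x : (ι → ℂ) → Fin 6 → ℂ}
    (hx : ∀ i, Pol fun v => x v i) (i : Fin 6) : Pol fun v => dual (x v) i := by
  fin_cases i <;> simp only [RuledContours.dual] <;> simp <;> fun_prop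

theorem Pol.Ns {ι : Type*} {x : (ι → ℂ) → Fin 6 → ℂ} {z : (ι → ℂ) → Fin 4 → ℂ}
    (hx : ∀ i, Pol fun v => x v i) (hz : ∀ i, Pol fun v => z v i) (i : Fin 4) :
    Pol fun v => Ns (x v) (z v) i := Pol.N (Pol.dual hx) hz i

theorem Pol.pf {ι : Type*} {x : (ι → ℂ) → Fin 6 → ℂ}
    (hx : ∀ i, Pol fun v => x v i) : Pol fun v => pf (x v) := by
  simp only [RuledContours.pf]; fun_prop

theorem Pol.pair {ι : Type*} {x y : (ι → ℂ) → Fin 6 → ℂ}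
    (hx : ∀ i, Pol fun v => x v i) (hy : ∀ i, Pol fun v => y v i) : Pol fun v => pair (x v) (y v) := by
  simp only [RuledContours.pair]; fun_prop

theorem Pol.dt {ι : Type*} {x y : (ι → ℂ) → Fin 4 → ℂ}
    (hx : ∀ i, Pol fun v => x v i) (hy : ∀ i, Pol fun v => y v i) : Pol fun v => dt (x v) (y v) := by
  simp only [RuledContours.dt]; fun_prop

theorem det_eq_pf {A : Type*} [CommRing A] (p q r s : Fin 4 → A) :
    Matrix.det (Matrix.of ![p, q, r, s]) =
      (p 0 * q 1 - p 1 * q 0) * (r 2 * s 3 - r 3 * s 2) -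
      (p 0 * q 2 - p 2 * q 0) * (r 1 * s 3 - r 3 * s 1) +
      (p 0 * q 3 - p 3 * q 0) * (r 1 * s 2 - r 2 * s 1) +
      (p 1 * q 2 - p 2 * q 1) * (r 0 * s 3 - r 3 * s 0) -
      (p 1 * q 3 - p 3 * q 1) * (r 0 * s 2 - r 2 * s 0) +
      (p 2 * q 3 - p 3 * q 2) * (r 0 * s 1 - r 1 * s 0) := by
  simp [Matrix.det_succ_row_zero, Fin.sum_univ_succ, Fin.succAbove]
  ring

/-- The Plücker coordinates of a parametrized family of lines. -/
noncomputable def wedPoly (p q : Fin 4 → Polynomial ℂ) : Fin 6 → Polynomial ℂ :=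
  ![p 0 * q 1 - p 1 * q 0, p 0 * q 2 - p 2 * q 0, p 0 * q 3 - p 3 * q 0,
    p 1 * q 2 - p 2 * q 1, p 1 * q 3 - p 3 * q 1, p 2 * q 3 - p 3 * q 2]

theorem eval_wedPoly (p q : Fin 4 → Polynomial ℂ) (s : ℂ) :
    (fun i => (wedPoly p q i).eval s) = wed (evalVec p s) (evalVec q s) := by
  ext i; fin_cases i <;> simp [wedPoly, wed, evalVec]

/-- The derivative of `p ∧ q` is `p' ∧ q + p ∧ q'`, and its Pfaffian is `det [p, q, p', q']` up to
sign. So regularity of the generic ruling is a property of the curve on the Klein quadric. -/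
theorem exists_pf_derivative_ne_zero {p q : Fin 4 → Polynomial ℂ} (h : GenericallyRegular p q) :
    ∃ s, pf (fun i => (wedPoly p q i).derivative.eval s) ≠ 0 := by
  by_contra! h0
  apply h
  refine Polynomial.funext fun s => ?_
  have h1 := h0 s
  rw [det_eq_pf]
  simp [pf, wedPoly, Polynomial.derivative_mul] at h1 ⊢
  linear_combination -h1

theorem mem_ruling_iff {p q : Fin 4 → Polynomial ℂ} {s : ℂ} {v : Fin 4 → ℂ} (hv : v ≠ 0) :
    Projectivization.mk ℂ v hv ∈ ruling p q s ↔
      v ∈ Submodule.span ℂ {evalVec p s, evalVec q s} := by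
  change (Projectivization.mk ℂ v hv).submodule ≤ _ ↔ _
  rw [Projectivization.submodule_mk, Submodule.span_singleton_le_iff_mem]

/-- `exists_luroth`, applied to the Plücker coordinates, makes an arbitrary parametrization proper
and free of base points. The lines of the new family then fill a closed set, and the surface equals
their union without a further closure. -/
theorem exists_scroll {p q : Fin 4 → Polynomial ℂ} {R : Set P3} (h : IsRuledParametrization p q R) :
    ∃ T : Scroll, (∀ v (hv : v ≠ 0), Projectivization.mk ℂ v hv ∈ R ↔ T.On v) ∧
      (∀ s, wed (evalVec p s) (evalVec q s) ≠ 0 → ∃ u, u ≠ 0 ∧ ∃ c : ℂ, c ≠ 0 ∧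
        wed (evalVec p s) (evalVec q s) = c • T.pl u) ∧
      ∀ᶠ u in gen (Fin 2), ∃ s, ∃ c : ℂ, c ≠ 0 ∧
        wed (evalVec p s) (evalVec q s) = c • T.pl u := by
  obtain ⟨hreg, hR⟩ := h
  obtain ⟨s₀, hs₀⟩ := exists_pf_derivative_ne_zero hreg
  set x := wedPoly p q with hx
  let m := ∑ i, (x i).natDegree
  have hm : ∀ i, (x i).natDegree ≤ m := fun i =>
    Finset.single_le_sum (f := fun i => (x i).natDegree) (fun _ _ => Nat.zero_le _) (Finset.mem_univ i)
  let f : Fin 6 → MvPolynomial (Fin 2) ℂ := fun i => (x i).homogenize m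
  have hf : ∀ i, (f i).IsHomogeneous m := fun i => Polynomial.isHomogeneous_homogenize _
  have hfs : ∀ i s, eval ![s, 1] (f i) = (x i).eval s := by
    intro i s
    have := Polynomial.aeval_homogenize_of_eq_one (hm i) ![s, 1] (by simp)
    simpa [aeval_eq_eval] using this
  have hxs : ∀ s, (fun i => (x i).eval s) = wed (evalVec p s) (evalVec q s) := eval_wedPoly p q
  -- If all the Plücker vectors were proportional to one of them, the derivative would be as well,
  -- and its Pfaffian would vanish.
  have hnc : ∃ u t i j, eval u (f i) * eval t (f j) ≠ eval u (f j) * eval t (f i) := by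
    by_contra! h0
    apply hs₀
    by_cases h1 : ∀ t i, (x i).eval t = 0
    · have : ∀ i, x i = 0 := fun i => Polynomial.funext fun s => by simp [h1]
      simp [this, pf]
    · push Not at h1
      obtain ⟨t, i₀, ht⟩ := h1
      have h2 : ∀ i j, x i * Polynomial.C ((x j).eval t) = x j * Polynomial.C ((x i).eval t) := by
        intro i j
        refine Polynomial.funext fun s => ?_
        have := h0 ![s, 1] ![t, 1] i j
        simpa [hfs] using this
      obtain ⟨c, hc⟩ := exists_smul_of_cross (x := fun i => (x i).derivative.eval s₀)
        (y := fun i => (x i).eval t) (Function.ne_iff.2 ⟨i₀, ht⟩) (fun i j => by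
          have := congrArg (fun P => (Polynomial.derivative P).eval s₀) (h2 i j)
          simpa [Polynomial.derivative_mul] using this)
      rw [hc, pf_smul, hxs, pf_wed, mul_zero]
  obtain ⟨d, e, k, g, A, B, Φ, Ψ, he, hg, hbpf, hA, hB, hAB, hfg, hΦ, hΨ, hΨ0, hinv⟩ :=
    exists_luroth hf hnc
  have hABne : ∀ u, u ≠ 0 → ![eval u A, eval u B] ≠ 0 := by
    intro u hu h0
    rcases hAB u hu with h1 | h1
    · exact h1 (congrFun h0 0)
    · exact h1 (congrFun h0 1)
  have hev0 : ∀ u, u ≠ 0 → ev g u ≠ 0 := fun u hu h0 => by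
    obtain ⟨i, hi⟩ := hbpf u hu
    exact hi (congrFun h0 i)
  have hs1 : ∀ s : ℂ, ![s, 1] ≠ (0 : Fin 2 → ℂ) := fun s h0 => by simpa using congrFun h0 1
  have hline : ∀ s, wed (evalVec p s) (evalVec q s) ≠ 0 → ∃ c : ℂ, c ≠ 0 ∧
      wed (evalVec p s) (evalVec q s) = c • ev g ![eval ![s, 1] A, eval ![s, 1] B] := by
    intro s hs
    obtain ⟨c, hc⟩ := exists_smul_of_cross (x := wed (evalVec p s) (evalVec q s))
      (hev0 _ (hABne _ (hs1 s))) (fun i j => by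
        have := hfg ![s, 1] i j
        rw [hfs, hfs] at this
        rw [← hxs]
        exact this)
    refine ⟨c, ?_, hc⟩
    rintro rfl
    exact hs (by simpa using hc)
  obtain ⟨j, hj⟩ : ∃ j, f j ≠ 0 := by
    by_contra! h0
    obtain ⟨u, t, i, j, hne⟩ := hnc
    exact hne (by simp [h0])
  -- The pair `(A, B)` is onto. The lines `u` to be avoided are the images of the parameters at
  -- infinity or with vanishing coordinate `f j`, which are finitely many.
  have hgen : ∀ᶠ u in gen (Fin 2), ∃ s, ∃ c : ℂ, c ≠ 0 ∧
      wed (evalVec p s) (evalVec q s) = c • ev g u := by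
    have h1 : ((X 1 : MvPolynomial (Fin 2) ℂ) * f j).IsHomogeneous (1 + m) :=
      (isHomogeneous_X _ _).mul (hf j)
    have h2 := eventually_forall_zero (l := gen (Fin 2)) h1
      (mul_ne_zero (X_ne_zero 1) hj)
      (Q := fun t u => eval t A * u 1 - eval t B * u 0 ≠ 0) (fun c t u hc h => by
        rw [eval_smul_form hA, eval_smul_form hB]
        have := mul_ne_zero (pow_ne_zero e hc) h
        intro h'
        apply this
        linear_combination h') (fun t ht _ => by
        rcases hAB t ht with h | h
        · exact Pol.eventually_ne (f := fun u : Fin 2 → ℂ => eval t A * u 1 - eval t B * u 0)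
            (by fun_prop) (v := ![0, 1]) (by simpa using h)
        · exact Pol.eventually_ne (f := fun u : Fin 2 → ℂ => eval t A * u 1 - eval t B * u 0)
            (by fun_prop) (v := ![1, 0]) (by simpa using h))
    filter_upwards [h2, (Pol.coord (0 : Fin 2)).eventually_ne (v := 1) (by simp)] with u hu hu0
    have hψ : (C (u 1) * A - C (u 0) * B).IsHomogeneous e :=
      (by simpa using (isHomogeneous_C _ (u 1)).mul hA : (C (u 1) * A).IsHomogeneous e).sub
        (by simpa using (isHomogeneous_C _ (u 0)).mul hB)
    obtain ⟨t, ht, htz⟩ := exists_zero hψ he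
    have htz' : eval t A * u 1 - eval t B * u 0 = 0 := by
      rw [← htz]; simp [mul_comm]
    have h3 : eval t (X 1 * f j) ≠ 0 := fun h => hu t ht h htz'
    rw [map_mul, eval_X] at h3
    have ht1 := left_ne_zero_of_mul h3
    have hts : t = t 1 • ![t 0 / t 1, 1] := by
      ext i; fin_cases i <;> simp; field_simp
    set s := t 0 / t 1 with hs
    have h4 : wed (evalVec p s) (evalVec q s) ≠ 0 := by
      intro h0
      rw [← hxs] at h0
      apply right_ne_zero_of_mul h3
      rw [hts, eval_smul_form (hf j), hfs]
      have : (x j).eval s = 0 := congrFun h0 j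
      rw [this, mul_zero]
    obtain ⟨c, hc, h5⟩ := hline s h4
    rw [hts, eval_smul_form hA, eval_smul_form hB] at htz'
    obtain ⟨c', hc'⟩ := exists_smul_of_wedge (u := ![eval ![s, 1] A, eval ![s, 1] B]) (v := u)
      (by rintro rfl; simp at hu0) (by
        simp only [wedge, Matrix.cons_val_zero, Matrix.cons_val_one]
        refine (mul_eq_zero.1 (?_ : t 1 ^ e * _ = 0)).resolve_left (pow_ne_zero _ ht1)
        linear_combination htz')
    have hc'0 : c' ≠ 0 := by
      rintro rfl
      exact hABne _ (hs1 s) (by simpa using hc')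
    refine ⟨s, c * c' ^ d, mul_ne_zero hc (pow_ne_zero _ hc'0), ?_⟩
    rw [h5, hc', ev_smul hg, smul_smul]
  have hpf : ∀ u, pf (ev g u) = 0 := by
    refine Pol.eq_zero (Pol.pf fun i => Pol.ev g i) ?_
    filter_upwards [hgen] with u ⟨s, c, hc, h1⟩
    have := pf_wed (evalVec p s) (evalVec q s)
    rw [h1, pf_smul] at this
    simpa [hc] using this
  have hnd : ∃ u w, pf (dv g u w) ≠ 0 := by
    by_contra! h0
    apply hs₀
    let A0 : Polynomial ℂ := aeval ![Polynomial.X, 1] A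
    let B0 : Polynomial ℂ := aeval ![Polynomial.X, 1] B
    have hA0 : ∀ (F : MvPolynomial (Fin 2) ℂ) s,
        (aeval ![Polynomial.X, 1] F : Polynomial ℂ).eval s = eval ![s, 1] F := by
      intro F s
      rw [eval_aeval_path]
      congr 2
      ext l; fin_cases l <;> simp
    let y : Fin 6 → Polynomial ℂ := fun i => aeval ![A0, B0] (g i)
    let u₀ : Fin 2 → ℂ := ![eval ![s₀, 1] A, eval ![s₀, 1] B]
    have hvec : ∀ s, (fun i => Polynomial.eval s (![A0, B0] i)) = ![eval ![s, 1] A, eval ![s, 1] B] := by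
      intro s
      ext l; fin_cases l
      · exact hA0 A s
      · exact hA0 B s
    have hys : ∀ s i, (y i).eval s = eval ![eval ![s, 1] A, eval ![s, 1] B] (g i) := by
      intro s i
      rw [eval_aeval_path, hvec]
    have hyd : ∀ i, (y i).derivative.eval s₀ =
        dv g u₀ ![A0.derivative.eval s₀, B0.derivative.eval s₀] i := by
      intro i
      rw [derivative_aeval, Polynomial.eval_finsetSum]
      simp only [dv]
      rw [eval_D]
      refine Finset.sum_congr rfl fun l _ => ?_
      rw [Polynomial.eval_mul, eval_aeval_path, hvec]
      congr 1
      fin_cases l <;> rfl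
    have hcross : ∀ i j, x i * y j = x j * y i := by
      intro i j
      refine Polynomial.funext fun s => ?_
      rw [Polynomial.eval_mul, Polynomial.eval_mul, hys, hys, ← hfs, ← hfs]
      exact hfg _ i j
    obtain ⟨j, hj⟩ := Function.ne_iff.1 (hev0 u₀ (hABne _ (hs1 s₀)))
    have hj1 : (y j).eval s₀ ≠ 0 := by rw [hys]; exact hj
    set Y := ev g u₀ with hY
    set Y' := dv g u₀ ![A0.derivative.eval s₀, B0.derivative.eval s₀] with hY'
    have hYe : ∀ i, (y i).eval s₀ = Y i := fun i => hys s₀ i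
    -- The vectors `x` and `y` are proportional along the curve, so the derivative of `x` is a
    -- combination of `Y` and `Y'`. If the Pfaffian of `Y'` vanished, it would vanish on all such
    -- combinations.
    have hkey : Y j ^ 2 • (fun i => (x i).derivative.eval s₀) =
        (Y j * (x j).derivative.eval s₀ - Y' j * (x j).eval s₀) • Y + (Y j * (x j).eval s₀) • Y' := by
      ext i
      have e1 := congrArg (Polynomial.eval s₀) (hcross i j)
      have e2 := congrArg (fun P => (Polynomial.derivative P).eval s₀) (hcross i j)
      simp only [Polynomial.derivative_mul, Polynomial.eval_add, Polynomial.eval_mul, hyd, hYe]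
        at e1 e2
      simp only [Pi.smul_apply, Pi.add_apply, smul_eq_mul]
      linear_combination Y j * e2 - Y' j * e1
    have h1 : ∀ (a b : ℂ), pf (a • Y + b • Y') = 0 := by
      intro a b
      have e1 : pf (a • Y + b • Y') = a ^ 2 * pf Y + a * b * pair Y Y' + b ^ 2 * pf Y' := by
        simp [pf, pair]; ring
      rw [e1, hY, hY', hpf, h0, pair_ev_dv hpf]
      ring
    have h2 := h1 (Y j * (x j).derivative.eval s₀ - Y' j * (x j).eval s₀) (Y j * (x j).eval s₀)
    rw [← hkey, pf_smul, mul_eq_zero] at h2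
    rw [hYe] at hj1
    exact h2.resolve_left (by simpa using hj1)
  have hprop : ∀ᶠ u in gen (Fin 2), ∀ t, t ≠ 0 → (∃ c : ℂ, ev g t = c • ev g u) →
      wedge t u = 0 := by
    obtain ⟨v, hv⟩ := hΨ0
    have hp : Pol fun u => eval (fun i => eval u (g i)) Ψ :=
      Pol.evalComp Ψ fun i => ⟨g i, fun _ => rfl⟩
    filter_upwards [hp.eventually_ne hv] with u hu t ht ⟨c, hc⟩
    have hc0 : c ≠ 0 := by
      rintro rfl
      exact hev0 t ht (by simpa using hc)
    have e1 : (fun i => eval t (g i)) = c • fun i => eval u (g i) := hc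
    have e2 := hinv t
    rw [e1, eval_smul_form hΨ, eval_smul_form hΦ] at e2
    have e3 := hinv u
    refine (mul_eq_zero.1 (?_ : (c ^ k * eval (fun i => eval u (g i)) Ψ) * _ = 0)).resolve_left
      (mul_ne_zero (pow_ne_zero _ hc0) hu)
    simp only [wedge]
    linear_combination u 1 * e2 - t 1 * c ^ k * e3
  let T : Scroll := ⟨d, g, hg, hbpf, hpf, hnd, hprop⟩
  refine ⟨T, fun v hv => ?_, fun s hs => ?_, hgen⟩
  · rw [hR]
    constructor
    · intro hvR
      by_contra hon
      obtain ⟨D, H, hH, hHT, hHv⟩ := T.exists_separating hon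
      refine hHv ((mk_mem_closure hv).1 hvR D H hH ?_)
      rw [vanishesOn_iff hH]
      intro y hy hyr
      obtain ⟨s, hyr⟩ := Set.mem_iUnion.1 hyr
      rw [mem_ruling_iff, Submodule.mem_span_pair] at hyr
      obtain ⟨a, b, rfl⟩ := hyr
      let P : Polynomial ℂ := aeval (fun i => Polynomial.C a * p i + Polynomial.C b * q i) H
      have hP : ∀ s, P.eval s = eval (a • evalVec p s + b • evalVec q s) H := by
        intro s
        rw [eval_aeval_path]
        congr 2
        ext i; simp [evalVec]
      -- Where `p` and `q` become dependent, the points of `ruling p q s` need not come from a known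
      -- line of the family. They are limits of points on genuine rulings, and multiplication by `x
      -- j` removes the exceptional parameters.
      have hP0 : P * x j = 0 := by
        refine Polynomial.funext fun s => ?_
        rw [Polynomial.eval_mul, Polynomial.eval_zero, mul_eq_zero]
        by_cases hs : wed (evalVec p s) (evalVec q s) = 0
        · right
          rw [← hxs] at hs
          exact congrFun hs j
        · left
          rw [hP]
          apply hHT
          obtain ⟨c, hc, h1⟩ := hline s hs
          refine ⟨_, hABne _ (hs1 s), ?_⟩
          have h2 := (mem_span_of_Ns hs).2 (Submodule.mem_span_pair.2 ⟨a, b, rfl⟩)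
          rw [h1, Ns_smul_left] at h2
          exact (smul_eq_zero.1 h2).resolve_left hc
      have hxj : x j ≠ 0 := fun h0 => hj (by simp [f, h0])
      rw [← hP, (mul_eq_zero.1 hP0).resolve_right hxj, Polynomial.eval_zero]
    · rintro ⟨u₀, hu₀, hu⟩
      obtain ⟨ζ, rfl⟩ := eq_N_of_Ns (T.pl_ne_zero hu₀) hu
      rw [mk_mem_closure]
      intro D H hH hHR
      rw [vanishesOn_iff hH] at hHR
      have hpN : ∀ i, Pol fun u => N (T.pl u) ζ i := Pol.N T.pol_pl fun i => Pol.const _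
      refine Pol.eq_zero (f := fun u => eval (N (T.pl u) ζ) H) (Pol.evalComp H hpN) ?_ u₀
      obtain ⟨i, hi⟩ := Function.ne_iff.1 hv
      filter_upwards [hgen, (hpN i).eventually_ne hi] with u ⟨s, c, hc, h1⟩ hui
      have hne : N (T.pl u) ζ ≠ 0 := fun h0 => hui (congrFun h0 i)
      refine hHR _ hne (Set.mem_iUnion.2 ⟨s, (mem_ruling_iff hne).2 ?_⟩)
      have hw : wed (evalVec p s) (evalVec q s) ≠ 0 := by
        rw [h1]
        refine smul_ne_zero hc fun h0 => hne ?_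
        rw [show T.pl u = 0 from h0, N_zero_left]
      rw [← mem_span_of_Ns hw, h1]
      change Ns (c • T.pl u) _ = 0
      rw [Ns_smul_left, Ns_N_self (T.pf_pl u), smul_zero]
  · obtain ⟨c, hc, h1⟩ := hline s hs
    exact ⟨_, hABne _ (hs1 s), c, hc, h1⟩

/-! ### Generic lines through a point -/

section
open scoped Polynomial

/-- The shift `b ↦ b + μ x`. -/
noncomputable def shift (x : Fin 4 → ℂ) : (MvPolynomial (Fin 4) ℂ)[X] →+* (MvPolynomial (Fin 4) ℂ)[X] :=
  Polynomial.eval₂RingHom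
    (aeval (R := ℂ) fun i => Polynomial.C (MvPolynomial.X i) + Polynomial.X * Polynomial.C (C (x i)) :
      MvPolynomial (Fin 4) ℂ →ₐ[ℂ] (MvPolynomial (Fin 4) ℂ)[X]).toRingHom Polynomial.X

theorem shift_X (x : Fin 4 → ℂ) : shift x Polynomial.X = Polynomial.X := by simp [shift]

theorem shift_C_C (x : Fin 4 → ℂ) (c : ℂ) :
    shift x (Polynomial.C (C c)) = Polynomial.C (C c) := by
  simp only [shift, Polynomial.coe_eval₂RingHom, Polynomial.eval₂_C]
  change aeval _ (C c) = _
  rw [aeval_C]; rfl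

theorem shift_C_X (x : Fin 4 → ℂ) (i : Fin 4) :
    shift x (Polynomial.C (X i)) =
      Polynomial.C (MvPolynomial.X i) + Polynomial.X * Polynomial.C (C (x i)) := by
  simp only [shift, Polynomial.coe_eval₂RingHom, Polynomial.eval₂_C]
  change aeval _ (X i) = _
  rw [aeval_X]

theorem shift_comp (x : Fin 4 → ℂ) : (shift (-x)).comp (shift x) = RingHom.id _ := by
  refine Polynomial.ringHom_ext' (MvPolynomial.ringHom_ext (fun c => ?_) fun i => ?_) ?_
  · change shift (-x) (shift x (Polynomial.C (C c))) = Polynomial.C (C c)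
    rw [shift_C_C, shift_C_C]
  · change shift (-x) (shift x (Polynomial.C (X i))) = Polynomial.C (X i)
    rw [shift_C_X, map_add, map_mul, shift_C_X, shift_X, shift_C_C]
    simp
    ring
  · change shift (-x) (shift x Polynomial.X) = Polynomial.X
    rw [shift_X, shift_X]

/-- The shift as an automorphism. -/
noncomputable def shiftEquiv (x : Fin 4 → ℂ) :
    (MvPolynomial (Fin 4) ℂ)[X] ≃+* (MvPolynomial (Fin 4) ℂ)[X] :=
  RingEquiv.ofRingHom (shift x) (shift (-x)) (by simpa using shift_comp (-x)) (shift_comp x)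

theorem eval_shift (x b : Fin 4 → ℂ) (μ : ℂ) (F : MvPolynomial (Fin 4) ℂ) :
    ((shift x (Polynomial.C F)).map (eval b)).eval μ = eval (b + μ • x) F := by
  induction F using MvPolynomial.induction_on with
  | C a => rw [shift_C_C]; simp
  | add p q hp hq => rw [map_add, map_add, Polynomial.map_add, Polynomial.eval_add, hp, hq, map_add]
  | mul_X p n hp =>
    rw [map_mul, map_mul, Polynomial.map_mul, Polynomial.eval_mul, hp, map_mul, shift_C_X]
    simp [mul_comm μ]

theorem derivative_shift (x : Fin 4 → ℂ) (F : MvPolynomial (Fin 4) ℂ) :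
    (shift x (Polynomial.C F)).derivative = shift x (Polynomial.C (D x F)) := by
  induction F using MvPolynomial.induction_on with
  | C a => rw [shift_C_C, D_C]; simp
  | add p q hp hq => simp only [map_add, hp, hq]
  | mul_X p n hp =>
    simp only [map_mul, Polynomial.derivative_mul, hp, D_mul, map_add, D_X, shift_C_X, shift_C_C]
    simp
    ring

/-- A generic line through `x` meets an irreducible surface transversally outside `x`. -/
theorem eventually_simple_roots {F : MvPolynomial (Fin 4) ℂ} (hF : Irreducible F) {x : Fin 4 → ℂ}
    (hx : D x F ≠ 0) :
    ∀ᶠ b in gen (Fin 4), ∀ μ : ℂ, eval (b + μ • x) F = 0 → eval (b + μ • x) (D x F) ≠ 0 := by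
  set P := shift x (Polynomial.C F) with hP
  -- The substitution `b ↦ b + μ x` is an automorphism of the polynomial ring in `b` and `μ`. By
  -- Gauss's lemma `P` stays irreducible over the field of fractions in `b`, hence separable in `μ`,
  -- as the characteristic is zero.
  have hirr : Irreducible P := by
    have h1 : Irreducible (Polynomial.C F : (MvPolynomial (Fin 4) ℂ)[X]) :=
      (Polynomial.prime_C_iff.2 hF.prime).irreducible
    exact (MulEquiv.irreducible_iff (shiftEquiv x).toMulEquiv).2 h1
  have hd : P.derivative ≠ 0 := by
    rw [hP, derivative_shift]
    exact (map_ne_zero_iff _ (shiftEquiv x).injective).2 (by simpa using hx)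
  have hdeg : P.natDegree ≠ 0 := fun h => hd (Polynomial.derivative_of_natDegree_zero h)
  have hprim : P.IsPrimitive := hirr.isPrimitive hdeg
  let K := FractionRing (MvPolynomial (Fin 4) ℂ)
  have hK : Irreducible (P.map (algebraMap (MvPolynomial (Fin 4) ℂ) K)) :=
    hprim.irreducible_iff_irreducible_map_fraction_map.1 hirr
  have hcz : CharZero K := charZero_of_injective_algebraMap
    (R := MvPolynomial (Fin 4) ℂ) (IsFractionRing.injective _ _)
  have hsep : (P.map (algebraMap (MvPolynomial (Fin 4) ℂ) K)).Separable := hK.separable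
  have hr := Polynomial.resultant_ne_zero _ _ hsep
  rw [Polynomial.derivative_map, Polynomial.natDegree_map_eq_of_injective (IsFractionRing.injective _ _),
    Polynomial.natDegree_map_eq_of_injective (IsFractionRing.injective _ _),
    Polynomial.resultant_map_map] at hr
  have hr' : P.resultant P.derivative P.natDegree P.derivative.natDegree ≠ 0 := by
    intro h0
    exact hr (by rw [h0, map_zero])
  -- The resultant is a combination of `P` and its derivative, so a multiple root on the line
  -- through `b` would make it vanish at `b`.
  obtain ⟨p, q, -, -, H⟩ := Polynomial.exists_mul_add_mul_eq_C_resultant P P.derivative le_rfl le_rfl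
    (Or.inl hdeg)
  refine eventually_gen.2 ⟨_, hr', fun b hb μ h0 h1 => hb ?_⟩
  have H1 := congrArg (fun Q => (Q.map (eval b)).eval μ) H
  simp only [Polynomial.map_add, Polynomial.map_mul, Polynomial.eval_add, Polynomial.eval_mul,
    Polynomial.map_C, Polynomial.eval_C] at H1
  rw [← H1, hP, derivative_shift, eval_shift, eval_shift, h0, h1]
  ring

end

/-- Forms with a vanishing Wronskian are proportional. -/
theorem cross_of_wronskian {f g : MvPolynomial (Fin 2) ℂ} {d : ℕ} (hf : f.IsHomogeneous d)
    (hg : g.IsHomogeneous d) (h : ∀ w, f * D w g - g * D w f = 0) (s t : Fin 2 → ℂ) :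
    eval s f * eval t g = eval t f * eval s g := by
  by_cases hf0 : f = 0
  · simp [hf0]
  obtain ⟨m, e, c, g', -, hc, -, hg', hgg, hb⟩ := exists_content (f := ![f, g]) (d := d)
    (by intro i; fin_cases i; exacts [hf, hg]) ⟨0, hf0⟩
  have e0 : f = c * g' 0 := hgg 0
  have e1 : g = c * g' 1 := hgg 1
  have hg0 : g' 0 ≠ 0 := fun h0 => hf0 (by rw [e0, h0, mul_zero])
  -- After removal of the common factor the Wronskian is still zero, which is possible only for
  -- constants.
  have he : e = 0 := by
    by_contra he
    obtain ⟨w, hw⟩ := wronskian_ne_zero he (hg' 0) hg0 (g := g' 1) (fun u hu h0 h1 => by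
      obtain ⟨i, hi⟩ := hb u hu
      fin_cases i
      · exact hi h0
      · exact hi h1)
    apply mul_ne_zero (mul_ne_zero hc hc) hw
    rw [← h w, e0, e1, D_mul, D_mul]
    ring
  subst he
  have k0 := form_degree_zero (hg' 0) s t
  have k1 := form_degree_zero (hg' 1) s t
  rw [e0, e1]
  simp only [map_mul]
  rw [k0, k1]
  ring

theorem cross_of_wronskian_eval {f g : MvPolynomial (Fin 2) ℂ} {d : ℕ} (hf : f.IsHomogeneous d)
    (hg : g.IsHomogeneous d)
    (h : ∀ w, ∀ᶠ u in gen (Fin 2), eval u f * eval u (D w g) = eval u g * eval u (D w f))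
    (s t : Fin 2 → ℂ) : eval s f * eval t g = eval t f * eval s g := by
  refine cross_of_wronskian hf hg (fun w => MvPolynomial.funext fun u => ?_) s t
  rw [map_zero]
  refine Pol.eq_zero (f := fun u => eval u (f * D w g - g * D w f)) ⟨_, fun _ => rfl⟩ ?_ u
  filter_upwards [h w] with u hu
  simp [hu]

/-! ### Geometry of a family of lines -/

theorem eval_D_eq_dt (F : MvPolynomial (Fin 4) ℂ) (x v : Fin 4 → ℂ) :
    eval x (D v F) = dt v (fun i => eval x (pderiv i F)) := by
  rw [eval_D, Fin.sum_univ_four]; rfl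

theorem eq_zero_of_dt {g : Fin 4 → ℂ} (h : ∀ v, dt v g = 0) : g = 0 := by
  by_contra h0
  obtain ⟨w, hw⟩ := exists_dt_ne_zero h0
  exact hw (by rw [dt_comm]; exact h w)

/-- Vectors with a common polynomial annihilator along a path are annihilated to first order. -/
theorem eval_D_eq_zero_of_path {F : MvPolynomial (Fin 4) ℂ} {γ : Fin 4 → Polynomial ℂ}
    (h : ∀ s, eval (fun i => (γ i).eval s) F = 0) (s : ℂ) :
    eval (fun i => (γ i).eval s) (D (fun i => (γ i).derivative.eval s) F) = 0 := by
  have h0 : aeval γ F = 0 := Polynomial.funext fun s => by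
    rw [eval_aeval_path, h, Polynomial.eval_zero]
  have h1 := derivative_aeval γ F
  rw [h0, Polynomial.derivative_zero] at h1
  have h2 := congrArg (Polynomial.eval s) h1
  rw [Polynomial.eval_zero, Polynomial.eval_finsetSum] at h2
  rw [eval_D, h2]
  refine Finset.sum_congr rfl fun i _ => ?_
  rw [Polynomial.eval_mul, eval_aeval_path]

namespace Scroll
variable (T : Scroll)

theorem N_pl_Ns_der (u w : Fin 2 → ℂ) (z : Fin 4 → ℂ) :
    N (T.pl u) (Ns (T.der u w) z) = - N (T.der u w) (Ns (T.pl u) z) := by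
  have := N_Ns_add (T.pl u) (T.der u w) z
  rw [T.pair_pl_der, neg_zero, zero_smul] at this
  exact eq_neg_of_add_eq_zero_left this

theorem Ns_pl_N_der (u w : Fin 2 → ℂ) (z : Fin 4 → ℂ) :
    Ns (T.pl u) (N (T.der u w) z) = - Ns (T.der u w) (N (T.pl u) z) := by
  have := Ns_N_add (T.pl u) (T.der u w) z
  rw [T.pair_pl_der, neg_zero, zero_smul] at this
  exact eq_neg_of_add_eq_zero_left this

theorem On_zero : T.On 0 := ⟨![1, 0], by simp, Ns_zero_right _⟩

/-- The polynomials vanishing on the surface. -/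
def Vanishes (F : MvPolynomial (Fin 4) ℂ) : Prop := ∀ v, T.On v → eval v F = 0

variable {T} {F : MvPolynomial (Fin 4) ℂ}

theorem Vanishes.eval_D_line (hF : T.Vanishes F) {u : Fin 2 → ℂ} (hu : u ≠ 0) {x y : Fin 4 → ℂ}
    (hx : Ns (T.pl u) x = 0) (hy : Ns (T.pl u) y = 0) : eval x (D y F) = 0 := by
  have := eval_D_eq_zero_of_path (F := F)
    (γ := fun i => Polynomial.C (x i) + Polynomial.X * Polynomial.C (y i)) (fun s => hF _ ⟨u, hu, by
      have : (fun i => Polynomial.eval s (Polynomial.C (x i) + Polynomial.X * Polynomial.C (y i))) =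
        x + s • y := by ext i; simp only [Polynomial.eval_add, Polynomial.eval_mul, Polynomial.eval_C, Polynomial.eval_X]; rfl
      rw [this, Ns_add_right, Ns_smul_right, hx, hy, smul_zero, add_zero]⟩) 0
  simpa using this

/-- The curve `s ↦ N (pl (u + s w)) ζ` remains on the surface, with velocity `N (der u w) ζ` at the
start. -/
theorem Vanishes.eval_D_der (hF : T.Vanishes F) (u w : Fin 2 → ℂ)
    (ζ : Fin 4 → ℂ) : eval (N (T.pl u) ζ) (D (N (T.der u w) ζ) F) = 0 := by
  let q : Fin 6 → Polynomial ℂ := fun i => chart u w (T.form i)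
  let γ : Fin 4 → Polynomial ℂ := fun i => ∑ j, q j * Polynomial.C (N (Pi.single j 1) ζ i)
  have hN : ∀ (x : Fin 6 → ℂ) i, N x ζ i = ∑ j, x j * N (Pi.single j 1) ζ i := by
    intro x i
    rw [Fin.sum_univ_six]
    fin_cases i <;> simp [N] <;> ring
  have hγ : ∀ s, (fun i => (γ i).eval s) = N (T.pl (u + s • w)) ζ := by
    intro s
    ext i
    rw [hN]
    simp only [γ, Polynomial.eval_finsetSum, Polynomial.eval_mul, Polynomial.eval_C, q, eval_chart]
    rfl
  have hγ' : (fun i => (γ i).derivative.eval 0) = N (T.der u w) ζ := by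
    ext i
    rw [hN]
    simp only [γ, Polynomial.derivative_sum, Polynomial.eval_finsetSum, Polynomial.derivative_mul,
      Polynomial.derivative_C, mul_zero, add_zero, Polynomial.eval_mul, Polynomial.eval_C, q,
      derivative_chart, eval_chart, zero_smul]
    rfl
  have h := eval_D_eq_zero_of_path (F := F) (γ := γ) (fun s => by
    rw [hγ]
    by_cases h0 : u + s • w = 0
    · rw [h0]
      have : T.pl 0 = 0 := by
        have := T.pl_smul 0 0
        rwa [smul_zero, zero_pow T.degree_ne_zero, zero_smul] at this
      rw [this, N_zero_left]
      exact hF _ T.On_zero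
    · exact hF _ ⟨_, h0, Ns_N_self (T.pf_pl _) _⟩) 0
  rw [hγ, hγ'] at h
  simpa using h

/-- The tangent plane along a ruling. -/
theorem Vanishes.exists_grad (hF : T.Vanishes F) {u w : Fin 2 → ℂ} (hu : u ≠ 0) {x : Fin 4 → ℂ}
    (hx : Ns (T.pl u) x = 0) (hw : Ns (T.der u w) x ≠ 0) :
    ∃ c : ℂ, ∀ v, eval x (D v F) = c * dt v (Ns (T.der u w) x) := by
  set g : Fin 4 → ℂ := fun i => eval x (pderiv i F) with hg
  obtain ⟨ζ, rfl⟩ := eq_N_of_Ns (T.pl_ne_zero hu) hx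
  -- The gradient, as a plane, contains the ruling, so it is `Ns (pl u) θ`; by `h2` it also contains
  -- the velocity `N (der u w) ζ`. The only such plane is `Ns (der u w) x`.
  have h1 : N (T.pl u) g = 0 := by
    refine eq_zero_of_dt fun v => ?_
    rw [dt_N, neg_eq_zero, dt_comm, hg, ← eval_D_eq_dt]
    exact hF.eval_D_line hu hx (Ns_N_self (T.pf_pl u) v)
  obtain ⟨θ, hθ⟩ := eq_Ns_of_N (T.pl_ne_zero hu) h1
  have h2 := hF.eval_D_der u w ζ
  rw [eval_D_eq_dt, ← hg, hθ, dt_Ns, neg_eq_zero] at h2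
  have h3 := Ns_pl_N_der T u w ζ
  obtain ⟨c, hc⟩ := exists_smul_Ns (T.pf_pl u) h2 (by rw [h3]; simpa using hw)
  refine ⟨-c, fun v => ?_⟩
  rw [eval_D_eq_dt, ← hg, hθ, hc, h3, dt_smul_right, ← neg_one_smul ℂ, dt_smul_right]
  ring

end Scroll

/-- Two different lines have at most one common point. -/
theorem exists_smul_of_common {x y : Fin 6 → ℂ} (hx : pf x = 0) (hy : pf y = 0) (hx0 : x ≠ 0)
    (hy0 : y ≠ 0) (hxy : ∀ c : ℂ, x ≠ c • y) {p q : Fin 4 → ℂ} (hq : q ≠ 0) (h1 : Ns x p = 0)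
    (h2 : Ns x q = 0) (h3 : Ns y p = 0) (h4 : Ns y q = 0) : ∃ c : ℂ, p = c • q := by
  by_contra h
  rw [← wed_eq_zero_iff hq] at h
  have key : ∀ x : Fin 6 → ℂ, pf x = 0 → x ≠ 0 → Ns x p = 0 → Ns x q = 0 →
      ∃ c : ℂ, wed p q = c • x := by
    intro x hx hx0 h1 h2
    refine exists_smul_of_line_le (pf_wed p q) hx hx0 fun z hz => ?_
    obtain ⟨a, b, rfl⟩ := Submodule.mem_span_pair.1 ((mem_span_of_Ns h).1 hz)
    rw [Ns_add_right, Ns_smul_right, Ns_smul_right, h1, h2]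
    simp
  obtain ⟨c, hc⟩ := key x hx hx0 h1 h2
  obtain ⟨c', hc'⟩ := key y hy hy0 h3 h4
  have hc0 : c ≠ 0 := by
    rintro rfl
    exact h (by simpa using hc)
  refine hxy (c⁻¹ * c') ?_
  rw [mul_smul, ← hc', hc, smul_smul, inv_mul_cancel₀ hc0, one_smul]

namespace Scroll
variable (T : Scroll)

/-- The pairing with a fixed vector as a form. -/
noncomputable def pairForm (x : Fin 6 → ℂ) : MvPolynomial (Fin 2) ℂ :=
  C (x 0) * T.form 5 - C (x 1) * T.form 4 + C (x 2) * T.form 3 + C (x 3) * T.form 2 -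
    C (x 4) * T.form 1 + C (x 5) * T.form 0

theorem pairForm_isHomogeneous (x : Fin 6 → ℂ) : (T.pairForm x).IsHomogeneous T.degree := by
  have h : ∀ i j, (C (x i) * T.form j).IsHomogeneous T.degree := fun i j => by
    simpa using (isHomogeneous_C _ (x i)).mul (T.homogeneous j)
  exact (((((h 0 5).sub (h 1 4)).add (h 2 3)).add (h 3 2)).sub (h 4 1)).add (h 5 0)

theorem eval_pairForm (x : Fin 6 → ℂ) (t : Fin 2 → ℂ) :
    eval t (T.pairForm x) = pair x (T.pl t) := by
  simp [pairForm, pair, pl, ev]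

theorem eval_D_pairForm (x : Fin 6 → ℂ) (t w : Fin 2 → ℂ) :
    eval t (D w (T.pairForm x)) = pair x (T.der t w) := by
  simp only [pairForm, map_add, map_sub, D_mul, D_C, mul_zero, add_zero, map_mul, eval_C]
  simp [pair, der, dv]

/-- If any two rulings met, the bilinear relation could be differentiated in both arguments, and
`pair (der u w) (der u w) = 2 * pf (der u w)` would vanish identically. -/
theorem exists_pair_ne_zero : ∃ u t, pair (T.pl u) (T.pl t) ≠ 0 := by
  by_contra! h
  obtain ⟨u, w, hn⟩ := T.nondeg
  have h1 : ∀ t, T.pairForm (T.pl t) = 0 := fun t => MvPolynomial.funext fun u => by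
    rw [eval_pairForm, h, map_zero]
  have h2 : ∀ s t, pair (T.pl t) (T.der s w) = 0 := fun s t => by
    rw [← eval_D_pairForm, h1, map_zero, map_zero]
  have h3 : T.pairForm (T.der u w) = 0 := MvPolynomial.funext fun t => by
    rw [eval_pairForm, pair_comm, h2, map_zero]
  have h4 := T.eval_D_pairForm (T.der u w) u w
  rw [h3, map_zero, map_zero, pair_self] at h4
  apply hn
  change pf (T.der u w) = 0
  simpa using h4.symm

theorem eventually_pairForm_ne_zero : ∀ᶠ u in gen (Fin 2), T.pairForm (T.pl u) ≠ 0 := by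
  obtain ⟨u, t, h⟩ := T.exists_pair_ne_zero
  filter_upwards [(Pol.pair T.pol_pl fun i => Pol.const (T.pl t i)).eventually_ne h] with v hv h0
  rw [← eval_pairForm, h0, map_zero] at hv
  exact hv rfl

theorem exists_pl_not_through {x : Fin 4 → ℂ} (hx : x ≠ 0) : ∃ t, t ≠ 0 ∧ Ns (T.pl t) x ≠ 0 := by
  by_contra! h
  obtain ⟨u, t, hut⟩ := T.exists_pair_ne_zero
  have hu : u ≠ 0 := by
    rintro rfl
    apply hut
    have := T.pl_smul 0 0
    rw [smul_zero, zero_pow T.degree_ne_zero, zero_smul] at this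
    rw [this]; simp [pair]
  have ht : t ≠ 0 := by
    rintro rfl
    apply hut
    have := T.pl_smul 0 0
    rw [smul_zero, zero_pow T.degree_ne_zero, zero_smul] at this
    rw [this]; simp [pair]
  exact hut (pair_eq_zero_of_common hx (h u hu) (h t ht))

/-- By Euler's relation `der u u` is a multiple of `pl u`, which is isotropic and orthogonal to all
derivatives. So only the component of `w'` transversal to `u` matters. -/
theorem pf_der_of_wedge {u w : Fin 2 → ℂ} (hw : wedge u w ≠ 0) (w' : Fin 2 → ℂ) :
    ∃ β : ℂ, wedge u w' = β * wedge u w ∧ pf (T.der u w') = β ^ 2 * pf (T.der u w) := by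
  obtain ⟨α, β, rfl⟩ := exists_combination hw w'
  refine ⟨β, by simp [wedge]; ring, ?_⟩
  rw [der_add, der_smul, der_smul, der_self]
  have e1 : ∀ (a b : ℂ) (Y Y' : Fin 6 → ℂ),
      pf (a • Y + b • Y') = a ^ 2 * pf Y + a * b * pair Y Y' + b ^ 2 * pf Y' := by
    intro a b Y Y'; simp [pf, pair]; ring
  rw [smul_smul, e1, T.pf_pl, T.pair_pl_der]
  ring

theorem eventually_pf_der : ∀ᶠ u in gen (Fin 2), ∀ w, wedge u w ≠ 0 → pf (T.der u w) ≠ 0 := by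
  obtain ⟨u₀, w₀, h⟩ := T.nondeg
  filter_upwards [(Pol.pf (T.pol_der w₀)).eventually_ne h] with u hu w hw h0
  obtain ⟨β, -, h1⟩ := T.pf_der_of_wedge hw w₀
  exact hu (by rw [h1, h0, mul_zero])

end Scroll

/-! ### The contour curve of a family of lines -/

/-- The skew symmetric matrix with the entries `x`. -/
def skew {A : Type*} [CommRing A] (x : Fin 6 → A) : Fin 4 → Fin 4 → A :=
  ![![0, x 0, x 1, x 2], ![-x 0, 0, x 3, x 4], ![-x 1, -x 3, 0, x 5], ![-x 2, -x 4, -x 5, 0]]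

/-- The skew symmetric matrix with the dual entries. -/
def skewDual {A : Type*} [CommRing A] (x : Fin 6 → A) : Fin 4 → Fin 4 → A :=
  skew ![x 5, -x 4, x 3, x 2, -x 1, x 0]

theorem N_eq_sum (x : Fin 6 → ℂ) (z : Fin 4 → ℂ) (i : Fin 4) : N x z i = ∑ j, skew x i j * z j := by
  fin_cases i <;> simp [N, skew, Fin.sum_univ_four, sub_eq_add_neg]

theorem Ns_eq_sum (x : Fin 6 → ℂ) (z : Fin 4 → ℂ) (i : Fin 4) :
    Ns x z i = ∑ j, skewDual x i j * z j := N_eq_sum _ _ _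

theorem eval_skew (u : Fin 2 → ℂ) (f : Fin 6 → MvPolynomial (Fin 2) ℂ) (i j : Fin 4) :
    eval u (skew f i j) = skew (fun l => eval u (f l)) i j := by
  fin_cases i <;> fin_cases j <;> simp [skew]

theorem eval_skewDual (u : Fin 2 → ℂ) (f : Fin 6 → MvPolynomial (Fin 2) ℂ) (i j : Fin 4) :
    eval u (skewDual f i j) = skewDual (fun l => eval u (f l)) i j := by
  fin_cases i <;> fin_cases j <;> simp [skew, skewDual]

theorem skew_isHomogeneous {f : Fin 6 → MvPolynomial (Fin 2) ℂ} {d : ℕ}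
    (hf : ∀ i, (f i).IsHomogeneous d) (i j : Fin 4) : (skew f i j).IsHomogeneous d := by
  fin_cases i <;> fin_cases j <;>
    first
    | exact hf _
    | exact (hf _).neg
    | exact isHomogeneous_zero _ _ _

theorem skewDual_isHomogeneous {f : Fin 6 → MvPolynomial (Fin 2) ℂ} {d : ℕ}
    (hf : ∀ i, (f i).IsHomogeneous d) (i j : Fin 4) : (skewDual f i j).IsHomogeneous d := by
  refine skew_isHomogeneous (fun l => ?_) i j
  fin_cases l <;>
    first
    | exact hf _
    | exact (hf _).neg

theorem N_Ns_of_pf (x : Fin 6 → ℂ) (z : Fin 4 → ℂ) : N x (Ns x z) = (-pf x) • z := by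
  have h := N_Ns_add x x z
  rw [pair_self, ← two_smul ℂ, ← mul_neg, mul_smul] at h
  exact smul_right_injective _ (two_ne_zero (α := ℂ)) h

theorem Ns_N_of_pf (x : Fin 6 → ℂ) (z : Fin 4 → ℂ) : Ns x (N x z) = (-pf x) • z := by
  have h := Ns_N_add x x z
  rw [pair_self, ← two_smul ℂ, ← mul_neg, mul_smul] at h
  exact smul_right_injective _ (two_ne_zero (α := ℂ)) h

namespace Scroll
variable (T : Scroll)

/-- The contour map before the removal of the common factor. -/
noncomputable def contourMap (u : Fin 2 → ℂ) (a : Fin 4 → ℂ) : Fin 4 → ℂ :=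
  N (T.der u ![0, 1]) (Ns (T.der u ![1, 0]) a) - N (T.der u ![1, 0]) (Ns (T.der u ![0, 1]) a)

theorem der_eq (u w : Fin 2 → ℂ) : T.der u w = w 0 • T.der u ![1, 0] + w 1 • T.der u ![0, 1] := by
  rw [← der_smul, ← der_smul, ← der_add]
  congr 1
  ext i; fin_cases i <;> simp

/-- The contour point on the ruling `u` is its intersection with the plane `Ns (der u w) a`. Euler's
relation expresses `pl u` by the two partial derivatives; the result is the antisymmetric expression
`contourMap`, in which the auxiliary direction `w` no longer occurs. -/
theorem N_pl_Ns_der_eq (u w : Fin 2 → ℂ) (a : Fin 4 → ℂ) :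
    (2 * T.degree : ℂ) • N (T.pl u) (Ns (T.der u w) a) = (-wedge u w) • T.contourMap u a := by
  have h := T.pair_pl_der u w
  have h0 : (T.degree : ℂ) * pair (T.pl u) (T.der u w) = 0 := by rw [h, mul_zero]
  have e : (T.degree : ℂ) • T.pl u = u 0 • T.der u ![1, 0] + u 1 • T.der u ![0, 1] := by
    rw [← der_self, der_eq]
  rw [mul_smul, ← N_smul_left, contourMap, e, T.der_eq u w]
  rw [← pair_smul_left, e, T.der_eq u w] at h0
  generalize T.der u ![1, 0] = x at *
  generalize T.der u ![0, 1] = y at *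
  have h00 := N_Ns_add x x a
  have h01 := N_Ns_add x y a
  have h11 := N_Ns_add y y a
  simp only [pair_add_left, pair_add_right, pair_smul_left, pair_smul_right, pair_comm y x] at h0
  simp only [N_add_left, N_smul_left, Ns_add_left, Ns_smul_left, N_add_right, N_smul_right, wedge]
  have h1 : (-(u 0 * w 0 * pair x x + u 1 * w 1 * pair y y +
      (u 0 * w 1 + u 1 * w 0) * pair x y)) • a = 0 := by
    rw [show u 0 * w 0 * pair x x + u 1 * w 1 * pair y y +
      (u 0 * w 1 + u 1 * w 0) * pair x y = 0 by linear_combination h0, neg_zero, zero_smul]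
  linear_combination (norm := module) (u 0 * w 0) • h00 + (u 0 * w 1 + u 1 * w 0) • h01 +
    (u 1 * w 1) • h11 + h1

theorem two_degree_ne_zero : (2 * T.degree : ℂ) ≠ 0 :=
  mul_ne_zero two_ne_zero (Nat.cast_ne_zero.2 T.degree_ne_zero)

theorem contourMap_eq {u w : Fin 2 → ℂ} (hw : wedge u w ≠ 0) (a : Fin 4 → ℂ) :
    ∃ c : ℂ, c ≠ 0 ∧ T.contourMap u a = c • N (T.pl u) (Ns (T.der u w) a) := by
  refine ⟨(-wedge u w)⁻¹ * (2 * T.degree), mul_ne_zero (inv_ne_zero (neg_ne_zero.2 hw))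
    T.two_degree_ne_zero, ?_⟩
  rw [mul_smul, N_pl_Ns_der_eq, smul_smul, inv_mul_cancel₀ (neg_ne_zero.2 hw), one_smul]

/-- The entries of the contour map. -/
noncomputable def contourForm (ij : Fin 4 × Fin 4) : MvPolynomial (Fin 2) ℂ :=
  ∑ l, (skew (fun i => D ![0, 1] (T.form i)) ij.1 l * skewDual (fun i => D ![1, 0] (T.form i)) l ij.2 -
    skew (fun i => D ![1, 0] (T.form i)) ij.1 l * skewDual (fun i => D ![0, 1] (T.form i)) l ij.2)

theorem contourForm_isHomogeneous (ij : Fin 4 × Fin 4) :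
    (T.contourForm ij).IsHomogeneous ((T.degree - 1) + (T.degree - 1)) := by
  have h : ∀ (w : Fin 2 → ℂ) i, (D w (T.form i)).IsHomogeneous (T.degree - 1) := fun w i =>
    D_isHomogeneous (T.homogeneous i) w
  exact IsHomogeneous.sum _ _ _ fun l _ =>
    ((skew_isHomogeneous (h _) _ _).mul (skewDual_isHomogeneous (h _) _ _)).sub
      ((skew_isHomogeneous (h _) _ _).mul (skewDual_isHomogeneous (h _) _ _))

theorem contourMap_apply (u : Fin 2 → ℂ) (a : Fin 4 → ℂ) (i : Fin 4) :
    T.contourMap u a i = ∑ j, eval u (T.contourForm (i, j)) * a j := by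
  have h : ∀ w, (fun l => eval u (D w (T.form l))) = T.der u w := fun w => rfl
  have e : ∀ j, eval u (T.contourForm (i, j)) =
      ∑ l, (skew (T.der u ![0, 1]) i l * skewDual (T.der u ![1, 0]) l j -
        skew (T.der u ![1, 0]) i l * skewDual (T.der u ![0, 1]) l j) := by
    intro j
    simp only [contourForm, map_sum, map_sub, map_mul, eval_skew, eval_skewDual, h]
  simp only [contourMap, Pi.sub_apply, N_eq_sum, Ns_eq_sum, e]
  generalize skew (T.der u ![0, 1]) = A, skew (T.der u ![1, 0]) = A',
    skewDual (T.der u ![0, 1]) = B, skewDual (T.der u ![1, 0]) = B'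
  simp only [Finset.mul_sum, Finset.sum_mul, sub_mul, Finset.sum_sub_distrib, mul_assoc]
  congr 1
  · exact Finset.sum_comm
  · exact Finset.sum_comm

/-- Up to a factor the map sends `a` to `N (der u w) (Ns (pl u) a)`, and `N (der u w)` is invertible
when its Pfaffian is not zero. -/
theorem contourMap_ne_zero {u w : Fin 2 → ℂ} (hw : wedge u w ≠ 0) (hp : pf (T.der u w) ≠ 0)
    {a : Fin 4 → ℂ} (h : T.contourMap u a = 0) : Ns (T.pl u) a = 0 := by
  obtain ⟨c, hc, h1⟩ := T.contourMap_eq hw a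
  rw [h1, smul_eq_zero, or_iff_right hc, N_pl_Ns_der, neg_eq_zero] at h
  have h2 := Ns_N_of_pf (T.der u w) (Ns (T.pl u) a)
  rw [h, Ns_zero_right, eq_comm, smul_eq_zero] at h2
  exact h2.resolve_left (neg_ne_zero.2 hp)

theorem exists_contourForm_ne_zero : ∃ ij, T.contourForm ij ≠ 0 := by
  by_contra! h
  obtain ⟨u, hu, h0⟩ := (T.eventually_pf_der.and
    ((Pol.coord (0 : Fin 2)).eventually_ne (v := 1) (by simp))).exists
  have hu0 : u ≠ 0 := by rintro rfl; simp at h0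
  obtain ⟨w, hw⟩ := exists_wedge_ne_zero hu0
  obtain ⟨a, ha⟩ := exists_Ns_ne_zero (T.pl_ne_zero hu0)
  exact ha (T.contourMap_ne_zero hw (hu w hw) (funext fun i => by
    simp [contourMap_apply, h]))

/-- The common factor is taken from the whole matrix and not from the curve of a single viewpoint,
so the reduced map `cv` remains linear in the viewpoint. -/
theorem exists_reduced : ∃ (m e : ℕ) (h : MvPolynomial (Fin 2) ℂ)
    (g : Fin 4 × Fin 4 → MvPolynomial (Fin 2) ℂ), h ≠ 0 ∧
      h.IsHomogeneous m ∧ (∀ i, (g i).IsHomogeneous e) ∧ (∀ i, T.contourForm i = h * g i) ∧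
      ∀ u, u ≠ 0 → ∃ i, eval u (g i) ≠ 0 := by
  obtain ⟨m, e, h, g, -, H⟩ := exists_content T.contourForm_isHomogeneous T.exists_contourForm_ne_zero
  exact ⟨m, e, h, g, H⟩

/-- The degree of the contour curves. -/
noncomputable def cdeg : ℕ := T.exists_reduced.choose_spec.choose

/-- The common factor of the contour map. -/
noncomputable def h : MvPolynomial (Fin 2) ℂ := T.exists_reduced.choose_spec.choose_spec.choose

/-- The entries of the contour map without their common factor. -/
noncomputable def cform (i j : Fin 4) : MvPolynomial (Fin 2) ℂ :=
  T.exists_reduced.choose_spec.choose_spec.choose_spec.choose (i, j)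

theorem h_ne_zero : T.h ≠ 0 := T.exists_reduced.choose_spec.choose_spec.choose_spec.choose_spec.1

theorem cform_isHomogeneous (i j : Fin 4) : (T.cform i j).IsHomogeneous T.cdeg :=
  T.exists_reduced.choose_spec.choose_spec.choose_spec.choose_spec.2.2.1 (i, j)

theorem contourForm_eq (i j : Fin 4) : T.contourForm (i, j) = T.h * T.cform i j :=
  T.exists_reduced.choose_spec.choose_spec.choose_spec.choose_spec.2.2.2.1 (i, j)

theorem exists_cform_ne_zero {u : Fin 2 → ℂ} (hu : u ≠ 0) : ∃ i j, eval u (T.cform i j) ≠ 0 := by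
  obtain ⟨⟨i, j⟩, h⟩ := T.exists_reduced.choose_spec.choose_spec.choose_spec.choose_spec.2.2.2.2 u hu
  exact ⟨i, j, h⟩

/-- The point of the contour with respect to `a` on the ruling with parameter `u`. -/
noncomputable def cv (u : Fin 2 → ℂ) (a : Fin 4 → ℂ) : Fin 4 → ℂ :=
  ev (fun i => comb (T.cform i) a) u

/-- The derivative of the contour curve. -/
noncomputable def cd (u w : Fin 2 → ℂ) (a : Fin 4 → ℂ) : Fin 4 → ℂ :=
  dv (fun i => comb (T.cform i) a) u w

theorem cv_apply (u : Fin 2 → ℂ) (a : Fin 4 → ℂ) (i : Fin 4) :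
    T.cv u a i = ∑ j, a j * eval u (T.cform i j) := eval_comb _ _ _

theorem curve_isHomogeneous (a : Fin 4 → ℂ) (i : Fin 4) :
    (comb (T.cform i) a).IsHomogeneous T.cdeg := comb_isHomogeneous (T.cform_isHomogeneous i) a

theorem cv_smul_left (c : ℂ) (u : Fin 2 → ℂ) (a : Fin 4 → ℂ) :
    T.cv (c • u) a = c ^ T.cdeg • T.cv u a := ev_smul (T.curve_isHomogeneous a) c u

theorem cv_add (u : Fin 2 → ℂ) (a b : Fin 4 → ℂ) : T.cv u (a + b) = T.cv u a + T.cv u b := by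
  ext i; simp [cv_apply, add_mul, Finset.sum_add_distrib]

theorem cv_smul (c : ℂ) (u : Fin 2 → ℂ) (a : Fin 4 → ℂ) : T.cv u (c • a) = c • T.cv u a := by
  ext i; simp [cv_apply, Finset.mul_sum, mul_assoc]

theorem cd_add (u w w' : Fin 2 → ℂ) (a : Fin 4 → ℂ) :
    T.cd u (w + w') a = T.cd u w a + T.cd u w' a := dv_add u w w'

theorem cd_smul (c : ℂ) (u w : Fin 2 → ℂ) (a : Fin 4 → ℂ) : T.cd u (c • w) a = c • T.cd u w a :=
  dv_smul c u w

theorem cd_self (u : Fin 2 → ℂ) (a : Fin 4 → ℂ) : T.cd u u a = (T.cdeg : ℂ) • T.cv u a :=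
  dv_self (T.curve_isHomogeneous a) u

theorem contourMap_eq_cv (u : Fin 2 → ℂ) (a : Fin 4 → ℂ) :
    T.contourMap u a = eval u T.h • T.cv u a := by
  ext i
  simp only [contourMap_apply, contourForm_eq, map_mul, Pi.smul_apply, cv_apply, smul_eq_mul,
    Finset.mul_sum]
  exact Finset.sum_congr rfl fun j _ => by ring

theorem exists_cv_ne_zero {u : Fin 2 → ℂ} (hu : u ≠ 0) : ∃ a, T.cv u a ≠ 0 := by
  obtain ⟨i, j, h⟩ := T.exists_cform_ne_zero hu
  refine ⟨Pi.single j 1, fun h0 => h ?_⟩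
  have := congrFun h0 i
  simpa [cv_apply, Pi.single_apply] using this

theorem pol_cv {ι : Type*} {u : (ι → ℂ) → Fin 2 → ℂ} {a : (ι → ℂ) → Fin 4 → ℂ}
    (hu : ∀ i, Pol fun v => u v i) (ha : ∀ i, Pol fun v => a v i) (i : Fin 4) :
    Pol fun v => T.cv (u v) (a v) i := by
  simp only [cv_apply]
  exact Pol.sum _ fun j => (ha j).mul (Pol.evalComp _ hu)

theorem pol_pl' {ι : Type*} {u : (ι → ℂ) → Fin 2 → ℂ} (hu : ∀ i, Pol fun v => u v i) (i : Fin 6) :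
    Pol fun v => T.pl (u v) i := Pol.evalComp _ hu

theorem pol_curve (a : Fin 4 → ℂ) (i : Fin 4) : Pol fun u => T.cv u a i := ⟨_, fun _ => rfl⟩

/-- An identity for the contour map that is invariant under scaling holds for the reduced map. -/
theorem eq_zero_of_contourMap {f : (Fin 2 → ℂ) → ℂ} (hf : Pol f)
    (h : ∀ u, u ≠ 0 → eval u T.h * f u = 0) (u : Fin 2 → ℂ) : f u = 0 := by
  refine hf.eq_zero ?_ u
  obtain ⟨v, hv⟩ := exists_eval_ne_zero T.h_ne_zero
  filter_upwards [(Pol.evalComp T.h Pol.coord).eventually_ne hv,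
    (Pol.coord (0 : Fin 2)).eventually_ne (v := 1) (by simp)] with u hu h0
  have hu0 : u ≠ 0 := by rintro rfl; simp at h0
  exact (mul_eq_zero.1 (h u hu0)).resolve_left hu

theorem Ns_pl_cv (u : Fin 2 → ℂ) (a : Fin 4 → ℂ) : Ns (T.pl u) (T.cv u a) = 0 := by
  ext i
  refine T.eq_zero_of_contourMap (f := fun u => Ns (T.pl u) (T.cv u a) i)
    (Pol.Ns T.pol_pl (T.pol_curve a) i) (fun u hu => ?_) u
  obtain ⟨w, hw⟩ := exists_wedge_ne_zero hu
  obtain ⟨c, hc, h⟩ := T.contourMap_eq hw a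
  have : eval u T.h • Ns (T.pl u) (T.cv u a) = 0 := by
    rw [← Ns_smul_right, ← contourMap_eq_cv, h, Ns_smul_right, Ns_N_self (T.pf_pl u), smul_zero]
  exact congrFun this i

theorem dt_Ns_der_cv (u w : Fin 2 → ℂ) (a : Fin 4 → ℂ) :
    dt a (Ns (T.der u w) (T.cv u a)) = 0 := by
  refine T.eq_zero_of_contourMap (f := fun u => dt a (Ns (T.der u w) (T.cv u a)))
    (Pol.dt (fun _ => Pol.const _)
      (Pol.Ns (T.pol_der w) (T.pol_curve a))) (fun u hu => ?_) u
  obtain ⟨w', hw⟩ := exists_wedge_ne_zero hu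
  obtain ⟨c, hc, h⟩ := T.contourMap_eq hw a
  obtain ⟨α, β, rfl⟩ := exists_combination hw w
  rw [← dt_smul_right, ← Ns_smul_right, ← contourMap_eq_cv, der_add, der_smul, der_smul, der_self,
    Ns_add_left, Ns_smul_left, Ns_smul_left, Ns_smul_left, contourMap_eq_cv, Ns_smul_right, Ns_pl_cv,
    ← contourMap_eq_cv, h, Ns_smul_right, smul_zero, smul_zero, smul_zero, zero_add, dt_smul_right,
    dt_smul_right, dt_Ns, dt_comm, dt_N, dt_N_self]
  ring

/-- The contour map factors through `Ns (pl u)`. Hence `cv u a` depends on `a`, up to a scalar, only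
through the plane joining `a` and the ruling. -/
theorem cv_eq_zero_of_Ns {u : Fin 2 → ℂ} (hu : u ≠ 0) {y : Fin 4 → ℂ} (hy : Ns (T.pl u) y = 0) : T.cv u y = 0 := by
  obtain ⟨ζ, rfl⟩ := eq_N_of_Ns (T.pl_ne_zero hu) hy
  ext i
  refine T.eq_zero_of_contourMap (f := fun u => T.cv u (N (T.pl u) ζ) i)
    (T.pol_cv (u := fun u => u) Pol.coord (Pol.N (z := fun _ => ζ) T.pol_pl fun _ => Pol.const _) i) (fun u hu => ?_) u
  obtain ⟨w, hw⟩ := exists_wedge_ne_zero hu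
  obtain ⟨c, hc, h⟩ := T.contourMap_eq hw (N (T.pl u) ζ)
  rw [N_pl_Ns_der, Ns_N_self (T.pf_pl u), N_zero_right, neg_zero, smul_zero, contourMap_eq_cv] at h
  exact congrFun h i

theorem Ns_pl_of_cv {u w : Fin 2 → ℂ} (hw : wedge u w ≠ 0) (hp : pf (T.der u w) ≠ 0)
    {a : Fin 4 → ℂ} (h : T.cv u a = 0) : Ns (T.pl u) a = 0 :=
  T.contourMap_ne_zero hw hp (by rw [contourMap_eq_cv, h, smul_zero])

theorem Ns_pl_cd (u w : Fin 2 → ℂ) (a : Fin 4 → ℂ) :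
    Ns (T.pl u) (T.cd u w a) = - Ns (T.der u w) (T.cv u a) := by
  rw [eq_neg_iff_add_eq_zero]
  ext i
  have h0 : ∑ j, skewDual T.form i j * comb (T.cform j) a = 0 := MvPolynomial.funext fun v => by
    have h1 := congrFun (T.Ns_pl_cv v a) i
    rw [Ns_eq_sum] at h1
    rw [map_zero, map_sum]
    refine Eq.trans ?_ h1
    exact Finset.sum_congr rfl fun j _ => by rw [map_mul, eval_skewDual]; rfl
  have h1 := congrArg (fun p => eval u (D w p)) h0
  have h2 : ∀ j, eval u (D w (skewDual T.form i j)) = skewDual (T.der u w) i j := by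
    intro j
    fin_cases i <;> fin_cases j <;> simp [skew, skewDual, der, dv]
  simp only [map_sum, D_mul, map_add, map_mul, map_zero, h2, eval_skewDual] at h1
  rw [Pi.add_apply, Ns_eq_sum, Ns_eq_sum, ← Finset.sum_add_distrib]
  refine Eq.trans (Finset.sum_congr rfl fun j _ => ?_) h1
  change _ = skewDual (T.pl u) i j * T.cd u w a j + T.cv u a j * _
  ring

/-- At a contour point the tangent plane contains the ruling and `a`, hence it is `Ns (pl u) a`, and
the tangent of the contour curve lies in it. This is what allows the plane to be recovered from the
curve and the viewpoint alone. -/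
theorem dt_cd (u w : Fin 2 → ℂ) (a : Fin 4 → ℂ) : dt (T.cd u w a) (Ns (T.pl u) a) = 0 := by
  have h := T.dt_Ns_der_cv u w a
  rw [dt_Ns, Ns_pl_cd, neg_eq_zero]
  generalize Ns (T.der u w) (T.cv u a) = z at h
  simp only [dt, Pi.neg_apply] at h ⊢
  linear_combination -h

end Scroll

/-! ### The restriction of a form to a line -/

/-- The restriction of a form to the line joining two points. -/
noncomputable def restrict (F : MvPolynomial (Fin 4) ℂ) (x y : Fin 4 → ℂ) : MvPolynomial (Fin 2) ℂ :=
  aeval (fun i => C (x i) * X 0 + C (y i) * X 1) F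

theorem eval_restrict (F : MvPolynomial (Fin 4) ℂ) (x y : Fin 4 → ℂ) (s : Fin 2 → ℂ) :
    eval s (restrict F x y) = eval (s 0 • x + s 1 • y) F := by
  rw [restrict, eval_aeval]
  congr 2
  ext i
  simp [mul_comm]

theorem D_restrict (F : MvPolynomial (Fin 4) ℂ) (x y : Fin 4 → ℂ) (w : Fin 2 → ℂ) :
    D w (restrict F x y) = restrict (D (w 0 • x + w 1 • y) F) x y := by
  induction F using MvPolynomial.induction_on with
  | C a => simp only [restrict, D_C, map_zero]; rw [aeval_C]; exact D_C _ _
  | add p q hp hq => simp only [restrict, map_add] at hp hq ⊢; rw [hp, hq]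
  | mul_X p n hp =>
    simp only [restrict, map_mul, aeval_X, D_mul, map_add, D_X, D_C] at hp ⊢
    rw [hp]
    simp [mul_comm]

theorem restrict_isHomogeneous {F : MvPolynomial (Fin 4) ℂ} {k : ℕ} (hF : F.IsHomogeneous k)
    (x y : Fin 4 → ℂ) : (restrict F x y).IsHomogeneous k := by
  have := hF.aeval (S := ℂ) (fun i => C (x i) * X 0 + C (y i) * X 1 : Fin 4 → MvPolynomial (Fin 2) ℂ)
    (n := 1) (fun i => (isHomogeneous_C_mul_X _ _).add (isHomogeneous_C_mul_X _ _))
  rwa [one_mul] at this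

/-! ### Smooth points of a surface and the rulings met by a line. -/

/-- A non-developable rational ruled surface of degree at least three with its family of lines. -/
structure Surface extends Scroll where
  F : MvPolynomial (Fin 4) ℂ
  k : ℕ
  irreducible : Irreducible F
  isHomogeneous : F.IsHomogeneous k
  three_le : 3 ≤ k
  eval_eq_zero_iff : ∀ v, eval v F = 0 ↔ toScroll.On v

namespace Surface
variable (S : Surface)

/-- The smooth points of the cone over the surface. -/
def Smooth (x : Fin 4 → ℂ) : Prop := S.On x ∧ ∃ v, eval x (D v S.F) ≠ 0

theorem vanishes : S.Vanishes S.F := fun v hv => (S.eval_eq_zero_iff v).2 hv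

theorem k_ne_zero : S.k ≠ 0 := by have := S.three_le; omega

variable {S}

theorem Smooth.ne_zero {x : Fin 4 → ℂ} (hx : S.Smooth x) : x ≠ 0 := by
  rintro rfl
  obtain ⟨-, v, hv⟩ := hx
  have h := eval_smul_form (D_isHomogeneous S.isHomogeneous v) 0 0
  have : S.k - 1 ≠ 0 := by have := S.three_le; omega
  rw [smul_zero, zero_pow this, zero_mul] at h
  exact hv h

/-- Otherwise `F` would be invariant under translation by `x`, a cone with vertex `x`. On the line
through `x` and `v` it would be a multiple of `X 1 ^ k`, whose derivative at `x` vanishes since `k ≥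
2`. -/
theorem Smooth.D_ne_zero {x : Fin 4 → ℂ} (hx : S.Smooth x) : D x S.F ≠ 0 := by
  intro h0
  obtain ⟨-, v, hv⟩ := hx
  have h1 : ∀ y (c : ℂ), eval (c • x + y) S.F = eval y S.F := by
    intro y c
    have h2 : (chart y x S.F).derivative = 0 := by rw [derivative_chart, h0]; simp [chart]
    obtain ⟨r, hr⟩ := Polynomial.natDegree_eq_zero.1 (Polynomial.derivative_eq_zero.1 h2)
    have e0 := eval_chart y x S.F 0
    have e1 := eval_chart y x S.F c
    rw [← hr, Polynomial.eval_C] at e0 e1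
    rw [zero_smul, add_zero] at e0
    rw [← e0, add_comm, ← e1]
  have h3 : restrict S.F x v = C (eval v S.F) * X 1 ^ S.k := MvPolynomial.funext fun s => by
    rw [eval_restrict, h1, eval_smul_form S.isHomogeneous]
    simp [mul_comm]
  have h4 := D_restrict S.F x v ![0, 1]
  have h5 := congrArg (eval ![1, 0]) h4
  rw [h3, eval_restrict] at h5
  apply hv
  have h6 : S.k - 1 ≠ 0 := by have := S.three_le; omega
  simpa [D_mul, D_C, Derivation.leibniz_pow, h6] using h5.symm

theorem splitting {s : Fin 2 → ℂ} (hs : s 0 ≠ 0) (b x : Fin 4 → ℂ) :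
    s 0 • b + s 1 • x = s 0 • (b + (s 1 / s 0) • x) := by
  rw [smul_add, smul_smul, mul_div_cancel₀ _ hs]

variable (S) in
theorem eval_D_ne_zero_of_root {x b : Fin 4 → ℂ}
    (hb : ∀ μ : ℂ, eval (b + μ • x) S.F = 0 → eval (b + μ • x) (D x S.F) ≠ 0) {s : Fin 2 → ℂ}
    (h0 : s 0 ≠ 0) (h : eval (s 0 • b + s 1 • x) S.F = 0) :
    eval (s 0 • b + s 1 • x) (D x S.F) ≠ 0 := by
  rw [splitting h0, eval_smul_form S.isHomogeneous, mul_eq_zero, or_iff_right (pow_ne_zero _ h0)] at h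
  rw [splitting h0, eval_smul_form (D_isHomogeneous S.isHomogeneous _)]
  exact mul_ne_zero (pow_ne_zero _ h0) (hb _ h)

variable (S) in
/-- The points outside `x` at which a transversal line through `x` meets the surface lie on
different rulings. -/
theorem exists_rulings {x b : Fin 4 → ℂ}
    (hb : ∀ μ : ℂ, eval (b + μ • x) S.F = 0 → eval (b + μ • x) (D x S.F) ≠ 0) :
    ∃ Z : Set P1, Z ⊆ zeros (S.pairForm (wed b x)) ∧
      Z.ncard = {s | s ∈ zeros (restrict S.F b x) ∧ s.rep 0 ≠ 0}.ncard ∧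
      ∀ t ∈ Z, Ns (S.pl t.rep) x ≠ 0 := by
  have hφ : ∀ t, eval t (S.pairForm (wed b x)) = dt b (Ns (S.pl t) x) := fun t => by
    rw [Scroll.eval_pairForm, pair_comm, pair_wed_eq]
  set A := {s | s ∈ zeros (restrict S.F b x) ∧ s.rep 0 ≠ 0} with hA
  have hroot : ∀ s : P1, s ∈ A → eval (s.rep 0 • b + s.rep 1 • x) S.F = 0 := fun s hs => by
    rw [← eval_restrict]; exact hs.1
  have hex : ∀ s : P1, ∃ t : P1, s ∈ A → Ns (S.pl t.rep) (s.rep 0 • b + s.rep 1 • x) = 0 := by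
    intro s
    by_cases hs : s ∈ A
    · obtain ⟨t, ht, h⟩ := (S.eval_eq_zero_iff _).1 (hroot s hs)
      obtain ⟨c, -, hc⟩ := rep_mk ht
      exact ⟨Projectivization.mk ℂ t ht, fun _ => by
        rw [hc, Scroll.pl_smul, Ns_smul_left, h, smul_zero]⟩
    · exact ⟨s, fun h => absurd h hs⟩
  choose τ hτ using hex
  -- A ruling through `x` and this point would be the whole line, against transversality.
  have hthrough : ∀ s ∈ A, Ns (S.pl (τ s).rep) x ≠ 0 := fun s hs h =>
    S.eval_D_ne_zero_of_root hb hs.2 (hroot s hs)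
      (S.vanishes.eval_D_line (τ s).rep_nonzero (hτ s hs) h)
  refine ⟨τ '' A, ?_, ?_, ?_⟩
  · rintro _ ⟨s, hs, rfl⟩
    change eval _ _ = 0
    have h := congrArg (dt b) (hτ s hs)
    rw [Ns_add_right, Ns_smul_right, Ns_smul_right, dt_add_right, dt_smul_right, dt_smul_right,
      dt_Ns_self, dt_zero_right, mul_zero, zero_add] at h
    rw [hφ]
    by_cases h1 : s.rep 1 = 0
    · have h2 := hτ s hs
      rw [h1, zero_smul, add_zero, Ns_smul_right, smul_eq_zero, or_iff_right hs.2] at h2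
      rw [dt_Ns, h2, dt_zero_right, neg_zero]
    · exact (mul_eq_zero.1 h).resolve_left h1
  -- Two points of the line on one ruling would put `x` on that ruling too.
  · rw [Set.InjOn.ncard_image]
    intro s hs s' hs' h
    by_contra hss
    refine hthrough s hs ?_
    have h1 := hτ s hs
    have h2 := hτ s' hs'
    rw [← h, Ns_add_right, Ns_smul_right, Ns_smul_right] at h2
    rw [Ns_add_right, Ns_smul_right, Ns_smul_right] at h1
    have h3 : (wedge s'.rep s.rep) • Ns (S.pl (τ s).rep) x = 0 := by
      rw [wedge]
      linear_combination (norm := module) s'.rep 0 • h1 - s.rep 0 • h2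
    rw [smul_eq_zero, wedge_rep] at h3
    exact h3.resolve_left fun h4 => hss h4.symm
  · rintro _ ⟨s, hs, rfl⟩
    exact hthrough s hs

theorem eventually_pairForm_wed_ne_zero (T : Scroll) {x : Fin 4 → ℂ} (hx : x ≠ 0) :
    ∀ᶠ b in gen (Fin 4), T.pairForm (wed b x) ≠ 0 := by
  obtain ⟨t₀, ht₀, hnot⟩ := T.exists_pl_not_through hx
  obtain ⟨b₀, hb₀⟩ := exists_dt_ne_zero hnot
  filter_upwards [(Pol.dt Pol.coord (fun i => Pol.const (Ns (T.pl t₀) x i))).eventually_ne (v := b₀)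
      (by rwa [dt_comm])] with b hb h0
  apply hb
  rw [← pair_wed_eq, pair_comm, ← Scroll.eval_pairForm, h0, map_zero]

/-- On a generic line through a smooth point there are `k - 1` further points, on different
rulings. -/
theorem Smooth.exists_zeros {x : Fin 4 → ℂ} (hx : S.Smooth x) :
    ∀ᶠ b in gen (Fin 4), S.pairForm (wed b x) ≠ 0 ∧ ∃ Z : Set P1, Z ⊆ zeros (S.pairForm (wed b x)) ∧
      Z.ncard = S.k - 1 ∧ ∀ t ∈ Z, Ns (S.pl t.rep) x ≠ 0 := by
  obtain ⟨v, hv⟩ := hx.2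
  have hp : Pol fun b => eval x (D b S.F) := by
    simp only [eval_D]
    exact Pol.sum _ fun i => (Pol.coord i).mul (Pol.const _)
  filter_upwards [eventually_simple_roots S.irreducible hx.D_ne_zero, hp.eventually_ne hv,
    eventually_pairForm_wed_ne_zero S.toScroll hx.ne_zero] with b hb hbx hb0
  refine ⟨hb0, ?_⟩
  obtain ⟨Z, hZ, hZc, hZt⟩ := S.exists_rulings hb
  refine ⟨Z, hZ, hZc.trans ?_, hZt⟩
  have hGk := restrict_isHomogeneous S.isHomogeneous b x
  have hGx : eval ![0, 1] (D ![1, 0] (restrict S.F b x)) ≠ 0 := by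
    rw [D_restrict, eval_restrict]
    simpa using hbx
  have hG0 : restrict S.F b x ≠ 0 := by
    intro h
    rw [h, map_zero, map_zero] at hGx
    exact hGx rfl
  have hsimple : ∀ s, s ≠ 0 → eval s (restrict S.F b x) = 0 →
      ∃ w, eval s (D w (restrict S.F b x)) ≠ 0 := by
    intro s hs h
    by_cases h0 : s 0 = 0
    · refine ⟨![1, 0], ?_⟩
      have e : s = s 1 • ![0, 1] := by ext i; fin_cases i <;> simp [h0]
      have h1 : s 1 ≠ 0 := fun h1 => hs (by rw [e, h1, zero_smul])
      rw [e, eval_smul_form (D_isHomogeneous hGk _)]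
      exact mul_ne_zero (pow_ne_zero _ h1) hGx
    · refine ⟨![0, 1], ?_⟩
      rw [D_restrict, eval_restrict]
      rw [eval_restrict] at h
      simpa using S.eval_D_ne_zero_of_root hb h0 h
  have hcard := zeros_ncard_eq hGk hG0 hsimple
  have hv0 : (![0, 1] : Fin 2 → ℂ) ≠ 0 := fun h => by simpa using congrFun h 1
  have hmem : Projectivization.mk ℂ ![0, 1] hv0 ∈ zeros (restrict S.F b x) := by
    rw [mk_mem_zeros hGk, eval_restrict]
    simpa using S.vanishes x hx.1
  -- The zero `(0, 1)` is `x` itself, so `k - 1` of the `k` simple zeros remain.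
  have hA : {s | s ∈ zeros (restrict S.F b x) ∧ s.rep 0 ≠ 0} =
      zeros (restrict S.F b x) \ {Projectivization.mk ℂ ![0, 1] hv0} := by
    ext s
    refine and_congr_right fun _ => not_congr ?_
    conv_rhs => rw [Set.mem_singleton_iff, ← s.mk_rep, mk_eq_mk_iff_wedge]
    simp [wedge]
  rw [hA, Set.ncard_sdiff_singleton_of_mem hmem, hcard]

/-- A generic line through a point outside of the surface meets `k` different rulings. -/
theorem eventually_ncard_zeros {x : Fin 4 → ℂ} (hx : ¬ S.On x) :
    ∀ᶠ b in gen (Fin 4), S.pairForm (wed b x) ≠ 0 ∧ S.k ≤ (zeros (S.pairForm (wed b x))).ncard := by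
  have hFx : eval x S.F ≠ 0 := fun h => hx ((S.eval_eq_zero_iff x).1 h)
  have hD : D x S.F ≠ 0 := by
    intro h
    have h1 := euler S.isHomogeneous x
    rw [h, map_zero] at h1
    exact mul_ne_zero (Nat.cast_ne_zero.2 S.k_ne_zero) hFx h1.symm
  have hx0 : x ≠ 0 := by
    rintro rfl
    exact hx S.On_zero
  filter_upwards [eventually_simple_roots S.irreducible hD,
    eventually_pairForm_wed_ne_zero S.toScroll hx0] with b hb hb0
  refine ⟨hb0, ?_⟩
  obtain ⟨Z, hZ, hZc, -⟩ := S.exists_rulings hb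
  have hGk := restrict_isHomogeneous S.isHomogeneous b x
  have hG0 : restrict S.F b x ≠ 0 := by
    intro h
    apply hFx
    have := eval_restrict S.F b x ![0, 1]
    rw [h, map_zero] at this
    simpa using this.symm
  have h0 : ∀ s : Fin 2 → ℂ, s ≠ 0 → eval s (restrict S.F b x) = 0 → s 0 ≠ 0 := by
    intro s hs h h0
    rw [eval_restrict, h0, zero_smul, zero_add, eval_smul_form S.isHomogeneous, mul_eq_zero,
      or_iff_left hFx] at h
    exact hs (by ext i; fin_cases i; exacts [h0, pow_eq_zero_iff S.k_ne_zero |>.1 h])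
  have hcard := zeros_ncard_eq hGk hG0 fun s hs h => ⟨![0, 1], by
    rw [D_restrict, eval_restrict]
    rw [eval_restrict] at h
    simpa using S.eval_D_ne_zero_of_root hb (h0 s hs (by rwa [eval_restrict])) h⟩
  have hA : {s | s ∈ zeros (restrict S.F b x) ∧ s.rep 0 ≠ 0} = zeros (restrict S.F b x) :=
    Set.Subset.antisymm (fun s hs => hs.1) fun s hs => ⟨hs, h0 s.rep s.rep_nonzero hs⟩
  rw [hA, hcard] at hZc
  rw [← hZc]
  exact Set.ncard_le_ncard hZ (zeros_finite (S.pairForm_isHomogeneous _) hb0).1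

end Surface

/-! ### The degree of the family of rulings -/

theorem eval_pairForm_wed (T : Scroll) (b x : Fin 4 → ℂ) (t : Fin 2 → ℂ) :
    eval t (T.pairForm (wed b x)) = dt b (Ns (T.pl t) x) := by
  rw [Scroll.eval_pairForm, pair_comm, pair_wed_eq]

theorem eval_D_pairForm_wed (T : Scroll) (b x : Fin 4 → ℂ) (t w : Fin 2 → ℂ) :
    eval t (D w (T.pairForm (wed b x))) = dt b (Ns (T.der t w) x) := by
  rw [Scroll.eval_D_pairForm, pair_comm, pair_wed_eq]

theorem Ns_pl_rep (T : Scroll) {u : Fin 2 → ℂ} (hu : u ≠ 0) {x : Fin 4 → ℂ} :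
    Ns (T.pl (Projectivization.mk ℂ u hu).rep) x = 0 ↔ Ns (T.pl u) x = 0 := by
  obtain ⟨c, hc, h⟩ := rep_mk hu
  rw [h, Scroll.pl_smul, Ns_smul_left, smul_eq_zero, or_iff_right (pow_ne_zero _ hc)]

theorem IsHomogeneous.eq_zero_of_dvd {F G : MvPolynomial (Fin 4) ℂ} {k d : ℕ} (hF : F.IsHomogeneous k)
    (hG : G.IsHomogeneous d) (hd : d < k) (h : F ∣ G) : G = 0 := by
  by_contra h0
  obtain ⟨H, rfl⟩ := h
  have hF0 : F ≠ 0 := fun h => h0 (by rw [h, zero_mul])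
  have hH0 : H ≠ 0 := fun h => h0 (by rw [h, mul_zero])
  have h1 := totalDegree_mul_of_isDomain hF0 hH0
  rw [hG.totalDegree h0, hF.totalDegree hF0] at h1
  omega

theorem Constr.vecEqZero {ι : Type} {n : ℕ} {f : (ι → ℂ) → Fin n → ℂ} (h : ∀ i, Pol fun v => f v i) :
    Constr fun v => f v = 0 := by
  simp only [funext_iff, Pi.zero_apply]
  exact Constr.forallFin fun i => Constr.eqZero (h i)

theorem Pol.wed {ι : Type*} {p q : (ι → ℂ) → Fin 4 → ℂ} (hp : ∀ i, Pol fun v => p v i)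
    (hq : ∀ i, Pol fun v => q v i) (i : Fin 6) : Pol fun v => wed (p v) (q v) i := by
  fin_cases i <;> simp only [RuledContours.wed] <;> simp <;> fun_prop

theorem Pol.wedge {ι : Type*} {p q : (ι → ℂ) → Fin 2 → ℂ} (hp : ∀ i, Pol fun v => p v i)
    (hq : ∀ i, Pol fun v => q v i) : Pol fun v => wedge (p v) (q v) := by
  simp only [RuledContours.wedge]; fun_prop

theorem pol_dt (w : Fin 4 → ℂ) : Pol fun z => dt z w := Pol.dt Pol.coord fun _ => Pol.const _

theorem pair_wed_combination (z z' a : Fin 4 → ℂ) (α β γ : ℂ) :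
    pair (wed z z') (wed a (α • z + β • z' - γ • a)) = 0 := by
  simp [pair, wed]; ring

/-- A generic member of a pencil without base points has simple zeros only. -/
theorem exists_simple_member {f g E : MvPolynomial (Fin 2) ℂ} {d m : ℕ} (hd : d ≠ 0)
    (hf : f.IsHomogeneous d) (hg : g.IsHomogeneous d) (hE : E.IsHomogeneous m) (hf0 : f ≠ 0)
    (hE0 : E ≠ 0) (hfg : ∀ t, t ≠ 0 → eval t f = 0 → eval t g ≠ 0) :
    ∃ α β : ℂ, (C α * f + C β * g).IsHomogeneous d ∧ C α * f + C β * g ≠ 0 ∧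
      ∀ t, t ≠ 0 → eval t (C α * f + C β * g) = 0 →
        eval t E ≠ 0 ∧ ∃ w, eval t (D w (C α * f + C β * g)) ≠ 0 := by
  -- A multiple zero of a member of the pencil is a zero of the Wronskian. A generic member vanishes
  -- at none of the finitely many zeros of the Wronskian and of `E`.
  obtain ⟨w, hw⟩ := wronskian_ne_zero hd hf hf0 hfg
  have hW : (f * D w g - g * D w f).IsHomogeneous (d + (d - 1)) :=
    (hf.mul (D_isHomogeneous hg w)).sub (hg.mul (D_isHomogeneous hf w))
  have hp : ∀ t, Pol fun α : Fin 2 → ℂ => α 0 * eval t f + α 1 * eval t g := fun t =>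
    ((Pol.coord _).mul (Pol.const _)).add ((Pol.coord _).mul (Pol.const _))
  have h3 := eventually_forall_zero (l := gen (Fin 2)) (hE.mul hW) (mul_ne_zero hE0 hw)
    (Q := fun t α => α 0 * eval t f + α 1 * eval t g ≠ 0) (fun c t α hc h => by
      rw [eval_smul_form hf, eval_smul_form hg]
      have := mul_ne_zero (pow_ne_zero d hc) h
      intro h0
      exact this (by linear_combination h0)) (fun t ht _ => by
        by_cases h : eval t f = 0
        · exact (hp t).eventually_ne (v := ![0, 1]) (by simpa using hfg t ht h)
        · exact (hp t).eventually_ne (v := ![1, 0]) (by simpa using h))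
  obtain ⟨t₀, ht₀⟩ := exists_eval_ne_zero hf0
  obtain ⟨α, hα, hα0⟩ := (h3.and ((hp t₀).eventually_ne (v := ![1, 0]) (by simpa using ht₀))).exists
  refine ⟨α 0, α 1, ?_, fun h => hα0 ?_, fun t ht h => ?_⟩
  · have := ((isHomogeneous_C _ (α 0)).mul hf).add ((isHomogeneous_C _ (α 1)).mul hg)
    rwa [zero_add] at this
  · have := congrArg (eval t₀) h
    simpa using this
  · have h1 : α 0 * eval t f + α 1 * eval t g = 0 := by simpa using h
    have h2 := mt (hα t ht) (not_not.2 h1)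
    rw [map_mul, mul_eq_zero, not_or] at h2
    refine ⟨h2.1, w, fun h4 => h2.2 ?_⟩
    have h5 : α 0 * eval t (D w f) + α 1 * eval t (D w g) = 0 := by simpa [D_mul, D_C] using h4
    rw [map_sub, map_mul, map_mul]
    by_cases hα1 : α 0 = 0
    · have hα2 : α 1 ≠ 0 := by
        rintro hα2
        rw [hα1, hα2] at hα0
        simp at hα0
      rw [hα1, zero_mul, zero_add, mul_eq_zero, or_iff_right hα2] at h1 h5
      rw [h1, h5]; ring
    · refine (mul_eq_zero.1 (?_ : α 0 * _ = 0)).resolve_left hα1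
      linear_combination eval t (D w g) * h1 - eval t g * h5

namespace Surface
variable (S : Surface)

theorem exists_smooth : ∃ x, S.Smooth x := by
  by_contra! h
  have h1 : ∀ v, D v S.F = 0 := fun v => by
    refine IsHomogeneous.eq_zero_of_dvd S.isHomogeneous (D_isHomogeneous S.isHomogeneous v)
      (by have := S.three_le; omega) (dvd_of_forall_eval S.irreducible fun x hx => ?_)
    by_contra h0
    exact h x ⟨(S.eval_eq_zero_iff x).1 hx, v, h0⟩
  refine S.irreducible.ne_zero (MvPolynomial.funext fun x => ?_)
  have h2 := euler S.isHomogeneous x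
  rw [h1, map_zero] at h2
  rw [map_zero]
  exact (mul_eq_zero.1 h2.symm).resolve_left (Nat.cast_ne_zero.2 S.k_ne_zero)

variable {S} in
-- The zeros of `pairForm (wed b x)` are the rulings meeting the line `bx`, at most `degree` many.
-- Among them are the rulings through `x` and `k - 1` others.
theorem Smooth.ncard_add_le {x : Fin 4 → ℂ} (hx : S.Smooth x) {W : Set P1} (hW : W.Finite)
    (h : ∀ t ∈ W, Ns (S.pl t.rep) x = 0) : W.ncard + (S.k - 1) ≤ S.degree := by
  obtain ⟨b, hb0, Z, hZ, hc, hn⟩ := hx.exists_zeros.exists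
  have hfin := zeros_finite (S.pairForm_isHomogeneous (wed b x)) hb0
  rw [← hc, ← Set.ncard_union_eq (Set.disjoint_left.2 fun t ht ht' => hn t ht' (h t ht)) hW
    (hfin.1.subset hZ)]
  refine (Set.ncard_le_ncard (Set.union_subset (fun t ht => ?_) hZ) hfin.1).trans hfin.2
  change eval _ _ = 0
  rw [eval_pairForm_wed, h t ht, dt_zero_right]

theorem k_le_degree : S.k ≤ S.degree := by
  obtain ⟨x, hx⟩ := S.exists_smooth
  obtain ⟨t, ht, h⟩ := hx.1
  have := hx.ncard_add_le (Set.finite_singleton (Projectivization.mk ℂ t ht)) (by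
    rintro _ rfl; exact (Ns_pl_rep _ ht).2 h)
  rw [Set.ncard_singleton] at this
  omega

end Surface

namespace Scroll
variable (T : Scroll)

/-- The points common to a generic ruling and to other rulings avoid a generic plane through `a`. -/
theorem eventually_common {a : Fin 4 → ℂ} (ha : ¬ T.On a) :
    ∀ᶠ z in gen (Fin 4 ⊕ Fin 4), ∀ᶠ u in gen (Fin 2), ∀ t y : _, wedge t u ≠ 0 →
      Ns (T.pl u) y = 0 → Ns (T.pl t) y = 0 →
      pair (wed (fun i => z (Sum.inl i)) fun i => z (Sum.inr i)) (wed a y) = 0 → y = 0 := by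
  -- For a fixed generic ruling `u` only finitely many points have to be avoided by the plane,
  -- because another ruling through a point of `u` is a zero of `pairForm (pl u)`. This order of
  -- choice is then exchanged.
  refine gen_swap (P := fun (u : Fin 2 → ℂ) (z : Fin 4 ⊕ Fin 4 → ℂ) => ∀ (t : Fin 2 → ℂ)
      (y : Fin 4 → ℂ), wedge t u ≠ 0 → Ns (T.pl u) y = 0 → Ns (T.pl t) y = 0 →
      pair (wed (fun i => z (Sum.inl i)) fun i => z (Sum.inr i)) (wed a y) = 0 → y = 0) ?_ ?_
  · refine Constr.all (Constr.all ?_)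
    refine (Constr.eqZero (Pol.wedge ?_ ?_)).not.imp ((Constr.vecEqZero (Pol.Ns (T.pol_pl' ?_) ?_)).imp
      ((Constr.vecEqZero (Pol.Ns (T.pol_pl' ?_) ?_)).imp ((Constr.eqZero (Pol.pair (Pol.wed ?_ ?_)
        (Pol.wed ?_ ?_))).imp (Constr.vecEqZero ?_)))) <;> intro i <;>
      first
      | exact Pol.coord _
      | exact Pol.const _
  · filter_upwards [T.eventually_pairForm_ne_zero, T.proper,
      (Pol.coord (0 : Fin 2)).eventually_ne (v := 1) (by simp)] with u hu hprop h0
    have hu0 : u ≠ 0 := by rintro rfl; simp at h0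
    have key := eventually_forall_zero (l := gen (Fin 4 ⊕ Fin 4)) (T.pairForm_isHomogeneous (T.pl u)) hu
      (Q := fun t z => ∀ y : Fin 4 → ℂ, wedge t u ≠ 0 →
      Ns (T.pl u) y = 0 → Ns (T.pl t) y = 0 →
      pair (wed (fun i => z (Sum.inl i)) fun i => z (Sum.inr i)) (wed a y) = 0 → y = 0) ?_ ?_
    · filter_upwards [key] with z hz t y htu h1 h2 h3
      by_contra hy
      have ht : t ≠ 0 := by rintro rfl; simp [wedge] at htu
      refine hy (hz t ht ?_ y htu h1 h2 h3)
      rw [eval_pairForm]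
      exact pair_eq_zero_of_common hy h1 h2
    · intro c t z hc h y h1 h2 h3
      rw [wedge_smul_left] at h1
      rw [pl_smul, Ns_smul_left, smul_eq_zero, or_iff_right (pow_ne_zero _ hc)] at h3
      exact h y (right_ne_zero_of_mul h1) h2 h3
    · intro t ht _
      by_cases htu : wedge t u = 0
      · exact Eventually.of_forall fun z y h => absurd htu h
      by_cases hy : ∃ y, y ≠ 0 ∧ Ns (T.pl u) y = 0 ∧ Ns (T.pl t) y = 0
      · obtain ⟨y, hy0, h1, h2⟩ := hy
        have hay : wed a y ≠ 0 := by
          intro h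
          obtain ⟨c, rfl⟩ := (wed_eq_zero_iff hy0).1 h
          exact ha ⟨u, hu0, by rw [Ns_smul_right, h1, smul_zero]⟩
        obtain ⟨z', hz'⟩ := exists_Ns_ne_zero hay
        obtain ⟨z, hz⟩ := exists_dt_ne_zero hz'
        have hp : Pol fun z : Fin 4 ⊕ Fin 4 → ℂ =>
            dt (fun i => z (Sum.inl i)) (Ns (wed a y) fun i => z (Sum.inr i)) :=
          Pol.dt (fun i => Pol.coord _) (Pol.Ns (fun _ => Pol.const _) fun _ => Pol.coord _)
        filter_upwards [hp.eventually_ne (v := Sum.elim z z') (by rw [dt_comm]; exact hz)] with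
          Z hZ y' _ h1' h2' h3
        obtain ⟨c, rfl⟩ := exists_smul_of_common (T.pf_pl t) (T.pf_pl u) (T.pl_ne_zero ht)
          (T.pl_ne_zero hu0) (fun c hc => htu (hprop t ht ⟨c, hc⟩)) hy0 h2' h2 h1' h1
        by_contra hc
        have hc0 : c ≠ 0 := by rintro rfl; exact hc (zero_smul _ _)
        apply hZ
        rw [← pair_wed_eq, pair_comm]
        have e : wed a (c • y) = c • wed a y := by
          have := wed_combination a y 1 0 0 c
          simpa using this
        rw [e, pair_smul_right] at h3
        exact (mul_eq_zero.1 h3).resolve_left hc0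
      · push Not at hy
        exact Eventually.of_forall fun z y _ h1 h2 _ => by
          by_contra h
          exact hy y h h1 h2

/-- A generic line through `a` meets as many rulings as the degree says, in different points. -/
theorem exists_transversal_line {a : Fin 4 → ℂ} (ha : ¬ T.On a) :
    ∃ b, T.pairForm (wed b a) ≠ 0 ∧ ∀ t, t ≠ 0 → eval t (T.pairForm (wed b a)) = 0 →
      (∃ w, eval t (D w (T.pairForm (wed b a))) ≠ 0) ∧
      ∀ t' (c : ℂ), wedge t' t ≠ 0 → Ns (T.pl t) (b - c • a) = 0 → Ns (T.pl t') (b - c • a) ≠ 0 := by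
  have h1 := gen_curry (T.eventually_common ha)
  have hNa : ∀ t, t ≠ 0 → Ns (T.pl t) a ≠ 0 := fun t ht h => ha ⟨t, ht, h⟩
  have e10 : (![1, 0] : Fin 2 → ℂ) ≠ 0 := fun h => by simpa using congrFun h 0
  obtain ⟨z₀, hz₀⟩ := exists_dt_ne_zero (hNa _ e10)
  obtain ⟨z, hz1, hz2⟩ := (h1.and ((pol_dt (Ns (T.pl ![1, 0]) a)).eventually_ne (v := z₀) (by rwa [dt_comm]))).exists
  have hfd := T.pairForm_isHomogeneous (wed z a)
  have hf0 : T.pairForm (wed z a) ≠ 0 := by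
    intro h
    apply hz2
    rw [← eval_pairForm_wed, h, map_zero]
  have h2 := eventually_forall_zero (l := gen (Fin 4)) hfd hf0
    (Q := fun t z' => dt z' (Ns (T.pl t) a) ≠ 0) (fun c t z' hc h => by
      rw [Scroll.pl_smul, Ns_smul_left, dt_smul_right]
      exact mul_ne_zero (pow_ne_zero _ hc) h) (fun t ht _ => by
        obtain ⟨z', hz'⟩ := exists_dt_ne_zero (hNa t ht)
        exact (pol_dt (Ns (T.pl t) a)).eventually_ne (v := z') (by rwa [dt_comm]))
  obtain ⟨z', hz', hzz⟩ := (hz1.and h2).exists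
  simp only [Sum.elim_inl, Sum.elim_inr] at hz'
  have hgd := T.pairForm_isHomogeneous (wed z' a)
  -- The lines through `a` in the plane of `a`, `z`, `z'` form a pencil. The zeros of `E` include
  -- every ruling that meets another one inside this plane, so the chosen member meets its rulings
  -- in different points.
  obtain ⟨m, E, hE, hE0, hEu⟩ := exists_form_of_eventually (P := fun u => ∀ t y : _, wedge t u ≠ 0 →
      Ns (T.pl u) y = 0 → Ns (T.pl t) y = 0 → pair (wed z z') (wed a y) = 0 → y = 0)
    (fun c u hc h t y h1 h2 h3 => h t y (by
      rw [wedge_smul_right] at h1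
      exact right_ne_zero_of_mul h1) (by
      rwa [Scroll.pl_smul, Ns_smul_left, smul_eq_zero, or_iff_right (pow_ne_zero _ hc)] at h2) h3) hz'
  obtain ⟨α, β, -, hφ0, hφ⟩ := exists_simple_member T.degree_ne_zero hfd hgd hE hf0 hE0
    (fun t ht h => by rw [eval_pairForm_wed]; exact hzz t ht h)
  have e : C α * T.pairForm (wed z a) + C β * T.pairForm (wed z' a) =
      T.pairForm (wed (α • z + β • z') a) := MvPolynomial.funext fun t => by
    rw [map_add, map_mul, map_mul, eval_C, eval_C, eval_pairForm_wed,
      eval_pairForm_wed, eval_pairForm_wed, dt_add_left, dt_smul_left, dt_smul_left]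
  rw [e] at hφ0 hφ
  refine ⟨α • z + β • z', hφ0, fun t ht h => ⟨(hφ t ht h).2, fun t' c htt hy hy' => hφ0 ?_⟩⟩
  have h5 := hEu t (hφ _ ht h).1 t' (α • z + β • z' - c • a) htt hy hy' (pair_wed_combination _ _ _ _ _ _)
  refine MvPolynomial.funext fun s => ?_
  rw [eval_pairForm_wed, sub_eq_zero.1 h5, dt_smul_left, dt_Ns_self, mul_zero, map_zero]

end Scroll

namespace Surface
variable (S : Surface)

/-- On the line of `exists_transversal_line` the `degree` many rulings have different points, and
these are zeros of the restriction of `F`, a form of degree `k`. -/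
theorem degree_le_k : S.degree ≤ S.k := by
  obtain ⟨a, ha⟩ := exists_eval_ne_zero S.irreducible.ne_zero
  have haOn : ¬ S.On a := fun h => ha (S.vanishes a h)
  have hNa : ∀ t, t ≠ 0 → Ns (S.pl t) a ≠ 0 := fun t ht h => haOn ⟨t, ht, h⟩
  obtain ⟨b, hφ0, hφ⟩ := S.exists_transversal_line haOn
  have hcard := zeros_ncard_eq (S.pairForm_isHomogeneous _) hφ0 fun t ht h => (hφ t ht h).1
  have hc : ∀ t : P1, ∃ c : ℂ, t ∈ zeros (S.pairForm (wed b a)) → Ns (S.pl t.rep) (b - c • a) = 0 := by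
    intro t
    by_cases ht : t ∈ zeros (S.pairForm (wed b a))
    · have h4 : dt b (Ns (S.pl t.rep) a) = 0 := by rw [← eval_pairForm_wed]; exact ht
      obtain ⟨c, y, hy, hby⟩ := exists_of_dt_Ns (S.pf_pl _) (hNa _ t.rep_nonzero) h4
      exact ⟨c, fun _ => by rw [hby, add_sub_cancel_left, hy]⟩
    · exact ⟨0, fun h => absurd h ht⟩
  choose c hc using hc
  have e1 : ∀ r : ℂ, (![1, r] : Fin 2 → ℂ) ≠ 0 := fun r h => by simpa using congrFun h 0
  have hGk := restrict_isHomogeneous S.isHomogeneous b a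
  have hG0 : restrict S.F b a ≠ 0 := by
    intro h
    apply ha
    have := eval_restrict S.F b a ![0, 1]
    rw [h, map_zero] at this
    simpa using this.symm
  let τ : P1 → P1 := fun t => Projectivization.mk ℂ ![1, -c t] (e1 _)
  have hτ : Set.MapsTo τ (zeros (S.pairForm (wed b a))) (zeros (restrict S.F b a)) := by
    intro t ht
    change Projectivization.mk ℂ _ _ ∈ _
    rw [mk_mem_zeros hGk, eval_restrict]
    have := S.vanishes (b - c t • a) ⟨t.rep, t.rep_nonzero, hc t ht⟩
    simpa [sub_eq_add_neg] using this
  have hinj : Set.InjOn τ (zeros (S.pairForm (wed b a))) := by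
    intro t ht t' ht' h
    have hcc : c t = c t' := by
      have := (mk_eq_mk_iff_wedge _ _).1 h
      simp [wedge] at this
      linear_combination this
    by_contra htt
    have hy' := hc t' ht'
    rw [← hcc] at hy'
    exact (hφ t.rep t.rep_nonzero ht).2 t'.rep (c t)
      (fun h6 => htt ((wedge_rep _ _).1 h6).symm) (hc t ht) hy'
  have hfin := zeros_finite hGk hG0
  rw [← hcard]
  exact (Set.ncard_le_ncard_of_injOn τ hτ hinj hfin.1).trans hfin.2

theorem degree_eq : S.degree = S.k := S.degree_le_k.antisymm S.k_le_degree

variable {S}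

/-- A smooth point lies on one ruling only. -/
theorem Smooth.wedge_eq_zero {x : Fin 4 → ℂ} (hx : S.Smooth x) {u t : Fin 2 → ℂ} (hu : u ≠ 0)
    (ht : t ≠ 0) (h : Ns (S.pl u) x = 0) (h' : Ns (S.pl t) x = 0) : wedge u t = 0 := by
  by_contra hut
  have h1 := hx.ncard_add_le (Set.toFinite {Projectivization.mk ℂ u hu, Projectivization.mk ℂ t ht}) (by
    rintro _ (rfl | rfl)
    · exact (Ns_pl_rep _ hu).2 h
    · exact (Ns_pl_rep _ ht).2 h')
  rw [Set.ncard_pair (fun h2 => hut ((mk_eq_mk_iff_wedge hu ht).1 h2)), S.degree_eq] at h1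
  have := S.three_le
  omega

/-- The family of rulings is transversal at a smooth point. -/
theorem Smooth.Ns_der_ne_zero {x : Fin 4 → ℂ} (hx : S.Smooth x) {u w : Fin 2 → ℂ}
    (h : Ns (S.pl u) x = 0) (hw : wedge u w ≠ 0) : Ns (S.der u w) x ≠ 0 := by
  intro h0
  have hu : u ≠ 0 := by rintro rfl; simp [wedge] at hw
  obtain ⟨b, hb0, Z, hZ, hc, hn⟩ := hx.exists_zeros.exists
  have hd := S.pairForm_isHomogeneous (wed b x)
  have hz : eval u (S.pairForm (wed b x)) = 0 := by rw [eval_pairForm_wed, h, dt_zero_right]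
  obtain ⟨e, g, he, hg, hfg⟩ := IsHomogeneous.exists_eq_lin_mul hd hb0 hu hz
  have h1 : eval u (D w (S.pairForm (wed b x))) = 0 := by
    rw [eval_D_pairForm_wed, h0, dt_zero_right]
  -- The ruling `u` would be a double zero. Then `g`, of degree `k - 1`, would vanish at `u` and at
  -- the `k - 1` rulings of `Z`.
  have hg0 : eval u g = 0 := by
    rw [hfg, D_mul, D_lin, map_add, map_mul, map_mul, eval_lin, wedge_self, zero_mul, zero_add,
      eval_C, mul_eq_zero] at h1
    refine h1.resolve_right fun h2 => hw ?_
    rw [wedge_swap, h2, neg_zero]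
  have hgne : g ≠ 0 := by rintro rfl; rw [mul_zero] at hfg; exact hb0 hfg
  have hfin := zeros_finite hg hgne
  rw [hfg, zeros_lin_mul hu] at hZ
  have hu' : Projectivization.mk ℂ u hu ∉ Z := fun h2 => hn _ h2 ((Ns_pl_rep _ hu).2 h)
  have hsub : insert (Projectivization.mk ℂ u hu) Z ⊆ zeros g := by
    intro t ht
    rcases ht with rfl | ht
    · exact (mk_mem_zeros hg hu).2 hg0
    · rcases hZ ht with rfl | h2
      · exact absurd ht hu'
      · exact h2
  have h3 := (Set.ncard_le_ncard hsub hfin.1).trans hfin.2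
  rw [Set.ncard_insert_of_notMem hu' (hfin.1.subset ((Set.subset_insert _ _).trans hsub)), hc] at h3
  have := S.degree_eq
  have := S.three_le
  omega

/-- The tangent plane at a smooth point joins the ruling and its derivative. -/
theorem Smooth.exists_grad {x : Fin 4 → ℂ} (hx : S.Smooth x) {u w : Fin 2 → ℂ}
    (h : Ns (S.pl u) x = 0) (hw : wedge u w ≠ 0) :
    ∃ c : ℂ, c ≠ 0 ∧ ∀ v, eval x (D v S.F) = c * dt v (Ns (S.der u w) x) := by
  have hu : u ≠ 0 := by rintro rfl; simp [wedge] at hw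
  obtain ⟨c, hc⟩ := S.vanishes.exists_grad hu h (hx.Ns_der_ne_zero h hw)
  refine ⟨c, ?_, hc⟩
  rintro rfl
  obtain ⟨-, v, hv⟩ := hx
  exact hv (by rw [hc, zero_mul])

end Surface

/-! ### Parametrized curves -/

theorem eventually_ne_zero : ∀ᶠ u in gen (Fin 2), u ≠ 0 := by
  filter_upwards [(Pol.coord (0 : Fin 2)).eventually_ne (v := 1) (by simp)] with u h0
  rintro rfl
  simp at h0

theorem finite_of_eventually {P : (Fin 2 → ℂ) → Prop} (hP : ∀ (c : ℂ) u, c ≠ 0 → P u → P (c • u))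
    (h : ∀ᶠ u in gen (Fin 2), P u) : {u : P1 | ¬ P u.rep}.Finite := by
  obtain ⟨d, f, hf, hf0, h⟩ := exists_form_of_eventually hP h
  refine (zeros_finite hf hf0).1.subset fun u hu => ?_
  by_contra h0
  exact hu (h _ h0)

theorem eventually_of_finite {A : Set P1} (hA : A.Finite) :
    ∀ᶠ u in gen (Fin 2), ∀ t ∈ A, wedge t.rep u ≠ 0 := by
  induction A, hA using Set.Finite.induction_on with
  | empty => simp
  | @insert t A _ _ ih =>
    obtain ⟨w, hw⟩ := exists_wedge_ne_zero t.rep_nonzero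
    have hp : Pol fun u => wedge t.rep u := Pol.wedge (fun _ => Pol.const _) Pol.coord
    filter_upwards [ih, hp.eventually_ne hw] with u h1 h2 s hs
    rcases hs with rfl | hs
    exacts [h2, h1 s hs]

theorem smul_of_mk_eq {n : ℕ} {v w : Fin n → ℂ} {hv : v ≠ 0} {hw : w ≠ 0}
    (h : Projectivization.mk ℂ v hv = Projectivization.mk ℂ w hw) : ∃ c : ℂ, c ≠ 0 ∧ v = c • w := by
  obtain ⟨c, hc⟩ := (Projectivization.mk_eq_mk_iff' ℂ v w hv hw).1 h
  refine ⟨c, ?_, hc.symm⟩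
  rintro rfl
  exact hv (by rw [← hc, zero_smul])

theorem mk_eq_of_smul {n : ℕ} {v w : Fin n → ℂ} {hv : v ≠ 0} {hw : w ≠ 0} {c : ℂ} (h : v = c • w) :
    Projectivization.mk ℂ v hv = Projectivization.mk ℂ w hw :=
  (Projectivization.mk_eq_mk_iff' ℂ v w hv hw).2 ⟨c, h.symm⟩

namespace RationalMap
variable (c : RationalMap)

/-- The value of a morphism in homogeneous coordinates. -/
noncomputable def val (u : Fin 2 → ℂ) : Fin 4 → ℂ := ev c.form u

theorem val_ne_zero {u : Fin 2 → ℂ} (hu : u ≠ 0) : c.val u ≠ 0 := fun h => by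
  obtain ⟨i, hi⟩ := c.base_point_free u hu
  exact hi (congrFun h i)

theorem val_smul (r : ℂ) (u : Fin 2 → ℂ) : c.val (r • u) = r ^ c.degree • c.val u :=
  ev_smul c.homogeneous r u

theorem pol_val (i : Fin 4) : Pol fun u => c.val u i := Pol.ev _ i

theorem pt_eq (u : P1) : c.pt u = Projectivization.mk ℂ (c.val u.rep) (c.val_ne_zero u.rep_nonzero) :=
  rfl

theorem pt_mk {u : Fin 2 → ℂ} (hu : u ≠ 0) :
    c.pt (Projectivization.mk ℂ u hu) = Projectivization.mk ℂ (c.val u) (c.val_ne_zero hu) := by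
  obtain ⟨r, -, h⟩ := rep_mk hu
  rw [pt_eq]
  refine mk_eq_of_smul (c := r ^ c.degree) ?_
  rw [h, val_smul]

theorem mk_mem_range {v : Fin 4 → ℂ} (hv : v ≠ 0) :
    Projectivization.mk ℂ v hv ∈ Set.range c.pt ↔ ∃ u, u ≠ 0 ∧ ∃ r : ℂ, v = r • c.val u := by
  constructor
  · rintro ⟨u, h⟩
    rw [pt_eq] at h
    obtain ⟨r, -, hr⟩ := smul_of_mk_eq h.symm
    exact ⟨u.rep, u.rep_nonzero, r, hr⟩
  · rintro ⟨u, hu, r, h⟩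
    exact ⟨Projectivization.mk ℂ u hu, by rw [pt_mk]; exact (mk_eq_of_smul h).symm⟩

/-- The equations of the points of a parametrized curve. -/
noncomputable def eqns (ij : Fin 4 × Fin 4) (l : Fin 4) : MvPolynomial (Fin 2) ℂ :=
  (if l = ij.1 then c.form ij.2 else 0) - (if l = ij.2 then c.form ij.1 else 0)

theorem eval_comb_eqns (ij : Fin 4 × Fin 4) (x : Fin 4 → ℂ) (u : Fin 2 → ℂ) :
    eval u (comb (c.eqns ij) x) = x ij.1 * c.val u ij.2 - x ij.2 * c.val u ij.1 := by
  simp only [eval_comb, eqns, map_sub, mul_sub, Finset.sum_sub_distrib, apply_ite (eval u), map_zero,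
    mul_ite, mul_zero, Finset.sum_ite_eq', Finset.mem_univ, if_true]
  rfl

theorem swept_eqns {x : Fin 4 → ℂ} :
    Swept c.eqns x ↔ ∃ u, u ≠ 0 ∧ ∃ r : ℂ, x = r • c.val u := by
  refine exists_congr fun u => and_congr_right fun hu => ?_
  simp only [eval_comb_eqns, sub_eq_zero]
  constructor
  · intro h
    exact exists_smul_of_cross (c.val_ne_zero hu) fun i j => h (i, j)
  · rintro ⟨r, rfl⟩ ij
    simp only [Pi.smul_apply, smul_eq_mul]
    ring

/-- The image of a morphism is closed. -/
theorem closure_range (hc : c.degree ≠ 0) : zariskiClosure (Set.range c.pt) = Set.range c.pt := by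
  refine Set.Subset.antisymm (fun x hx => ?_) (subset_zariskiClosure _)
  by_contra h
  rw [← x.mk_rep, mk_mem_range, ← swept_eqns] at h
  obtain ⟨d, H, hH, h0, hne⟩ := exists_separating_form hc (fun ij l => by
    unfold eqns
    refine IsHomogeneous.sub ?_ ?_ <;> split_ifs <;>
      first
      | exact c.homogeneous _
      | exact isHomogeneous_zero _ _ _) h
  refine hne (hx d H hH ((vanishesOn_iff hH).2 fun v hv hvr => h0 v ?_))
  exact c.swept_eqns.2 ((c.mk_mem_range hv).1 hvr)

/-- A morphism is generically injective. -/
def GenericallyInjective : Prop :=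
  ∀ᶠ u in gen (Fin 2), ∀ t, t ≠ 0 → (∃ r : ℂ, c.val t = r • c.val u) → wedge t u = 0

variable {c}

theorem GenericallyInjective.degree_ne_zero (h : c.GenericallyInjective) : c.degree ≠ 0 := by
  intro h0
  obtain ⟨u, hu, hu0⟩ := (h.and eventually_ne_zero).exists
  obtain ⟨w, hw⟩ := exists_wedge_ne_zero hu0
  have hw0 : w ≠ 0 := by rintro rfl; simp [wedge] at hw
  refine hw ?_
  rw [wedge_swap, hu w hw0 ⟨1, ?_⟩, neg_zero]
  rw [one_smul]
  ext i
  have := c.homogeneous i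
  rw [h0] at this
  exact form_degree_zero this _ _

theorem isProperParametrization_iff {C : Set P3} :
    IsProperParametrization c C ↔ c.GenericallyInjective ∧ C = Set.range c.pt := by
  have key : {u : P1 | ∃ v, v ≠ u ∧ c.pt v = c.pt u}.Finite ↔ c.GenericallyInjective := by
    constructor
    · intro h
      filter_upwards [eventually_of_finite h, eventually_ne_zero] with u hu hu0 t ht ⟨r, hr⟩
      by_contra htu
      refine hu (Projectivization.mk ℂ u hu0) ⟨Projectivization.mk ℂ t ht, ?_, ?_⟩ ?_
      · rwa [Ne, mk_eq_mk_iff_wedge]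
      · rw [pt_mk, pt_mk]
        exact mk_eq_of_smul hr
      · obtain ⟨s, -, hs⟩ := rep_mk hu0
        rw [hs, wedge_smul_left, wedge_self, mul_zero]
    · intro h
      refine (finite_of_eventually ?_ h).subset ?_
      · rintro a u ha hu t ht ⟨r, hr⟩
        rw [wedge_smul_right, hu t ht ⟨r * a ^ c.degree, by rw [hr, val_smul, smul_smul]⟩, mul_zero]
      · rintro u ⟨v, hvu, h1⟩ h2
        obtain ⟨r, -, hr⟩ := smul_of_mk_eq h1
        exact hvu ((wedge_rep _ _).1 (h2 v.rep v.rep_nonzero ⟨r, hr⟩))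
  constructor
  · rintro ⟨h1, h2⟩
    have h3 := key.1 h2
    exact ⟨h3, h1.trans (closure_range _ h3.degree_ne_zero)⟩
  · rintro ⟨h1, h2⟩
    exact ⟨h2.trans (closure_range _ h1.degree_ne_zero).symm, key.2 h1⟩

end RationalMap

theorem eval_form_one {A : MvPolynomial (Fin 2) ℂ} (hA : A.IsHomogeneous 1) (u : Fin 2 → ℂ) :
    eval u A = u 0 * eval ![1, 0] A + u 1 * eval ![0, 1] A := by
  have h : ∀ u, eval u A = u 0 * eval 0 (pderiv 0 A) + u 1 * eval 0 (pderiv 1 A) := by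
    intro u
    have h1 := euler hA u
    rw [eval_D, Fin.sum_univ_two] at h1
    have h2 : ∀ i, eval u (pderiv i A) = eval 0 (pderiv i A) := fun i =>
      form_degree_zero (by simpa using hA.pderiv (i := i)) _ _
    rw [h2, h2] at h1
    simpa using h1.symm
  rw [h u, h ![1, 0], h ![0, 1]]
  simp

theorem exists_linearEquiv {A B : MvPolynomial (Fin 2) ℂ} (hA : A.IsHomogeneous 1)
    (hB : B.IsHomogeneous 1) (hAB : ∀ u, u ≠ 0 → eval u A ≠ 0 ∨ eval u B ≠ 0) :
    ∃ α : (Fin 2 → ℂ) ≃ₗ[ℂ] (Fin 2 → ℂ), ∀ u, α u = ![eval u A, eval u B] := by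
  let φ : (Fin 2 → ℂ) →ₗ[ℂ] (Fin 2 → ℂ) :=
    { toFun := fun u => ![eval u A, eval u B]
      map_add' := fun u v => by
        rw [eval_form_one hA (u + v), eval_form_one hB (u + v), eval_form_one hA u, eval_form_one hA v,
          eval_form_one hB u, eval_form_one hB v]
        ext i; fin_cases i <;> simp <;> ring
      map_smul' := fun c u => by
        rw [eval_smul_form hA, eval_smul_form hB]
        ext i; fin_cases i <;> simp }
  have hφ : Function.Injective φ := by
    rw [← LinearMap.ker_eq_bot, LinearMap.ker_eq_bot']
    intro u hu
    by_contra h0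
    rcases hAB u h0 with h | h
    · exact h (congrFun hu 0)
    · exact h (congrFun hu 1)
  exact ⟨LinearEquiv.ofInjectiveEndo φ hφ, fun u => rfl⟩

theorem det_ne_zero {A B : MvPolynomial (Fin 2) ℂ} (hA : A.IsHomogeneous 1)
    (hB : B.IsHomogeneous 1) (hAB : ∀ u, u ≠ 0 → eval u A ≠ 0 ∨ eval u B ≠ 0) :
    eval ![1, 0] A * eval ![0, 1] B - eval ![0, 1] A * eval ![1, 0] B ≠ 0 := by
  intro h
  have h1 : ∀ u, eval u A = 0 → eval u B = 0 → u = 0 := fun u hu hu' => by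
    by_contra h0
    rcases hAB u h0 with h | h
    exacts [h hu, h hu']
  have z0 : (![eval ![0, 1] A, -eval ![1, 0] A] : Fin 2 → ℂ) = 0 := by
    apply h1
    · rw [eval_form_one hA]; simp; ring
    · rw [eval_form_one hB]; simp; linear_combination -h
  have z1 : (![eval ![0, 1] B, -eval ![1, 0] B] : Fin 2 → ℂ) = 0 := by
    apply h1
    · rw [eval_form_one hA]; simp; linear_combination h
    · rw [eval_form_one hB]; simp; ring
  have e0 := congrFun z0 1
  have e1 := congrFun z1 1
  simp at e0 e1
  have := congrFun (h1 _ e0 e1) 0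
  simp at this

namespace RationalMap
variable {c : RationalMap}

/-- If the curve factors through `(A, B)`, then `(A, B)` is itself generically injective, hence
linear. -/
theorem GenericallyInjective.degree_eq_one (hc : c.GenericallyInjective)
    {A B : MvPolynomial (Fin 2) ℂ} {e d : ℕ} (hA : A.IsHomogeneous e) (hB : B.IsHomogeneous e)
    (hAB : ∀ u, u ≠ 0 → eval u A ≠ 0 ∨ eval u B ≠ 0) {g : Fin 4 → MvPolynomial (Fin 2) ℂ}
    (hg : ∀ i, (g i).IsHomogeneous d)
    (h : ∀ u, u ≠ 0 → ∃ r : ℂ, c.val u = r • ev g ![eval u A, eval u B]) : e = 1 := by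
  refine degree_eq_one_of_generically_injective hA hB hAB ?_
  filter_upwards [hc, eventually_ne_zero] with u hu hu0 t ht hut
  have hM : ![eval u A, eval u B] ≠ (0 : Fin 2 → ℂ) := fun h0 => by
    rcases hAB u hu0 with h | h
    · exact h (congrFun h0 0)
    · exact h (congrFun h0 1)
  obtain ⟨s, hs⟩ := exists_smul_of_wedge (u := ![eval t A, eval t B]) hM (by
    simp [wedge]; linear_combination -hut)
  obtain ⟨r, hr⟩ := h u hu0
  obtain ⟨r', hr'⟩ := h t ht
  have hr0 : r ≠ 0 := by
    rintro rfl
    exact c.val_ne_zero hu0 (by rw [hr, zero_smul])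
  refine hu t ht ⟨r' * s ^ d * r⁻¹, ?_⟩
  rw [hr', hs, ev_smul hg, hr, smul_smul, smul_smul, mul_assoc, inv_mul_cancel₀ hr0, mul_one]

theorem GenericallyInjective.not_const (hc : c.GenericallyInjective) :
    ∃ u t i j, eval u (c.form i) * eval t (c.form j) ≠ eval u (c.form j) * eval t (c.form i) := by
  by_contra! h
  obtain ⟨u, hu, hu0⟩ := (hc.and eventually_ne_zero).exists
  obtain ⟨w, hw⟩ := exists_wedge_ne_zero hu0
  have hw0 : w ≠ 0 := by rintro rfl; simp [wedge] at hw
  refine hw ?_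
  rw [wedge_swap, hu w hw0 (exists_smul_of_cross (c.val_ne_zero hu0) fun i j => ?_), neg_zero]
  exact h w u i j

/-- The rational inverse of a generically injective morphism. -/
theorem GenericallyInjective.exists_inverse (hc : c.GenericallyInjective) :
    ∃ (k : ℕ) (Φ Ψ : MvPolynomial (Fin 4) ℂ), Φ.IsHomogeneous k ∧ Ψ.IsHomogeneous k ∧
      (∃ u, eval (c.val u) Φ ≠ 0 ∨ eval (c.val u) Ψ ≠ 0) ∧
      ∀ u : Fin 2 → ℂ, u 0 * eval (c.val u) Ψ = u 1 * eval (c.val u) Φ := by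
  obtain ⟨d, e, k, g, A, B, Φ, Ψ, he, hg, hbpf, hA, hB, hAB, hfg, hΦ, hΨ, hΨ0, hinv⟩ :=
    exists_luroth (f := c.form) c.homogeneous hc.not_const
  have hABne : ∀ u, u ≠ 0 → ![eval u A, eval u B] ≠ (0 : Fin 2 → ℂ) := fun u hu h0 => by
    rcases hAB u hu with h | h
    · exact h (congrFun h0 0)
    · exact h (congrFun h0 1)
  have hline : ∀ u, u ≠ 0 → ∃ r : ℂ, c.val u = r • ev g ![eval u A, eval u B] := fun u hu =>
    exists_smul_of_cross (fun h0 => by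
      obtain ⟨i, hi⟩ := hbpf _ (hABne u hu)
      exact hi (congrFun h0 i)) (hfg u)
  obtain rfl := hc.degree_eq_one hA hB hAB hg hline
  have hD := det_ne_zero hA hB hAB
  obtain ⟨α, hα⟩ := exists_linearEquiv hA hB hAB
  have e1 := fun u => eval_form_one hA u
  have e2 := fun u => eval_form_one hB u
  generalize eval ![1, 0] A = a₀ at *
  generalize eval ![0, 1] A = a₁ at *
  generalize eval ![1, 0] B = b₀ at *
  generalize eval ![0, 1] B = b₁ at *
  have hh : ∀ c : ℂ, ∀ {Θ : MvPolynomial (Fin 4) ℂ}, Θ.IsHomogeneous k →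
      (C c * Θ).IsHomogeneous k := fun c Θ h => by
    simpa using (isHomogeneous_C _ c).mul h
  -- The inverse from Lüroth's theorem is composed with the adjugate of the linear map `(A, B)`.
  refine ⟨k, C b₁ * Φ - C a₁ * Ψ, C a₀ * Ψ - C b₀ * Φ, (hh _ hΦ).sub (hh _ hΨ),
    (hh _ hΨ).sub (hh _ hΦ), ?_, fun u => ?_⟩
  · obtain ⟨u₀, hu₀⟩ := hΨ0
    have hp : Pol fun u => eval (ev g u) Ψ := Pol.evalComp _ fun i => Pol.ev g i
    obtain ⟨u, hu, hu0⟩ := ((hp.eventually_ne hu₀).and eventually_ne_zero).exists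
    have hv0 : α.symm u ≠ 0 := by simpa using hu0
    refine ⟨α.symm u, ?_⟩
    obtain ⟨r, hr⟩ := hline _ hv0
    rw [← hα, LinearEquiv.apply_symm_apply] at hr
    have hr0 : r ≠ 0 := by
      rintro rfl
      exact c.val_ne_zero hv0 (by rw [hr, zero_smul])
    rw [hr]
    by_contra! h
    simp only [map_sub, map_mul, eval_C, eval_smul_form hΦ, eval_smul_form hΨ] at h
    refine mul_ne_zero hD (mul_ne_zero (pow_ne_zero k hr0) hu) ?_
    linear_combination b₀ * h.1 + b₁ * h.2
  · by_cases hu : u = 0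
    · simp [hu]
    obtain ⟨r, hr⟩ := hline u hu
    have h := hinv ![eval u A, eval u B]
    change _ * eval (ev g _) Ψ = _ * eval (ev g _) Φ at h
    simp only [Matrix.cons_val_zero, Matrix.cons_val_one] at h
    rw [hr]
    simp only [map_sub, map_mul, eval_C, eval_smul_form hΦ, eval_smul_form hΨ]
    generalize eval (ev g ![eval u A, eval u B]) Φ = P at *
    generalize eval (ev g ![eval u A, eval u B]) Ψ = Q at *
    rw [e1, e2] at h
    linear_combination r ^ k * h

/-- A morphism whose values lie on a properly parametrized curve factors through it. -/
theorem GenericallyInjective.exists_lift (hc : c.GenericallyInjective)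
    {f : Fin 4 → MvPolynomial (Fin 2) ℂ} {m : ℕ} (hf : ∀ i, (f i).IsHomogeneous m)
    (hnc : ∃ u t i j, eval u (f i) * eval t (f j) ≠ eval u (f j) * eval t (f i))
    (h : ∀ᶠ σ in gen (Fin 2), ∃ u, u ≠ 0 ∧ ∃ r : ℂ, ev f σ = r • c.val u) :
    ∃ (e : ℕ) (A B : MvPolynomial (Fin 2) ℂ), A.IsHomogeneous e ∧ B.IsHomogeneous e ∧
      (∀ u, u ≠ 0 → eval u A ≠ 0 ∨ eval u B ≠ 0) ∧
      ∀ σ i j, ev f σ i * c.val ![eval σ A, eval σ B] j = ev f σ j * c.val ![eval σ A, eval σ B] i := by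
  obtain ⟨k, Φ, Ψ, hΦ, hΨ, ⟨u₀, hu₀⟩, hinv⟩ := hc.exists_inverse
  obtain ⟨Θ, hΘ, hΘ0, hΘz⟩ : ∃ Θ : MvPolynomial (Fin 4) ℂ, Θ.IsHomogeneous k ∧
      eval (c.val u₀) Θ ≠ 0 ∧ ∀ v, eval v Θ ≠ 0 → eval v Φ ≠ 0 ∨ eval v Ψ ≠ 0 := by
    rcases hu₀ with h | h
    exacts [⟨Φ, hΦ, h, fun _ => Or.inl⟩, ⟨Ψ, hΨ, h, fun _ => Or.inr⟩]
  have hΘc : (aeval c.form Θ : MvPolynomial (Fin 2) ℂ).IsHomogeneous (c.degree * k) :=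
    hΘ.aeval (S := ℂ) c.form (n := c.degree) c.homogeneous
  have hev : ∀ (Θ : MvPolynomial (Fin 4) ℂ) t, eval t (aeval c.form Θ) = eval (c.val t) Θ :=
    fun Θ t => eval_aeval _ _ _
  have hevf : ∀ (Θ : MvPolynomial (Fin 4) ℂ) t, eval t (aeval f Θ) = eval (ev f t) Θ :=
    fun Θ t => eval_aeval _ _ _
  -- The rational inverse may be undefined only at finitely many points of the curve. A non-constant
  -- `f` passes through none of them for generic `σ`.
  have hbad := eventually_forall_zero (l := gen (Fin 2)) hΘc
    (fun h0 => hΘ0 (by rw [← hev, h0, map_zero]))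
    (Q := fun t σ => ∃ i j, ev f σ i * c.val t j - ev f σ j * c.val t i ≠ 0)
    (by
      rintro r t σ hr ⟨i, j, hij⟩
      refine ⟨i, j, fun h0 => mul_ne_zero (pow_ne_zero c.degree hr) hij ?_⟩
      rw [val_smul] at h0
      simp only [Pi.smul_apply, smul_eq_mul] at h0
      linear_combination h0)
    (fun t ht _ => by
      have hp : ∀ i j, Pol fun σ => ev f σ i * c.val t j - ev f σ j * c.val t i := fun i j =>
        ((Pol.ev f i).mul (Pol.const _)).sub ((Pol.ev f j).mul (Pol.const _))
      by_contra h0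
      have h1 : ∀ i j σ, ev f σ i * c.val t j - ev f σ j * c.val t i = 0 := by
        intro i j σ
        by_contra h2
        exact h0 (((hp i j).eventually_ne h2).mono fun σ' h3 => ⟨i, j, h3⟩)
      obtain ⟨σ, τ, i, j, hne⟩ := hnc
      obtain ⟨r, hr⟩ := exists_smul_of_cross (c.val_ne_zero ht) fun i j => sub_eq_zero.1 (h1 i j σ)
      obtain ⟨s, hs⟩ := exists_smul_of_cross (c.val_ne_zero ht) fun i j => sub_eq_zero.1 (h1 i j τ)
      refine hne ?_
      change ev f σ i * ev f τ j = ev f σ j * ev f τ i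
      rw [hr, hs]
      simp only [Pi.smul_apply, smul_eq_mul]
      ring)
  have hfne : ∀ᶠ σ in gen (Fin 2), ev f σ ≠ 0 := by
    obtain ⟨σ, τ, i, j, hne⟩ := hnc
    have : ∃ σ i, ev f σ i ≠ 0 := by
      by_contra! h0
      refine hne ?_
      change ev f σ i * ev f τ j = ev f σ j * ev f τ i
      rw [h0 σ i, h0 σ j]
      ring
    obtain ⟨σ, i, hi⟩ := this
    filter_upwards [(Pol.ev f i).eventually_ne hi] with τ hτ h0
    exact hτ (by rw [h0]; rfl)
  have hmain : ∀ᶠ σ in gen (Fin 2), (eval σ (aeval f Φ) ≠ 0 ∨ eval σ (aeval f Ψ) ≠ 0) ∧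
      ∀ i j, ev f σ i * c.val ![eval σ (aeval f Φ), eval σ (aeval f Ψ)] j =
        ev f σ j * c.val ![eval σ (aeval f Φ), eval σ (aeval f Ψ)] i := by
    filter_upwards [h, hbad, hfne] with σ ⟨u, hu, r, hr⟩ hσ hσ0
    have hr0 : r ≠ 0 := by
      rintro rfl
      exact hσ0 (by rw [hr, zero_smul])
    have h1 : eval (c.val u) Θ ≠ 0 := by
      intro h0
      obtain ⟨i, j, hij⟩ := hσ u hu (by rw [hev, h0])
      apply hij
      rw [hr]
      simp only [Pi.smul_apply, smul_eq_mul]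
      ring
    rw [hevf, hevf]
    have h2 : eval (ev f σ) Φ = r ^ k * eval (c.val u) Φ := by rw [hr, eval_smul_form hΦ]
    have h3 : eval (ev f σ) Ψ = r ^ k * eval (c.val u) Ψ := by rw [hr, eval_smul_form hΨ]
    constructor
    · rw [h2, h3]
      exact (hΘz _ h1).imp (mul_ne_zero (pow_ne_zero _ hr0)) (mul_ne_zero (pow_ne_zero _ hr0))
    · obtain ⟨s, hs⟩ := exists_smul_of_wedge (u := ![eval (ev f σ) Φ, eval (ev f σ) Ψ]) hu (by
        simp only [wedge, h2, h3, Matrix.cons_val_zero, Matrix.cons_val_one]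
        linear_combination -r ^ k * hinv u)
      intro i j
      rw [hs, val_smul, hr]
      simp only [Pi.smul_apply, smul_eq_mul]
      ring
  obtain ⟨σ₀, hσ₀, -⟩ := hmain.exists
  obtain ⟨p, e, q, g, -, hq, -, hg, hfg, hb⟩ := exists_content
    (f := ![(aeval f Φ : MvPolynomial (Fin 2) ℂ), aeval f Ψ]) (d := m * k)
    (by
      intro i; fin_cases i
      · exact hΦ.aeval (S := ℂ) f (n := m) hf
      · exact hΨ.aeval (S := ℂ) f (n := m) hf)
    (by
      rcases hσ₀ with h0 | h0
      · exact ⟨0, fun h1 => h0 (by rw [show (aeval f Φ : MvPolynomial (Fin 2) ℂ) = 0 from h1, map_zero])⟩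
      · exact ⟨1, fun h1 => h0 (by rw [show (aeval f Ψ : MvPolynomial (Fin 2) ℂ) = 0 from h1, map_zero])⟩)
  have g0 : (aeval f Φ : MvPolynomial (Fin 2) ℂ) = q * g 0 := hfg 0
  have g1 : (aeval f Ψ : MvPolynomial (Fin 2) ℂ) = q * g 1 := hfg 1
  refine ⟨e, g 0, g 1, hg 0, hg 1, fun u hu => ?_, fun σ i j => ?_⟩
  · obtain ⟨i, hi⟩ := hb u hu
    fin_cases i
    exacts [Or.inl hi, Or.inr hi]
  · have hpv : ∀ i, Pol fun σ => c.val ![eval σ (g 0), eval σ (g 1)] i := fun i =>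
      Pol.evalComp (c.form i) fun l => by fin_cases l; exacts [⟨_, fun _ => rfl⟩, ⟨_, fun _ => rfl⟩]
    refine sub_eq_zero.1 ((((Pol.ev f i).mul (hpv j)).sub ((Pol.ev f j).mul (hpv i))).eq_zero ?_ σ)
    filter_upwards [hmain] with σ ⟨hσ, h1⟩
    have hq0 : eval σ q ≠ 0 := by
      intro h0
      rw [g0, g1, map_mul, map_mul, h0, zero_mul, zero_mul] at hσ
      simp at hσ
    have h2 : ![eval σ (aeval f Φ), eval σ (aeval f Ψ)] =
        eval σ q • ![eval σ (g 0), eval σ (g 1)] := by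
      rw [g0, g1]
      ext i; fin_cases i <;> simp
    have h3 := h1 i j
    rw [h2, val_smul] at h3
    simp only [Pi.smul_apply, smul_eq_mul] at h3
    refine (mul_eq_zero.1 (?_ : eval σ q ^ c.degree * _ = 0)).resolve_left (pow_ne_zero _ hq0)
    linear_combination h3

/-- Two proper parametrizations of a curve differ by a linear fractional transformation. -/
theorem GenericallyInjective.exists_equiv {c' : RationalMap} (hc : c.GenericallyInjective)
    (hc' : c'.GenericallyInjective) (h : Set.range c'.pt ⊆ Set.range c.pt) :
    ∃ α : (Fin 2 → ℂ) ≃ₗ[ℂ] (Fin 2 → ℂ), ∀ u, u ≠ 0 → ∃ r : ℂ, r ≠ 0 ∧ c'.val u = r • c.val (α u) := by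
  obtain ⟨e, A, B, hA, hB, hAB, hl⟩ := hc.exists_lift c'.homogeneous hc'.not_const (by
    filter_upwards [eventually_ne_zero] with σ hσ
    exact (c.mk_mem_range (c'.val_ne_zero hσ)).1 (h ⟨Projectivization.mk ℂ σ hσ, c'.pt_mk hσ⟩))
  have hABne : ∀ u, u ≠ 0 → ![eval u A, eval u B] ≠ (0 : Fin 2 → ℂ) := fun u hu h0 => by
    rcases hAB u hu with h | h
    · exact h (congrFun h0 0)
    · exact h (congrFun h0 1)
  have hline : ∀ u, u ≠ 0 → ∃ r : ℂ, c'.val u = r • c.val ![eval u A, eval u B] := fun u hu =>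
    exists_smul_of_cross (c.val_ne_zero (hABne u hu)) (hl u)
  obtain rfl := hc'.degree_eq_one hA hB hAB c.homogeneous hline
  obtain ⟨α, hα⟩ := exists_linearEquiv hA hB hAB
  refine ⟨α, fun u hu => ?_⟩
  obtain ⟨r, hr⟩ := hline u hu
  refine ⟨r, ?_, by rw [hα, hr]⟩
  rintro rfl
  exact c'.val_ne_zero hu (by rw [hr, zero_smul])

end RationalMap

/-! ### The contours of a surface -/

theorem exists_rep_eq {n : ℕ} {v : Fin n → ℂ} (hv : v ≠ 0) :
    ∃ c : ℂ, c ≠ 0 ∧ v = c • (Projectivization.mk ℂ v hv).rep := by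
  obtain ⟨c, hc, h⟩ := rep_mk hv
  exact ⟨c⁻¹, inv_ne_zero hc, by rw [h, smul_smul, inv_mul_cancel₀ hc, one_smul]⟩

namespace Surface
variable {S : Surface}

theorem Smooth.smul {x : Fin 4 → ℂ} (hx : S.Smooth x) {c : ℂ} (hc : c ≠ 0) : S.Smooth (c • x) := by
  obtain ⟨h, v, hv⟩ := hx
  exact ⟨h.smul c, v, by
    rw [eval_smul_form (D_isHomogeneous S.isHomogeneous v)]
    exact mul_ne_zero (pow_ne_zero _ hc) hv⟩

theorem Smooth.of_smul {x : Fin 4 → ℂ} {c : ℂ} (hx : S.Smooth (c • x)) : S.Smooth x := by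
  have hc : c ≠ 0 := by
    rintro rfl
    exact hx.ne_zero (zero_smul _ _)
  have := hx.smul (inv_ne_zero hc)
  rwa [smul_smul, inv_mul_cancel₀ hc, one_smul] at this

variable (S)

/-- The points of the surface. -/
def points : Set P3 := {x : P3 | eval x.rep S.F = 0}

theorem mem_points {v : Fin 4 → ℂ} (hv : v ≠ 0) : Projectivization.mk ℂ v hv ∈ S.points ↔ S.On v := by
  rw [← S.eval_eq_zero_iff]
  exact eval_rep_mk S.isHomogeneous hv

theorem mem_smoothLocus {v : Fin 4 → ℂ} (hv : v ≠ 0) :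
    Projectivization.mk ℂ v hv ∈ smoothLocus S.points ↔ S.Smooth v := by
  rw [points, mem_smoothLocus_iff S.irreducible S.isHomogeneous S.k_ne_zero, S.eval_eq_zero_iff]
  obtain ⟨c, hc, h⟩ := exists_rep_eq hv
  constructor
  · intro h1
    rw [h]
    exact Smooth.smul h1 hc
  · intro h1
    rw [h] at h1
    exact h1.of_smul

theorem submodule_le_tangentSpace {v a : Fin 4 → ℂ} (hv : v ≠ 0) (ha : a ≠ 0) (h : S.On v) :
    (Projectivization.mk ℂ a ha).submodule ≤ tangentSpace S.points (Projectivization.mk ℂ v hv) ↔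
      eval v (D a S.F) = 0 := by
  rw [Projectivization.submodule_mk, Submodule.span_singleton_le_iff_mem, points,
    mem_tangentSpace_iff S.irreducible S.isHomogeneous S.k_ne_zero ((S.mem_points hv).2 h)]
  exact eval_rep_mk (D_isHomogeneous S.isHomogeneous a) hv

variable {S}

/-- At a zero of the common factor the contour map is zero for all viewpoints, so `Ns (der u w) x`
would annihilate every vector, whereas the family is transversal at a smooth point. -/
theorem Smooth.h_ne_zero {x : Fin 4 → ℂ} (hx : S.Smooth x) {u : Fin 2 → ℂ} (hu : u ≠ 0)
    (h : Ns (S.pl u) x = 0) : eval u S.h ≠ 0 := by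
  intro h0
  obtain ⟨w, hw⟩ := exists_wedge_ne_zero hu
  obtain ⟨ζ, rfl⟩ := eq_N_of_Ns (S.pl_ne_zero hu) h
  refine hx.Ns_der_ne_zero h hw (eq_zero_of_dt fun a => ?_)
  obtain ⟨c, hc, h1⟩ := S.contourMap_eq hw a
  rw [Scroll.contourMap_eq_cv, h0, zero_smul, eq_comm, smul_eq_zero, or_iff_right hc] at h1
  rw [dt_Ns, dt_comm, dt_N, h1, dt_zero_right, neg_zero, neg_zero]

/-- The tangency condition puts `x` on the plane `Ns (der u w) a`, which meets the ruling in a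
single point. -/
theorem Smooth.exists_eq_smul_cv {x : Fin 4 → ℂ} (hx : S.Smooth x) {u : Fin 2 → ℂ} (hu : u ≠ 0)
    (h : Ns (S.pl u) x = 0) {a : Fin 4 → ℂ} (ha : eval x (D a S.F) = 0) (hcv : S.cv u a ≠ 0) :
    ∃ c : ℂ, c ≠ 0 ∧ x = c • S.cv u a := by
  have hh := hx.h_ne_zero hu h
  obtain ⟨w, hw⟩ := exists_wedge_ne_zero hu
  obtain ⟨c, hc, hg⟩ := hx.exists_grad h hw
  obtain ⟨r, hr, h1⟩ := S.contourMap_eq hw a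
  rw [Scroll.contourMap_eq_cv] at h1
  rw [hg, mul_eq_zero, or_iff_right hc] at ha
  have hx0 := hx.ne_zero
  obtain ⟨ζ, rfl⟩ := eq_N_of_Ns (S.pl_ne_zero hu) h
  have hN : N (S.pl u) (Ns (S.der u w) a) ≠ 0 := by
    intro h0
    rw [h0, smul_zero, smul_eq_zero] at h1
    exact h1.elim hh hcv
  obtain ⟨s, hs⟩ := exists_smul_N (S.pf_pl u) (z := ζ) (w := Ns (S.der u w) a) (by
    rw [dt_Ns, dt_comm, dt_N, neg_neg] at ha
    exact ha) hN
  have e : N (S.pl u) ζ = (s * r⁻¹ * eval u S.h) • S.cv u a := by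
    rw [hs, mul_smul, h1, smul_smul, mul_assoc, inv_mul_cancel₀ hr, mul_one]
  refine ⟨_, ?_, e⟩
  intro h0
  rw [h0, zero_smul] at e
  exact hx0 e

theorem Smooth.eval_D_cv {u : Fin 2 → ℂ} (hu : u ≠ 0) {a : Fin 4 → ℂ} (hx : S.Smooth (S.cv u a)) :
    eval (S.cv u a) (D a S.F) = 0 := by
  obtain ⟨w, hw⟩ := exists_wedge_ne_zero hu
  obtain ⟨c, hc, hg⟩ := hx.exists_grad (S.Ns_pl_cv u a) hw
  rw [hg, Scroll.dt_Ns_der_cv, mul_zero]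

variable (S)

/-- The viewpoint `a` is outside of the surface, and its contour is a curve of generically smooth
points. -/
def General (a : Fin 4 → ℂ) : Prop :=
  ¬ S.On a ∧ (∀ u, u ≠ 0 → S.cv u a ≠ 0) ∧ ∀ᶠ u in gen (Fin 2), S.Smooth (S.cv u a)

/-- On a regular ruling every point is a contour point: the viewpoint `N (der u w) ζ` has the
contour point `N (pl u) ζ`, since `Ns (der u w)` undoes `N (der u w)` up to the Pfaffian. -/
theorem exists_smooth_cv : ∃ u a, S.Smooth (S.cv u a) := by
  obtain ⟨x, hx⟩ := S.exists_smooth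
  obtain ⟨u₀, hu₀, h⟩ := hx.1
  obtain ⟨ζ, rfl⟩ := eq_N_of_Ns (S.pl_ne_zero hu₀) h
  obtain ⟨-, v, hv⟩ := hx
  have hp : Pol fun u => eval (N (S.pl u) ζ) (D v S.F) :=
    Pol.evalComp _ (Pol.N (z := fun _ => ζ) S.pol_pl fun _ => Pol.const _)
  obtain ⟨u, ⟨hu, hu0⟩, hpf⟩ := (((hp.eventually_ne hv).and eventually_ne_zero).and
    S.eventually_pf_der).exists
  obtain ⟨w, hw⟩ := exists_wedge_ne_zero hu0
  have hs : S.Smooth (N (S.pl u) ζ) := ⟨⟨u, hu0, Ns_N_self (S.pf_pl u) ζ⟩, v, hu⟩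
  obtain ⟨r, hr, h1⟩ := S.contourMap_eq hw (N (S.der u w) ζ)
  rw [Ns_N_of_pf, N_smul_right, Scroll.contourMap_eq_cv, smul_smul] at h1
  have h2 : S.Smooth (eval u S.h • S.cv u (N (S.der u w) ζ)) := by
    rw [h1]
    exact hs.smul (mul_ne_zero hr (neg_ne_zero.2 (hpf w hw)))
  exact ⟨u, _, h2.of_smul⟩

/-- On a regular ruling `cv u a = 0` would put `a` on the surface. Only finitely many rulings
remain, and on each of them a generic `a` has `cv u a ≠ 0`. -/
theorem eventually_general : ∀ᶠ a in gen (Fin 4), S.General a := by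
  have h1 : ∀ᶠ a in gen (Fin 4), ¬ S.On a := by
    obtain ⟨a, ha⟩ := exists_eval_ne_zero S.irreducible.ne_zero
    filter_upwards [(Pol.evalComp S.F Pol.coord).eventually_ne ha] with b hb h
    exact hb (S.vanishes b h)
  obtain ⟨d, f, hf, hf0, hreg⟩ := exists_form_of_eventually
    (P := fun u => ∀ w, wedge u w ≠ 0 → pf (S.der u w) ≠ 0) (fun c u hc h w hw => by
      have hw' : wedge u w ≠ 0 := by
        rw [wedge_smul_left] at hw
        exact right_ne_zero_of_mul hw
      have e : S.der (c • u) w = c ^ (S.degree - 1) • S.der u w :=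
        ev_smul (fun i => D_isHomogeneous (S.homogeneous i) w) c u
      rw [e, pf_smul]
      exact mul_ne_zero (pow_ne_zero _ (pow_ne_zero _ hc)) (h w hw')) S.eventually_pf_der
  have h2 := eventually_forall_zero (l := gen (Fin 4)) hf hf0 (Q := fun u a => S.cv u a ≠ 0)
    (fun c u a hc h => by
      rw [Scroll.cv_smul_left]
      exact smul_ne_zero (pow_ne_zero _ hc) h)
    (fun u hu _ => by
      obtain ⟨a, ha⟩ := S.exists_cv_ne_zero hu
      obtain ⟨i, hi⟩ := Function.ne_iff.1 ha
      have hp : Pol fun a => S.cv u a i := S.pol_cv (u := fun _ => u) (a := fun a => a) (fun _ => Pol.const _) Pol.coord i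
      filter_upwards [hp.eventually_ne hi] with b hb h0
      exact hb (by rw [h0]; rfl))
  obtain ⟨u₀, a₀, hs, v, hv⟩ := S.exists_smooth_cv
  have hp : Pol fun z : Fin 4 ⊕ Fin 2 → ℂ =>
      eval (S.cv (fun i => z (Sum.inr i)) fun i => z (Sum.inl i)) (D v S.F) :=
    Pol.evalComp _ (S.pol_cv (fun _ => Pol.coord _) fun _ => Pol.coord _)
  have h3 := gen_curry (hp.eventually_ne (v := Sum.elim a₀ u₀) hv)
  filter_upwards [h1, h2, h3] with a ha hb hc
  refine ⟨ha, fun u hu h0 => ?_, ?_⟩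
  · by_cases hfu : eval u f = 0
    · exact hb u hu hfu h0
    · obtain ⟨w, hw⟩ := exists_wedge_ne_zero hu
      exact ha ⟨u, hu, S.Ns_pl_of_cv hw (hreg u hfu w hw) h0⟩
  · filter_upwards [hc, eventually_ne_zero] with u hu hu0
    exact ⟨⟨u, hu0, S.Ns_pl_cv u a⟩, v, hu⟩

variable {S}

theorem General.ne_zero {a : Fin 4 → ℂ} (ha : S.General a) : a ≠ 0 := by
  rintro rfl
  exact ha.1 S.On_zero

/-- The contour curve as a morphism. -/
noncomputable def General.curve {a : Fin 4 → ℂ} (ha : S.General a) : RationalMap where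
  degree := S.cdeg
  form := fun i => comb (S.cform i) a
  homogeneous := S.curve_isHomogeneous a
  base_point_free := fun u hu => Function.ne_iff.1 (ha.2.1 u hu)

theorem General.val_curve {a : Fin 4 → ℂ} (ha : S.General a) (u : Fin 2 → ℂ) :
    ha.curve.val u = S.cv u a := rfl

theorem General.generallyInjective {a : Fin 4 → ℂ} (ha : S.General a) :
    ha.curve.GenericallyInjective := by
  filter_upwards [ha.2.2, eventually_ne_zero] with u hu hu0 t ht ⟨r, hr⟩
  rw [ha.val_curve, ha.val_curve] at hr
  have hr0 : r ≠ 0 := by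
    rintro rfl
    exact ha.2.1 t ht (by rw [hr, zero_smul])
  refine hu.wedge_eq_zero ht hu0 ?_ (S.Ns_pl_cv u a)
  have := S.Ns_pl_cv t a
  rwa [hr, Ns_smul_right, smul_eq_zero, or_iff_right hr0] at this

/-- The contour is the contour curve. -/
theorem General.contour_eq {a : Fin 4 → ℂ} (ha : S.General a) :
    contour S.points (Projectivization.mk ℂ a ha.ne_zero) = Set.range ha.curve.pt := by
  rw [← RationalMap.closure_range _ ha.generallyInjective.degree_ne_zero]
  refine zariskiClosure_eq_of ?_ ?_
  · rintro x ⟨hx, hax⟩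
    refine subset_zariskiClosure _ ?_
    have hx0 := x.rep_nonzero
    rw [← x.mk_rep] at hx hax ⊢
    rw [mem_smoothLocus] at hx
    rw [submodule_le_tangentSpace _ _ _ hx.1] at hax
    obtain ⟨u, hu, h⟩ := hx.1
    obtain ⟨c, -, hc⟩ := hx.exists_eq_smul_cv hu h hax (ha.2.1 u hu)
    exact (ha.curve.mk_mem_range hx0).2 ⟨u, hu, c, hc⟩
  · rintro _ ⟨t, rfl⟩ d G hG hG0
    rw [vanishesOn_iff hG] at hG0
    have h1 : ∀ u, eval (S.cv u a) G = 0 := fun u => by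
      refine (Pol.evalComp G (S.pol_curve a)).eq_zero ?_ u
      filter_upwards [ha.2.2, eventually_ne_zero] with u hu hu0
      refine hG0 _ hu.ne_zero ⟨(mem_smoothLocus _ _).2 hu, ?_⟩
      rw [submodule_le_tangentSpace _ _ _ hu.1]
      exact hu.eval_D_cv hu0
    rw [RationalMap.pt_eq]
    exact (eval_rep_mk hG _).2 (h1 _)

theorem General.isProperParametrization {a : Fin 4 → ℂ} (ha : S.General a) :
    IsProperParametrization ha.curve (contour S.points (Projectivization.mk ℂ a ha.ne_zero)) :=
  RationalMap.isProperParametrization_iff.2 ⟨ha.generallyInjective, ha.contour_eq⟩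

end Surface

/-! ### Planes that contain all contour points with respect to one of their points. -/

namespace Scroll
variable (T : Scroll)

/-- A linear form in the Plücker coordinates of the rulings. -/
noncomputable def linForm (c : Fin 6 → ℂ) : MvPolynomial (Fin 2) ℂ := ∑ j, C (c j) * T.form j

theorem linForm_isHomogeneous (c : Fin 6 → ℂ) : (T.linForm c).IsHomogeneous T.degree :=
  IsHomogeneous.sum _ _ _ fun j _ => by simpa using (isHomogeneous_C _ (c j)).mul (T.homogeneous j)

theorem eval_linForm (c : Fin 6 → ℂ) (t : Fin 2 → ℂ) :
    eval t (T.linForm c) = ∑ j, c j * T.pl t j := by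
  simp [linForm, pl, ev]

theorem eval_D_linForm (c : Fin 6 → ℂ) (t w : Fin 2 → ℂ) :
    eval t (D w (T.linForm c)) = ∑ j, c j * T.der t w j := by
  simp [linForm, der, dv]

end Scroll

theorem wed_N_eq_sum (x z : Fin 4 → ℂ) (p : Fin 6 → ℂ) (i : Fin 6) :
    wed x (N p z) i = ∑ j, wed x (N (Pi.single j 1) z) i * p j := by
  rw [Fin.sum_univ_six]
  fin_cases i <;> simp [wed, N] <;> ring

theorem wed_smul_right (c : ℂ) (x y : Fin 4 → ℂ) : wed x (c • y) = c • wed x y := by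
  have := wed_combination x y 1 0 0 c
  simpa using this

theorem wed_smul_left (c : ℂ) (x y : Fin 4 → ℂ) : wed (c • x) y = c • wed x y := by
  have := wed_combination x y c 0 0 1
  simpa using this

theorem wed_sub_right (x y z : Fin 4 → ℂ) : wed x (y - z) = wed x y - wed x z := by
  ext i; fin_cases i <;> simp [wed] <;> ring

/-- Two planes with three independent common points are equal. -/
theorem Ns_wed_eq_zero {x y z π π' : Fin 4 → ℂ} (hxy : wed x y ≠ 0) (h1 : dt x π = 0)
    (h2 : dt y π = 0) (h3 : dt z π = 0) (h1' : dt x π' = 0) (h2' : dt y π' = 0) (h3' : dt z π' = 0)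
    (hπ' : π' ≠ 0) (hπ : ∀ c : ℂ, π ≠ c • π') : Ns (wed x y) z = 0 := by
  by_contra hz
  have key : ∀ π, dt x π = 0 → dt y π = 0 → dt z π = 0 → ∃ c : ℂ, π = c • Ns (wed x y) z := by
    intro π h1 h2 h3
    obtain ⟨ζ, rfl⟩ := eq_Ns_of_N hxy (z := π) (by rw [N_wed, h1, h2]; simp)
    rw [dt_Ns, neg_eq_zero] at h3
    exact exists_smul_Ns (pf_wed x y) h3 hz
  obtain ⟨c, hc⟩ := key π h1 h2 h3
  obtain ⟨c', hc'⟩ := key π' h1' h2' h3'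
  have hc0 : c' ≠ 0 := by
    rintro rfl
    exact hπ' (by rw [hc', zero_smul])
  refine hπ (c * c'⁻¹) ?_
  rw [hc', smul_smul, mul_assoc, inv_mul_cancel₀ hc0, mul_one, hc]

theorem Ns_sub_right (x : Fin 6 → ℂ) (z w : Fin 4 → ℂ) : Ns x (z - w) = Ns x z - Ns x w := by
  rw [sub_eq_add_neg, ← neg_one_smul ℂ w, Ns_add_right, Ns_smul_right, neg_one_smul, sub_eq_add_neg]

namespace Scroll
variable (T : Scroll)

/-- If the contour point on every ruling with respect to `x` lies in a plane through `x`, then the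
points of the rulings in that plane lie on a line through `x`. -/
theorem cross_of_planar {x π : Fin 4 → ℂ} (hx : x ≠ 0) (hxπ : dt x π = 0)
    (h : ∀ t, dt π (T.cv t x) = 0) (s t : Fin 2 → ℂ) (i j : Fin 6) :
    wed x (N (T.pl s) π) i * wed x (N (T.pl t) π) j =
      wed x (N (T.pl t) π) i * wed x (N (T.pl s) π) j := by
  let f : Fin 6 → MvPolynomial (Fin 2) ℂ := fun i =>
    T.linForm fun j => wed x (N (Pi.single j 1) π) i
  have hf : ∀ i t, eval t (f i) = wed x (N (T.pl t) π) i := fun i t => by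
    rw [eval_linForm, wed_N_eq_sum]
  have hdf : ∀ i t w, eval t (D w (f i)) = wed x (N (T.der t w) π) i := fun i t w => by
    rw [eval_D_linForm, wed_N_eq_sum]
  have key := cross_of_wronskian_eval (T.linForm_isHomogeneous _) (T.linForm_isHomogeneous _)
    (f := f i) (g := f j) (fun w => ?_) s t
  · rwa [hf, hf, hf, hf] at key
  obtain ⟨t₀, -, ht₀⟩ := T.exists_pl_not_through hx
  obtain ⟨l, hl⟩ := Function.ne_iff.1 ht₀
  have hp : Pol fun t => Ns (T.pl t) x l :=
    Pol.Ns (z := fun _ => x) T.pol_pl (fun _ => Pol.const _) l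
  filter_upwards [hp.eventually_ne hl] with u hu
  have hu' : Ns (T.pl u) x ≠ 0 := fun h0 => hu (by rw [h0]; rfl)
  rw [hf, hf, hdf, hdf]
  by_cases h0 : wed x (N (T.pl u) π) = 0
  · rw [h0]; simp
  -- The ruling meets the plane `π` in its contour point with respect to `x`, so the tangent plane
  -- there contains `x`.
  have e1 : dt x (Ns (T.der u w) (N (T.pl u) π)) = 0 := by
    have h1 := T.N_pl_Ns_der_eq u w x
    rw [contourMap_eq_cv, smul_smul] at h1
    have h2 := congrArg (dt π) h1
    rw [dt_smul_right, dt_smul_right, h, mul_zero] at h2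
    have h3 := (mul_eq_zero.1 h2).resolve_left T.two_degree_ne_zero
    rw [dt_N, neg_eq_zero] at h3
    rw [dt_Ns, dt_comm, h3, neg_zero]
  -- The point `N (pl u) π` and its velocity lie with `x` in the plane `π` and in the plane of `x`
  -- and the ruling. If these planes differ, the three points are collinear, so the direction from
  -- `x` is stationary. If they coincide, the point is zero.
  have h4 : Ns (wed x (N (T.pl u) π)) (N (T.der u w) π) = 0 := by
    refine Ns_wed_eq_zero (π := π) (π' := Ns (T.pl u) x) h0 hxπ ?_ ?_ (dt_Ns_self _ _) ?_ ?_ hu' ?_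
    · rw [dt_comm, dt_N_self]
    · rw [dt_comm, dt_N_self]
    · rw [dt_Ns, Ns_N_self (T.pf_pl u), dt_zero_right, neg_zero]
    · rw [dt_Ns, Ns_pl_N_der, neg_eq_zero]
      rw [show -Ns (T.der u w) (N (T.pl u) π) = (-1 : ℂ) • Ns (T.der u w) (N (T.pl u) π) by simp,
        dt_smul_right, e1, mul_zero]
    · intro c hc
      apply h0
      rw [hc, N_smul_right, N_Ns_self (T.pf_pl u), smul_zero]
      ext i; fin_cases i <;> simp [wed]
  obtain ⟨α, β, hαβ⟩ := Submodule.mem_span_pair.1 ((mem_span_of_Ns h0).1 h4)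
  have h5 : wed x (N (T.der u w) π) = β • wed x (N (T.pl u) π) := by
    rw [← hαβ]
    have := wed_combination x (N (T.pl u) π) 1 0 α β
    simpa using this
  rw [h5]
  simp only [Pi.smul_apply, smul_eq_mul]
  ring

end Scroll

namespace Surface
variable (S : Surface)

/-- This is where `k ≥ 3` enters the uniqueness. Suppose that the contour with respect to `x = cv u
a` always lies in the plane `π` of `a` and the ruling `u`. Then all rulings meet `π` in points of
one line through `x`. For a smooth point `z` of the ruling `u`, the line `az` lies in `π` and meets
two further rulings in different points. So `az` is that line, hence `x = z`; but `a` was chosen off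
the tangent plane at `z`. -/
theorem exists_planar_ne_zero :
    ∃ a u t, dt (Ns (S.pl u) a) (S.cv t (S.cv u a)) ≠ 0 := by
  by_contra! hcon
  obtain ⟨u, z, hu0, hpair, hz, hzu⟩ : ∃ u z, u ≠ 0 ∧ S.pairForm (S.pl u) ≠ 0 ∧ S.Smooth z ∧
      Ns (S.pl u) z = 0 := by
    obtain ⟨x₀, hx₀⟩ := S.exists_smooth
    obtain ⟨u₀, hu₀, h⟩ := hx₀.1
    obtain ⟨ζ, rfl⟩ := eq_N_of_Ns (S.pl_ne_zero hu₀) h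
    obtain ⟨-, v, hv⟩ := hx₀
    have hp : Pol fun u => eval (N (S.pl u) ζ) (D v S.F) :=
      Pol.evalComp _ (Pol.N (z := fun _ => ζ) S.pol_pl fun _ => Pol.const _)
    obtain ⟨u, ⟨hu, hu0⟩, hpair⟩ := (((hp.eventually_ne hv).and eventually_ne_zero).and
      S.eventually_pairForm_ne_zero).exists
    exact ⟨u, _, hu0, hpair, ⟨⟨u, hu0, Ns_N_self (S.pf_pl u) ζ⟩, v, hu⟩, Ns_N_self (S.pf_pl u) ζ⟩
  obtain ⟨v, hv⟩ := hz.2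
  -- The viewpoint avoids the planes joining `z` to those rulings that meet the ruling `u` but miss
  -- `z`. So the further rulings met by the line `az` are skew to the ruling `u`.
  have hskew := eventually_forall_zero (l := gen (Fin 4)) (S.pairForm_isHomogeneous (S.pl u)) hpair
    (Q := fun t a => Ns (S.pl t) z ≠ 0 → dt a (Ns (S.pl t) z) ≠ 0) (fun c t a hc h => by
      rw [Scroll.pl_smul, Ns_smul_left, dt_smul_right]
      exact fun h1 => mul_ne_zero (pow_ne_zero _ hc) (h (right_ne_zero_of_smul h1)))
    (fun t ht _ => by
      by_cases h0 : Ns (S.pl t) z = 0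
      · exact Eventually.of_forall fun a h => absurd h0 h
      · obtain ⟨z', hz'⟩ := exists_dt_ne_zero h0
        exact ((pol_dt (Ns (S.pl t) z)).eventually_ne (v := z') (by rwa [dt_comm])).mono
          fun a h _ => h)
  have hpD : Pol fun a => eval z (D a S.F) := by
    simp only [eval_D]
    exact Pol.sum _ fun i => (Pol.coord i).mul (Pol.const _)
  obtain ⟨a, ⟨⟨⟨⟨ha, haskew⟩, haz⟩, hφ, Z, hZ, hZc, hZt⟩, haD⟩⟩ := ((((S.eventually_general.and hskew).and
    (eventually_simple_roots S.irreducible hz.D_ne_zero)).and hz.exists_zeros).and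
      (hpD.eventually_ne hv)).exists
  set x := S.cv u a with hx
  have hx0 : x ≠ 0 := ha.2.1 u hu0
  have hau : Ns (S.pl u) a ≠ 0 := fun h => ha.1 ⟨u, hu0, h⟩
  set π := Ns (S.pl u) a with hπ
  have hline : ∀ y, Ns (S.pl u) y = 0 → dt π y = 0 := fun y hy => by
    rw [hπ, dt_comm, dt_Ns, hy, dt_zero_right, neg_zero]
  have hcross := S.cross_of_planar hx0 (by rw [dt_comm]; exact hline x (S.Ns_pl_cv u a))
    (hcon a u)
  have hex : ∀ t ∈ Z, ∃ (c : ℂ) (r : ℂ), Ns (S.pl t.rep) (a - c • z) = 0 ∧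
      a - c • z = r • N (S.pl t.rep) π ∧ wed x (a - c • z) ≠ 0 := by
    intro t ht
    have h0 : dt a (Ns (S.pl t.rep) z) = 0 := by rw [← eval_pairForm_wed]; exact hZ ht
    obtain ⟨c, y, hy, hay⟩ := exists_of_dt_Ns (S.pf_pl t.rep) (hZt t ht) h0
    have hyc : a - c • z = y := by rw [hay, add_sub_cancel_left]
    have hskew' : pair (S.pl u) (S.pl t.rep) ≠ 0 := fun h1 =>
      haskew t.rep t.rep_nonzero (by rwa [Scroll.eval_pairForm]) (hZt t ht) h0
    have hy0 : y ≠ 0 := by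
      rintro rfl
      refine ha.1 ⟨u, hu0, ?_⟩
      rw [hay, add_zero, Ns_smul_right, hzu, smul_zero]
    have hN : N (S.pl t.rep) π ≠ 0 := by
      intro h1
      have h2 := N_Ns_add (S.pl u) (S.pl t.rep) a
      rw [← hπ, h1, add_zero] at h2
      have h3 := congrArg (Ns (S.pl u)) h2
      rw [Ns_N_self (S.pf_pl u), Ns_smul_right, eq_comm, smul_eq_zero] at h3
      exact h3.elim (neg_ne_zero.2 hskew') hau
    have hyπ : dt π y = 0 := by
      rw [← hyc, hπ, dt_comm, dt_Ns, Ns_sub_right, Ns_smul_right, hzu, smul_zero, sub_zero,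
        dt_Ns_self, neg_zero]
    obtain ⟨r, hr⟩ : ∃ r : ℂ, y = r • N (S.pl t.rep) π := by
      obtain ⟨ζ, rfl⟩ := eq_N_of_Ns (S.pl_ne_zero t.rep_nonzero) hy
      exact exists_smul_N (S.pf_pl _) (by rw [dt_N, hyπ, neg_zero]) hN
    refine ⟨c, r, by rw [hyc, hy], by rw [hyc, hr], ?_⟩
    rw [hyc]
    intro h1
    obtain ⟨s, hs⟩ := (wed_eq_zero_iff hy0).1 h1
    refine hskew' (pair_eq_zero_of_common hx0 (S.Ns_pl_cv u a) ?_)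
    rw [hs, Ns_smul_right, hy, smul_zero]
  -- Two of the `k - 1 ≥ 2` further rulings.
  obtain ⟨t, t', ht, ht', htt⟩ := (Set.one_lt_ncard_iff (Set.finite_of_ncard_pos (by
    rw [hZc]; have := S.three_le; omega))).1 (by rw [hZc]; have := S.three_le; omega)
  obtain ⟨c, r, hy, hyr, hxy⟩ := hex t ht
  obtain ⟨c', r', hy', hyr', hxy'⟩ := hex t' ht'
  obtain ⟨s, hs⟩ := exists_smul_of_cross hxy' (x := wed x (a - c • z)) fun i j => by
    rw [hyr, hyr', wed_smul_right, wed_smul_right]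
    simp only [Pi.smul_apply, smul_eq_mul]
    linear_combination r * r' * hcross t.rep t'.rep i j
  rw [← wed_smul_right, ← sub_eq_zero, ← wed_sub_right, wed_swap, smul_eq_zero,
    or_iff_right (by simp), wed_eq_zero_iff hx0] at hs
  obtain ⟨κ, hκ⟩ := hs
  have h1 : (1 - s) • π = 0 := by
    have h2 := congrArg (Ns (S.pl u)) hκ
    have h3 : Ns (S.pl u) x = 0 := S.Ns_pl_cv u a
    rw [Ns_smul_right, h3] at h2
    simp only [Ns_sub_right, Ns_smul_right, hzu, smul_zero, sub_zero] at h2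
    rw [sub_smul, one_smul]
    exact h2
  rw [smul_eq_zero, or_iff_left hau, sub_eq_zero] at h1
  rw [← h1, one_smul, show a - c • z - (a - c' • z) = (c' - c) • z by module] at hκ
  -- If `κ = 0`, both rulings pass through the same point of the line `az`; but the line is
  -- transversal there, so the point is smooth and lies on one ruling only.
  have hk : κ ≠ 0 := by
    rintro rfl
    rw [zero_smul, smul_eq_zero, or_iff_left hz.ne_zero, sub_eq_zero] at hκ
    rw [hκ] at hy'
    have hF : eval (a + (-c) • z) S.F = 0 := by
      rw [neg_smul, ← sub_eq_add_neg]
      exact S.vanishes _ ⟨t.rep, t.rep_nonzero, hy⟩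
    have hs : S.Smooth (a - c • z) := ⟨⟨t.rep, t.rep_nonzero, hy⟩, z, by
      have := haz _ hF
      rwa [neg_smul, ← sub_eq_add_neg] at this⟩
    exact htt ((wedge_rep _ _).1 (hs.wedge_eq_zero t.rep_nonzero t'.rep_nonzero hy hy'))
  have hxz : x = (κ⁻¹ * (c' - c)) • z := by
    rw [mul_smul, hκ, smul_smul, inv_mul_cancel₀ hk, one_smul]
  have hr0 : κ⁻¹ * (c' - c) ≠ 0 := by
    intro h0
    exact hx0 (by rw [hxz, h0, zero_smul])
  have hxs : S.Smooth x := by rw [hxz]; exact hz.smul hr0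
  have h2 := hxs.eval_D_cv hu0
  rw [← hx, hxz, eval_smul_form (D_isHomogeneous S.isHomogeneous a)] at h2
  exact mul_ne_zero (pow_ne_zero _ hr0) haD h2

end Surface

/-! ### Generic pairs of viewpoints -/

/-- All contour curves pass through the same point of the ruling. -/
def Scroll.Focal (T : Scroll) (u : Fin 2 → ℂ) : Prop := ∀ b b', wed (T.cv u b) (T.cv u b') = 0

/-- The conditions on two viewpoints used for the reconstruction. -/
structure Surface.GeneralPair (S : Surface) (a b : Fin 4 → ℂ) : Prop where
  left : S.General a
  right : S.General b
  regular : ∃ u, dt b (Ns (S.pl u) a) ≠ 0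
  zeros : ∃ t : Fin S.k × Fin 2 → ℂ, (∀ i, dt b (Ns (S.pl fun l => t (i, l)) a) = 0) ∧
    ∀ p : {p : Fin S.k × Fin S.k // p.1 ≠ p.2},
      wedge (fun l => t (p.1.1, l)) (fun l => t (p.1.2, l)) ≠ 0
  smooth : ∀ u, u ≠ 0 → dt b (Ns (S.pl u) a) = 0 → S.Smooth (S.cv u a)
  disjoint : ∀ u t, wedge u t ≠ 0 → ¬ S.Focal u → wed (S.cv u a) (S.cv t b) ≠ 0
  skew : ∀ᶠ u in gen (Fin 2), ∀ t, wedge t u ≠ 0 →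
    ¬ (dt (S.cv t b) (Ns (S.pl u) a) = 0 ∧ dt (S.cv u a) (Ns (S.pl t) b) = 0)

namespace Scroll
variable (T : Scroll)

theorem focal_iff (u : Fin 2 → ℂ) :
    T.Focal u ↔ ∀ i j, wed (T.cv u (Pi.single i 1)) (T.cv u (Pi.single j 1)) = 0 := by
  refine ⟨fun h i j => h _ _, fun h b b' => ?_⟩
  have e : ∀ b, T.cv u b = ∑ i, b i • T.cv u (Pi.single i 1) := by
    intro b
    ext l
    simp [cv_apply, Pi.single_apply]
  rw [e b, e b']
  simp only [Fin.sum_univ_four]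
  have hadd : ∀ x y z : Fin 4 → ℂ, wed (x + y) z = wed x z + wed y z := by
    intro x y z; ext i; fin_cases i <;> simp [wed] <;> ring
  have hadd' : ∀ x y z : Fin 4 → ℂ, wed z (x + y) = wed z x + wed z y := by
    intro x y z; ext i; fin_cases i <;> simp [wed] <;> ring
  simp [hadd, hadd', wed_smul_left, wed_smul_right, h]

theorem Focal.smul {u : Fin 2 → ℂ} {c : ℂ} (hc : c ≠ 0) : T.Focal (c • u) ↔ T.Focal u := by
  simp only [Focal, cv_smul_left, wed_smul_left, wed_smul_right, smul_eq_zero,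
    pow_ne_zero T.cdeg hc, false_or]

/-- On a regular ruling the contour points with respect to the viewpoints `N (der u w) ζ` fill the
whole ruling. -/
theorem eventually_not_focal : ∀ᶠ u in gen (Fin 2), ¬ T.Focal u := by
  obtain ⟨u, hu, hu0⟩ := (T.eventually_pf_der.and eventually_ne_zero).exists
  obtain ⟨w, hw⟩ := exists_wedge_ne_zero hu0
  have h0 : ¬ T.Focal u := by
    intro h
    obtain ⟨a, ha⟩ := T.exists_cv_ne_zero hu0
    have h1 : ∀ ζ, ∃ c : ℂ, N (T.pl u) ζ = c • T.cv u a := by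
      intro ζ
      obtain ⟨r, hr, h1⟩ := T.contourMap_eq hw (N (T.der u w) ζ)
      obtain ⟨s, hs⟩ := (wed_eq_zero_iff ha).1 (h (N (T.der u w) ζ) a)
      rw [Ns_N_of_pf, N_smul_right, contourMap_eq_cv, hs, smul_smul, smul_smul] at h1
      have hne := mul_ne_zero hr (neg_ne_zero.2 (hu w hw))
      refine ⟨(r * -pf (T.der u w))⁻¹ * (eval u T.h * s), ?_⟩
      rw [mul_smul, h1, smul_smul, inv_mul_cancel₀ hne, one_smul]
    obtain ⟨p, q, hpq⟩ := exists_eq_wed (T.pf_pl u)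
    have hne := T.pl_ne_zero hu0
    obtain ⟨ζ, hζ⟩ := eq_N_of_Ns hne (z := p) (by rw [hpq, Ns_wed_left])
    obtain ⟨ζ', hζ'⟩ := eq_N_of_Ns hne (z := q) (by rw [hpq, Ns_wed_right])
    obtain ⟨c, hc⟩ := h1 ζ
    obtain ⟨c', hc'⟩ := h1 ζ'
    apply hne
    rw [hpq, hζ, hζ', hc, hc', wed_smul_left, wed_smul_right, wed_self, smul_zero, smul_zero]
  rw [focal_iff] at h0
  push Not at h0
  obtain ⟨i, j, hij⟩ := h0
  obtain ⟨l, hl⟩ := Function.ne_iff.1 hij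
  have hp : Pol fun u => wed (T.cv u (Pi.single i 1)) (T.cv u (Pi.single j 1)) l :=
    Pol.wed (p := fun u => T.cv u (Pi.single i 1)) (q := fun u => T.cv u (Pi.single j 1))
      (T.pol_curve _) (T.pol_curve _) l
  filter_upwards [hp.eventually_ne hl] with v hv hf
  exact hv (by rw [hf]; rfl)

end Scroll

namespace Surface
variable (S : Surface)

theorem smooth_cv_iff {u : Fin 2 → ℂ} (hu : u ≠ 0) (a : Fin 4 → ℂ) :
    S.Smooth (S.cv u a) ↔ ∃ i, eval (S.cv u a) (pderiv i S.F) ≠ 0 := by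
  constructor
  · rintro ⟨-, v, hv⟩
    by_contra! h
    apply hv
    rw [eval_D]
    exact Finset.sum_eq_zero fun i _ => by rw [h, mul_zero]
  · rintro ⟨i, hi⟩
    refine ⟨⟨u, hu, S.Ns_pl_cv u a⟩, Pi.single i 1, ?_⟩
    rw [eval_D]
    simpa [Pi.single_apply] using hi

/-- The rulings met by the line `ab`, stated through the existence of coordinates of `k` different
parameters, so that the property is constructible and the two viewpoints can be chosen one after the
other. -/
theorem eventually_zeros : ∀ᶠ z in gen (Fin 4 ⊕ Fin 4), ∃ t : Fin S.k × Fin 2 → ℂ,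
    (∀ i, dt (fun i => z (Sum.inr i)) (Ns (S.pl fun l => t (i, l)) fun i => z (Sum.inl i)) = 0) ∧
    ∀ p : {p : Fin S.k × Fin S.k // p.1 ≠ p.2},
      wedge (fun l => t (p.1.1, l)) (fun l => t (p.1.2, l)) ≠ 0 := by
  refine gen_uncurry (Constr.ex (Constr.and (Constr.forallFin fun i => Constr.eqZero (Pol.dt ?_
    (Pol.Ns (S.pol_pl' ?_) ?_))) (Constr.forallFin fun p => (Constr.eqZero (Pol.wedge ?_ ?_)).not))) ?_
  · exact fun _ => Pol.coord _
  · exact fun _ => Pol.coord _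
  · exact fun _ => Pol.coord _
  · exact fun _ => Pol.coord _
  · exact fun _ => Pol.coord _
  · filter_upwards [S.eventually_general] with a ha
    filter_upwards [S.eventually_ncard_zeros ha.1] with b hb
    have hfin := (zeros_finite (S.pairForm_isHomogeneous _) hb.1).1
    have := hfin.to_subtype
    let e := Finite.equivFin (RuledContours.zeros (S.pairForm (wed b a)))
    let τ : Fin S.k → RuledContours.zeros (S.pairForm (wed b a)) := fun i => e.symm (Fin.castLE hb.2 i)
    have hτ : Function.Injective τ := e.symm.injective.comp (Fin.castLE_injective _)
    refine ⟨fun p => (τ p.1).1.rep p.2, fun i => ?_, fun p h => ?_⟩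
    · have := (τ i).2
      change eval _ _ = 0 at this
      rwa [eval_pairForm_wed] at this
    · exact p.2 (hτ (Subtype.ext ((wedge_rep _ _).1 h)))

/-- For fixed `a` only finitely many points of the contour curve are singular, and a generic `b`
avoids the planes joining `a` to their rulings. -/
theorem eventually_smooth : ∀ᶠ z in gen (Fin 4 ⊕ Fin 4), ∀ u : Fin 2 → ℂ, u ≠ 0 →
    dt (fun i => z (Sum.inr i)) (Ns (S.pl u) fun i => z (Sum.inl i)) = 0 →
    ∃ i, eval (S.cv u fun i => z (Sum.inl i)) (pderiv i S.F) ≠ 0 := by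
  refine gen_uncurry (Constr.all (Constr.imp (Constr.vecEqZero ?_).not (Constr.imp (Constr.eqZero (Pol.dt ?_
    (Pol.Ns (S.pol_pl' ?_) ?_))) (Constr.existsFin fun i => (Constr.eqZero
      (Pol.evalComp _ (S.pol_cv ?_ ?_))).not)))) ?_
  · exact fun _ => Pol.coord _
  · exact fun _ => Pol.coord _
  · exact fun _ => Pol.coord _
  · exact fun _ => Pol.coord _
  · exact fun _ => Pol.coord _
  · exact fun _ => Pol.coord _
  · filter_upwards [S.eventually_general] with a ha
    obtain ⟨d, f, hf, hf0, hs⟩ := exists_form_of_eventually (P := fun u => S.Smooth (S.cv u a))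
      (fun c u hc h => by rw [Scroll.cv_smul_left]; exact h.smul (pow_ne_zero _ hc)) ha.2.2
    have h := eventually_forall_zero (l := gen (Fin 4)) hf hf0
      (Q := fun u b => dt b (Ns (S.pl u) a) ≠ 0) (fun c u b hc h => by
        rw [Scroll.pl_smul, Ns_smul_left, dt_smul_right]
        exact mul_ne_zero (pow_ne_zero _ hc) h) (fun u hu _ => by
        obtain ⟨z, hz⟩ := exists_dt_ne_zero fun h : Ns (S.pl u) a = 0 => ha.1 ⟨u, hu, h⟩
        exact (pol_dt (Ns (S.pl u) a)).eventually_ne (v := z) (by rwa [dt_comm]))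
    filter_upwards [h] with b hb u hu h0
    by_contra h1
    refine h1 ((S.smooth_cv_iff hu a).1 (hs u ?_))
    intro h2
    exact hb u hu h2 h0

/-- All contour points on a focal ruling `t` are one point `p`. Only finitely many rulings pass
through it apart from `p` being their focal point, and there are finitely many focal rulings, so a
generic contour curve misses these points on all non-focal rulings. -/
theorem eventually_disjoint_focal : ∀ᶠ a in gen (Fin 4), ∀ t u, wedge u t ≠ 0 → S.Focal t →
    ¬ S.Focal u → ∀ b, S.cv t b ≠ 0 → wed (S.cv u a) (S.cv t b) ≠ 0 := by
  obtain ⟨d, f, hf, hf0, hfocal⟩ := exists_form_of_eventually (P := fun u => ¬ S.Focal u)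
    (fun c u hc h => by rwa [Scroll.Focal.smul _ hc]) S.eventually_not_focal
  have h := eventually_forall_zero (l := gen (Fin 4)) hf hf0
    (Q := fun t a => S.General a → ∀ u, wedge u t ≠ 0 → S.Focal t →
      ¬ S.Focal u → ∀ b, S.cv t b ≠ 0 → wed (S.cv u a) (S.cv t b) ≠ 0)
    (fun c t a hc h ha u h1 h2 h3 b h4 => by
      rw [wedge_smul_right] at h1
      rw [Scroll.Focal.smul _ hc] at h2
      rw [Scroll.cv_smul_left] at h4 ⊢
      rw [wed_smul_right]
      exact smul_ne_zero (pow_ne_zero _ hc)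
        (h ha u (right_ne_zero_of_mul h1) h2 h3 b (right_ne_zero_of_smul h4)))
    (fun t ht _ => ?_)
  · filter_upwards [h, S.eventually_general] with a h1 ha t u htu ht
    have ht0 : t ≠ 0 := by rintro rfl; simp [wedge] at htu
    exact h1 t ht0 (by_contra fun h2 => hfocal t h2 ht) ha u htu ht
  · by_cases htf : S.Focal t
    swap
    · exact Eventually.of_forall fun a _ u _ h => absurd h htf
    obtain ⟨b₀, hb₀⟩ := S.exists_cv_ne_zero ht
    set p := S.cv t b₀ with hp
    obtain ⟨z, hz⟩ := (eventually_pairForm_wed_ne_zero S.toScroll hb₀).exists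
    have h2 := eventually_forall_zero (l := gen (Fin 4)) (S.pairForm_isHomogeneous _) hz
      (Q := fun u a => ¬ S.Focal u → wed (S.cv u a) p ≠ 0)
      (fun c u a hc h h1 => by
        rw [Scroll.Focal.smul _ hc] at h1
        rw [Scroll.cv_smul_left, wed_smul_left]
        exact smul_ne_zero (pow_ne_zero _ hc) (h h1))
      (fun u hu _ => by
        by_cases huf : S.Focal u
        · exact Eventually.of_forall fun a h => absurd huf h
        have h3 : ∃ a, wed (S.cv u a) p ≠ 0 := by
          by_contra! h4
          refine huf fun b b' => ?_
          obtain ⟨c, hc⟩ := (wed_eq_zero_iff hb₀).1 (h4 b)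
          obtain ⟨c', hc'⟩ := (wed_eq_zero_iff hb₀).1 (h4 b')
          rw [hc, hc', wed_smul_left, wed_smul_right, wed_self, smul_zero, smul_zero]
        obtain ⟨a, ha⟩ := h3
        obtain ⟨l, hl⟩ := Function.ne_iff.1 ha
        have hpol : Pol fun a => wed (S.cv u a) p l := Pol.wed (p := fun a => S.cv u a) (q := fun _ => p)
          (S.pol_cv (u := fun _ => u) (a := fun a => a) (fun _ => Pol.const _) Pol.coord)
          (fun _ => Pol.const _) l
        filter_upwards [hpol.eventually_ne hl] with a' ha' _ h0
        exact ha' (by rw [h0]; rfl))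
    filter_upwards [h2] with a ha1 ha u htu _ huf b hb h0
    have hu : u ≠ 0 := by rintro rfl; simp [wedge] at htu
    obtain ⟨c, hc⟩ := (wed_eq_zero_iff hb₀).1 (htf b b₀)
    have hc0 : c ≠ 0 := by
      rintro rfl
      exact hb (by rw [hc, zero_smul])
    rw [hc, wed_smul_right, smul_eq_zero, or_iff_right hc0] at h0
    refine ha1 u hu ?_ huf h0
    obtain ⟨r, hr⟩ := (wed_eq_zero_iff hb₀).1 h0
    have hr0 : r ≠ 0 := by
      rintro rfl
      exact ha.2.1 u hu (by rw [hr, zero_smul])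
    have h3 := S.Ns_pl_cv u a
    rw [hr, Ns_smul_right, smul_eq_zero, or_iff_right hr0] at h3
    rw [eval_pairForm_wed, h3, dt_zero_right]

/-- A smooth contour point lies on no other ruling. Each of the finitely many remaining contour
points of `a` lies on finitely many rulings; for generic `b` the contour point on such a ruling is
another one, unless the ruling is focal, and that case is excluded by the choice of `a`. -/
theorem eventually_disjoint : ∀ᶠ z in gen (Fin 4 ⊕ Fin 4), ∀ u t : Fin 2 → ℂ, wedge u t ≠ 0 →
    (¬ ∀ i j, wed (S.cv u (Pi.single i 1)) (S.cv u (Pi.single j 1)) = 0) →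
    ¬ wed (S.cv u fun i => z (Sum.inl i)) (S.cv t fun i => z (Sum.inr i)) = 0 := by
  refine gen_uncurry (Constr.all (Constr.all (Constr.imp (Constr.eqZero (Pol.wedge ?_ ?_)).not
    (Constr.imp (Constr.forallFin fun i => Constr.forallFin fun j => Constr.vecEqZero
      (Pol.wed (S.pol_cv ?_ ?_) (S.pol_cv ?_ ?_))).not
      (Constr.vecEqZero (Pol.wed (S.pol_cv ?_ ?_) (S.pol_cv ?_ ?_))).not)))) ?_
  · exact fun _ => Pol.coord _
  · exact fun _ => Pol.coord _
  · exact fun _ => Pol.coord _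
  · exact fun _ => Pol.const _
  · exact fun _ => Pol.coord _
  · exact fun _ => Pol.const _
  · exact fun _ => Pol.coord _
  · exact fun _ => Pol.coord _
  · exact fun _ => Pol.coord _
  · exact fun _ => Pol.coord _
  · filter_upwards [S.eventually_general, S.eventually_disjoint_focal] with a ha hfocal
    obtain ⟨d, f, hf, hf0, hs⟩ := exists_form_of_eventually (P := fun u => S.Smooth (S.cv u a))
      (fun c u hc h => by rw [Scroll.cv_smul_left]; exact h.smul (pow_ne_zero _ hc)) ha.2.2
    have h := eventually_forall_zero (l := gen (Fin 4)) hf hf0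
      (Q := fun u b => S.General b → ∀ t, wedge u t ≠ 0 → ¬ S.Focal u → wed (S.cv u a) (S.cv t b) ≠ 0)
      (fun c u b hc h hb t h1 h2 => by
        rw [wedge_smul_left] at h1
        rw [Scroll.Focal.smul _ hc] at h2
        rw [Scroll.cv_smul_left, wed_smul_left]
        exact smul_ne_zero (pow_ne_zero _ hc) (h hb t (right_ne_zero_of_mul h1) h2))
      (fun u hu _ => by
        have hp := ha.2.1 u hu
        obtain ⟨z, hz⟩ := (eventually_pairForm_wed_ne_zero S.toScroll hp).exists
        have h2 := eventually_forall_zero (l := gen (Fin 4)) (S.pairForm_isHomogeneous _) hz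
          (Q := fun t b => S.General b → wedge u t ≠ 0 → ¬ S.Focal u → wed (S.cv u a) (S.cv t b) ≠ 0)
          (fun c t b hc h hb h1 h2 => by
            rw [wedge_smul_right] at h1
            rw [Scroll.cv_smul_left, wed_smul_right]
            exact smul_ne_zero (pow_ne_zero _ hc) (h hb (right_ne_zero_of_mul h1) h2))
          (fun t ht _ => by
            by_cases htf : S.Focal t
            · exact Eventually.of_forall fun b hb h1 h2 => hfocal t u h1 htf h2 b (hb.2.1 t ht)
            have h3 : ∃ b, wed (S.cv u a) (S.cv t b) ≠ 0 := by
              by_contra! h4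
              refine htf fun b b' => ?_
              have h5 : ∀ b, ∃ c : ℂ, S.cv t b = c • S.cv u a := fun b => by
                have := h4 b
                rw [wed_swap, smul_eq_zero, or_iff_right (by simp)] at this
                exact (wed_eq_zero_iff hp).1 this
              obtain ⟨c, hc⟩ := h5 b
              obtain ⟨c', hc'⟩ := h5 b'
              rw [hc, hc', wed_smul_left, wed_smul_right, wed_self, smul_zero, smul_zero]
            obtain ⟨b, hb⟩ := h3
            obtain ⟨l, hl⟩ := Function.ne_iff.1 hb
            have hpol : Pol fun b => wed (S.cv u a) (S.cv t b) l :=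
              Pol.wed (p := fun _ => S.cv u a) (q := fun b => S.cv t b) (fun _ => Pol.const _)
              (S.pol_cv (u := fun _ => t) (a := fun a => a) (fun _ => Pol.const _) Pol.coord) l
            filter_upwards [hpol.eventually_ne hl] with b' hb' _ _ _ h0
            exact hb' (by rw [h0]; rfl))
        filter_upwards [h2] with b hb hgb t hut huf h0
        have ht : t ≠ 0 := by rintro rfl; simp [wedge] at hut
        refine hb t ht ?_ hgb hut huf h0
        obtain ⟨r, hr⟩ := (wed_eq_zero_iff (hgb.2.1 t ht)).1 h0
        rw [eval_pairForm_wed, hr, Ns_smul_right, S.Ns_pl_cv, smul_zero, dt_zero_right])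
    filter_upwards [h, S.eventually_general] with b hb hgb u t hut huf h0
    simp only [Sum.elim_inl, Sum.elim_inr] at h0
    rw [← Scroll.focal_iff] at huf
    have hu : u ≠ 0 := by rintro rfl; simp [wedge] at hut
    have ht : t ≠ 0 := by rintro rfl; simp [wedge] at hut
    refine hb u hu ?_ hgb t hut huf h0
    by_contra hfu
    obtain ⟨r, hr⟩ := (wed_eq_zero_iff (hgb.2.1 t ht)).1 h0
    exact hut ((hs u hfu).wedge_eq_zero hu ht (S.Ns_pl_cv u a)
      (by rw [hr, Ns_smul_right, S.Ns_pl_cv, smul_zero]))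

end Surface

theorem eventually_comp_injective {ι κ : Type*} {f : ι → κ} (hf : Function.Injective f) {P : (ι → ℂ) → Prop}
    (h : ∀ᶠ v in gen ι, P v) : ∀ᶠ z in gen κ, P fun i => z (f i) := by
  obtain ⟨G, hG, h⟩ := eventually_gen.1 h
  refine eventually_gen.2 ⟨rename f G, (map_ne_zero_iff _ (rename_injective _ hf)).2 hG, fun z hz => h _ ?_⟩
  rwa [eval_rename] at hz

namespace Surface
variable (S : Surface)

/-- Put `x = cv u a`. The second incidence places `b` in the plane of `x` and the ruling `t`; hence
`cv t b` is proportional to `cv t x`, and the first incidence puts `cv t x` on the plane of `a` and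
the ruling `u`. By `exists_planar_ne_zero` this happens for finitely many `t` only, and a generic
`b` avoids the planes joining `x` to these rulings. -/
theorem eventually_eventually_skew : ∀ᶠ z in gen (Fin 4 ⊕ Fin 2), ∀ᶠ b in gen (Fin 4), ∀ t,
    wedge t (fun i => z (Sum.inr i)) ≠ 0 →
    ¬ (dt (S.cv t b) (Ns (S.pl fun i => z (Sum.inr i)) fun i => z (Sum.inl i)) = 0 ∧
      dt (S.cv (fun i => z (Sum.inr i)) fun i => z (Sum.inl i)) (Ns (S.pl t) b) = 0) := by
  obtain ⟨a₀, u₀, t₀, h0⟩ := S.exists_planar_ne_zero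
  have hpu : ∀ i, Pol fun z : Fin 4 ⊕ Fin 2 → ℂ => z (Sum.inr i) := fun i => Pol.coord _
  have hpa : ∀ i, Pol fun z : Fin 4 ⊕ Fin 2 → ℂ => z (Sum.inl i) := fun i => Pol.coord _
  have he : Pol fun z : Fin 4 ⊕ Fin 2 → ℂ => dt (Ns (S.pl fun i => z (Sum.inr i)) fun i => z (Sum.inl i))
      (S.cv t₀ (S.cv (fun i => z (Sum.inr i)) fun i => z (Sum.inl i))) :=
    Pol.dt (Pol.Ns (S.pol_pl' hpu) hpa)
      (S.pol_cv (u := fun _ => t₀) (fun _ => Pol.const _) (S.pol_cv hpu hpa))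
  obtain ⟨a₁, ha₁⟩ := S.eventually_general.exists
  obtain ⟨u₁, h1, hu₁⟩ := (ha₁.2.2.and eventually_ne_zero).exists
  obtain ⟨i₁, hi₁⟩ := (S.smooth_cv_iff hu₁ a₁).1 h1
  have hs : Pol fun z : Fin 4 ⊕ Fin 2 → ℂ =>
      eval (S.cv (fun i => z (Sum.inr i)) fun i => z (Sum.inl i)) (pderiv i₁ S.F) :=
    Pol.evalComp _ (S.pol_cv hpu hpa)
  have he' := he.eventually_ne (v := Sum.elim a₀ u₀) (by simpa only [Sum.elim_inl, Sum.elim_inr] using h0)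
  have hs' := hs.eventually_ne (v := Sum.elim a₁ u₁) (by simpa only [Sum.elim_inl, Sum.elim_inr] using hi₁)
  filter_upwards [he', hs',
    eventually_comp_injective Sum.inr_injective eventually_ne_zero] with z hz hz' hu
  set u : Fin 2 → ℂ := fun i => z (Sum.inr i) with hudef
  set a : Fin 4 → ℂ := fun i => z (Sum.inl i) with hadef
  have hx := (S.smooth_cv_iff hu a).2 ⟨_, hz'⟩
  set x := S.cv u a with hxdef
  have hNs : ∀ t, t ≠ 0 → wedge t u ≠ 0 → Ns (S.pl t) x ≠ 0 := fun t ht htu h =>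
    htu (hx.wedge_eq_zero ht hu h (S.Ns_pl_cv u a))
  obtain ⟨d, f, hf, hf0, hs⟩ := exists_form_of_eventually
    (P := fun t => dt (Ns (S.pl u) a) (S.cv t x) ≠ 0)
    (fun c t hc h => by
      rw [Scroll.cv_smul_left, dt_smul_right]; exact mul_ne_zero (pow_ne_zero _ hc) h)
    ((Pol.dt (x := fun _ => Ns (S.pl u) a) (y := fun t => S.cv t x) (fun i => Pol.const _)
      (S.pol_curve x)).eventually_ne hz)
  have h2 := eventually_forall_zero (l := gen (Fin 4)) hf hf0
    (Q := fun t b => wedge t u ≠ 0 → dt b (Ns (S.pl t) x) ≠ 0)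
    (fun c t b hc h h1 => by
      rw [wedge_smul_left] at h1
      rw [Scroll.pl_smul, Ns_smul_left, dt_smul_right]
      exact mul_ne_zero (pow_ne_zero _ hc) (h (right_ne_zero_of_mul h1)))
    (fun t ht _ => by
      by_cases htu : wedge t u = 0
      · exact Eventually.of_forall fun b h => absurd htu h
      obtain ⟨b, hb⟩ := exists_dt_ne_zero (hNs t ht htu)
      filter_upwards [(pol_dt (Ns (S.pl t) x)).eventually_ne (v := b) (by rwa [dt_comm])] with b hb _
      exact hb)
  filter_upwards [h2, S.eventually_general] with b hb hgb t htu ⟨h1, h2⟩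
  have ht : t ≠ 0 := by rintro rfl; simp [wedge] at htu
  have h3 : dt b (Ns (S.pl t) x) = 0 := by
    rw [dt_Ns, h2, neg_zero]
  have h4 : dt (Ns (S.pl u) a) (S.cv t x) = 0 := by
    obtain ⟨β, y, hy, rfl⟩ := exists_of_dt_Ns (S.pf_pl t) (hNs t ht htu) h3
    rw [Scroll.cv_add, Scroll.cv_smul, S.cv_eq_zero_of_Ns ht hy, add_zero, dt_smul_left, mul_eq_zero] at h1
    rcases h1 with rfl | h1
    · exact absurd ⟨t, ht, by rwa [zero_smul, zero_add]⟩ hgb.1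
    · rwa [dt_comm]
  exact hb t ht (by_contra fun h => hs t h h4) htu h3

/-- The choice in the order `(a, u)`, then `b`, is merged into one open condition and split again as
`(a, b)`, then `u`. -/
theorem eventually_skew : ∀ᶠ z in gen (Fin 4 ⊕ Fin 4), ∀ᶠ u in gen (Fin 2), ∀ t, wedge t u ≠ 0 →
    ¬ (dt (S.cv t fun i => z (Sum.inr i)) (Ns (S.pl u) fun i => z (Sum.inl i)) = 0 ∧
      dt (S.cv u fun i => z (Sum.inl i)) (Ns (S.pl t) fun i => z (Sum.inr i)) = 0) := by
  have h : ∀ᶠ z in gen ((Fin 4 ⊕ Fin 2) ⊕ Fin 4), ∀ t : Fin 2 → ℂ,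
      ¬ wedge t (fun i => z (Sum.inl (Sum.inr i))) = 0 →
      ¬ (dt (S.cv t fun i => z (Sum.inr i))
          (Ns (S.pl fun i => z (Sum.inl (Sum.inr i))) fun i => z (Sum.inl (Sum.inl i))) = 0 ∧
        dt (S.cv (fun i => z (Sum.inl (Sum.inr i))) fun i => z (Sum.inl (Sum.inl i)))
          (Ns (S.pl t) fun i => z (Sum.inr i)) = 0) := by
    refine gen_uncurry (Constr.all (Constr.imp (Constr.eqZero (Pol.wedge ?_ ?_)).not
      (Constr.and (Constr.eqZero (Pol.dt (S.pol_cv ?_ ?_) (Pol.Ns (S.pol_pl' ?_) ?_)))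
        (Constr.eqZero (Pol.dt (S.pol_cv ?_ ?_) (Pol.Ns (S.pol_pl' ?_) ?_)))).not))
      S.eventually_eventually_skew
    all_goals exact fun _ => Pol.coord _
  let f : (Fin 4 ⊕ Fin 2) ⊕ Fin 4 → (Fin 4 ⊕ Fin 4) ⊕ Fin 2 :=
    Sum.elim (Sum.elim (Sum.inl ∘ Sum.inl) Sum.inr) (Sum.inl ∘ Sum.inr)
  have hf : Function.Injective f := by
    rintro ((i | i) | i) ((j | j) | j) h <;> simp_all [f]
  exact gen_curry (eventually_comp_injective hf h)

theorem eventually_regular : ∀ᶠ z in gen (Fin 4 ⊕ Fin 4),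
    ∃ u, dt (fun i => z (Sum.inr i)) (Ns (S.pl u) fun i => z (Sum.inl i)) ≠ 0 := by
  obtain ⟨a, ha⟩ := S.eventually_general.exists
  obtain ⟨u, hu⟩ := eventually_ne_zero.exists
  obtain ⟨b, hb⟩ := exists_dt_ne_zero fun h : Ns (S.pl u) a = 0 => ha.1 ⟨u, hu, h⟩
  have hp : Pol fun z : Fin 4 ⊕ Fin 4 → ℂ =>
      dt (fun i => z (Sum.inr i)) (Ns (S.pl u) fun i => z (Sum.inl i)) :=
    Pol.dt (fun _ => Pol.coord _) (Pol.Ns (x := fun _ => S.pl u) (fun _ => Pol.const _) fun _ => Pol.coord _)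
  filter_upwards [hp.eventually_ne (v := Sum.elim a b) (by
    simpa only [Sum.elim_inl, Sum.elim_inr, dt_comm b] using hb)] with z hz
  exact ⟨u, hz⟩

theorem eventually_generalPair : ∀ᶠ z in gen (Fin 4 ⊕ Fin 4),
    S.GeneralPair (fun i => z (Sum.inl i)) fun i => z (Sum.inr i) := by
  filter_upwards [eventually_comp_injective Sum.inl_injective S.eventually_general,
    eventually_comp_injective Sum.inr_injective S.eventually_general, S.eventually_regular, S.eventually_zeros,
    S.eventually_smooth, S.eventually_disjoint, S.eventually_skew] with z h1 h2 h0 h3 h4 h5 h6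
  exact ⟨h1, h2, h0, h3, fun u hu h => (S.smooth_cv_iff hu _).2 (h4 u hu h),
    fun u t hut hu => h5 u t hut (by rwa [← Scroll.focal_iff]), h6⟩

theorem forGeneric_generalPair {P : (Fin 2 → P3) → Prop}
    (h : ∀ a b (hab : S.GeneralPair a b),
      P ![Projectivization.mk ℂ a hab.left.ne_zero, Projectivization.mk ℂ b hab.right.ne_zero]) :
    ForGeneric P := by
  let f : Fin 4 ⊕ Fin 4 → Fin 2 × Fin 4 := Sum.elim (fun i => (0, i)) fun i => (1, i)
  have hf : Function.Injective f := by
    rintro (i | i) (j | j) h <;> simp_all [f]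
  obtain ⟨G, hG, h1⟩ := eventually_gen.1 (eventually_comp_injective hf S.eventually_generalPair)
  refine ⟨G, hG, fun v hv hne => ?_⟩
  convert h _ _ (h1 _ hne) using 1
  ext i
  fin_cases i <;> rfl

end Surface

/-! ### Reconstruction from two contours -/

theorem ne_zero_of_wedge_left {u t : Fin 2 → ℂ} (h : wedge u t ≠ 0) : u ≠ 0 := by
  rintro rfl; simp [wedge] at h

theorem ne_zero_of_wedge_right {u t : Fin 2 → ℂ} (h : wedge u t ≠ 0) : t ≠ 0 := by
  rintro rfl; simp [wedge] at h

theorem pol_linearMap (M : (Fin 2 → ℂ) →ₗ[ℂ] (Fin 2 → ℂ)) (i : Fin 2) : Pol fun u => M u i := by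
  have : (fun u => M u i) = fun u => ∑ j, u j * M (fun l => if j = l then 1 else 0) i := by
    ext u
    simpa [Finset.sum_apply] using congrFun (LinearMap.pi_apply_eq_sum_univ M u) i
  rw [this]
  exact Pol.sum _ fun j => (Pol.coord j).mul (Pol.const _)

theorem eventually_comp_linearEquiv {P : (Fin 2 → ℂ) → Prop} (h : ∀ᶠ u in gen (Fin 2), P u)
    (α : (Fin 2 → ℂ) ≃ₗ[ℂ] (Fin 2 → ℂ)) : ∀ᶠ u in gen (Fin 2), P (α u) := by
  obtain ⟨G, hG, h⟩ := eventually_gen.1 h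
  obtain ⟨v, hv⟩ := exists_eval_ne_zero hG
  have hp : Pol fun u => eval (fun i => α u i) G := Pol.evalComp _ (pol_linearMap α.toLinearMap)
  filter_upwards [hp.eventually_ne (v := α.symm v) (by simpa using hv)] with u hu
  exact h _ hu

/-- A linear map of the plane with three eigenlines is a homothety. -/
theorem wedge_map_eq_zero (M : (Fin 2 → ℂ) →ₗ[ℂ] (Fin 2 → ℂ)) {t₀ t₁ t₂ : Fin 2 → ℂ}
    (h01 : wedge t₀ t₁ ≠ 0) (h02 : wedge t₀ t₂ ≠ 0) (h12 : wedge t₁ t₂ ≠ 0) (h0 : wedge (M t₀) t₀ = 0)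
    (h1 : wedge (M t₁) t₁ = 0) (h2 : wedge (M t₂) t₂ = 0) (u : Fin 2 → ℂ) : wedge (M u) u = 0 := by
  -- In a basis of two eigenvectors the quadratic form `wedge (M u) u` has a mixed term only, and
  -- the third eigenline kills its coefficient.
  have key : ∀ x y : ℂ, wedge (M (x • t₀ + y • t₁)) (x • t₀ + y • t₁) =
      x * y * (wedge (M t₀) t₁ + wedge (M t₁) t₀) := by
    intro x y
    simp only [map_add, map_smul]
    simp only [wedge, Pi.add_apply, Pi.smul_apply, smul_eq_mul] at h0 h1 ⊢
    linear_combination x ^ 2 * h0 + y ^ 2 * h1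
  obtain ⟨x, y, rfl⟩ := exists_combination h01 t₂
  obtain ⟨x', y', rfl⟩ := exists_combination h01 u
  rw [key] at h2 ⊢
  have hx : x ≠ 0 := by
    rintro rfl
    apply h12
    rw [zero_smul, zero_add, wedge_smul_right, wedge_self, mul_zero]
  have hy : y ≠ 0 := by
    rintro rfl
    apply h02
    rw [zero_smul, add_zero, wedge_smul_right, wedge_self, mul_zero]
  rw [(mul_eq_zero.1 h2).resolve_left (mul_ne_zero hx hy), mul_zero]

/-- The fractional linear transformation of a linear automorphism. -/
noncomputable def moebius (φ : (Fin 2 → ℂ) ≃ₗ[ℂ] (Fin 2 → ℂ)) : P1 → P1 :=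
  Projectivization.map φ.toLinearMap φ.injective

theorem moebius_eq (φ : (Fin 2 → ℂ) ≃ₗ[ℂ] (Fin 2 → ℂ)) (u : P1) :
    moebius φ u = Projectivization.mk ℂ (φ u.rep) (φ.map_ne_zero_iff.2 u.rep_nonzero) := by
  conv_lhs => rw [← u.mk_rep]
  rfl

theorem moebius_congr {γ φ : (Fin 2 → ℂ) ≃ₗ[ℂ] (Fin 2 → ℂ)} (h : ∀ u, wedge (φ.symm (γ u)) u = 0) :
    moebius γ = moebius φ := by
  ext u
  rw [moebius_eq, moebius_eq]
  obtain ⟨c, hc⟩ := exists_smul_of_wedge u.rep_nonzero (h u.rep)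
  refine mk_eq_of_smul (c := c) ?_
  rw [← map_smul, ← hc, LinearEquiv.apply_symm_apply]

theorem mem_span_of_common {x : Fin 6 → ℂ} (hx : pf x = 0) (hx0 : x ≠ 0) {p q z : Fin 4 → ℂ}
    (hpq : wed p q ≠ 0) (hp : Ns x p = 0) (hq : Ns x q = 0) :
    Ns x z = 0 ↔ z ∈ Submodule.span ℂ {p, q} := by
  obtain ⟨c, hc⟩ := exists_smul_of_line_le (x := wed p q) (y := x) (pf_wed p q) hx hx0 (fun z hz => by
    rw [mem_span_of_Ns hpq, Submodule.mem_span_pair] at hz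
    obtain ⟨a, b, rfl⟩ := hz
    rw [Ns_add_right, Ns_smul_right, Ns_smul_right, hp, hq, smul_zero, smul_zero, add_zero])
  have hc0 : c ≠ 0 := by
    rintro rfl
    exact hpq (by rw [hc, zero_smul])
  rw [← mem_span_of_Ns hpq, hc, Ns_smul_left, smul_eq_zero, or_iff_right hc0]

theorem mk_mem_joinPoints {x y z : Fin 4 → ℂ} (hx : x ≠ 0) (hy : y ≠ 0) (hz : z ≠ 0) :
    Projectivization.mk ℂ z hz ∈ joinPoints (Projectivization.mk ℂ x hx) (Projectivization.mk ℂ y hy) ↔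
      z ∈ Submodule.span ℂ {x, y} := by
  change (Projectivization.mk ℂ z hz).submodule ≤ _ ↔ _
  rw [Projectivization.submodule_mk, Projectivization.submodule_mk, Projectivization.submodule_mk,
    Submodule.span_singleton_le_iff_mem, Submodule.span_insert]

theorem mk_ne_mk_iff {x y : Fin 4 → ℂ} (hx : x ≠ 0) (hy : y ≠ 0) :
    Projectivization.mk ℂ x hx ≠ Projectivization.mk ℂ y hy ↔ wed x y ≠ 0 := by
  rw [Ne, Projectivization.mk_eq_mk_iff', Ne, wed_eq_zero_iff hy]
  simp only [eq_comm]

theorem exists_surface {k : ℕ} (hk : 3 ≤ k) {R : Set P3} {p q : Fin 4 → Polynomial ℂ}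
    (h : IsRuledParametrization p q R) (hR : HasDegree R k) :
    ∃ S : Surface, S.k = k ∧ R = S.points ∧
      (∀ s, wed (evalVec p s) (evalVec q s) ≠ 0 → ∃ u, u ≠ 0 ∧ ∃ c : ℂ, c ≠ 0 ∧
        wed (evalVec p s) (evalVec q s) = c • S.pl u) ∧
      ∀ᶠ u in gen (Fin 2), ∃ s, ∃ c : ℂ, c ≠ 0 ∧ wed (evalVec p s) (evalVec q s) = c • S.pl u := by
  obtain ⟨T, h1, h2, h3⟩ := exists_scroll h
  obtain ⟨F, hF, hFk, hRF⟩ := hR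
  refine ⟨{ T with
    F := F, k := k, irreducible := hF, isHomogeneous := hFk, three_le := hk
    eval_eq_zero_iff := fun v => ?_ }, rfl, hRF, h2, h3⟩
  by_cases hv : v = 0
  · subst hv
    refine ⟨fun _ => T.On_zero, fun _ => ?_⟩
    have := eval_smul_form hFk 0 0
    rwa [smul_zero, zero_pow (by omega), zero_mul] at this
  · rw [← h1 v hv, hRF]
    exact (eval_rep_mk hFk hv).symm

namespace Surface
variable {S : Surface}

/-- Two different points force `p(s)` and `q(s)` to be independent, so the parameter `s` belongs to
a genuine ruling. -/
theorem exists_common_line {p q : Fin 4 → Polynomial ℂ}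
    (h1 : ∀ s, wed (evalVec p s) (evalVec q s) ≠ 0 → ∃ u, u ≠ 0 ∧ ∃ c : ℂ, c ≠ 0 ∧
        wed (evalVec p s) (evalVec q s) = c • S.pl u) {s : ℂ} {x y : Fin 4 → ℂ} (hxy : wed x y ≠ 0)
    (hx : x ∈ Submodule.span ℂ {evalVec p s, evalVec q s})
    (hy : y ∈ Submodule.span ℂ {evalVec p s, evalVec q s}) :
    ∃ u, u ≠ 0 ∧ Ns (S.pl u) x = 0 ∧ Ns (S.pl u) y = 0 := by
  have hpq : wed (evalVec p s) (evalVec q s) ≠ 0 := by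
    intro h
    obtain ⟨a, b, rfl⟩ := Submodule.mem_span_pair.1 hx
    obtain ⟨c, d, rfl⟩ := Submodule.mem_span_pair.1 hy
    exact hxy (by rw [wed_combination, h, smul_zero])
  obtain ⟨u, hu, c, hc, h⟩ := h1 s hpq
  rw [← mem_span_of_Ns hpq, h, Ns_smul_left, smul_eq_zero, or_iff_right hc] at hx hy
  exact ⟨u, hu, hx, hy⟩

namespace GeneralPair
variable {a b : Fin 4 → ℂ}

/-- If the contour points agree up to the factor `r`, then `cv u (a - r • b) = 0` by linearity, so
on a regular ruling `b` lies in the plane of `a` and the ruling. The field `regular` excludes this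
for generic `u`. -/
theorem eventually_wed (h : S.GeneralPair a b) :
    ∀ᶠ u in gen (Fin 2), wed (S.cv u a) (S.cv u b) ≠ 0 := by
  obtain ⟨u₀, hu₀⟩ := h.regular
  have hp : Pol fun u => dt b (Ns (S.pl u) a) :=
    Pol.dt (fun _ => Pol.const _) (Pol.Ns (z := fun _ => a) S.pol_pl fun _ => Pol.const _)
  filter_upwards [hp.eventually_ne hu₀, eventually_ne_zero, S.eventually_pf_der] with u h1 hu h2 h3
  obtain ⟨w, hw⟩ := exists_wedge_ne_zero hu
  obtain ⟨r, hr⟩ := (wed_eq_zero_iff (h.right.2.1 u hu)).1 h3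
  have h4 : S.cv u (a - r • b) = 0 := by
    rw [sub_eq_add_neg, ← neg_smul, Scroll.cv_add, Scroll.cv_smul, hr]
    module
  have h5 := S.Ns_pl_of_cv hw (h2 w hw) h4
  rw [Ns_sub_right, sub_eq_zero] at h5
  exact h1 (by rw [h5, Ns_smul_right, dt_smul_right, dt_Ns_self, mul_zero])

/-- When `b` lies in the plane of `a` and the ruling, it differs from a multiple of `a` by a point
of the ruling, and `cv u` ignores the latter. -/
theorem exists_common (h : S.GeneralPair a b) {u : Fin 2 → ℂ} (hu : u ≠ 0)
    (h0 : dt b (Ns (S.pl u) a) = 0) : ∃ r : ℂ, S.cv u b = r • S.cv u a := by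
  obtain ⟨c, y, hy, rfl⟩ := exists_of_dt_Ns (S.pf_pl u) (fun h1 => h.left.1 ⟨u, hu, h1⟩) h0
  exact ⟨c, by rw [Scroll.cv_add, Scroll.cv_smul, S.cv_eq_zero_of_Ns hu hy, add_zero]⟩

/-- A common point of the contours comes from the same ruling on both curves, by the field
`disjoint`, or lies on a focal ruling, where the contour points coincide anyway. -/
theorem wed_eq_zero_of_common (h : S.GeneralPair a b) {u t : Fin 2 → ℂ} (hu : u ≠ 0) (ht : t ≠ 0)
    (h0 : wed (S.cv u a) (S.cv t b) = 0) : wed (S.cv u a) (S.cv u b) = 0 := by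
  by_cases hut : wedge t u = 0
  · obtain ⟨c, rfl⟩ := exists_smul_of_wedge hu hut
    have hc : c ≠ 0 := by
      rintro rfl
      exact ht (zero_smul _ _)
    rwa [Scroll.cv_smul_left, wed_smul_right, smul_eq_zero, or_iff_right (pow_ne_zero _ hc)] at h0
  · by_contra h1
    refine h.disjoint u t (by rwa [wedge_swap, neg_ne_zero]) (fun hf => h1 (hf a b)) h0

theorem encard_le (h : S.GeneralPair a b) :
    (S.k : ℕ∞) ≤ (Set.range h.left.curve.pt ∩ Set.range h.right.curve.pt ∩
      smoothLocus S.points).encard := by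
  obtain ⟨t, ht, ht'⟩ := h.zeros
  have h2 : ∀ i : Fin S.k, (fun l => t (i, l)) ≠ 0 := fun i => by
    have hk := S.three_le
    obtain ⟨j, hj⟩ : ∃ j : Fin S.k, i ≠ j := by
      by_cases hi : i = ⟨0, by omega⟩
      · exact ⟨⟨1, by omega⟩, by rw [hi]; simp [Fin.ext_iff]⟩
      · exact ⟨_, hi⟩
    exact ne_zero_of_wedge_left (ht' ⟨(i, j), hj⟩)
  let x : Fin S.k → P3 := fun i => Projectivization.mk ℂ _ (h.left.2.1 _ (h2 i))
  have hx : Function.Injective x := by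
    intro i j hij
    by_contra hne
    obtain ⟨r, hr, hrr⟩ := smul_of_mk_eq hij
    refine ht' ⟨(i, j), hne⟩ ((h.smooth _ (h2 i) (ht i)).wedge_eq_zero (h2 i) (h2 j) (S.Ns_pl_cv _ _) ?_)
    rw [hrr, Ns_smul_right, S.Ns_pl_cv, smul_zero]
  have hxm : Set.range x ⊆ Set.range h.left.curve.pt ∩ Set.range h.right.curve.pt ∩
      smoothLocus S.points := by
    rintro _ ⟨i, rfl⟩
    refine ⟨⟨⟨_, h.left.curve.pt_mk (h2 i)⟩, Projectivization.mk ℂ _ (h2 i), ?_⟩,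
      (S.mem_smoothLocus _).2 (h.smooth _ (h2 i) (ht i))⟩
    rw [RationalMap.pt_mk]
    obtain ⟨r, hr⟩ := h.exists_common (h2 i) (ht i)
    exact mk_eq_of_smul hr
  refine le_trans ?_ (Set.encard_le_encard hxm)
  rw [← Set.image_univ, hx.encard_image, Set.encard_univ]
  simp

end GeneralPair

/-- Both parametrizations differ by linear maps `α`, `β` from the curves `u ↦ cv u a` and `u ↦ cv u
b`, which are matched ruling by ruling. So `β⁻¹ ∘ α` is the required transformation. -/
theorem reconstruction {p q : Fin 4 → Polynomial ℂ}
    (hp1 : ∀ s, wed (evalVec p s) (evalVec q s) ≠ 0 → ∃ u, u ≠ 0 ∧ ∃ c : ℂ, c ≠ 0 ∧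
      wed (evalVec p s) (evalVec q s) = c • S.pl u)
    (hp2 : ∀ᶠ u in gen (Fin 2), ∃ s, ∃ c : ℂ, c ≠ 0 ∧ wed (evalVec p s) (evalVec q s) = c • S.pl u)
    {a b : Fin 4 → ℂ} (h : S.GeneralPair a b) {c c' : RationalMap}
    (hc : IsProperParametrization c (contour S.points (Projectivization.mk ℂ a h.left.ne_zero)))
    (hc' : IsProperParametrization c' (contour S.points (Projectivization.mk ℂ b h.right.ne_zero))) :
    ∃ f : P1 → P1, IsMoebius f ∧ MatchesRulings p q c c' f ∧
      (∀ g : P1 → P1, IsMoebius g → MatchesRulings p q c c' g → g = f) ∧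
      S.points = zariskiClosure (⋃ u : P1, joinPoints (c.pt u) (c'.pt (f u))) ∧
      (∀ u : P1, c.pt u ∈ contour S.points (Projectivization.mk ℂ b h.right.ne_zero) →
        c'.pt (f u) = c.pt u) ∧
      (∀ g : P1 → P1, IsMoebius g →
        (∀ u : P1, c.pt u ∈ contour S.points (Projectivization.mk ℂ b h.right.ne_zero) ∩
          smoothLocus S.points → c'.pt (g u) = c.pt u) → g = f) := by
  rw [h.left.contour_eq, RationalMap.isProperParametrization_iff] at hc
  rw [h.right.contour_eq] at hc' ⊢
  rw [RationalMap.isProperParametrization_iff] at hc'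
  obtain ⟨α, hα⟩ := h.left.generallyInjective.exists_equiv hc.1 hc.2.ge
  obtain ⟨β, hβ⟩ := h.right.generallyInjective.exists_equiv hc'.1 hc'.2.ge
  simp only [General.val_curve] at hα hβ
  have hα0 : ∀ {u}, u ≠ 0 → α u ≠ 0 := fun hu => α.map_ne_zero_iff.2 hu
  have hpt : ∀ {u} (hu : u ≠ 0), c.pt (Projectivization.mk ℂ u hu) =
      Projectivization.mk ℂ (S.cv (α u) a) (h.left.2.1 _ (hα0 hu)) := fun hu => by
    obtain ⟨r, -, hr⟩ := hα _ hu
    rw [c.pt_mk]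
    exact mk_eq_of_smul hr
  have hβ0 : ∀ {u}, u ≠ 0 → β u ≠ 0 := fun hu => β.map_ne_zero_iff.2 hu
  have hpt' : ∀ {u} (hu : u ≠ 0), c'.pt (Projectivization.mk ℂ u hu) =
      Projectivization.mk ℂ (S.cv (β u) b) (h.right.2.1 _ (hβ0 hu)) := fun hu => by
    obtain ⟨r, -, hr⟩ := hβ _ hu
    rw [c'.pt_mk]
    exact mk_eq_of_smul hr
  let φ := α.trans β.symm
  have hφ : ∀ u, β (φ u) = α u := fun u => β.apply_symm_apply _
  have hφ0 : ∀ {u}, u ≠ 0 → φ u ≠ 0 := fun hu => φ.map_ne_zero_iff.2 hu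
  have hptφ : ∀ {u} (hu : u ≠ 0), c'.pt (moebius φ (Projectivization.mk ℂ u hu)) =
      Projectivization.mk ℂ (S.cv (α u) b) (h.right.2.1 _ (hα0 hu)) := fun {u} hu => by
    change c'.pt (Projectivization.mk ℂ (φ u) (hφ0 hu)) = _
    rw [hpt' (hφ0 hu)]
    simp only [hφ]
  have hφs : ∀ (γ : (Fin 2 → ℂ) ≃ₗ[ℂ] (Fin 2 → ℂ)) u, φ.symm (γ u) = α.symm (β (γ u)) := fun _ _ => rfl
  have hwed := eventually_comp_linearEquiv h.eventually_wed α
  refine ⟨moebius φ, ⟨φ, rfl⟩, ?_, ?_, ?_, ?_, ?_⟩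
  · have hP := finite_of_eventually (P := fun u => wed (S.cv (α u) a) (S.cv (α u) b) ≠ 0 ∧
      ∃ s, ∃ c : ℂ, c ≠ 0 ∧ wed (evalVec p s) (evalVec q s) = c • S.pl (α u)) ?_
      (hwed.and (eventually_comp_linearEquiv hp2 α))
    · refine hP.subset fun u hu h1 => hu ?_
      obtain ⟨h1, s, r, hr, h2⟩ := h1
      rw [← u.mk_rep, hptφ u.rep_nonzero, hpt u.rep_nonzero, mk_ne_mk_iff]
      have hne : wed (evalVec p s) (evalVec q s) ≠ 0 := by
        rw [h2]
        exact smul_ne_zero hr (S.pl_ne_zero (hα0 u.rep_nonzero))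
      refine ⟨h1, s, ?_, ?_⟩ <;>
        rw [mem_ruling_iff, ← mem_span_of_Ns hne, h2, Ns_smul_left, S.Ns_pl_cv, smul_zero]
    · rintro r u hr ⟨h1, s, c, hc, h2⟩
      simp only [map_smul, Scroll.cv_smul_left, wed_smul_left, wed_smul_right]
      refine ⟨smul_ne_zero (pow_ne_zero _ hr) (smul_ne_zero (pow_ne_zero _ hr) h1), s,
        c * (r ^ S.degree)⁻¹, mul_ne_zero hc (inv_ne_zero (pow_ne_zero _ hr)), ?_⟩
      rw [Scroll.pl_smul, smul_smul, inv_mul_cancel_right₀ (pow_ne_zero _ hr), h2]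
  -- At a generic parameter both contour points are smooth, so each lies on one ruling only; a
  -- common ruling `t` makes `α u` and `β (γ u)` proportional.
  · rintro _ ⟨γ, rfl⟩ hg
    refine moebius_congr fun u => ?_
    have hp : Pol fun u => wedge (φ.symm (γ u)) u := by
      exact Pol.wedge (pol_linearMap (γ.trans φ.symm).toLinearMap) Pol.coord
    refine hp.eq_zero ?_ u
    filter_upwards [eventually_of_finite hg, eventually_comp_linearEquiv h.left.2.2 α,
      eventually_comp_linearEquiv h.right.2.2 (γ.trans β), eventually_ne_zero] with u h1 h2 h3 hu
    by_contra hcon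
    refine h1 (Projectivization.mk ℂ u hu) ?_ ((mk_eq_mk_iff_wedge (Projectivization.rep_nonzero _) hu).1
      (Projectivization.mk_rep _))
    rintro ⟨h4, s, h5, h6⟩
    have hγ : γ u ≠ 0 := γ.map_ne_zero_iff.2 hu
    have h7 : c'.pt (Projectivization.map γ.toLinearMap γ.injective (Projectivization.mk ℂ u hu)) =
        Projectivization.mk ℂ (S.cv (β (γ u)) b) (h.right.2.1 _ (hβ0 hγ)) := hpt' hγ
    rw [h7, hpt hu, mk_ne_mk_iff] at h4
    rw [hpt hu, mem_ruling_iff] at h5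
    rw [h7, mem_ruling_iff] at h6
    obtain ⟨t, ht, hta, htb⟩ := exists_common_line hp1 h4 h5 h6
    obtain ⟨r, hr⟩ := exists_smul_of_wedge ht (h2.wedge_eq_zero (hα0 hu) ht (S.Ns_pl_cv _ _) hta)
    obtain ⟨r', hr'⟩ := exists_smul_of_wedge ht (Smooth.wedge_eq_zero h3 (hβ0 hγ) ht (S.Ns_pl_cv _ _) htb)
    have hr0 : r ≠ 0 := by
      rintro rfl
      exact hα0 hu (by rw [hr, zero_smul])
    apply hcon
    rw [hφs, hr', map_smul, wedge_smul_left]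
    have : u = r • α.symm t := by rw [← map_smul, ← hr, α.symm_apply_apply]
    rw [this, wedge_smul_right, wedge_self, mul_zero, mul_zero]
  · refine Set.Subset.antisymm ?_ ?_
    · intro v hv
      rw [← v.mk_rep] at hv ⊢
      rw [mem_points] at hv
      obtain ⟨t, ht, h0⟩ := hv
      obtain ⟨ζ, hζ⟩ := eq_N_of_Ns (S.pl_ne_zero ht) h0
      rw [mk_mem_closure]
      intro d G hG hX
      rw [vanishesOn_iff hG] at hX
      have hpol : Pol fun u => eval (N (S.pl u) ζ) G :=
        Pol.evalComp _ (Pol.N (z := fun _ => ζ) S.pol_pl fun _ => Pol.const _)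
      rw [hζ]
      refine hpol.eq_zero ?_ t
      filter_upwards [h.eventually_wed, eventually_ne_zero] with u hu hu0
      have hX' : ∀ z, z ≠ 0 → Ns (S.pl u) z = 0 → eval z G = 0 := fun z hz hz' => by
        have hα' : α.symm u ≠ 0 := α.symm.map_ne_zero_iff.2 hu0
        refine hX z hz (Set.mem_iUnion.2 ⟨Projectivization.mk ℂ _ hα', ?_⟩)
        rw [hptφ hα', hpt hα', mk_mem_joinPoints]
        rw [α.apply_symm_apply]
        exact (mem_span_of_common (S.pf_pl u) (S.pl_ne_zero hu0) hu (S.Ns_pl_cv _ _) (S.Ns_pl_cv _ _)).1 hz'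
      by_cases hz : N (S.pl u) ζ = 0
      · rw [hz, ← zero_smul ℂ (S.cv u a), eval_smul_form hG,
          hX' (S.cv u a) (h.left.2.1 u hu0) (S.Ns_pl_cv _ _), mul_zero]
      · exact hX' _ hz (Ns_N_self (S.pf_pl u) ζ)
    · refine subset_trans (zariskiClosure_mono ?_) (zariskiClosure_zeroLocus S.isHomogeneous).le
      refine Set.iUnion_subset fun u x hx => ?_
      rw [← u.mk_rep, hptφ u.rep_nonzero, hpt u.rep_nonzero, ← x.mk_rep, mk_mem_joinPoints] at hx
      rw [← x.mk_rep]
      obtain ⟨r, r', hr⟩ := Submodule.mem_span_pair.1 hx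
      refine (S.mem_points x.rep_nonzero).2 ⟨_, hα0 u.rep_nonzero, ?_⟩
      rw [← hr, Ns_add_right, Ns_smul_right, Ns_smul_right, S.Ns_pl_cv, S.Ns_pl_cv, smul_zero, smul_zero,
        add_zero]
  · intro u hu
    rw [← u.mk_rep, hpt u.rep_nonzero, RationalMap.mk_mem_range] at hu
    rw [← u.mk_rep, hptφ u.rep_nonzero, hpt u.rep_nonzero]
    obtain ⟨t, ht, r, hr⟩ := hu
    rw [h.right.val_curve] at hr
    by_contra hne
    rw [eq_comm] at hne
    exact (mk_ne_mk_iff _ _).1 hne (h.wed_eq_zero_of_common (hα0 u.rep_nonzero) ht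
      (by rw [hr, wed_smul_left, wed_self, smul_zero]))
  -- At the parameters of the `k ≥ 3` coincidences the intersection point is smooth and determines
  -- its ruling, so `γ` and `φ` agree there. Three common values suffice.
  · rintro _ ⟨γ, rfl⟩ hg
    refine moebius_congr ?_
    obtain ⟨t, ht, ht'⟩ := h.zeros
    have hk := S.three_le
    have hw : ∀ i j : Fin S.k, i ≠ j → wedge (α.symm fun l => t (i, l)) (α.symm fun l => t (j, l)) ≠ 0 := by
      intro i j hij h0
      have hi := ne_zero_of_wedge_right (ht' ⟨(i, j), hij⟩)
      obtain ⟨r, hr⟩ := exists_smul_of_wedge (α.symm.map_ne_zero_iff.2 hi) h0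
      rw [← map_smul] at hr
      refine ht' ⟨(i, j), hij⟩ ?_
      rw [α.symm.injective hr]
      exact (wedge_smul_left r _ _).trans (by rw [wedge_self, mul_zero])
    have hz : ∀ i : Fin S.k, wedge (φ.symm (γ (α.symm fun l => t (i, l)))) (α.symm fun l => t (i, l)) = 0 := by
      intro i
      obtain ⟨j, hj⟩ : ∃ j : Fin S.k, i ≠ j := by
        by_cases hi : i = ⟨0, by omega⟩
        · exact ⟨⟨1, by omega⟩, by rw [hi]; simp [Fin.ext_iff]⟩
        · exact ⟨_, hi⟩
      have hi := ne_zero_of_wedge_left (ht' ⟨(i, j), hj⟩)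
      set τ : Fin 2 → ℂ := fun l => t (i, l) with hτ
      have hτ' : α.symm τ ≠ 0 := α.symm.map_ne_zero_iff.2 hi
      have hγ : γ (α.symm τ) ≠ 0 := γ.map_ne_zero_iff.2 hτ'
      have hsm := h.smooth τ hi (ht i)
      obtain ⟨r, hr⟩ := h.exists_common hi (ht i)
      have hr0 : r ≠ 0 := by
        rintro rfl
        exact h.right.2.1 τ hi (by rw [hr, zero_smul])
      have h1 := hg (Projectivization.mk ℂ _ hτ') (by
        rw [hpt hτ']
        simp only [α.apply_symm_apply]
        refine ⟨(RationalMap.mk_mem_range _ _).2 ⟨τ, hi, r⁻¹, ?_⟩, (S.mem_smoothLocus _).2 hsm⟩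
        rw [h.right.val_curve, hr, smul_smul, inv_mul_cancel₀ hr0, one_smul])
      have h7 : c'.pt (Projectivization.map γ.toLinearMap γ.injective (Projectivization.mk ℂ _ hτ')) =
        Projectivization.mk ℂ (S.cv (β (γ (α.symm τ))) b) (h.right.2.1 _ (hβ0 hγ)) := hpt' hγ
      rw [h7, hpt hτ'] at h1
      simp only [α.apply_symm_apply] at h1
      obtain ⟨r', hr', h2⟩ := smul_of_mk_eq h1.symm
      obtain ⟨r'', h3⟩ := exists_smul_of_wedge hi (hsm.wedge_eq_zero (hβ0 hγ) hi
        (by rw [h2, Ns_smul_right, S.Ns_pl_cv, smul_zero]) (S.Ns_pl_cv _ _))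
      rw [hφs, h3, map_smul, wedge_smul_left, wedge_self, mul_zero]
    exact wedge_map_eq_zero (γ.trans φ.symm).toLinearMap
      (hw ⟨0, by omega⟩ ⟨1, by omega⟩ (by simp [Fin.ext_iff]))
      (hw ⟨0, by omega⟩ ⟨2, by omega⟩ (by simp [Fin.ext_iff]))
      (hw ⟨1, by omega⟩ ⟨2, by omega⟩ (by simp [Fin.ext_iff])) (hz _) (hz _) (hz _)

end Surface

/-! ### Curves that span more than a line -/

theorem D_aeval {κ : Type*} [Fintype κ] (w : Fin 2 → ℂ) (g : κ → MvPolynomial (Fin 2) ℂ)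
    (F : MvPolynomial κ ℂ) : D w (aeval g F) = ∑ i, aeval g (pderiv i F) * D w (g i) := by
  classical
  induction F using MvPolynomial.induction_on with
  | C a => simp
  | add p q hp hq => simp only [map_add, hp, hq, add_mul, Finset.sum_add_distrib]
  | mul_X p i hp =>
    simp only [map_mul, hp, aeval_X, Derivation.leibniz, pderiv_X, smul_eq_mul, map_add, add_mul,
      Finset.sum_add_distrib]
    congr 1
    · rw [Finset.sum_eq_single i]
      · simp
      · intro j _ hj
        simp [hj.symm]
      · simp
    · rw [Finset.mul_sum]
      exact Finset.sum_congr rfl fun j _ => by ring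

theorem exists_dt_eq_zero_and_ne_zero {a v : Fin 4 → ℂ} (h : wed a v ≠ 0) :
    ∃ η, dt a η = 0 ∧ dt v η ≠ 0 := by
  by_contra! e
  apply h
  simp only [dt] at e
  have e0 := e ![-a 1, a 0, 0, 0] (by simp; ring)
  have e1 := e ![-a 2, 0, a 0, 0] (by simp; ring)
  have e2 := e ![-a 3, 0, 0, a 0] (by simp; ring)
  have e3 := e ![0, -a 2, a 1, 0] (by simp; ring)
  have e4 := e ![0, -a 3, 0, a 1] (by simp; ring)
  have e5 := e ![0, 0, -a 3, a 2] (by simp; ring)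
  simp at e0 e1 e2 e3 e4 e5
  ext l
  fin_cases l <;> simp [wed]
  · linear_combination e0
  · linear_combination e1
  · linear_combination e2
  · linear_combination e3
  · linear_combination e4
  · linear_combination e5

theorem cross_of_wed {x y : Fin 4 → ℂ} (h : wed x y = 0) (i j : Fin 4) : x i * y j = x j * y i := by
  have e := fun j => congrFun h j
  simp [wed, Fin.forall_fin_succ, sub_eq_zero] at e
  obtain ⟨e1, e2, e3, e4, e5, e6⟩ := e
  fin_cases i <;> fin_cases j <;> simp_all

/-- A family of vectors that is not contained in a line of the projective space. -/
def NotInLine (f : (Fin 2 → ℂ) → Fin 4 → ℂ) : Prop :=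
  ∀ x : Fin 6 → ℂ, pf x = 0 → x ≠ 0 → ∃ u, u ≠ 0 ∧ Ns x (f u) ≠ 0

theorem Ns_wed_eq_zero_of_dt {p q v : Fin 4 → ℂ}
    (h : ∀ ξ, dt p ξ = 0 → dt q ξ = 0 → dt v ξ = 0) : Ns (wed p q) v = 0 := by
  refine eq_zero_of_dt fun z => ?_
  rw [dt_Ns, h (Ns (wed p q) z), neg_zero]
  · rw [dt_Ns, Ns_wed_left, dt_zero_right, neg_zero]
  · rw [dt_Ns, Ns_wed_right, dt_zero_right, neg_zero]

theorem exists_wed_ne_zero {p : Fin 4 → ℂ} (hp : p ≠ 0) : ∃ q, wed p q ≠ 0 := by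
  by_contra! h
  obtain ⟨i, hi⟩ := Function.ne_iff.1 hp
  have h0 := h (Pi.single 0 1)
  have h1 := h (Pi.single 1 1)
  have e := fun j => congrFun h0 j
  have e' := fun j => congrFun h1 j
  simp [wed, Fin.forall_fin_succ] at e e'
  fin_cases i <;> simp_all

namespace NotInLine
variable {f : (Fin 2 → ℂ) → Fin 4 → ℂ}

theorem exists_wed (h : NotInLine f) {p : Fin 4 → ℂ} (hp : p ≠ 0) : ∃ u, u ≠ 0 ∧ wed p (f u) ≠ 0 := by
  obtain ⟨q, hq⟩ := exists_wed_ne_zero hp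
  obtain ⟨u, hu, h1⟩ := h (wed p q) (pf_wed p q) hq
  refine ⟨u, hu, fun h2 => h1 ?_⟩
  rw [Ns_wed_cyc, Ns_wed_cyc, wed_swap, h2, smul_zero]
  ext i; fin_cases i <;> simp [Ns, N, dual]

theorem eventually_not_smul (h : NotInLine f) (hf : ∀ i, Pol fun u => f u i) {p : Fin 4 → ℂ} (hp : p ≠ 0) :
    ∀ᶠ u in gen (Fin 2), ∀ r : ℂ, f u ≠ r • p := by
  obtain ⟨u, -, hu⟩ := h.exists_wed hp
  obtain ⟨i, hi⟩ := Function.ne_iff.1 hu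
  have hpol : Pol fun u => wed p (f u) i := Pol.wed (p := fun _ => p) (fun _ => Pol.const _) hf i
  filter_upwards [hpol.eventually_ne hi] with v hv r hr
  exact hv (by rw [hr, wed_smul_right, wed_self, smul_zero]; rfl)

end NotInLine

/-- The generic tangent of a curve that is not contained in a line misses a given point. -/
theorem eventually_tangent {f : Fin 4 → MvPolynomial (Fin 2) ℂ} {d : ℕ} (hf : ∀ i, (f i).IsHomogeneous d)
    (h : NotInLine (ev f)) {a : Fin 4 → ℂ} (ha : a ≠ 0) :
    ∃ w, ∀ᶠ u in gen (Fin 2), Ns (wed (ev f u) (dv f u w)) a ≠ 0 := by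
  by_contra! hcon
  have hz : ∀ u w, Ns (wed (ev f u) (dv f u w)) a = 0 := by
    intro u w
    by_contra h0
    obtain ⟨i, hi⟩ := Function.ne_iff.1 h0
    have hp : Pol fun u => Ns (wed (ev f u) (dv f u w)) a i :=
      Pol.Ns (Pol.wed (Pol.ev f) (Pol.dv f w)) (z := fun _ => a) (fun _ => Pol.const _) i
    refine hcon w ?_
    filter_upwards [hp.eventually_ne hi] with v hv h1
    exact hv (by rw [h1]; rfl)
  -- Linear forms vanishing at `a` are the coordinates of the projection from `a`. If all tangents
  -- pass through `a`, their Wronskians vanish, the projection is constant, and the curve lies in a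
  -- line.
  let L : (Fin 4 → ℂ) → MvPolynomial (Fin 2) ℂ := fun ξ => ∑ i, C (ξ i) * f i
  have hL : ∀ ξ, (L ξ).IsHomogeneous d := fun ξ => IsHomogeneous.sum _ _ _ fun i _ => by
    simpa using (isHomogeneous_C _ (ξ i)).mul (hf i)
  have eL : ∀ ξ u, eval u (L ξ) = dt (ev f u) ξ := fun ξ u => by
    simp [L, ev, dt, Fin.sum_univ_four, mul_comm]
  have dL : ∀ ξ u w, eval u (D w (L ξ)) = dt (dv f u w) ξ := fun ξ u w => by
    simp [L, dv, dt, Fin.sum_univ_four, mul_comm]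
  have cross : ∀ ξ η, dt a ξ = 0 → dt a η = 0 → ∀ s t,
      dt (ev f s) ξ * dt (ev f t) η = dt (ev f t) ξ * dt (ev f s) η := by
    intro ξ η hξ hη s t
    have := cross_of_wronskian_eval (hL ξ) (hL η) (fun w => Eventually.of_forall fun u => ?_) s t
    · simpa only [eL] using this
    rw [eL, eL, dL, dL]
    by_cases h0 : wed (ev f u) (dv f u w) = 0
    · have h1 := cross_of_wed h0
      simp only [dt]
      linear_combination (ξ 0 * η 1 - ξ 1 * η 0) * h1 0 1 + (ξ 0 * η 2 - ξ 2 * η 0) * h1 0 2 +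
        (ξ 0 * η 3 - ξ 3 * η 0) * h1 0 3 + (ξ 1 * η 2 - ξ 2 * η 1) * h1 1 2 +
        (ξ 1 * η 3 - ξ 3 * η 1) * h1 1 3 + (ξ 2 * η 3 - ξ 3 * η 2) * h1 2 3
    · obtain ⟨α, β, hαβ⟩ := Submodule.mem_span_pair.1 ((mem_span_of_Ns h0).1 (hz u w))
      rw [← hαβ, dt_add_left, dt_smul_left, dt_smul_left] at hξ hη
      by_cases hα : α = 0
      · have hβ : β ≠ 0 := by
          rintro rfl
          exact ha (by rw [← hαβ, hα]; simp)
        rw [hα, zero_mul, zero_add, mul_eq_zero, or_iff_right hβ] at hξ hη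
        rw [hξ, hη]
        ring
      · refine mul_left_cancel₀ hα ?_
        linear_combination dt (dv f u w) η * hξ - dt (dv f u w) ξ * hη
  obtain ⟨t, -, ht⟩ := h.exists_wed ha
  obtain ⟨s, -, hs⟩ := h _ (pf_wed _ _) ht
  refine hs (Ns_wed_eq_zero_of_dt fun ξ hξ hξt => ?_)
  obtain ⟨η, hη, hηt⟩ := exists_dt_eq_zero_and_ne_zero ht
  have := cross ξ η hξ hη s t
  rw [hξt, zero_mul] at this
  exact (mul_eq_zero.1 this).resolve_right hηt

theorem exists_wed_ne_zero_of_line {x : Fin 6 → ℂ} (hx : pf x = 0) (hx0 : x ≠ 0) {a : Fin 4 → ℂ}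
    (ha : a ≠ 0) : ∃ z, Ns x z = 0 ∧ wed a z ≠ 0 := by
  obtain ⟨p, q, rfl⟩ := exists_eq_wed hx
  by_contra! h
  have hp := h p (Ns_wed_left _ _)
  have hq := h q (Ns_wed_right _ _)
  rw [wed_swap, smul_eq_zero, or_iff_right (by simp), wed_eq_zero_iff ha] at hp hq
  obtain ⟨r, rfl⟩ := hp
  obtain ⟨r', rfl⟩ := hq
  exact hx0 (by rw [wed_smul_left, wed_smul_right, wed_self, smul_zero, smul_zero])

/-- The lines of a family are not coplanar. -/
theorem Scroll.not_coplanar (T : Scroll) {π : Fin 4 → ℂ} (hπ : π ≠ 0) :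
    ¬ ∀ᶠ u in gen (Fin 2), N (T.pl u) π = 0 := by
  intro h
  have h' : ∀ u, N (T.pl u) π = 0 := fun u => funext fun i =>
    (Pol.N (z := fun _ => π) T.pol_pl (fun _ => Pol.const _) i).eq_zero
      (h.mono fun u hu => congrFun hu i) u
  obtain ⟨u, t, hut⟩ := T.exists_pair_ne_zero
  have := Ns_N_add (T.pl u) (T.pl t) π
  rw [h', h', Ns_zero_right, Ns_zero_right, add_zero, eq_comm, smul_eq_zero, or_iff_left hπ,
    neg_eq_zero] at this
  exact hut this

theorem Ns_dv_eq_zero {f : Fin 4 → MvPolynomial (Fin 2) ℂ} {x : Fin 6 → ℂ}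
    (h : ∀ u, Ns x (ev f u) = 0) (u w : Fin 2 → ℂ) : Ns x (dv f u w) = 0 := by
  refine eq_zero_of_dt fun v => ?_
  have h0 : ∑ i, C (Ns x v i) * f i = 0 := MvPolynomial.funext fun u => by
    have := dt_Ns x v (ev f u)
    rw [h u, dt_zero_right, eq_comm, neg_eq_zero] at this
    simp only [dt, ev] at this
    simp only [Fin.sum_univ_four, map_add, map_mul, eval_C, map_zero]
    linear_combination this
  have h1 := congrArg (fun p => eval u (D w p)) h0
  simp only [Fin.sum_univ_four, D_mul, D_C, map_mul, map_add, eval_C,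
    map_zero] at h1
  rw [dt_Ns, neg_eq_zero]
  simp only [dt, dv]
  linear_combination h1

namespace Surface
variable {S : Surface}

/-- If the contour curve were a line off `a`, the plane of `a` and each ruling, which contains the
tangent, would be one fixed plane; all rulings would be coplanar. -/
theorem General.notInLine {a : Fin 4 → ℂ} (ha : S.General a) : NotInLine fun u => S.cv u a := by
  intro x hx hx0
  by_contra! hcon
  have hcdeg : S.cdeg ≠ 0 := ha.generallyInjective.degree_ne_zero
  have hline : ∀ u, Ns x (S.cv u a) = 0 := by
    intro u
    by_cases hu : u = 0
    · have := S.cv_smul_left 0 0 a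
      rw [smul_zero, zero_pow hcdeg, zero_smul] at this
      rw [hu, this, Ns_zero_right]
    · exact hcon u hu
  -- If the line contained `a`, a plane through `a` not containing the line would meet the curve,
  -- and only at `a`; but `a` is not on the surface.
  have hxa : Ns x a ≠ 0 := by
    intro hxa
    obtain ⟨z, hz, haz⟩ := exists_wed_ne_zero_of_line hx hx0 ha.ne_zero
    obtain ⟨η, hη, hηz⟩ := exists_dt_eq_zero_and_ne_zero haz
    let g : MvPolynomial (Fin 2) ℂ := ∑ i, C (η i) * comb (S.cform i) a
    have hg : g.IsHomogeneous S.cdeg := IsHomogeneous.sum _ _ _ fun i _ => by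
      simpa using (isHomogeneous_C _ (η i)).mul (S.curve_isHomogeneous a i)
    obtain ⟨u, hu, h0⟩ := exists_zero hg hcdeg
    have h1 : dt (S.cv u a) η = 0 := by
      rw [← h0]
      simp only [g, Fin.sum_univ_four, map_add, map_mul, eval_C, dt, Scroll.cv, ev]
      ring
    obtain ⟨r, r', hr⟩ := Submodule.mem_span_pair.1
      ((mem_span_of_common hx hx0 haz hxa hz).1 (hline u))
    rw [← hr, dt_add_left, dt_smul_left, dt_smul_left, hη, mul_zero, zero_add, mul_eq_zero,
      or_iff_left hηz] at h1
    rw [h1, zero_smul, add_zero] at hr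
    have hr0 : r ≠ 0 := by
      rintro rfl
      exact ha.2.1 u hu (by rw [← hr, zero_smul])
    have h2 := S.Ns_pl_cv u a
    rw [← hr, Ns_smul_right, smul_eq_zero, or_iff_right hr0] at h2
    exact ha.1 ⟨u, hu, h2⟩
  obtain ⟨u₀, w, hw⟩ : ∃ u w, wed (S.cv u a) (S.cd u w a) ≠ 0 := by
    by_contra! h
    obtain ⟨s, t, i, j, hne⟩ := ha.generallyInjective.not_const
    refine hne ?_
    have := cross_of_wronskian_eval (S.curve_isHomogeneous a i) (S.curve_isHomogeneous a j)
      (fun w => Eventually.of_forall fun u => cross_of_wed (h u w) i j) s t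
    simp only [General.curve]
    rw [this]
    ring
  obtain ⟨l, hl⟩ := Function.ne_iff.1 hw
  have hpol : Pol fun u => wed (S.cv u a) (S.cd u w a) l :=
    Pol.wed (S.pol_curve a) (Pol.dv (fun i => comb (S.cform i) a) w) l
  refine S.not_coplanar hxa ?_
  filter_upwards [hpol.eventually_ne hl, eventually_ne_zero] with u hu hu0
  have hne : wed (S.cv u a) (S.cd u w a) ≠ 0 := fun h => hu (by rw [h]; rfl)
  have hcd : Ns x (S.cd u w a) = 0 := Ns_dv_eq_zero (f := fun i => comb (S.cform i) a) hline u w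
  have hπ : Ns (S.pl u) a ≠ 0 := fun h => ha.1 ⟨u, hu0, h⟩
  -- Both planes contain `a` and the tangent of the curve, which is the line `x` itself.
  obtain ⟨c, hc⟩ : ∃ c : ℂ, Ns x a = c • Ns (S.pl u) a := by
    by_contra! h
    have := Ns_wed_eq_zero (z := a) hne (π := Ns x a) (π' := Ns (S.pl u) a)
      (by rw [dt_Ns, hline, dt_zero_right, neg_zero]) (by rw [dt_Ns, hcd, dt_zero_right, neg_zero])
      (dt_Ns_self _ _) (by rw [dt_Ns, S.Ns_pl_cv, dt_zero_right, neg_zero]) (S.dt_cd u w a)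
      (dt_Ns_self _ _) hπ h
    rw [mem_span_of_Ns hne, ← mem_span_of_common hx hx0 hne (hline u) hcd] at this
    exact hxa this
  rw [hc, N_smul_right, N_Ns_self (S.pf_pl u), smul_zero]

end Surface

namespace Scroll
variable {T : Scroll} {R : Set P3}

theorem vanishes_of_vanishesOn (hR : ∀ v (hv : v ≠ 0), Projectivization.mk ℂ v hv ∈ R ↔ T.On v)
    {F : MvPolynomial (Fin 4) ℂ} {d : ℕ} (hF : F.IsHomogeneous d) (h : VanishesOn F R) : T.Vanishes F := by
  rw [vanishesOn_iff hF] at h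
  intro v hv
  by_cases h0 : v = 0
  · obtain ⟨p, q, hpq⟩ := exists_eq_wed (T.pf_pl ![1, 0])
    have hne : p ≠ 0 := by
      rintro rfl
      refine T.pl_ne_zero (u := ![1, 0]) (by intro h; simpa using congrFun h 0) ?_
      rw [hpq, ← zero_smul ℂ (0 : Fin 4 → ℂ), wed_smul_left, zero_smul]
    have := h p hne ((hR p hne).2 ⟨![1, 0], by intro h; simpa using congrFun h 0,
      by rw [hpq, Ns_wed_left]⟩)
    rw [h0, ← zero_smul ℂ p, eval_smul_form hF, this, mul_zero]
  · exact h v h0 ((hR v h0).2 hv)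

/-- The points on regular rulings contributing to the contour lie on the contour curve. -/
theorem exists_eq_smul_cv (hR : ∀ v (hv : v ≠ 0), Projectivization.mk ℂ v hv ∈ R ↔ T.On v) {x : P3}
    (hx : x ∈ smoothLocus R) {a : Fin 4 → ℂ} (ha : a ≠ 0)
    (hax : (Projectivization.mk ℂ a ha).submodule ≤ tangentSpace R x) {σ w : Fin 2 → ℂ} (hσ : σ ≠ 0)
    (hw : wedge σ w ≠ 0) (hreg : pf (T.der σ w) ≠ 0) (hσx : Ns (T.pl σ) x.rep = 0)
    (hσa : Ns (T.pl σ) a ≠ 0) : ∃ r : ℂ, x.rep = r • T.cv σ a := by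
  have hx0 := x.rep_nonzero
  have hder : Ns (T.der σ w) x.rep ≠ 0 := by
    intro h
    have := N_Ns_of_pf (T.der σ w) x.rep
    rw [h, N_zero_right, eq_comm, smul_eq_zero] at this
    exact this.elim (neg_ne_zero.2 hreg) hx0
  rw [Projectivization.submodule_mk, Submodule.span_singleton_le_iff_mem] at hax
  have h0 : dt a (Ns (T.der σ w) x.rep) = 0 := by
    by_contra h0
    have htop : tangentSpace R x = ⊤ := by
      refine eq_top_iff.2 fun v _ d F hF hX => ?_
      obtain ⟨c, hc⟩ := (vanishes_of_vanishesOn hR hF hX).exists_grad hσ hσx hder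
      have h1 := hax d F hF hX
      rw [← eval_D] at h1 ⊢
      rw [hc, mul_eq_zero, or_iff_left h0] at h1
      rw [hc, h1, zero_mul]
    have := hx.2
    rw [htop, finrank_top, Module.finrank_fin_fun] at this
    omega
  obtain ⟨ζ, hζ⟩ := eq_N_of_Ns (T.pl_ne_zero hσ) hσx
  obtain ⟨c, hc, h1⟩ := T.contourMap_eq hw a
  have hne : T.contourMap σ a ≠ 0 := fun h => hσa (T.contourMap_ne_zero hw hreg h)
  have h2 : N (T.pl σ) (Ns (T.der σ w) a) ≠ 0 := fun h => hne (by rw [h1, h, smul_zero])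
  obtain ⟨r, hr⟩ := exists_smul_N (x := T.pl σ) (z := ζ) (w := Ns (T.der σ w) a) (T.pf_pl σ) (by
    rw [dt_N, ← hζ, dt_comm, dt_Ns, h0]; simp) h2
  rw [contourMap_eq_cv] at h1
  refine ⟨r * (c⁻¹ * eval σ T.h), ?_⟩
  rw [hζ, hr, mul_smul, mul_smul, h1, inv_smul_smul₀ hc]

end Scroll

/-! ### A surface with the same contours -/

/-- The equations of a line. -/
noncomputable def lineForm (x : Fin 6 → ℂ) (i : Fin 4) : MvPolynomial (Fin 4) ℂ :=
  ∑ j, C (skewDual x i j) * X j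

theorem lineForm_isHomogeneous (x : Fin 6 → ℂ) (i : Fin 4) : (lineForm x i).IsHomogeneous 1 :=
  IsHomogeneous.sum _ _ _ fun j _ => by
    simpa using (isHomogeneous_C _ (skewDual x i j)).mul (isHomogeneous_X ℂ j)

theorem eval_lineForm (x : Fin 6 → ℂ) (i : Fin 4) (v : Fin 4 → ℂ) :
    eval v (lineForm x i) = Ns x v i := by
  rw [Ns_eq_sum]
  simp [lineForm]

theorem NotInLine.of_smul {f g : (Fin 2 → ℂ) → Fin 4 → ℂ} (hf : NotInLine f)
    (h : ∀ u, u ≠ 0 → ∃ r : ℂ, f u = r • g u) : NotInLine g := by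
  intro x hx hx0
  obtain ⟨u, hu, h1⟩ := hf x hx hx0
  refine ⟨u, hu, fun h2 => h1 ?_⟩
  obtain ⟨r, hr⟩ := h u hu
  rw [hr, Ns_smul_right, h2, smul_zero]

theorem NotInLine.exists_not_smul {f : (Fin 2 → ℂ) → Fin 4 → ℂ} (hf : NotInLine f) {p : Fin 4 → ℂ}
    (hp : p ≠ 0) : ∃ u, u ≠ 0 ∧ ∀ r : ℂ, f u ≠ r • p := by
  obtain ⟨u, hu, h⟩ := hf.exists_wed hp
  exact ⟨u, hu, fun r hr => h (by rw [hr, wed_smul_right, wed_self, smul_zero])⟩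

namespace Surface
variable {S : Surface} {T : Scroll} {R : Set P3}

/-- The contour of the larger surface consists of points of its contour curve, together possibly
with points on finitely many exceptional rulings: those with degenerate derivative or through `a`.
These rulings have to be discarded. -/
theorem General.eval_eq_zero {a : Fin 4 → ℂ} (ha : S.General a)
    (hR : ∀ v (hv : v ≠ 0), Projectivization.mk ℂ v hv ∈ R ↔ T.On v)
    (hsub : contour S.points (Projectivization.mk ℂ a ha.ne_zero) ⊆
      contour R (Projectivization.mk ℂ a ha.ne_zero))
    {H : MvPolynomial (Fin 4) ℂ} {d : ℕ} (hH : H.IsHomogeneous d)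
    (h0 : ∀ σ, σ ≠ 0 → eval (T.cv σ a) H = 0) (u : Fin 2 → ℂ) : eval (S.cv u a) H = 0 := by
  classical
  obtain ⟨d₀, f₀, hf₀, hf₀0, hreg⟩ : ∃ (d₀ : ℕ) (f₀ : MvPolynomial (Fin 2) ℂ), f₀.IsHomogeneous d₀ ∧
      f₀ ≠ 0 ∧ ∀ σ, eval σ f₀ ≠ 0 → (∀ w, wedge σ w ≠ 0 → pf (T.der σ w) ≠ 0) ∧ Ns (T.pl σ) a ≠ 0 := by
    refine exists_form_of_eventually ?_ ?_
    · rintro c σ hc ⟨h1, h2⟩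
      refine ⟨fun w hw => ?_, ?_⟩
      · have e : T.der (c • σ) w = c ^ (T.degree - 1) • T.der σ w :=
          ev_smul (fun i => D_isHomogeneous (T.homogeneous i) w) c σ
        rw [wedge_smul_left] at hw
        rw [e, pf_smul]
        exact mul_ne_zero (pow_ne_zero _ (pow_ne_zero _ hc)) (h1 w (right_ne_zero_of_mul hw))
      · rw [Scroll.pl_smul, Ns_smul_left]
        exact smul_ne_zero (pow_ne_zero _ hc) h2
    · obtain ⟨t, -, ht⟩ := T.exists_pl_not_through ha.ne_zero
      obtain ⟨l, hl⟩ := Function.ne_iff.1 ht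
      have hp : Pol fun t => Ns (T.pl t) a l := Pol.Ns (z := fun _ => a) T.pol_pl (fun _ => Pol.const _) l
      filter_upwards [T.eventually_pf_der, hp.eventually_ne hl] with σ h1 h2
      exact ⟨h1, fun h => h2 (by rw [h]; rfl)⟩
  have hfin := (zeros_finite hf₀ hf₀0).1
  have hL : ∀ τ : P1, ∃ i u, Ns (T.pl τ.rep) (S.cv u a) i ≠ 0 := fun τ => by
    obtain ⟨u, -, hu⟩ := ha.notInLine _ (T.pf_pl τ.rep) (T.pl_ne_zero τ.rep_nonzero)
    obtain ⟨i, hi⟩ := Function.ne_iff.1 hu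
    exact ⟨i, u, hi⟩
  choose i v hiv using hL
  -- For each exceptional ruling the factor is a linear equation of it that does not vanish on the
  -- given contour curve. It exists because this curve is not contained in a line.
  let G := H * ∏ τ ∈ hfin.toFinset, lineForm (T.pl τ.rep) (i τ)
  have hG : G.IsHomogeneous (d + ∑ τ ∈ hfin.toFinset, 1) :=
    hH.mul (IsHomogeneous.prod _ _ _ fun τ _ => lineForm_isHomogeneous _ _)
  have hvan : ∀ u, u ≠ 0 → eval (S.cv u a) G = 0 := by
    intro u hu
    have hmem := hsub (by
      rw [ha.contour_eq]
      exact ⟨Projectivization.mk ℂ u hu, ha.curve.pt_mk hu⟩)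
    refine (mk_mem_closure _).1 hmem _ G hG fun x hx => ?_
    obtain ⟨hx, hax⟩ := hx
    have hxR := hx.1
    rw [← x.mk_rep, hR] at hxR
    obtain ⟨σ, hσ, hσx⟩ := hxR
    change eval x.rep (H * _) = 0
    rw [map_mul, map_prod]
    by_cases hz : eval σ f₀ = 0
    · have hτ : Projectivization.mk ℂ σ hσ ∈ hfin.toFinset := by
        rw [Set.Finite.mem_toFinset, mk_mem_zeros hf₀]
        exact hz
      rw [Finset.prod_eq_zero hτ, mul_zero]
      obtain ⟨c, -, hc⟩ := rep_mk hσ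
      rw [eval_lineForm, hc, Scroll.pl_smul, Ns_smul_left, hσx, smul_zero]
      rfl
    · obtain ⟨w, hw⟩ := exists_wedge_ne_zero hσ
      obtain ⟨r, hr⟩ := Scroll.exists_eq_smul_cv hR hx ha.ne_zero hax hσ hw ((hreg σ hz).1 w hw) hσx
        (hreg σ hz).2
      rw [hr, eval_smul_form hH, h0 σ hσ, mul_zero, zero_mul]
  refine Pol.eq_zero (f := fun u => eval (S.cv u a) H) (Pol.evalComp _ (S.pol_curve a)) ?_ u
  have hall : ∀ᶠ u in gen (Fin 2), ∀ τ ∈ hfin.toFinset, Ns (T.pl τ.rep) (S.cv u a) (i τ) ≠ 0 := by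
    rw [Finset.eventually_all]
    intro τ _
    exact Pol.eventually_ne (f := fun u => Ns (T.pl τ.rep) (S.cv u a) (i τ))
      (Pol.Ns (x := fun _ => T.pl τ.rep) (fun _ => Pol.const _) (S.pol_curve a) _) (hiv τ)
  filter_upwards [hall, eventually_ne_zero] with u hu hu0
  have := hvan u hu0
  change eval _ (H * _) = 0 at this
  rw [map_mul, map_prod] at this
  refine (mul_eq_zero.1 this).resolve_right (Finset.prod_ne_zero_iff.2 fun τ hτ => ?_)
  rw [eval_lineForm]
  exact hu τ hτ

/-- The contour curve of a surface with a larger contour factors through the contour curve. -/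
theorem General.exists_factor {a : Fin 4 → ℂ} (ha : S.General a)
    (hR : ∀ v (hv : v ≠ 0), Projectivization.mk ℂ v hv ∈ R ↔ T.On v)
    (hsub : contour S.points (Projectivization.mk ℂ a ha.ne_zero) ⊆
      contour R (Projectivization.mk ℂ a ha.ne_zero)) :
    NotInLine (fun σ => T.cv σ a) ∧ ∃ (e : ℕ) (A : Fin 2 → MvPolynomial (Fin 2) ℂ), e ≠ 0 ∧
      (∀ i, (A i).IsHomogeneous e) ∧ (∀ σ, σ ≠ 0 → ev A σ ≠ 0) ∧
      ∀ σ, σ ≠ 0 → ∃ r : ℂ, T.cv σ a = r • S.cv (ev A σ) a := by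
  have hT : NotInLine fun σ => T.cv σ a := by
    intro x hx hx0
    by_contra! h
    obtain ⟨u, -, hu⟩ := ha.notInLine x hx hx0
    refine hu (funext fun i => ?_)
    rw [← eval_lineForm]
    refine ha.eval_eq_zero hR hsub (lineForm_isHomogeneous x i) (fun σ hσ => ?_) u
    rw [eval_lineForm, h σ hσ]
    rfl
  refine ⟨hT, ?_⟩
  obtain ⟨m, e, h, g, -, hh0, hh, hg, hfg, hb⟩ := exists_content (f := fun i => comb (T.cform i) a)
    (T.curve_isHomogeneous a) (by
      by_contra! h0
      obtain ⟨u, -, hu⟩ := hT (T.pl ![1, 0]) (T.pf_pl _) (T.pl_ne_zero (by intro h; simpa using congrFun h 0))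
      refine hu ?_
      have : T.cv u a = 0 := funext fun i => by simp [Scroll.cv, ev, h0]
      exact (congrArg (Ns _) this).trans (Ns_zero_right _))
  let c' : RationalMap := ⟨e, g, hg, hb⟩
  have hval : ∀ σ, T.cv σ a = eval σ h • c'.val σ := fun σ => funext fun i => by
    simp only [Scroll.cv, ev, hfg, map_mul]
    rfl
  have hc' : NotInLine c'.val := hT.of_smul fun σ _ => ⟨_, hval σ⟩
  have hnc : ∀ {f : (Fin 2 → ℂ) → Fin 4 → ℂ}, NotInLine f → ∀ {p : Fin 4 → ℂ}, p ≠ 0 →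
      ¬ ∀ u, u ≠ 0 → ∃ r : ℂ, f u = r • p := fun hf p hp h => by
    obtain ⟨u, hu, h1⟩ := hf.exists_not_smul hp
    obtain ⟨r, hr⟩ := h u hu
    exact h1 r hr
  have h10 : (![1, 0] : Fin 2 → ℂ) ≠ 0 := by intro h; simpa using congrFun h 0
  have he : c'.degree ≠ 0 := by
    intro he
    have hg0 : ∀ i, (c'.form i).IsHomogeneous 0 := fun i => he ▸ c'.homogeneous i
    refine hnc hc' (c'.val_ne_zero h10) fun u _ => ⟨1, ?_⟩
    rw [one_smul]
    exact funext fun i => form_degree_zero (hg0 i) _ _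
  have hCc' : ∀ u, u ≠ 0 → ∃ σ, σ ≠ 0 ∧ ∃ r : ℂ, S.cv u a = r • c'.val σ := by
    intro u hu
    rw [← c'.mk_mem_range (ha.2.1 u hu), ← c'.closure_range he, mk_mem_closure]
    intro d H hH hX
    refine ha.eval_eq_zero hR hsub hH (fun σ hσ => ?_) u
    rw [hval, eval_smul_form hH, (vanishesOn_iff hH).1 hX _ (c'.val_ne_zero hσ)
      ⟨Projectivization.mk ℂ σ hσ, c'.pt_mk hσ⟩, mul_zero]
  -- A form that vanishes on the contour of `S` but not on `c'` has finitely many zeros along `c'`.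
  -- The contour curve of `S` lies on the image of `c'`, so it would consist of finitely many
  -- points.
  have hc'C : ∀ σ, σ ≠ 0 → ∃ u, u ≠ 0 ∧ ∃ r : ℂ, c'.val σ = r • ha.curve.val u := by
    intro σ₀ hσ₀
    rw [← ha.curve.mk_mem_range (c'.val_ne_zero hσ₀),
      ← ha.curve.closure_range ha.generallyInjective.degree_ne_zero, mk_mem_closure]
    intro d H hH hX
    by_contra hne
    rw [vanishesOn_iff hH] at hX
    obtain ⟨d₁, f₁, hf₁, hf₁0, hP⟩ := exists_form_of_eventually (P := fun σ => eval (c'.val σ) H ≠ 0)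
      (fun r σ hr h => by
        rw [c'.val_smul, eval_smul_form hH]
        exact mul_ne_zero (pow_ne_zero _ (pow_ne_zero _ hr)) h)
      ((Pol.evalComp H c'.pol_val).eventually_ne hne)
    have h2 := eventually_forall_zero (l := gen (Fin 2)) hf₁ hf₁0
      (Q := fun τ u => ∀ r : ℂ, S.cv u a ≠ r • c'.val τ) (fun r τ u _ h s => by
        rw [c'.val_smul, smul_smul]
        exact h _) (fun τ hτ _ => ha.notInLine.eventually_not_smul (S.pol_curve a) (c'.val_ne_zero hτ))
    obtain ⟨u, hu, hu0⟩ := (h2.and eventually_ne_zero).exists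
    obtain ⟨σ, hσ, r, hr⟩ := hCc' u hu0
    refine hu σ hσ (by_contra fun h3 => hP σ h3 ?_) r hr
    have h4 := hX _ (ha.2.1 u hu0) ⟨Projectivization.mk ℂ u hu0, ha.curve.pt_mk hu0⟩
    have hr0 : r ≠ 0 := by
      rintro rfl
      exact ha.2.1 u hu0 (by rw [hr, zero_smul])
    rw [hr, eval_smul_form hH] at h4
    exact (mul_eq_zero.1 h4).resolve_left (pow_ne_zero _ hr0)
  obtain ⟨e', A, B, hA, hB, hAB, hl⟩ := ha.generallyInjective.exists_lift hg (by
    by_contra! h0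
    refine hnc hc' (c'.val_ne_zero h10) fun u _ => ?_
    refine exists_smul_of_cross (c'.val_ne_zero h10) fun i j => ?_
    have := h0 u ![1, 0] i j
    exact this) (by
    filter_upwards [eventually_ne_zero] with σ hσ
    exact hc'C σ hσ)
  have hev : ∀ σ, ev ![A, B] σ = ![eval σ A, eval σ B] := fun σ => by
    ext i; fin_cases i <;> rfl
  have hev0 : ∀ σ, σ ≠ 0 → ev ![A, B] σ ≠ 0 := fun σ hσ h0 => by
    rcases hAB σ hσ with h | h
    · exact h (congrFun h0 0)
    · exact h (congrFun h0 1)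
  have hfac : ∀ σ, σ ≠ 0 → ∃ r : ℂ, c'.val σ = r • S.cv (ev ![A, B] σ) a := fun σ hσ =>
    exists_smul_of_cross (ha.2.1 _ (hev0 σ hσ)) fun i j => by
      rw [hev]
      exact hl σ i j
  refine ⟨e', ![A, B], ?_, ?_, hev0, fun σ hσ => ?_⟩
  · rintro rfl
    refine hnc hc' (ha.2.1 _ (hev0 _ h10)) fun u hu => ?_
    obtain ⟨r, hr⟩ := hfac u hu
    refine ⟨r, ?_⟩
    rw [hr, hev, hev, form_degree_zero hA u ![1, 0], form_degree_zero hB u ![1, 0]]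
  · intro i; fin_cases i; exacts [hA, hB]
  · obtain ⟨r, hr⟩ := hfac σ hσ
    exact ⟨eval σ h * r, by rw [hval, hr, smul_smul]⟩

end Surface

/-- A pair of forms of positive degree without a common zero is onto, so the pull-back of a non-zero
form is non-zero. -/
theorem eventually_comp_forms {A : Fin 2 → MvPolynomial (Fin 2) ℂ} {e : ℕ} (he : e ≠ 0)
    (hA : ∀ i, (A i).IsHomogeneous e) {P : (Fin 2 → ℂ) → Prop}
    (hP : ∀ (c : ℂ) u, c ≠ 0 → P u → P (c • u)) (hA0 : ∀ σ, σ ≠ 0 → ev A σ ≠ 0)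
    (h : ∀ᶠ u in gen (Fin 2), P u) : ∀ᶠ σ in gen (Fin 2), P (ev A σ) := by
  obtain ⟨d, f, hf, hf0, hfP⟩ := exists_form_of_eventually hP h
  obtain ⟨u, hu⟩ := exists_eval_ne_zero hf0
  obtain ⟨σ, hσ, h0⟩ := exists_zero (f := C (u 0) * A 1 - C (u 1) * A 0) (d := e)
    (by
      refine IsHomogeneous.sub ?_ ?_
      · simpa using (isHomogeneous_C _ (u 0)).mul (hA 1)
      · simpa using (isHomogeneous_C _ (u 1)).mul (hA 0)) he
  have hw : wedge u (ev A σ) = 0 := by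
    simpa [wedge, ev] using h0
  obtain ⟨c, hc⟩ := exists_smul_of_wedge (hA0 σ hσ) hw
  have hp : Pol fun σ => eval (ev A σ) f := Pol.evalComp _ (Pol.ev A)
  filter_upwards [hp.eventually_ne (v := σ) (by
    intro h1
    rw [hc, eval_smul_form hf, h1, mul_zero] at hu
    exact hu rfl)] with τ hτ
  exact hfP _ hτ

theorem exists_smul_ev {A : Fin 2 → MvPolynomial (Fin 2) ℂ} {e : ℕ} (he : e ≠ 0)
    (hA : ∀ i, (A i).IsHomogeneous e) (hA0 : ∀ σ, σ ≠ 0 → ev A σ ≠ 0) (u : Fin 2 → ℂ) :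
    ∃ σ, σ ≠ 0 ∧ ∃ c : ℂ, u = c • ev A σ := by
  obtain ⟨σ, hσ, h0⟩ := exists_zero (f := C (u 0) * A 1 - C (u 1) * A 0) (d := e)
    (by
      refine IsHomogeneous.sub ?_ ?_
      · simpa using (isHomogeneous_C _ (u 0)).mul (hA 1)
      · simpa using (isHomogeneous_C _ (u 1)).mul (hA 0)) he
  exact ⟨σ, hσ, exists_smul_of_wedge (hA0 σ hσ) (by simpa [wedge, ev] using h0)⟩

/-- Differentiation of a proportionality between a curve and a reparametrized curve. -/
theorem dt_dv_eq_zero {f g : Fin 4 → MvPolynomial (Fin 2) ℂ} {A : Fin 2 → MvPolynomial (Fin 2) ℂ}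
    (h : ∀ σ, σ ≠ 0 → ∃ r : ℂ, ev f σ = r • ev g (ev A σ)) {σ : Fin 2 → ℂ} (hσ : σ ≠ 0)
    (hne : ev g (ev A σ) ≠ 0) {π : Fin 4 → ℂ} (h0 : dt (ev g (ev A σ)) π = 0)
    (h1 : ∀ w, dt (dv g (ev A σ) w) π = 0) (w : Fin 2 → ℂ) : dt (dv f σ w) π = 0 := by
  have hcomp : ∀ σ i, eval σ (aeval A (g i)) = ev g (ev A σ) i := fun σ i => eval_aeval _ _ _
  have hD : ∀ i, eval σ (D w (aeval A (g i))) = dv g (ev A σ) (dv A σ w) i := fun i => by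
    rw [D_aeval, map_sum]
    simp only [dv, eval_D, map_mul]
    refine Finset.sum_congr rfl fun l _ => ?_
    rw [eval_aeval, mul_comm]
    rfl
  have key : ∀ i j, f i * aeval A (g j) - f j * aeval A (g i) = 0 := fun i j => by
    refine MvPolynomial.funext fun σ => ?_
    rw [map_zero]
    refine Pol.eq_zero (f := fun σ => eval σ (f i * aeval A (g j) - f j * aeval A (g i)))
      ⟨_, fun _ => rfl⟩ ?_ σ
    filter_upwards [eventually_ne_zero] with τ hτ
    obtain ⟨r, hr⟩ := h τ hτ
    have e : ∀ i, eval τ (f i) = r * ev g (ev A τ) i := fun i => congrFun hr i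
    rw [map_sub, map_mul, map_mul, hcomp, hcomp, e, e]
    ring
  obtain ⟨j, hj⟩ := Function.ne_iff.1 hne
  obtain ⟨r, hr⟩ := h σ hσ
  have e : ∀ i, eval σ (f i) = r * ev g (ev A σ) i := fun i => congrFun hr i
  have k : ∀ i, dv f σ w i * ev g (ev A σ) j + r * ev g (ev A σ) i * dv g (ev A σ) (dv A σ w) j =
      dv f σ w j * ev g (ev A σ) i + r * ev g (ev A σ) j * dv g (ev A σ) (dv A σ w) i := fun i => by
    have := congrArg (fun p => eval σ (D w p)) (key i j)
    simp only [map_sub, D_mul, map_add, map_mul, map_zero, hcomp, hD, e] at this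
    simp only [dv] at this ⊢
    linear_combination this
  have h1' := h1 (dv A σ w)
  refine (mul_eq_zero.1 (?_ : ev g (ev A σ) j * dt (dv f σ w) π = 0)).resolve_left hj
  simp only [dt] at h0 h1' ⊢
  linear_combination π 0 * k 0 + π 1 * k 1 + π 2 * k 2 + π 3 * k 3 +
    (dv f σ w j - r * dv g (ev A σ) (dv A σ w) j) * h0 + r * ev g (ev A σ) j * h1'

namespace Surface
variable {S : Surface} {T : Scroll} {R : Set P3} {a b : Fin 4 → ℂ}

/-- The tangent of the common contour curve and `a` span a plane for generic `σ`. By `dt_cd` it is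
the plane of `a` and the ruling, for either surface. -/
theorem General.eventually_plane (ha : S.General a) (hT : NotInLine fun σ => T.cv σ a)
    {A : Fin 2 → MvPolynomial (Fin 2) ℂ} (hA0 : ∀ σ, σ ≠ 0 → ev A σ ≠ 0)
    (h : ∀ σ, σ ≠ 0 → ∃ r : ℂ, T.cv σ a = r • S.cv (ev A σ) a) :
    ∀ᶠ σ in gen (Fin 2), ∃ c : ℂ, Ns (S.pl (ev A σ)) a = c • Ns (T.pl σ) a := by
  obtain ⟨w, hw⟩ := eventually_tangent (T.curve_isHomogeneous a) hT ha.ne_zero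
  obtain ⟨t, -, ht⟩ := T.exists_pl_not_through ha.ne_zero
  obtain ⟨l, hl⟩ := Function.ne_iff.1 ht
  have hp : Pol fun t => Ns (T.pl t) a l := Pol.Ns (z := fun _ => a) T.pol_pl (fun _ => Pol.const _) l
  filter_upwards [hw, hp.eventually_ne hl, eventually_ne_zero] with σ h1 h2 hσ
  by_contra! hcon
  refine h1 (Ns_wed_eq_zero (π := Ns (S.pl (ev A σ)) a) (π' := Ns (T.pl σ) a) ?_ ?_ ?_ (dt_Ns_self _ _)
    ?_ (T.dt_cd σ w a) (dt_Ns_self _ _) ?_ hcon)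
  · intro h3
    refine h1 ?_
    rw [h3]
    ext i; fin_cases i <;> simp [Ns, N, dual]
  · obtain ⟨r, hr⟩ := h σ hσ
    change dt (T.cv σ a) _ = 0
    rw [hr, dt_smul_left, dt_Ns, S.Ns_pl_cv, dt_zero_right, neg_zero, mul_zero]
  · refine dt_dv_eq_zero (f := fun i => comb (T.cform i) a) (g := fun i => comb (S.cform i) a) h hσ
      (ha.2.1 _ (hA0 σ hσ)) ?_ (fun w => S.dt_cd _ w a) w
    change dt (S.cv (ev A σ) a) _ = 0
    rw [dt_Ns, S.Ns_pl_cv, dt_zero_right, neg_zero]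
  · change dt (T.cv σ a) _ = 0
    rw [dt_Ns, T.Ns_pl_cv, dt_zero_right, neg_zero]
  · intro h3
    exact h2 (by rw [h3]; rfl)

/-- The generic ruling of `T` joins the points `cv (A σ) a` and `cv (B σ) b` of `S`. Once `A σ` and
`B σ` are known to be proportional, it shares two points with the ruling `A σ` of `S`, so the
families of lines agree. -/
theorem GeneralPair.unique (h : S.GeneralPair a b) (hR : IsRationalRuledSurface R)
    (hsa : contour S.points (Projectivization.mk ℂ a h.left.ne_zero) ⊆
      contour R (Projectivization.mk ℂ a h.left.ne_zero))
    (hsb : contour S.points (Projectivization.mk ℂ b h.right.ne_zero) ⊆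
      contour R (Projectivization.mk ℂ b h.right.ne_zero)) : R = S.points := by
  obtain ⟨p, q, hpq⟩ := hR
  obtain ⟨T, hT, -, -⟩ := exists_scroll hpq
  obtain ⟨hTa, e, A, he, hA, hA0, ha⟩ := h.left.exists_factor hT hsa
  obtain ⟨hTb, e', B, he', hB, hB0, hb⟩ := h.right.exists_factor hT hsb
  have hev : ∀ {a : Fin 4 → ℂ}, NotInLine (fun σ => T.cv σ a) → ∀ᶠ σ in gen (Fin 2), T.cv σ a ≠ 0 := by
    intro a hTa
    obtain ⟨u, -, hu⟩ := hTa (T.pl ![1, 0]) (T.pf_pl _) (T.pl_ne_zero (by intro h; simpa using congrFun h 0))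
    have : T.cv u a ≠ 0 := fun h0 => hu ((congrArg (Ns _) h0).trans (Ns_zero_right _))
    obtain ⟨l, hl⟩ := Function.ne_iff.1 this
    filter_upwards [(T.pol_curve a l).eventually_ne hl] with σ hσ h0
    exact hσ (by rw [h0]; rfl)
  have hskew := eventually_comp_forms he hA (fun c u hc h t ht => by
    rw [Scroll.pl_smul, Scroll.cv_smul_left, Ns_smul_left, dt_smul_right, dt_smul_left]
    rw [wedge_smul_right] at ht
    rw [mul_eq_zero, mul_eq_zero, or_iff_right (pow_ne_zero _ hc), or_iff_right (pow_ne_zero _ hc)]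
    exact h t (right_ne_zero_of_mul ht)) hA0 h.skew
  have hwed := eventually_comp_forms he hA (fun c u hc h => by
    rw [Scroll.cv_smul_left, Scroll.cv_smul_left, wed_smul_left, wed_smul_right]
    exact smul_ne_zero (pow_ne_zero _ hc) (smul_ne_zero (pow_ne_zero _ hc) h)) hA0 h.eventually_wed
  have hline : ∀ᶠ σ in gen (Fin 2), ∃ c : ℂ, c ≠ 0 ∧ T.pl σ = c • S.pl (ev A σ) := by
    filter_upwards [hskew, hwed, hev hTa, hev hTb, h.left.eventually_plane hTa hA0 ha,
      h.right.eventually_plane hTb hB0 hb, eventually_ne_zero] with σ h1 h2 h3 h4 h5 h6 hσ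
    obtain ⟨r, hr⟩ := ha σ hσ
    obtain ⟨s, hs⟩ := hb σ hσ
    obtain ⟨c, hc⟩ := h5
    obtain ⟨c', hc'⟩ := h6
    have hr0 : r ≠ 0 := fun h0 => h3 (by rw [hr, h0, zero_smul])
    have hs0 : s ≠ 0 := fun h0 => h4 (by rw [hs, h0, zero_smul])
    have hTa' := T.Ns_pl_cv σ a
    have hTb' := T.Ns_pl_cv σ b
    rw [hr, Ns_smul_right, smul_eq_zero, or_iff_right hr0] at hTa'
    rw [hs, Ns_smul_right, smul_eq_zero, or_iff_right hs0] at hTb'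
    -- The planes of the viewpoints and the rulings agree for `S` and `T`, and the ruling of `T`
    -- contains both contour points. So these points satisfy the two incidences excluded by `skew`.
    have hw : wedge (ev B σ) (ev A σ) = 0 := by
      by_contra hw
      refine h1 _ hw ⟨?_, ?_⟩
      · rw [hc, dt_smul_right, dt_Ns, hTb', dt_zero_right, neg_zero, mul_zero]
      · rw [hc', dt_smul_right, dt_Ns, hTa', dt_zero_right, neg_zero, mul_zero]
    obtain ⟨m, hm⟩ := exists_smul_of_wedge (hA0 σ hσ) hw
    have hm0 : m ≠ 0 := by
      rintro rfl
      exact hB0 σ hσ (by rw [hm, zero_smul])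
    rw [hm, Scroll.cv_smul_left, Ns_smul_right, smul_eq_zero, or_iff_right (pow_ne_zero _ hm0)] at hTb'
    obtain ⟨c, hc⟩ := exists_smul_of_line_le (T.pf_pl σ) (S.pf_pl _) (S.pl_ne_zero (hA0 σ hσ))
      (fun z hz => by
        rw [mem_span_of_common (T.pf_pl σ) (T.pl_ne_zero hσ) h2 hTa' hTb'] at hz
        rwa [mem_span_of_common (S.pf_pl _) (S.pl_ne_zero (hA0 σ hσ)) h2 (S.Ns_pl_cv _ _)
          (S.Ns_pl_cv _ _)])
    refine ⟨c, ?_, hc⟩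
    rintro rfl
    exact T.pl_ne_zero hσ (by rw [hc, zero_smul])
  have h1 : ∀ v, T.On v → S.On v := by
    rintro v ⟨σ, hσ, hv⟩
    obtain ⟨ζ, rfl⟩ := eq_N_of_Ns (T.pl_ne_zero hσ) hv
    rw [← S.eval_eq_zero_iff]
    refine Pol.eq_zero (f := fun σ => eval (N (T.pl σ) ζ) S.F) (Pol.evalComp _
      (Pol.N (z := fun _ => ζ) T.pol_pl fun _ => Pol.const _)) ?_ σ
    filter_upwards [hline, eventually_ne_zero] with τ hτ hτ0
    obtain ⟨c, -, hc⟩ := hτ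
    refine S.vanishes _ ⟨_, hA0 τ hτ0, ?_⟩
    rw [hc, N_smul_left, Ns_smul_right, Ns_N_self (S.pf_pl _), smul_zero]
  have h2 : ∀ v, S.On v → T.On v := by
    intro v hv
    by_contra hvT
    obtain ⟨d, H, hH, hH0, hne⟩ := T.exists_separating hvT
    obtain ⟨u, hu, hv⟩ := hv
    obtain ⟨ζ, rfl⟩ := eq_N_of_Ns (S.pl_ne_zero hu) hv
    obtain ⟨σ, hσ, c, rfl⟩ := exists_smul_ev he hA hA0 u
    apply hne
    rw [Scroll.pl_smul, N_smul_left, eval_smul_form hH]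
    have : eval (N (S.pl (ev A σ)) ζ) H = 0 := by
      refine Pol.eq_zero (f := fun σ => eval (N (S.pl (ev A σ)) ζ) H) (Pol.evalComp _
        (Pol.N (z := fun _ => ζ) (S.pol_pl' (Pol.ev A)) fun _ => Pol.const _)) ?_ σ
      filter_upwards [hline, eventually_ne_zero] with τ hτ hτ0
      obtain ⟨c, hc0, hc⟩ := hτ
      refine hH0 _ ⟨τ, hτ0, ?_⟩
      rw [hc, Ns_smul_left, Ns_N_self (S.pf_pl _), smul_zero]
    rw [this, mul_zero]
  ext x
  rw [← x.mk_rep, hT, mem_points]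
  exact ⟨h1 _, h2 _⟩

end Surface

/-! ### A second surface with the same contour -/

theorem exists_affine {P : (Fin 2 → ℂ) → Prop} (hP : ∀ (c : ℂ) u, c ≠ 0 → P u → P (c • u))
    (h : ∀ᶠ u in gen (Fin 2), P u) : ∃ s : ℂ, P ![1, s] := by
  obtain ⟨u, hu, h0⟩ := (h.and ((Pol.coord (0 : Fin 2)).eventually_ne (v := 1) (by simp))).exists
  refine ⟨u 1 / u 0, ?_⟩
  convert hP (u 0)⁻¹ u (inv_ne_zero h0) hu using 1
  ext i
  fin_cases i <;> simp [h0, div_eq_inv_mul]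

namespace Scroll
variable (T : Scroll)

/-- Points in the planes spanned by the rulings and the viewpoint `a`. -/
noncomputable def tilt (a ζ : Fin 4 → ℂ) (l : Fin 2 → ℂ) (i : Fin 4) : MvPolynomial (Fin 2) ℂ :=
  C (l 0) * ∑ j, skew T.form i j * C (ζ j) + C (l 1 * a i) * X 0 ^ T.degree

theorem tilt_isHomogeneous (a ζ : Fin 4 → ℂ) (l : Fin 2 → ℂ) (i : Fin 4) :
    (T.tilt a ζ l i).IsHomogeneous T.degree := by
  have h : ∀ (c : ℂ) {p : MvPolynomial (Fin 2) ℂ}, p.IsHomogeneous T.degree →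
      (C c * p).IsHomogeneous T.degree := fun c p hp => by
    simpa using (isHomogeneous_C _ c).mul hp
  refine (h _ (IsHomogeneous.sum _ _ _ fun j _ => ?_)).add (h _ (by
    simpa using (isHomogeneous_X ℂ (0 : Fin 2)).pow T.degree))
  rw [mul_comm]
  exact h _ (skew_isHomogeneous T.homogeneous i j)

theorem ev_tilt (a ζ : Fin 4 → ℂ) (l u : Fin 2 → ℂ) :
    ev (T.tilt a ζ l) u = l 0 • N (T.pl u) ζ + (l 1 * u 0 ^ T.degree) • a := by
  ext i
  simp only [ev, tilt, map_add, map_mul, map_sum, eval_C, eval_skew, map_pow, eval_X, Pi.add_apply,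
    Pi.smul_apply, smul_eq_mul, N_eq_sum]
  simp only [pl]
  unfold ev
  ring

theorem dv_tilt (a ζ : Fin 4 → ℂ) (l u w : Fin 2 → ℂ) :
    ∃ r : ℂ, dv (T.tilt a ζ l) u w = l 0 • N (T.der u w) ζ + r • a := by
  refine ⟨l 1 * eval u (D w (X 0 ^ T.degree)), ?_⟩
  have h2 : ∀ i j, eval u (D w (skew T.form i j)) = skew (T.der u w) i j := by
    intro i j
    fin_cases i <;> fin_cases j <;> simp [skew, der, dv]
  ext i
  simp only [dv, tilt, map_add, D_mul, map_mul, map_sum, eval_C, D_C, h2, mul_zero, zero_add,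
    add_zero, Pi.add_apply, Pi.smul_apply, smul_eq_mul, N_eq_sum]
  simp only [mul_comm (ζ _)]; ring

end Scroll

namespace Surface
variable {S : Surface} {a : Fin 4 → ℂ}

/-- Otherwise the curve would lie in the planes of `a` and each ruling. Two different ones confine
it to a line; if they all agree, the rulings are coplanar. -/
theorem General.exists_dt_ne_zero (ha : S.General a) :
    ∃ u t, dt (S.cv u a) (Ns (S.pl t) a) ≠ 0 := by
  by_contra! h
  have h10 : (![1, 0] : Fin 2 → ℂ) ≠ 0 := by intro h; simpa using congrFun h 0
  have hπ : Ns (S.pl ![1, 0]) a ≠ 0 := fun h => ha.1 ⟨_, h10, h⟩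
  refine S.not_coplanar hπ ?_
  filter_upwards [eventually_ne_zero] with t ht
  have hπt : Ns (S.pl t) a ≠ 0 := fun h => ha.1 ⟨_, ht, h⟩
  by_cases hw : wed (Ns (S.pl ![1, 0]) a) (Ns (S.pl t) a) = 0
  · obtain ⟨c, hc⟩ := (wed_eq_zero_iff hπt).1 hw
    rw [hc, N_smul_right, N_Ns_self (S.pf_pl t), smul_zero]
  · obtain ⟨u, -, hu⟩ := ha.notInLine (dual (wed (Ns (S.pl ![1, 0]) a) (Ns (S.pl t) a)))
      (by rw [pf_dual, pf_wed]) (fun h0 => hw (by rw [← dual_dual (wed _ _), h0]; ext i; fin_cases i <;> simp [dual]))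
    refine absurd ?_ hu
    rw [Ns, dual_dual, N_wed, dt_comm, h, dt_comm, h, zero_smul, zero_smul, sub_zero]

/-- Each ruling is to be replaced by the line joining its contour point to a tilted point in the
same plane through `a`. The conditions ensure that the joining lines are all defined, that the new
surface is regular and has a smooth contour point at the parameter `s`, and that it leaves the old
surface. -/
theorem General.exists_tilt (ha : S.General a) : ∃ (s : ℂ) (ζ : Fin 4 → ℂ) (l : Fin 2 → ℂ),
    (∀ t, t ≠ 0 → wed (S.cv t a) (ev (S.tilt a ζ l) t) ≠ 0) ∧
    Ns (wed (S.cv ![1, s] a) (S.cd ![1, s] ![0, 1] a)) (ev (S.tilt a ζ l) ![1, s]) ≠ 0 ∧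
    (∀ t, t ≠ 0 → Ns (wed (S.cv t a) (ev (S.tilt a ζ l) t)) (S.cv ![1, s] a) = 0 →
      wedge t ![1, s] = 0) ∧
    dt (dv (S.tilt a ζ l) ![1, s] ![0, 1]) (Ns (S.pl ![1, s]) a) ≠ 0 ∧
    ¬ S.On (ev (S.tilt a ζ l) ![1, s]) := by
  obtain ⟨w₀, hw₀⟩ := eventually_tangent (S.curve_isHomogeneous a) ha.notInLine ha.ne_zero
  obtain ⟨u₁, t₁, h₁⟩ := ha.exists_dt_ne_zero
  have hpol : Pol fun u => dt (S.cv u a) (Ns (S.pl t₁) a) := Pol.dt (S.pol_curve a) fun _ => Pol.const _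
  obtain ⟨s, hs, ⟨w₁, hw₁⟩, t₂, ht₂⟩ := exists_affine (P := fun u => S.Smooth (S.cv u a) ∧
      (∃ w, Ns (wed (S.cv u a) (S.cd u w a)) a ≠ 0) ∧ ∃ t, dt (S.cv u a) (Ns (S.pl t) a) ≠ 0)
    (fun c u hc h => by
      obtain ⟨h1, ⟨w, h2⟩, t, h3⟩ := h
      have e : S.cd (c • u) w a = c ^ (S.cdeg - 1) • S.cd u w a :=
        ev_smul (fun i => D_isHomogeneous (S.curve_isHomogeneous a i) w) c u
      refine ⟨?_, ⟨w, ?_⟩, t, ?_⟩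
      · rw [Scroll.cv_smul_left]
        exact h1.smul (pow_ne_zero _ hc)
      · rw [Scroll.cv_smul_left, e, wed_smul_left, wed_smul_right, Ns_smul_left, Ns_smul_left]
        exact smul_ne_zero (pow_ne_zero _ hc) (smul_ne_zero (pow_ne_zero _ hc) h2)
      · rw [Scroll.cv_smul_left, dt_smul_left]
        exact mul_ne_zero (pow_ne_zero _ hc) h3)
    (by
      filter_upwards [ha.2.2, hw₀, hpol.eventually_ne h₁] with u h1 h2 h3
      exact ⟨h1, ⟨w₀, h2⟩, t₁, h3⟩)
  set u₀ : Fin 2 → ℂ := ![1, s] with hu₀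
  set x := S.cv u₀ a with hx
  have hu0 : u₀ ≠ 0 := fun h => by simpa [hu₀] using congrFun h 0
  have hw : wedge u₀ ![0, 1] ≠ 0 := by simp [wedge, hu₀]
  have htan : Ns (wed x (S.cd u₀ ![0, 1] a)) a ≠ 0 := by
    intro h0
    obtain ⟨α, β, rfl⟩ := exists_combination hw w₁
    apply hw₁
    rw [Scroll.cd_add, Scroll.cd_smul, Scroll.cd_smul, Scroll.cd_self]
    have := wed_combination (S.cv u₀ a) (S.cd u₀ ![0, 1] a) 1 0 (α * S.cdeg) β
    rw [one_smul, zero_smul, add_zero, mul_smul] at this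
    rw [this, Ns_smul_left, h0, smul_zero]
  have hQ0 : S.pairForm (wed x a) ≠ 0 := fun h => ht₂ (by
    rw [← eval_pairForm_wed, h, map_zero])
  have hQX : (S.pairForm (wed x a) * X 0).IsHomogeneous (S.degree + 1) :=
    (S.pairForm_isHomogeneous _).mul (isHomogeneous_X ℂ 0)
  have hζ1 := eventually_forall_zero (l := gen (Fin 4)) hQX (mul_ne_zero hQ0 (X_ne_zero 0))
    -- The factor `X 0` accounts for the parameter with `t 0 = 0`, where the tilted point has no
    -- component along `a`, so that `ζ` alone must provide a second point.
    (Q := fun t ζ => wed (S.cv t a) (N (S.pl t) ζ) ≠ 0) (fun c t ζ hc h => by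
      rw [Scroll.cv_smul_left, Scroll.pl_smul, N_smul_left, wed_smul_left, wed_smul_right]
      exact smul_ne_zero (pow_ne_zero _ hc) (smul_ne_zero (pow_ne_zero _ hc) h))
    (fun t ht _ => by
      obtain ⟨z, hz, hz'⟩ := exists_wed_ne_zero_of_line (S.pf_pl t) (S.pl_ne_zero ht) (ha.2.1 t ht)
      obtain ⟨ζ, rfl⟩ := eq_N_of_Ns (S.pl_ne_zero ht) hz
      obtain ⟨i, hi⟩ := Function.ne_iff.1 hz'
      have hp : Pol fun ζ => wed (S.cv t a) (N (S.pl t) ζ) i :=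
        Pol.wed (p := fun _ => S.cv t a) (fun _ => Pol.const _)
          (Pol.N (x := fun _ => S.pl t) (fun _ => Pol.const _) Pol.coord) i
      filter_upwards [hp.eventually_ne hi] with ζ hζ h0
      exact hζ (by rw [h0]; rfl))
  obtain ⟨ζ₁, hζ₁⟩ := RuledContours.exists_dt_ne_zero hs.ne_zero
  obtain ⟨ζ, hζ, hζx⟩ := (hζ1.and ((pol_dt x).eventually_ne (v := ζ₁) (by rwa [dt_comm]))).exists
  have hη : ∀ (t : Fin 2 → ℂ) i, Pol fun l : Fin 2 → ℂ => ev (S.tilt a ζ l) t i := fun t i => by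
    simp only [Scroll.ev_tilt, Pi.add_apply, Pi.smul_apply, smul_eq_mul]
    exact ((Pol.coord 0).mul (Pol.const _)).add
      (((Pol.coord 1).mul (Pol.const _)).mul (Pol.const _))
  -- A new line through `x` forces `x` into the plane of `a` and the ruling `t`, which happens for
  -- finitely many `t`. The choice `l = (1, 0)` gives back the old ruling, which misses the smooth
  -- point `x` for `t` different from `u₀`; so a generic `l` works.
  have hl1 := eventually_forall_zero (l := gen (Fin 2)) (S.pairForm_isHomogeneous (wed x a)) hQ0
    (Q := fun t l => wedge t u₀ ≠ 0 → Ns (wed (S.cv t a) (ev (S.tilt a ζ l) t)) x ≠ 0)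
    (fun c t l hc h h1 => by
      rw [wedge_smul_left] at h1
      rw [Scroll.cv_smul_left, ev_smul (S.tilt_isHomogeneous a ζ l), wed_smul_left, wed_smul_right,
        Ns_smul_left, Ns_smul_left]
      exact smul_ne_zero (pow_ne_zero _ hc)
        (smul_ne_zero (pow_ne_zero _ hc) (h (right_ne_zero_of_mul h1))))
    (fun t ht h0 => by
      by_cases htu : wedge t u₀ = 0
      · exact Eventually.of_forall fun l h => absurd htu h
      have hne := hζ t ht (by rw [map_mul, h0, zero_mul])
      have h1 : Ns (wed (S.cv t a) (ev (S.tilt a ζ ![1, 0]) t)) x ≠ 0 := by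
        have e : ev (S.tilt a ζ ![1, 0]) t = N (S.pl t) ζ := by
          rw [Scroll.ev_tilt]
          simp
        rw [e, Ne, mem_span_of_Ns hne, ← mem_span_of_common (S.pf_pl t) (S.pl_ne_zero ht) hne
          (S.Ns_pl_cv t a) (Ns_N_self (S.pf_pl t) ζ)]
        exact fun h => htu (hs.wedge_eq_zero ht hu0 h (S.Ns_pl_cv u₀ a))
      obtain ⟨i, hi⟩ := Function.ne_iff.1 h1
      have hp : Pol fun l => Ns (wed (S.cv t a) (ev (S.tilt a ζ l) t)) x i :=
        Pol.Ns (z := fun _ => x) (Pol.wed (p := fun _ => S.cv t a) (fun _ => Pol.const _) (hη t))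
          (fun _ => Pol.const _) i
      filter_upwards [hp.eventually_ne hi] with l hl _ h0
      exact hl (by rw [h0]; rfl))
  have e1 : ev (S.tilt a ζ ![0, 1]) u₀ = a := by
    rw [Scroll.ev_tilt]
    simp [hu₀]
  have hl2 : ∀ᶠ l in gen (Fin 2), Ns (wed x (S.cd u₀ ![0, 1] a)) (ev (S.tilt a ζ l) u₀) ≠ 0 := by
    obtain ⟨i, hi⟩ := Function.ne_iff.1 htan
    have hp : Pol fun l => Ns (wed x (S.cd u₀ ![0, 1] a)) (ev (S.tilt a ζ l) u₀) i :=
      Pol.Ns (x := fun _ => wed x (S.cd u₀ ![0, 1] a)) (fun _ => Pol.const _) (hη u₀) i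
    filter_upwards [hp.eventually_ne (v := ![0, 1]) (by rw [e1]; exact hi)] with l hl h0
    exact hl (by rw [h0]; rfl)
  have hl3 : ∀ᶠ l in gen (Fin 2), ¬ S.On (ev (S.tilt a ζ l) u₀) := by
    have hp : Pol fun l => eval (ev (S.tilt a ζ l) u₀) S.F := Pol.evalComp _ (hη u₀)
    filter_upwards [hp.eventually_ne (v := ![0, 1]) (by
      rw [e1]; exact fun h => ha.1 ((S.eval_eq_zero_iff a).1 h))] with l hl h0
    exact hl ((S.eval_eq_zero_iff _).2 h0)
  obtain ⟨l, ⟨⟨⟨hl1, hl2⟩, hl3⟩, hl0⟩, hl4⟩ := ((((hl1.and hl2).and hl3).and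
    ((Pol.coord (0 : Fin 2)).eventually_ne (v := 1) (by simp))).and
    ((Pol.coord (1 : Fin 2)).eventually_ne (v := 1) (by simp))).exists
  have hbpf : ∀ t, t ≠ 0 → wed (S.cv t a) (ev (S.tilt a ζ l) t) ≠ 0 := by
    intro t ht h0
    rw [wed_swap, smul_eq_zero, or_iff_right (by simp), wed_eq_zero_iff (ha.2.1 t ht)] at h0
    obtain ⟨r, hr⟩ := h0
    rw [Scroll.ev_tilt] at hr
    by_cases h0 : t 0 = 0
    · rw [h0, zero_pow S.degree_ne_zero, mul_zero, zero_smul, add_zero] at hr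
      refine hζ t ht (by rw [map_mul, eval_X, h0, mul_zero]) ?_
      rw [← inv_smul_smul₀ hl0 (N (S.pl t) ζ), hr, wed_smul_right, wed_smul_right, wed_self, smul_zero,
        smul_zero]
    · have h1 := congrArg (Ns (S.pl t)) hr
      rw [Ns_add_right, Ns_smul_right, Ns_smul_right, Ns_smul_right, S.Ns_pl_cv, Ns_N_self (S.pf_pl t),
        smul_zero, smul_zero, zero_add, smul_eq_zero,
        or_iff_right (mul_ne_zero hl4 (pow_ne_zero _ h0))] at h1
      exact ha.1 ⟨t, ht, h1⟩
  refine ⟨s, ζ, l, hbpf, hl2, fun t ht h => ?_, ?_, hl3⟩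
  · by_contra htu
    refine hl1 t ht ?_ htu h
    rw [mem_span_of_Ns (hbpf t ht), Submodule.mem_span_pair] at h
    obtain ⟨α, β, h⟩ := h
    rw [eval_pairForm_wed, hx, hu₀, ← h, dt_add_left, dt_smul_left, dt_smul_left, Scroll.ev_tilt, dt_add_left,
      dt_smul_left, dt_smul_left, dt_Ns_self, dt_Ns, S.Ns_pl_cv, dt_zero_right, dt_Ns _ (N _ _),
      Ns_N_self (S.pf_pl t), dt_zero_right]
    ring
  · obtain ⟨r, hr⟩ := S.dv_tilt a ζ l u₀ ![0, 1]
    rw [hr, dt_add_left, dt_smul_left, dt_smul_left, dt_Ns_self, mul_zero, add_zero]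
    refine mul_ne_zero hl0 ?_
    obtain ⟨c, hc, h1⟩ := S.contourMap_eq hw a
    rw [Scroll.contourMap_eq_cv, Scroll.N_pl_Ns_der] at h1
    have h2 := congrArg (dt ζ) h1
    rw [dt_smul_right, dt_smul_right] at h2
    have h3 : dt ζ (-N (S.der u₀ ![0, 1]) (Ns (S.pl u₀) a)) =
        dt (N (S.der u₀ ![0, 1]) ζ) (Ns (S.pl u₀) a) := by
      rw [dt_comm (N _ _), dt_N, ← neg_one_smul ℂ (N _ _), dt_smul_right]
      ring
    rw [h3] at h2
    intro h0
    rw [h0, mul_zero, mul_eq_zero, or_iff_right (hs.h_ne_zero hu0 (S.Ns_pl_cv u₀ a))] at h2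
    exact hζx (by rw [dt_comm] at h2; rwa [dt_comm])

end Surface

theorem exists_smul_of_dt {x y z π ρ : Fin 4 → ℂ} (h : Ns (wed x y) z ≠ 0) (h1 : dt x π = 0)
    (h2 : dt y π = 0) (h3 : dt z π = 0) (h1' : dt x ρ = 0) (h2' : dt y ρ = 0) (h3' : dt z ρ = 0)
    (hρ : ρ ≠ 0) : ∃ c : ℂ, π = c • ρ := by
  by_contra! h0
  refine h (Ns_wed_eq_zero (fun hw => h ?_) h1 h2 h3 h1' h2' h3' hρ h0)
  rw [hw, ← zero_smul ℂ (0 : Fin 6 → ℂ), Ns_smul_left, zero_smul]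

theorem finrank_ker_dt {π : Fin 4 → ℂ} (hπ : π ≠ 0) {V : Submodule ℂ (Fin 4 → ℂ)}
    (h : ∀ v, v ∈ V ↔ dt v π = 0) : Module.finrank ℂ V = 3 := by
  let φ : (Fin 4 → ℂ) →ₗ[ℂ] ℂ :=
    { toFun := fun v => dt v π
      map_add' := fun v w => dt_add_left _ _ _
      map_smul' := fun c v => dt_smul_left _ _ _ }
  have hV : V = φ.ker := by
    ext v
    rw [h, LinearMap.mem_ker]
    rfl
  have h1 := φ.finrank_range_add_finrank_ker
  obtain ⟨v, hv⟩ := exists_dt_ne_zero hπ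
  have : φ.range = ⊤ := LinearMap.range_eq_top.2 (LinearMap.surjective fun h0 => hv (by
    rw [dt_comm]
    exact LinearMap.congr_fun h0 v))
  rw [Module.finrank_fin_fun, this, finrank_top, Module.finrank_self] at h1
  rw [hV]
  omega

/-- The Plücker coordinates of the lines joining corresponding points of two curves. -/
noncomputable def wedForm (g h : Fin 4 → MvPolynomial (Fin 2) ℂ) : Fin 6 → MvPolynomial (Fin 2) ℂ :=
  ![g 0 * h 1 - g 1 * h 0, g 0 * h 2 - g 2 * h 0, g 0 * h 3 - g 3 * h 0,
    g 1 * h 2 - g 2 * h 1, g 1 * h 3 - g 3 * h 1, g 2 * h 3 - g 3 * h 2]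

section
variable {g h : Fin 4 → MvPolynomial (Fin 2) ℂ} {m n : ℕ}

theorem wedForm_isHomogeneous (hg : ∀ i, (g i).IsHomogeneous m) (hh : ∀ i, (h i).IsHomogeneous n)
    (i : Fin 6) : (wedForm g h i).IsHomogeneous (m + n) := by
  have (i j : Fin 4) : (g i * h j - g j * h i).IsHomogeneous (m + n) :=
    ((hg _).mul (hh _)).sub ((hg _).mul (hh _))
  fin_cases i <;> exact this _ _

theorem ev_wedForm (u : Fin 2 → ℂ) : ev (wedForm g h) u = wed (ev g u) (ev h u) := by
  ext i
  fin_cases i <;> simp [ev, wedForm, wed]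

theorem dv_wedForm (u w : Fin 2 → ℂ) :
    dv (wedForm g h) u w = wed (dv g u w) (ev h u) + wed (ev g u) (dv h u w) := by
  ext i
  fin_cases i <;> simp [ev, dv, wedForm, wed] <;> ring

/-- The surface of the lines joining corresponding points of two curves. -/
noncomputable def joinSurface (g h : Fin 4 → MvPolynomial (Fin 2) ℂ) : Set P3 :=
  zariskiClosure (⋃ s : ℂ, ruling (fun i => chart ![1, 0] ![0, 1] (g i))
    (fun i => chart ![1, 0] ![0, 1] (h i)) s)

theorem evalVec_chart (g : Fin 4 → MvPolynomial (Fin 2) ℂ) (s : ℂ) :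
    evalVec (fun i => chart ![1, 0] ![0, 1] (g i)) s = ev g ![1, s] := by
  ext i
  rw [evalVec, eval_chart]
  simp [ev]

theorem mk_mem_ruling_iff {v : Fin 4 → ℂ} (hv : v ≠ 0) {s : ℂ} :
    Projectivization.mk ℂ v hv ∈ ruling (fun i => chart ![1, 0] ![0, 1] (g i))
      (fun i => chart ![1, 0] ![0, 1] (h i)) s ↔
        v ∈ Submodule.span ℂ {ev g ![1, s], ev h ![1, s]} := by
  rw [mem_ruling_iff, evalVec_chart, evalVec_chart]

theorem mk_mem_joinSurface (hg : ∀ i, (g i).IsHomogeneous m) (hh : ∀ i, (h i).IsHomogeneous n)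
    {u : Fin 2 → ℂ} (hu : u 0 ≠ 0) (x y : ℂ) (hv : x • ev g u + y • ev h u ≠ 0) :
    Projectivization.mk ℂ (x • ev g u + y • ev h u) hv ∈ joinSurface g h := by
  refine subset_zariskiClosure _ (Set.mem_iUnion.2 ⟨u 1 / u 0, (mk_mem_ruling_iff hv).2 ?_⟩)
  have e : u = u 0 • ![1, u 1 / u 0] := by
    ext i
    fin_cases i
    · simp
    · simp [mul_div_cancel₀ _ hu]
  rw [Submodule.mem_span_pair]
  refine ⟨x * u 0 ^ m, y * u 0 ^ n, ?_⟩
  conv_rhs => rw [e, ev_smul hg, ev_smul hh]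
  rw [mul_smul, mul_smul]

theorem eval_eq_zero_of_vanishesOn_joinSurface (hg : ∀ i, (g i).IsHomogeneous m)
    (hh : ∀ i, (h i).IsHomogeneous n) (hne : ∀ t, t ≠ 0 → ev g t ≠ 0)
    {G : MvPolynomial (Fin 4) ℂ} {d : ℕ} (hG : G.IsHomogeneous d)
    (hGR : VanishesOn G (joinSurface g h)) (u : Fin 2 → ℂ) (x y : ℂ) :
    eval (x • ev g u + y • ev h u) G = 0 := by
  rw [vanishesOn_iff hG] at hGR
  have hP : ∀ i, Pol fun u => (x • ev g u + y • ev h u) i := fun i =>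
    ((Pol.const x).mul (Pol.ev g i)).add ((Pol.const y).mul (Pol.ev h i))
  refine (Pol.evalComp G hP).eq_zero ?_ u
  filter_upwards [(Pol.coord (0 : Fin 2)).eventually_ne (v := 1) (by simp)] with u h0
  by_cases hv : x • ev g u + y • ev h u = 0
  · have hu : ev g u ≠ 0 := hne u (by rintro rfl; exact h0 rfl)
    have h1 := hGR ((1 : ℂ) • ev g u + (0 : ℂ) • ev h u) (by simpa using hu)
      (mk_mem_joinSurface hg hh h0 1 0 _)
    rw [one_smul, zero_smul, add_zero] at h1
    change eval (x • ev g u + y • ev h u) G = 0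
    rw [hv, ← zero_smul ℂ (ev g u), eval_smul_form hG, h1, mul_zero]
  · exact hGR _ hv (mk_mem_joinSurface hg hh h0 x y hv)

theorem genericallyRegular_chart {s : ℂ}
    (h0 : dt (dv h ![1, s] ![0, 1]) (Ns (wed (ev g ![1, s]) (dv g ![1, s] ![0, 1])) (ev h ![1, s])) ≠ 0) :
    GenericallyRegular (fun i => chart ![1, 0] ![0, 1] (g i)) (fun i => chart ![1, 0] ![0, 1] (h i)) := by
  intro hdet
  apply h0
  have h1 := congrArg (Polynomial.eval s) hdet
  rw [det_eq_pf] at h1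
  simp only [derivative_chart, Polynomial.eval_add, Polynomial.eval_sub, Polynomial.eval_mul, eval_chart,
    Polynomial.eval_zero] at h1
  have e : (![1, 0] + s • ![0, 1] : Fin 2 → ℂ) = ![1, s] := by ext i; fin_cases i <;> simp
  rw [e] at h1
  simp [dt, Ns, N, wed, dual, ev, dv]
  linear_combination h1

/-- Along the curve `g` every form vanishing on the surface has a gradient proportional to `π u`, as
that plane contains the joining line and the tangent of the curve. One form with non-zero gradient
at a single point makes the generic point of the curve smooth with tangent plane `π u`, which
contains `a`. -/
theorem joinSurface_contour (hg : ∀ i, (g i).IsHomogeneous m) (hh : ∀ i, (h i).IsHomogeneous n)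
    (hmn : m + n ≠ 0) (hne : ∀ t, t ≠ 0 → wed (ev g t) (ev h t) ≠ 0) {s : ℂ}
    (hs : Ns (wed (ev g ![1, s]) (dv g ![1, s] ![0, 1])) (ev h ![1, s]) ≠ 0)
    (huniq : ∀ t, t ≠ 0 → Ns (wed (ev g t) (ev h t)) (ev g ![1, s]) = 0 → wedge t ![1, s] = 0)
    {π : (Fin 2 → ℂ) → Fin 4 → ℂ} (hπ : ∀ u, u ≠ 0 → π u ≠ 0) (hgπ : ∀ u, dt (ev g u) (π u) = 0)
    (hgπ' : ∀ u w, dt (dv g u w) (π u) = 0) (hhπ : ∀ u, dt (ev h u) (π u) = 0)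
    {a : Fin 4 → ℂ} (ha : a ≠ 0) (haπ : ∀ u, dt a (π u) = 0) {u : Fin 2 → ℂ} (hu : ev g u ≠ 0) :
    Projectivization.mk ℂ (ev g u) hu ∈ contour (joinSurface g h) (Projectivization.mk ℂ a ha) := by
  have hg0 : ∀ t, t ≠ 0 → ev g t ≠ 0 := fun t ht h0 => hne t ht (by
    rw [h0, ← zero_smul ℂ (0 : Fin 4 → ℂ), wed_smul_left, zero_smul])
  set u₀ : Fin 2 → ℂ := ![1, s] with hu₀
  set ρ := Ns (wed (ev g u₀) (dv g u₀ ![0, 1])) (ev h u₀) with hρ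
  have hu0 : u₀ ≠ 0 := fun h => by simpa [hu₀] using congrFun h 0
  have hw01 : wedge u₀ ![0, 1] ≠ 0 := by simp [wedge, hu₀]
  have hρg : dt (ev g u₀) ρ = 0 := by rw [hρ, dt_Ns, Ns_wed_left, dt_zero_right, neg_zero]
  have hρh : dt (ev h u₀) ρ = 0 := dt_Ns_self _ _
  obtain ⟨v, hv⟩ := exists_dt_ne_zero hs
  have hev : ∀ i x t, eval t (comb (skewDual (wedForm g h) i) x) = Ns (wed (ev g t) (ev h t)) x i := by
    intro i x t
    rw [eval_comb, ← ev_wedForm, Ns_eq_sum]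
    simp only [eval_skewDual, mul_comm (x _)]
    rfl
  have hdv : ∀ i x t w, eval t (D w (comb (skewDual (wedForm g h) i) x)) =
      Ns (dv (wedForm g h) t w) x i := by
    intro i x t w
    have h2 : ∀ j, eval t (D w (skewDual (wedForm g h) i j)) =
        skewDual (dv (wedForm g h) t w) i j := by
      intro j
      fin_cases i <;> fin_cases j <;> simp [skew, skewDual, dv]
    simp only [comb, map_sum, D_mul, D_C, map_mul, mul_zero, add_zero, eval_C, h2,
      Ns_eq_sum, mul_comm (x _)]
  -- At `u₀` only one joining line passes through the point and the family is transversal, so an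
  -- equation of the surface exists whose derivative along a vector `v` off the tangent plane `ρ` is
  -- not zero.
  obtain ⟨d, H, hH, hH0, hHv⟩ := exists_smooth_form hmn (T := skewDual (wedForm g h))
    (fun i j => skewDual_isHomogeneous (wedForm_isHomogeneous hg hh) i j) (x := ev g u₀) (v := v) hu0
    (fun i => by rw [hev, Ns_wed_left]; rfl)
    (fun t ht h0 => huniq t ht (funext fun i => by rw [← hev, h0]; rfl))
    (fun w hw => by
      obtain ⟨α, β, rfl⟩ := exists_combination hw01 w
      have hβ : β ≠ 0 := by
        rintro rfl
        rw [zero_smul, add_zero, wedge_smul_right, wedge_self, mul_zero] at hw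
        exact hw rfl
      have e : Ns (dv (wedForm g h) u₀ (α • u₀ + β • ![0, 1])) (ev g u₀) = β • ρ := by
        rw [dv_wedForm, Ns_add_left, Ns_wed_left, add_zero, Ns_wed_cyc, Ns_wed_cyc, dv_add, dv_smul,
          dv_smul, dv_self hg]
        have := wed_combination (ev g u₀) (dv g u₀ ![0, 1]) 1 0 (α * m) β
        rw [one_smul, zero_smul, add_zero, mul_smul] at this
        rw [this, Ns_smul_left]
        simp [hρ]
      constructor
      · obtain ⟨i, hi⟩ := Function.ne_iff.1 (smul_ne_zero hβ hs)
        exact ⟨i, by rw [hdv, e]; exact hi⟩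
      · by_contra! hc
        obtain ⟨c, hc⟩ := hc
        have h1 : Ns (wed (ev g u₀) (ev h u₀)) v = (c * β) • ρ := by
          ext i
          rw [← hev, hc, hdv, e, mul_smul]
          rfl
        have h2 := dt_Ns_self (wed (ev g u₀) (ev h u₀)) v
        rw [h1, dt_smul_right, mul_eq_zero, dt_comm, or_iff_left hv] at h2
        rw [h2, zero_smul, mem_span_of_Ns (hne u₀ hu0), Submodule.mem_span_pair] at h1
        obtain ⟨x, y, rfl⟩ := h1
        rw [dt_comm, dt_add_left, dt_smul_left, dt_smul_left, hρg, hρh] at hv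
        simp at hv)
  have hHR : VanishesOn H (joinSurface g h) := by
    refine (vanishesOn_closure hH).2 ((vanishesOn_iff hH).2 fun z hz hzr => hH0 z ?_)
    obtain ⟨r, hr⟩ := Set.mem_iUnion.1 hzr
    have hr0 : (![1, r] : Fin 2 → ℂ) ≠ 0 := fun h => by simpa using congrFun h 0
    exact ⟨_, hr0, fun i => by
      rw [hev, (mem_span_of_Ns (hne _ hr0)).2 ((mk_mem_ruling_iff hz).1 hr)]; rfl⟩
  obtain ⟨i, hi⟩ := Function.ne_iff.1 hs
  have key : ∀ᶠ u in gen (Fin 2), ∀ hu : ev g u ≠ 0, Projectivization.mk ℂ (ev g u) hu ∈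
      {x | x ∈ smoothLocus (joinSurface g h) ∧
        (Projectivization.mk ℂ a ha).submodule ≤ tangentSpace (joinSurface g h) x} := by
    filter_upwards [(Pol.evalComp (D v H) (Pol.ev g)).eventually_ne hHv,
      (Pol.Ns (Pol.wed (Pol.ev g) (Pol.dv g ![0, 1])) (Pol.ev h) i).eventually_ne hi,
      (Pol.coord (0 : Fin 2)).eventually_ne (v := 1) (by simp)] with u h1 h2 h3 hu
    have hun : u ≠ 0 := by rintro rfl; exact h3 rfl
    -- The gradient kills the point itself, the direction of the joining line and the velocity of
    -- the curve. For generic `u` these are independent and span the plane `π u`.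
    have hgrad : ∀ (d : ℕ) (G : MvPolynomial (Fin 4) ℂ), G.IsHomogeneous d →
        VanishesOn G (joinSurface g h) →
        ∃ c : ℂ, ∀ w, eval (ev g u) (D w G) = c * dt w (π u) := by
      intro d G hG hGR
      have hz := eval_eq_zero_of_vanishesOn_joinSurface hg hh hg0 hG hGR
      have hline : ∀ z : Fin 4 → ℂ, (∀ r : ℂ, eval (ev g u + r • z) G = 0) →
          eval (ev g u) (D z G) = 0 := by
        intro z hz
        have := eval_D_eq_zero_of_path (F := G)
          (γ := fun i => Polynomial.C (ev g u i) + Polynomial.X * Polynomial.C (z i)) (fun r => by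
            convert hz r using 2
            congr 1
            ext i
            simp [mul_comm r]) 0
        simpa using this
      have k1 : eval (ev g u) (D (ev g u) G) = 0 := hline _ fun r => by
        have := hz u (1 + r) 0
        rwa [zero_smul, add_zero, add_smul, one_smul] at this
      have k2 : eval (ev g u) (D (ev h u) G) = 0 := hline _ fun r => by
        have := hz u 1 r
        rwa [one_smul] at this
      have k3 : eval (ev g u) (D (dv g u ![0, 1]) G) = 0 := by
        have := eval_D_eq_zero_of_path (F := G) (γ := fun i => chart u ![0, 1] (g i)) (fun r => by
          have := hz (u + r • ![0, 1]) 1 0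
          rw [one_smul, zero_smul, add_zero] at this
          simp only [eval_chart]
          exact this) 0
        simp only [derivative_chart, eval_chart, zero_smul, add_zero] at this
        exact this
      rw [eval_D_eq_dt] at k1 k2 k3
      obtain ⟨c, hc⟩ := exists_smul_of_dt (fun h0 => h2 (by rw [h0]; rfl)) k1 k3 k2 (hgπ u)
        (hgπ' u _) (hhπ u) (hπ u hun)
      exact ⟨c, fun w => by rw [eval_D_eq_dt, hc, dt_smul_right]⟩
    obtain ⟨r, hr, hrep⟩ := rep_mk hu
    have htan : ∀ w, w ∈ tangentSpace (joinSurface g h) (Projectivization.mk ℂ (ev g u) hu) ↔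
        dt w (π u) = 0 := by
      intro w
      have hD : ∀ (d : ℕ) (G : MvPolynomial (Fin 4) ℂ), G.IsHomogeneous d →
          (∑ i, w i * eval (Projectivization.mk ℂ (ev g u) hu).rep (pderiv i G) = 0 ↔
            eval (ev g u) (D w G) = 0) := by
        intro d G hG
        rw [← eval_D, hrep, eval_smul_form (D_isHomogeneous hG w), mul_eq_zero,
          or_iff_right (pow_ne_zero _ hr)]
      constructor
      · intro hw
        obtain ⟨c, hc⟩ := hgrad d H hH hHR
        have h4 := (hD d H hH).1 (hw d H hH hHR)
        rw [hc, mul_eq_zero] at h4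
        refine h4.resolve_left ?_
        rintro rfl
        exact h1 (by simpa using hc v)
      · intro hw d G hG hGR
        obtain ⟨c, hc⟩ := hgrad d G hG hGR
        rw [hD d G hG, hc, hw, mul_zero]
    refine ⟨⟨?_, finrank_ker_dt (hπ u hun) htan⟩, ?_⟩
    · have := mk_mem_joinSurface hg hh h3 1 0 (by simpa using hu)
      simpa only [one_smul, zero_smul, add_zero] using this
    · rw [Projectivization.submodule_mk, Submodule.span_singleton_le_iff_mem]
      exact (htan a).2 (haπ u)
  refine (mk_mem_closure hu).2 fun d G hG hGX => ?_
  rw [vanishesOn_iff hG] at hGX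
  refine (Pol.evalComp G (Pol.ev g)).eq_zero ?_ u
  filter_upwards [key, eventually_ne_zero] with t h1 h2
  exact hGX _ (hg0 t h2) (h1 (hg0 t h2))

end

namespace Surface
variable {S : Surface} {a : Fin 4 → ℂ}

/-- The tilted lines remain in the planes of `a` and the old rulings, which contain the tangents of
the contour curve. So the curve is again a contour curve, although a tilted point lies off the old
surface. -/
theorem General.exists_other (ha : S.General a) : ∃ R, IsRationalRuledSurface R ∧
    contour S.points (Projectivization.mk ℂ a ha.ne_zero) ⊆
      contour R (Projectivization.mk ℂ a ha.ne_zero) ∧ R ≠ S.points := by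
  obtain ⟨s, ζ, l, hA, hB, hC, hD, hE⟩ := ha.exists_tilt
  have hg := S.curve_isHomogeneous a
  have hh := S.tilt_isHomogeneous a ζ l
  have hπ : ∀ u, u ≠ 0 → Ns (S.pl u) a ≠ 0 := fun u hu h => ha.1 ⟨u, hu, h⟩
  have hgπ : ∀ u, dt (S.cv u a) (Ns (S.pl u) a) = 0 := fun u => by
    rw [dt_Ns, S.Ns_pl_cv, dt_zero_right, neg_zero]
  have hhπ : ∀ u, dt (ev (S.tilt a ζ l) u) (Ns (S.pl u) a) = 0 := fun u => by
    rw [Scroll.ev_tilt, dt_add_left, dt_smul_left, dt_smul_left, dt_Ns_self, dt_Ns,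
      Ns_N_self (S.pf_pl u), dt_zero_right]
    ring
  have hs0 : (![1, s] : Fin 2 → ℂ) ≠ 0 := fun h => by simpa using congrFun h 0
  refine ⟨joinSurface (fun i => comb (S.cform i) a) (S.tilt a ζ l),
    ⟨_, _, genericallyRegular_chart (s := s) ?_, rfl⟩, ?_, ?_⟩
  · obtain ⟨c, hc⟩ := exists_smul_of_dt hB (hgπ ![1, s]) (S.dt_cd _ _ a) (hhπ ![1, s])
      (ρ := Ns (wed (S.cv ![1, s] a) (S.cd ![1, s] ![0, 1] a)) (ev (S.tilt a ζ l) ![1, s]))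
      (by rw [dt_Ns, Ns_wed_left, dt_zero_right, neg_zero])
      (by rw [dt_Ns, Ns_wed_right, dt_zero_right, neg_zero]) (dt_Ns_self _ _) hB
    rw [hc, dt_smul_right] at hD
    exact right_ne_zero_of_mul hD
  · rw [ha.contour_eq]
    rintro _ ⟨u, rfl⟩
    exact joinSurface_contour hg hh (by have := S.degree_ne_zero; omega) hA hB hC hπ hgπ
      (fun u w => S.dt_cd u w a) hhπ ha.ne_zero (fun u => dt_Ns_self _ _) _
  · intro h
    have hne : ev (S.tilt a ζ l) ![1, s] ≠ 0 := fun h0 => hE (by rw [h0]; exact S.On_zero)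
    have := mk_mem_joinSurface hg hh (u := ![1, s]) (by simp) 0 1 (by simpa using hne)
    simp only [one_smul, zero_smul, zero_add] at this
    rw [h, S.mem_points] at this
    exact hE this

end Surface

/-! ### Surfaces of every degree -/

/-- The form defining the conoidal surface `x₁ᵐ x₂ = x₀ᵐ x₃`. -/
noncomputable def conoidForm (m : ℕ) : MvPolynomial (Fin 4) ℂ := X 1 ^ m * X 2 + -(X 0 ^ m * X 3)

theorem conoidForm_isHomogeneous (m : ℕ) : (conoidForm m).IsHomogeneous (m + 1) := by
  have (i j : Fin 4) : (X i ^ m * X j : MvPolynomial (Fin 4) ℂ).IsHomogeneous (m + 1) := by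
    simpa using ((isHomogeneous_X ℂ i).pow m).mul (isHomogeneous_X ℂ j)
  exact (this _ _).add (this _ _).neg

theorem eval_conoidForm (m : ℕ) (v : Fin 4 → ℂ) :
    eval v (conoidForm m) = v 1 ^ m * v 2 - v 0 ^ m * v 3 := by
  simp [conoidForm, sub_eq_add_neg]

theorem conoidForm_irreducible (m : ℕ) : Irreducible (conoidForm m) := by
  refine irreducible_mul_X_add _ _ 2 (pow_ne_zero _ (X_ne_zero 1)) (fun h => ?_) (fun h => ?_) ?_
  · have := vars_pow _ _ h
    simp [vars_X] at this
  · rw [vars_neg] at h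
    have := vars_mul _ _ h
    rw [Finset.mem_union] at this
    rcases this with h | h
    · have := vars_pow _ _ h
      simp [vars_X] at this
    · simp [vars_X] at h
  · refine IsRelPrime.pow_left ((X_prime (i := (1 : Fin 4))).irreducible.isRelPrime_iff_not_dvd.2 ?_)
    rintro ⟨q, hq⟩
    have := congrArg (eval ![1, 0, 1, 1]) hq
    simp at this

/-- The directrices of the conoidal surface. -/
noncomputable def conoidLeft : Fin 4 → Polynomial ℂ := ![1, Polynomial.X, 0, 0]

noncomputable def conoidRight (m : ℕ) : Fin 4 → Polynomial ℂ := ![0, 0, 1, Polynomial.X ^ m]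

theorem evalVec_conoidLeft (s : ℂ) : evalVec conoidLeft s = ![1, s, 0, 0] := by
  ext i; fin_cases i <;> simp [evalVec, conoidLeft]

theorem evalVec_conoidRight (m : ℕ) (s : ℂ) : evalVec (conoidRight m) s = ![0, 0, 1, s ^ m] := by
  ext i; fin_cases i <;> simp [evalVec, conoidRight]

theorem mk_mem_conoid_ruling {m : ℕ} {s : ℂ} {v : Fin 4 → ℂ} (hv : v ≠ 0) :
    Projectivization.mk ℂ v hv ∈ ruling conoidLeft (conoidRight m) s ↔
      v 1 = v 0 * s ∧ v 3 = v 2 * s ^ m := by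
  rw [mem_ruling_iff, evalVec_conoidLeft, evalVec_conoidRight, Submodule.mem_span_pair]
  constructor
  · rintro ⟨x, y, rfl⟩
    simp
  · rintro ⟨h1, h2⟩
    refine ⟨v 0, v 2, ?_⟩
    ext i
    fin_cases i <;> simp [h1, h2]

theorem conoid_genericallyRegular {m : ℕ} (hm : m ≠ 0) :
    GenericallyRegular conoidLeft (conoidRight m) := by
  intro h
  have := congrArg (Polynomial.eval 1) h
  rw [det_eq_pf] at this
  simp [conoidLeft, conoidRight, Polynomial.derivative_X_pow] at this
  exact hm this

theorem conoid_hasDegree (m : ℕ) :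
    HasDegree (zariskiClosure (⋃ s : ℂ, ruling conoidLeft (conoidRight m) s)) (m + 1) := by
  have hF := conoidForm_isHomogeneous m
  refine ⟨conoidForm m, conoidForm_irreducible m, hF, Set.Subset.antisymm ?_ fun x hx d G hG hGX => ?_⟩
  · refine fun x hx => hx _ _ hF ((vanishesOn_iff hF).2 fun v hv hvr => ?_)
    obtain ⟨s, hs⟩ := Set.mem_iUnion.1 hvr
    obtain ⟨h1, h2⟩ := (mk_mem_conoid_ruling hv).1 hs
    rw [eval_conoidForm, h1, h2]
    ring
  · rw [vanishesOn_iff hG] at hGX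
    -- A zero with non-vanishing first coordinate lies on the ruling `s = v 1 / v 0`. The factor `X
    -- 0` covers the other zeros, and it is then cancelled because the conoid form is prime and does
    -- not divide it.
    have hdvd : conoidForm m ∣ X 0 * G := by
      refine dvd_of_forall_eval (conoidForm_irreducible m) fun v hv => ?_
      rw [map_mul, eval_X, mul_eq_zero, or_iff_not_imp_left]
      intro h0
      refine hGX v (by rintro rfl; exact h0 rfl) (Set.mem_iUnion.2 ⟨v 1 / v 0,
        (mk_mem_conoid_ruling _).2 ⟨(mul_div_cancel₀ _ h0).symm, ?_⟩⟩)
      rw [eval_conoidForm] at hv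
      rw [div_pow, mul_div_assoc', eq_div_iff (pow_ne_zero m h0)]
      linear_combination -hv
    obtain ⟨Q, hQ⟩ := ((conoidForm_irreducible m).prime.dvd_or_dvd hdvd).resolve_left (by
      rintro ⟨Q, hQ⟩
      have := congrArg (eval ![1, 0, 0, 0]) hQ
      rw [map_mul, eval_conoidForm] at this
      simp at this)
    rw [hQ, map_mul, show eval x.rep (conoidForm m) = 0 from hx, zero_mul]

theorem exists_surface_of_degree {k : ℕ} (hk : 3 ≤ k) : ∃ S : Surface,
    IsRationalRuledSurface S.points ∧ HasDegree S.points k := by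
  obtain ⟨m, rfl⟩ : ∃ m, k = m + 1 := ⟨k - 1, by omega⟩
  have h : IsRuledParametrization conoidLeft (conoidRight m) _ :=
    ⟨conoid_genericallyRegular (by omega), rfl⟩
  obtain ⟨S, -, hS, -⟩ := exists_surface hk h (conoid_hasDegree m)
  exact ⟨S, hS ▸ ⟨_, _, h⟩, hS ▸ conoid_hasDegree m⟩

/-- One viewpoint that is both general and in the given open set is enough. For `n = 0` nothing
links the two, and any general viewpoint serves to produce a second surface. -/
theorem not_determinedByContours {k n : ℕ} (hk : 3 ≤ k) (hn : n < 2) : ¬ DeterminedByContours k n := by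
  intro hdet
  obtain ⟨S, hS, hSk⟩ := exists_surface_of_degree hk
  obtain ⟨G, hG, h⟩ := hdet S.points hS hSk
  have hgen : ∀ᶠ v in gen (Fin n × Fin 4), eval v G ≠ 0 := eventually_gen.2 ⟨G, hG, fun _ h => h⟩
  obtain ⟨a, ha, v, hva, hv⟩ : ∃ a, S.General a ∧ ∃ v : Fin n × Fin 4 → ℂ,
      (∀ i j, v (i, j) = a j) ∧ eval v G ≠ 0 := by
    interval_cases n
    · obtain ⟨a, ha⟩ := S.eventually_general.exists
      obtain ⟨v, hv⟩ := hgen.exists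
      exact ⟨a, ha, v, fun i => i.elim0, hv⟩
    · obtain ⟨v, hv, h1⟩ := (hgen.and (eventually_comp_injective
        (Prod.mk_right_injective (0 : Fin 1)) S.eventually_general)).exists
      exact ⟨_, h1, v, fun i j => by rw [Subsingleton.elim i 0], hv⟩
  obtain ⟨R, hR, hsub, hne⟩ := ha.exists_other
  have hrow : ∀ i, (fun j => v (i, j)) = a := fun i => funext (hva i)
  exact hne (h (fun i j => v (i, j)) (fun i => by rw [hrow]; exact ha.ne_zero) hv R hR
    fun i => by simpa only [hrow] using hsub)

theorem determinedByContours_two {k : ℕ} (hk : 3 ≤ k) : DeterminedByContours k 2 := by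
  rintro R ⟨p, q, hpq⟩ hR
  obtain ⟨S, -, rfl, -⟩ := exists_surface hk hpq hR
  exact S.forGeneric_generalPair fun a b hab R' hR' hsub => hab.unique hR' (hsub 0) (hsub 1)

end RuledContours

/-! ### The main theorem. -/

theorem mainTheorem3 (k : ℕ) (hk : 3 ≤ k) :
    -- the minimal number of generic contours that determine the surface is two
    IsLeast {n : ℕ | DeterminedByContours k n} 2 ∧
    -- the reconstruction from two generic contours
    ∀ (R : Set P3) (p q : Fin 4 → Polynomial ℂ),
      IsRuledParametrization p q R → HasDegree R k →
      ForGeneric (fun a : Fin 2 → P3 =>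
        -- both contours are rational curves
        (∀ i, ∃ c : RationalMap, IsProperParametrization c (contour R (a i))) ∧
        -- they meet in at least `deg R` regular points of the surface
        (k : ℕ∞) ≤ (contour R (a 0) ∩ contour R (a 1) ∩ smoothLocus R).encard ∧
        ∀ c c' : RationalMap,
          IsProperParametrization c (contour R (a 0)) →
          IsProperParametrization c' (contour R (a 1)) →
          ∃ f : P1 → P1, IsMoebius f ∧
            -- `f` matches the contours ruling by ruling, and it is the only one that does
            MatchesRulings p q c c' f ∧
            (∀ g : P1 → P1, IsMoebius g → MatchesRulings p q c c' g → g = f) ∧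
            -- the surface is recovered from `f`
            R = zariskiClosure (⋃ u : P1, joinPoints (c.pt u) (c'.pt (f u))) ∧
            -- `f` respects all the intersection points, and the regular ones determine it
            (∀ u : P1, c.pt u ∈ contour R (a 1) → c'.pt (f u) = c.pt u) ∧
            (∀ g : P1 → P1, IsMoebius g →
              (∀ u : P1, c.pt u ∈ contour R (a 1) ∩ smoothLocus R → c'.pt (g u) = c.pt u) →
              g = f)) := by
  refine ⟨⟨determinedByContours_two hk, fun n hn => ?_⟩, fun R p q hpq hR => ?_⟩
  · by_contra! h
    exact not_determinedByContours hk h hn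
  · obtain ⟨S, rfl, rfl, hp1, hp2⟩ := exists_surface hk hpq hR
    refine S.forGeneric_generalPair fun a b hab => ⟨Fin.forall_fin_two.2
      ⟨⟨_, hab.left.isProperParametrization⟩, ⟨_, hab.right.isProperParametrization⟩⟩, ?_,
      fun c c' hc hc' => S.reconstruction hp1 hp2 hab hc hc'⟩
    have := hab.encard_le
    rwa [← hab.left.contour_eq, ← hab.right.contour_eq] at this
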